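/- **Definitions.** Fix a universe; "commutative ring" etc. mean small ones. *Props.* A *prop* $A$ is a strict symmetric monoidal category with objects the natural numbers, $\oplus$ being addition on objects, and with $0$ both initial and final; write $A_{n,m}$ for the arrows $m\to n$ ("$n\times m$ matrices"). It is *commutative* if (i) the scalars $s\in A_{1,1}$ are central: $s^{\oplus n}\circ a=a\circ s^{\oplus m}=:s\cdot a$ for $a\in A_{n,m}$; (ii) $q\circ p=p^{\oplus m}\circ\sigma_{m,n}\circ q^{\oplus n}$ for every row $p\in A_{1,n}$ and every column $q\in A_{m,1}$, with $\sigma_{m,n}$ the permutation exchanging the two labellings of the $mn$ wires; (iii) $b^{\oplus n}\circ\sigma\circ a^{\oplus k}\circ\sigma'\circ d^{\oplus m}=(b\circ d)\cdot a$ for $b\in A_{1,k}$, $a\in A_{n,m}$, $d\in A_{k,1}$ ($\sigma,\sigma'$ the analogous permutations). With functors strictly compatible with all structure and the identity on objects, these form the category $\mathrm{CProp}$. *Bios.* A *bio* $P=(P^-,P^+)$ consists of two symmetric operads, of operations $P^-(n)$ ("row vectors") and co-operations $P^+(n)$ ("column vectors"), with one-point sets $P^\pm(0)$, together with actions $p\circ(c_0\oplus\cdots\oplus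 c_{n-1})\in P^-(n)$ for $p\in P^-(\sum k_i)$, $c_i\in P^+(k_i)$, and $(r_0\oplus\cdots\oplus r_{n-1})\circ c\in P^+(n)$ for $c\in P^+(\sum k_i)$, $r_i\in P^-(k_i)$, such that all compositions are equivariant, unital and associative in every way in which they make sense for matrices; in particular $P^-(1)\cong P^+(1)=:P(1)$. It is *commutative* if $q\circ p=p^{\oplus m}\circ\sigma_{m,n}\circ q^{\oplus n}$ for all $p\in P^-(n)$, $q\in P^+(m)$, meaning that replacing one side by the other at any number of places of a composite with a row on the left, or with a column on the right, does not change that composite. Then $P(1)$ is a commutative monoid acting centrally. The category is $\mathrm{CBio}$. *Comparison functors.* Sending a commutative ring to its matrices gives $M:\mathrm{CRing}\to\mathrm{CProp}$; sending a commutative prop to its rows and columns, $P^-(n)=A_{1,n}$, $P^+(n)=A_{n,1}$, gives $U:\mathrm{CProp}\to\mathrm{CBio}$. *Spectra.* An *ideal* of a commutative bio $P$ is a subset $I\subseteq P(1)$ with $b\circ(a_1\oplus\cdots\oplus a_n)\circ d\in I$ for all $n\ge0$, $b\in P^-(n)$, $d\in P^+(n)$, $a_i\in I$; it is *prime* if its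 complement is a submonoid of $P(1)$, and *maximal* if it is maximal among the ideals not containing $1$. The bio is *local* if it has exactly one maximal ideal; a commutative prop $A$ is local if $UA$ is. $\operatorname{spec}(P)$ is the set of primes with the topology generated by the sets $D(f)=\{\mathfrak p: f\notin\mathfrak p\}$, and $\mathcal O_P(V)$ consists of the families $(s_{\mathfrak p})_{\mathfrak p\in V}$ of elements of the localizations $P_{\mathfrak p}$ that are locally given by fractions $a/f$; it is a commutative bio. Likewise $\mathcal O_A$ is a presheaf of commutative props on $\operatorname{spec}(A):=\operatorname{spec}(UA)$. Both are functorial contravariantly in $P$ and in $A$. *Spaces.* Let $\mathrm{CBio}/\mathrm{Top}$ (resp. $\mathrm{CProp}/\mathrm{Top}$) be the category of pairs $(X,\mathcal O_X)$ of a topological space and a sheaf of commutative bios (resp. props) with local stalks $\mathcal O_{X,x}=\varinjlim_{x\in V}\mathcal O_X(V)$; a morphism is a continuous map $f$ with pull-backs $\mathcal O_Y(V)\to\mathcal O_X(f^{-1}V)$ compatible with restrictions whose maps on stalks $\mathcal O_{Y,f(x)}\to\mathcal O_{X,x}$ carry the maximal ideal into the maximal ideal. $\mathrm{CRing}/\mathrm{Top}$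 is the category of locally ringed spaces. $\mathrm{BSch}$ and $\mathrm{PSch}$ are the full subcategories of the spaces covered by open subspaces isomorphic to affine spectra $\operatorname{spec}(P)$, resp. $\operatorname{spec}(A)$; $\mathrm{Sch}$ is the category of schemes. **Theorem.** 1. The pairs $(\operatorname{spec}P,\mathcal O_P)$ and $(\operatorname{spec}(UA),\mathcal O_A)$ are a bio scheme and a prop scheme, for all commutative bios $P$ and props $A$ (in particular $\mathcal O_P,\mathcal O_A$ are sheaves with local stalks), and $\operatorname{spec}$ gives functors $(\mathrm{CBio})^{op}\to\mathrm{BSch}$ and $(\mathrm{CProp})^{op}\to\mathrm{PSch}$. 2. In each row of $$\begin{array}{ccccc}(\mathrm{CRing})^{op}&\to&\mathrm{Sch}&\to&\mathrm{CRing}/\mathrm{Top}\\ \downarrow&&\downarrow&&\downarrow\\(\mathrm{CProp})^{op}&\to&\mathrm{PSch}&\to&\mathrm{CProp}/\mathrm{Top}\\ \downarrow&&\downarrow&&\downarrow\\(\mathrm{CBio})^{op}&\to&\mathrm{BSch}&\to&\mathrm{CBio}/\mathrm{Top}\end{array}$$ (affine spectra, followed by the inclusion) both functors are fully faithful. 3.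 Applying $M$ and $U$ to the structure sheaf defines the functors of the right column. They restrict to functors between the categories of schemes, and all four squares of the diagram commute up to natural isomorphism, the left column being $M^{op}$ and $U^{op}$. 4. In each column, the functor from the first row to the second and the composite functor from the first row to the third are fully faithful. 5. $\mathrm{BSch}$ and $\mathrm{PSch}$ have all finite limits; in particular they have fiber products. -/

import Mathlib

open CategoryTheory CategoryTheory.Limits TopologicalSpace Opposite AlgebraicGeometry

universe u

noncomputable section

namespace GenGeom

/-! ### Block decompositions of finite index sets -/

/-- A decomposition of `Fin m` into blocks of sizes `k 0, …, k (n-1)`. The blocks need not be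
intervals, so that such decompositions incorporate all permutations. -/
abbrev Split {n : ℕ} (k : Fin n → ℕ) (m : ℕ) : Type := (Σ i, Fin (k i)) ≃ Fin m

/-- The decomposition of `Fin n` into a single block. -/
def Split.single (n : ℕ) : Split (fun _ : Fin 1 => n) n where
  toFun x := x.2
  invFun j := ⟨0, j⟩
  left_inv := by rintro ⟨i, j⟩; simp [Subsingleton.elim i 0]
  right_inv _ := rfl

/-- The decomposition of `Fin n` into singletons. -/
def Split.ones (n : ℕ) : Split (fun _ : Fin n => 1) n where
  toFun x := x.1
  invFun i := ⟨i, 0⟩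
  left_inv := by rintro ⟨i, j⟩; simp [Subsingleton.elim j 0]
  right_inv _ := rfl

/-- `Fin m` is decomposed by `e` into blocks indexed by `Fin n`, and by `e'` into blocks indexed
by `Fin N`. The decomposition `e` refines `e'`: the `j`-th block of `e'` is decomposed by `f j`
into those blocks of `e` whose index lies in the `j`-th block of the decomposition `g` of
`Fin n`. -/
def Split.Nested {N n m : ℕ} {h : Fin N → ℕ} {k : Fin n → ℕ} {l : Fin N → ℕ}
    (g : Split h n) (e : Split k m) (f : ∀ j, Split (fun i => k (g ⟨j, i⟩)) (l j))
    (e' : Split l m) : Prop :=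
  ∀ j i t, e ⟨g ⟨j, i⟩, t⟩ = e' ⟨j, f j ⟨i, t⟩⟩

/-! ### Bios -/

/-- A bio: two closed symmetric operads `R = P⁻` (operations, "row vectors") and `C = P⁺`
(co-operations, "column vectors") acting on each other. With matrix notation
* `compR e p q = p ∘ (q₀ ⊕ ⋯ ⊕ q_{n-1})` is the composition of the operad `P⁻`,
* `compC e q c = (q₀ ⊕ ⋯ ⊕ q_{n-1}) ∘ c` is the composition of the operad `P⁺`,
* `actR e p c = p ∘ (c₀ ⊕ ⋯ ⊕ c_{n-1})` is the action of `P⁺` on `P⁻`,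
* `actC e r c = (r₀ ⊕ ⋯ ⊕ r_{n-1}) ∘ c` is the action of `P⁻` on `P⁺`,
where the inputs and outputs of the blocks are labelled through the decomposition `e`. The symmetric
group actions and their equivariance are contained in this: the permuted operation is
`compR e p (fun _ => oneR)`, for a decomposition `e` into singletons. The axioms say that all
ways of evaluating a composite of three layers agree. The sets `R 1` and `C 1` are identified by
`s ↦ actC s oneC` and `c ↦ actR oneR c`, which are inverse to each other by the axioms. -/
structure Bio where
  R : ℕ → Type u
  C : ℕ → Type u
  oneR : R 1
  oneC : C 1
  uniqueR : Unique (R 0)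
  uniqueC : Unique (C 0)
  compR : ∀ {n m : ℕ} {k : Fin n → ℕ}, Split k m → R n → (∀ i, R (k i)) → R m
  compC : ∀ {n m : ℕ} {k : Fin n → ℕ}, Split k m → (∀ i, C (k i)) → C n → C m
  actR : ∀ {n m : ℕ} {k : Fin n → ℕ}, Split k m → R m → (∀ i, C (k i)) → R n
  actC : ∀ {n m : ℕ} {k : Fin n → ℕ}, Split k m → (∀ i, R (k i)) → C m → C n
  compR_one : ∀ {n : ℕ} (p : R n), compR (Split.ones n) p (fun _ => oneR) = p
  one_compR : ∀ {n : ℕ} (p : R n), compR (Split.single n) oneR (fun _ => p) = p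
  compC_one : ∀ {n : ℕ} (c : C n), compC (Split.ones n) (fun _ => oneC) c = c
  one_compC : ∀ {n : ℕ} (c : C n), compC (Split.single n) (fun _ => c) oneC = c
  actR_one : ∀ {n : ℕ} (p : R n), actR (Split.ones n) p (fun _ => oneC) = p
  actC_one : ∀ {n : ℕ} (c : C n), actC (Split.ones n) (fun _ => oneR) c = c
  /-- `(p ∘ ⊕ q) ∘ ⊕ r = p ∘ ⊕ (q ∘ ⊕ r)` -/
  compR_compR : ∀ {N n m : ℕ} {h : Fin N → ℕ} {k : Fin n → ℕ} {l : Fin N → ℕ}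
    {g : Split h n} {e : Split k m} {f : ∀ j, Split (fun i => k (g ⟨j, i⟩)) (l j)}
    {e' : Split l m}, Split.Nested g e f e' →
    ∀ (p : R N) (q : ∀ j, R (h j)) (r : ∀ s, R (k s)),
    compR e (compR g p q) r = compR e' p (fun j => compR (f j) (q j) (fun i => r (g ⟨j, i⟩)))
  /-- `(p ∘ ⊕ c) ∘ ⊕ d = p ∘ ⊕ (⊕ c ∘ d)` -/
  actR_actR : ∀ {N n m : ℕ} {h : Fin N → ℕ} {k : Fin n → ℕ} {l : Fin N → ℕ}
    {g : Split h n} {e : Split k m} {f : ∀ j, Split (fun i => k (g ⟨j, i⟩)) (l j)}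
    {e' : Split l m}, Split.Nested g e f e' →
    ∀ (p : R m) (c : ∀ s, C (k s)) (d : ∀ j, C (h j)),
    actR g (actR e p c) d = actR e' p (fun j => compC (f j) (fun i => c (g ⟨j, i⟩)) (d j))
  /-- `(p ∘ ⊕ q) ∘ ⊕ d = p ∘ ⊕ (q ∘ ⊕ d)` -/
  actR_compR : ∀ {N n m : ℕ} {h : Fin N → ℕ} {k : Fin n → ℕ} {l : Fin N → ℕ}
    {g : Split h n} {e : Split k m} {f : ∀ j, Split (fun i => k (g ⟨j, i⟩)) (l j)}
    {e' : Split l m}, Split.Nested g e f e' →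
    ∀ (p : R N) (q : ∀ j, R (l j)) (d : ∀ s, C (k s)),
    actR e (compR e' p q) d = compR g p (fun j => actR (f j) (q j) (fun i => d (g ⟨j, i⟩)))
  /-- `(p ∘ ⊕ q) ∘ ⊕ d = p ∘ ⊕ (⊕ q ∘ d)` -/
  actR_compR' : ∀ {N n m : ℕ} {h : Fin N → ℕ} {k : Fin n → ℕ} {l : Fin N → ℕ}
    {g : Split h n} {e : Split k m} {f : ∀ j, Split (fun i => k (g ⟨j, i⟩)) (l j)}
    {e' : Split l m}, Split.Nested g e f e' →
    ∀ (p : R n) (q : ∀ s, R (k s)) (d : ∀ j, C (l j)),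
    actR e' (compR e p q) d = actR g p (fun j => actC (f j) (fun i => q (g ⟨j, i⟩)) (d j))
  /-- `⊕ r ∘ (⊕ q ∘ c) = ⊕ (⊕ r ∘ q) ∘ c` -/
  compC_compC : ∀ {N n m : ℕ} {h : Fin N → ℕ} {k : Fin n → ℕ} {l : Fin N → ℕ}
    {g : Split h n} {e : Split k m} {f : ∀ j, Split (fun i => k (g ⟨j, i⟩)) (l j)}
    {e' : Split l m}, Split.Nested g e f e' →
    ∀ (c : C N) (q : ∀ j, C (h j)) (r : ∀ s, C (k s)),
    compC e r (compC g q c) = compC e' (fun j => compC (f j) (fun i => r (g ⟨j, i⟩)) (q j)) c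
  /-- `⊕ q ∘ (⊕ r ∘ c) = ⊕ (q ∘ ⊕ r) ∘ c` -/
  actC_actC : ∀ {N n m : ℕ} {h : Fin N → ℕ} {k : Fin n → ℕ} {l : Fin N → ℕ}
    {g : Split h n} {e : Split k m} {f : ∀ j, Split (fun i => k (g ⟨j, i⟩)) (l j)}
    {e' : Split l m}, Split.Nested g e f e' →
    ∀ (c : C m) (r : ∀ s, R (k s)) (q : ∀ j, R (h j)),
    actC g q (actC e r c) = actC e' (fun j => compR (f j) (q j) (fun i => r (g ⟨j, i⟩))) c
  /-- `⊕ r ∘ (⊕ d ∘ c) = ⊕ (⊕ r ∘ d) ∘ c` -/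
  actC_compC : ∀ {N n m : ℕ} {h : Fin N → ℕ} {k : Fin n → ℕ} {l : Fin N → ℕ}
    {g : Split h n} {e : Split k m} {f : ∀ j, Split (fun i => k (g ⟨j, i⟩)) (l j)}
    {e' : Split l m}, Split.Nested g e f e' →
    ∀ (c : C N) (d : ∀ j, C (l j)) (r : ∀ s, R (k s)),
    actC e r (compC e' d c) = compC g (fun j => actC (f j) (fun i => r (g ⟨j, i⟩)) (d j)) c
  /-- `⊕ r ∘ (⊕ d ∘ c) = ⊕ (r ∘ ⊕ d) ∘ c` -/
  actC_compC' : ∀ {N n m : ℕ} {h : Fin N → ℕ} {k : Fin n → ℕ} {l : Fin N → ℕ}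
    {g : Split h n} {e : Split k m} {f : ∀ j, Split (fun i => k (g ⟨j, i⟩)) (l j)}
    {e' : Split l m}, Split.Nested g e f e' →
    ∀ (c : C n) (d : ∀ s, C (k s)) (r : ∀ j, R (l j)),
    actC e' r (compC e d c) = actC g (fun j => actR (f j) (r j) (fun i => d (g ⟨j, i⟩))) c

/-- Two decompositions of `Fin L` as in the interchange law `q ∘ p = (⊕ p) ∘ σ ∘ (⊕ q)`, carried out
at several places `x` at once: the wire number `j` of the copy `(x, i)` of `p x` is the wire number
`i` of the copy `(x, j)` of `q x`. -/
def Split.Interchange {l M N L : ℕ} {m n : Fin l → ℕ} (e : Split m M) (e₂ : Split n N)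
    (e₃ : Split (fun s => n (e.symm s).1) L) (e₄ : Split (fun t => m (e₂.symm t).1) L) : Prop :=
  ∀ (s : Fin M) (t : Fin N) (hst : (e.symm s).1 = (e₂.symm t).1),
    e₃ ⟨s, Fin.cast (congrArg n hst.symm) (e₂.symm t).2⟩ =
      e₄ ⟨t, Fin.cast (congrArg m hst) (e.symm s).2⟩

/-- A commutative bio: all operations `p ∈ P⁻(n)` and all co-operations `q ∈ P⁺(m)` commute,
`q ∘ p = (p ⊕ ⋯ ⊕ p) ∘ σ ∘ (q ⊕ ⋯ ⊕ q)`. As `q ∘ p` itself is neither a row nor a column vector, the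
law says that both sides (used at any finite number of places `x` of a composite) have the same
composite with all row vectors on the left, and with all column vectors on the right. -/
structure CBio extends Bio.{u} where
  comm_row : ∀ {l M N L : ℕ} {m n : Fin l → ℕ} {e : Split m M} {e₂ : Split n N}
    {e₃ : Split (fun s => n (e.symm s).1) L} {e₄ : Split (fun t => m (e₂.symm t).1) L},
    Split.Interchange e e₂ e₃ e₄ →
    ∀ (r : R M) (q : ∀ x, C (m x)) (p : ∀ x, R (n x)),
    compR e₂ (actR e r q) p =
      actR e₄ (compR e₃ r (fun s => p (e.symm s).1)) (fun t => q (e₂.symm t).1)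
  comm_col : ∀ {l M N L : ℕ} {m n : Fin l → ℕ} {e : Split m M} {e₂ : Split n N}
    {e₃ : Split (fun s => n (e.symm s).1) L} {e₄ : Split (fun t => m (e₂.symm t).1) L},
    Split.Interchange e e₂ e₃ e₄ →
    ∀ (c : C N) (q : ∀ x, C (m x)) (p : ∀ x, R (n x)),
    compC e q (actC e₂ p c) =
      actC e₃ (fun s => p (e.symm s).1) (compC e₄ (fun t => q (e₂.symm t).1) c)

/-- A homomorphism of bios. -/
@[ext]
structure Bio.Hom (P Q : Bio.{u}) where
  onR : ∀ n, P.R n → Q.R n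
  onC : ∀ n, P.C n → Q.C n
  map_oneR : onR 1 P.oneR = Q.oneR
  map_oneC : onC 1 P.oneC = Q.oneC
  map_compR : ∀ {n m : ℕ} {k : Fin n → ℕ} (e : Split k m) (p : P.R n) (q : ∀ i, P.R (k i)),
    onR m (P.compR e p q) = Q.compR e (onR n p) (fun i => onR _ (q i))
  map_compC : ∀ {n m : ℕ} {k : Fin n → ℕ} (e : Split k m) (q : ∀ i, P.C (k i)) (c : P.C n),
    onC m (P.compC e q c) = Q.compC e (fun i => onC _ (q i)) (onC n c)
  map_actR : ∀ {n m : ℕ} {k : Fin n → ℕ} (e : Split k m) (p : P.R m) (c : ∀ i, P.C (k i)),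
    onR n (P.actR e p c) = Q.actR e (onR m p) (fun i => onC _ (c i))
  map_actC : ∀ {n m : ℕ} {k : Fin n → ℕ} (e : Split k m) (r : ∀ i, P.R (k i)) (c : P.C m),
    onC n (P.actC e r c) = Q.actC e (fun i => onR _ (r i)) (onC m c)

/-- The category of commutative bios. -/
instance : Category CBio.{u} where
  Hom P Q := Bio.Hom P.toBio Q.toBio
  id P := ⟨fun _ x => x, fun _ x => x, rfl, rfl, fun _ _ _ => rfl, fun _ _ _ => rfl,
    fun _ _ _ => rfl, fun _ _ _ => rfl⟩
  comp f g := ⟨fun n x => g.onR n (f.onR n x), fun n x => g.onC n (f.onC n x),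
    by rw [f.map_oneR, g.map_oneR], by rw [f.map_oneC, g.map_oneC],
    fun e p q => by rw [f.map_compR, g.map_compR], fun e p q => by rw [f.map_compC, g.map_compC],
    fun e p q => by rw [f.map_actR, g.map_actR], fun e p q => by rw [f.map_actC, g.map_actC]⟩

/-! ### Scalars of a commutative bio -/

/-- The commutative monoid `M` acts on the set `X`. -/
class MAct (M : Type u) [CommMonoid M] (X : Type u) where
  act : M → X → X
  one_act : ∀ x, act 1 x = x
  mul_act : ∀ s t x, act (s * t) x = act s (act t x)

namespace CBio

variable (P : CBio.{u})

/-- The identification of `P⁻(1)` with `P⁺(1)`. -/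
def toC (s : P.R 1) : P.C 1 := P.actC (Split.single 1) (fun _ => s) P.oneC

lemma single_one : Split.single 1 = Split.ones 1 := Equiv.ext fun _ => Subsingleton.elim _ _

/-- `p ∘ (s ⊕ ⋯ ⊕ s)`, computed with `s` as a co-operation. -/
lemma actR_toC {n : ℕ} (p : P.R n) (s : Fin n → P.R 1) :
    P.actR (Split.ones n) p (fun i => P.toC (s i)) = P.compR (Split.ones n) p s := by
  have := P.actR_compR' (g := Split.ones n) (e := Split.ones n) (f := fun _ => Split.single 1)
    (e' := Split.ones n) (fun _ _ _ => rfl) p s (fun _ => P.oneC)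
  rw [P.actR_one] at this
  exact this.symm

/-- `(s ⊕ ⋯ ⊕ s) ∘ c`, computed with `s` as a co-operation. -/
lemma compC_toC {n : ℕ} (s : Fin n → P.R 1) (c : P.C n) :
    P.compC (Split.ones n) (fun i => P.toC (s i)) c = P.actC (Split.ones n) s c := by
  have := P.actC_compC (g := Split.ones n) (e := Split.ones n) (f := fun _ => Split.single 1)
    (e' := Split.ones n) (fun _ _ _ => rfl) c (fun _ => P.oneC) s
  rw [P.compC_one] at this
  exact this.symm

/-- Scalars are central with respect to row vectors. -/
lemma central_row {n : ℕ} (s : P.R 1) (p : P.R n) :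
    P.compR (Split.ones n) p (fun _ => s) = P.compR (Split.single n) s (fun _ => p) := by
  have := P.comm_row (l := 1) (m := fun _ => 1) (n := fun _ => n) (e := Split.single 1)
    (e₂ := Split.single n) (e₃ := Split.single n) (e₄ := Split.ones n) (fun _ _ _ => rfl)
    P.oneR (fun _ => P.toC s) (fun _ => p)
  rw [P.one_compR, P.actR_toC, single_one, P.actR_toC, ← single_one, P.one_compR] at this
  exact this.symm

/-- Scalars are central with respect to column vectors. -/
lemma central_col {n : ℕ} (s : P.R 1) (c : P.C n) :
    P.compC (Split.single n) (fun _ => c) (P.toC s) = P.actC (Split.ones n) (fun _ => s) c := by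
  have := P.comm_col (l := 1) (m := fun _ => n) (n := fun _ => 1) (e := Split.single n)
    (e₂ := Split.single 1) (e₃ := Split.ones n) (e₄ := Split.single n) (fun _ _ _ => rfl)
    P.oneC (fun _ => c) (fun _ => s)
  rw [P.one_compC] at this
  exact this

/-- The commutative monoid `P(1)`. -/
instance : CommMonoid (P.R 1) where
  mul s t := P.compR (Split.single 1) s (fun _ => t)
  one := P.oneR
  mul_assoc s t r := P.compR_compR (g := Split.single 1) (e := Split.single 1)
    (f := fun _ => Split.single 1) (e' := Split.single 1) (fun _ _ _ => rfl) s (fun _ => t)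
    (fun _ => r)
  one_mul s := P.one_compR s
  mul_one s := by
    have := P.compR_one s
    rw [← single_one] at this
    exact this
  mul_comm s t := by
    have := P.central_row t s
    rw [← single_one] at this
    exact this

lemma mul_def (s t : P.R 1) : s * t = P.compR (Split.single 1) s (fun _ => t) := rfl
lemma one_def : (1 : P.R 1) = P.oneR := rfl

/-- Scalar multiplication of row vectors. -/
instance (n : ℕ) : MAct (P.R 1) (P.R n) where
  act s p := P.compR (Split.single n) s (fun _ => p)
  one_act p := P.one_compR p
  mul_act s t p := P.compR_compR (g := Split.single 1) (e := Split.single n)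
    (f := fun _ => Split.single n) (e' := Split.single n) (fun _ _ _ => rfl) s (fun _ => t)
    (fun _ => p)

/-- Scalar multiplication of column vectors. -/
instance (n : ℕ) : MAct (P.R 1) (P.C n) where
  act s c := P.actC (Split.ones n) (fun _ => s) c
  one_act c := P.actC_one c
  mul_act s t c := (P.actC_actC (g := Split.ones n) (e := Split.ones n)
    (f := fun _ => Split.single 1) (e' := Split.ones n) (fun _ _ _ => rfl) c (fun _ => t)
    (fun _ => s)).symm

lemma actR_def {n : ℕ} (s : P.R 1) (p : P.R n) :
    MAct.act s p = P.compR (Split.single n) s (fun _ => p) := rfl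
lemma actC_def {n : ℕ} (s : P.R 1) (c : P.C n) :
    MAct.act s c = P.actC (Split.ones n) (fun _ => s) c := rfl

section
variable {n m : ℕ} {k : Fin n → ℕ} (e : Split k m) (s : P.R 1)

lemma act_compR (p : P.R n) (q : ∀ i, P.R (k i)) :
    P.compR e (MAct.act s p) q = MAct.act s (P.compR e p q) :=
  P.compR_compR (g := Split.single n) (e := e) (f := fun _ => e) (e' := Split.single m)
    (fun _ _ _ => rfl) s (fun _ => p) q

lemma compR_act (p : P.R n) (q : ∀ i, P.R (k i)) :
    P.compR e p (fun i => MAct.act s (q i)) = MAct.act s (P.compR e p q) := by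
  have := P.compR_compR (g := Split.ones n) (e := e) (f := fun i => Split.single (k i)) (e' := e)
    (fun _ _ _ => rfl) p (fun _ => s) q
  rw [P.central_row] at this
  exact this.symm.trans (P.act_compR e s p q)

lemma act_actR (p : P.R m) (c : ∀ i, P.C (k i)) :
    P.actR e (MAct.act s p) c = MAct.act s (P.actR e p c) :=
  P.actR_compR (g := Split.single n) (e := e) (f := fun _ => e) (e' := Split.single m)
    (fun _ _ _ => rfl) s (fun _ => p) c

lemma refine_ones : Split.Nested e (Split.ones m) (fun i => Split.ones (k i)) e :=
  fun _ _ _ => rfl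

lemma actR_act (p : P.R m) (c : ∀ i, P.C (k i)) :
    P.actR e p (fun i => MAct.act s (c i)) = MAct.act s (P.actR e p c) := by
  have := P.actR_compR' (refine_ones e) p (fun _ => s) c
  rw [P.central_row] at this
  exact this.symm.trans (P.act_actR e s p c)

lemma act_compC (q : ∀ i, P.C (k i)) (c : P.C n) :
    P.compC e (fun i => MAct.act s (q i)) c = MAct.act s (P.compC e q c) :=
  (P.actC_compC (refine_ones e) c q (fun _ => s)).symm

lemma compC_act (q : ∀ i, P.C (k i)) (c : P.C n) :
    P.compC e q (MAct.act s c) = MAct.act s (P.compC e q c) := by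
  rw [← P.act_compC, P.actC_def, ← P.compC_toC, P.compC_compC (g := Split.ones n) (e := e)
    (f := fun i => Split.single (k i)) (e' := e) (fun _ _ _ => rfl)]
  congr 1
  funext i
  exact P.central_col s (q i)

lemma act_actC (r : ∀ i, P.R (k i)) (c : P.C m) :
    P.actC e (fun i => MAct.act s (r i)) c = MAct.act s (P.actC e r c) :=
  (P.actC_actC (g := Split.ones n) (e := e) (f := fun i => Split.single (k i)) (e' := e)
    (fun _ _ _ => rfl) c r (fun _ => s)).symm

lemma actC_act (r : ∀ i, P.R (k i)) (c : P.C m) :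
    P.actC e r (MAct.act s c) = MAct.act s (P.actC e r c) := by
  rw [← P.act_actC, P.actC_def, P.actC_actC (refine_ones e)]
  congr 1
  funext i
  exact P.central_row s (r i)

end
end CBio

/-! ### Localization and locally constant fractions -/

section Loc
variable {M : Type u} [CommMonoid M] (S : Submonoid M) (X : Type u) [MAct M X]

/-- Fractions `x / s` and `y / t` are identified if `u t x = u s y` for some `u ∈ S`. -/
def Loc.setoid : Setoid (X × S) where
  r a b := ∃ u ∈ S, MAct.act (u * b.2) a.1 = MAct.act (u * a.2) b.1
  iseqv := by
    refine ⟨fun a => ⟨1, S.one_mem, rfl⟩, fun ⟨u, hu, h⟩ => ⟨u, hu, h.symm⟩, ?_⟩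
    rintro ⟨x, s⟩ ⟨y, t⟩ ⟨z, r⟩ ⟨u, hu, h⟩ ⟨v, hv, h'⟩
    refine ⟨u * v * t, S.mul_mem (S.mul_mem hu hv) t.2, ?_⟩
    dsimp only at *
    have e1 : u * v * t * r = (v * r) * (u * t) := by
      simp only [mul_comm, mul_left_comm]
    have e2 : (v * r) * (u * s) = (u * s) * (v * r) := mul_comm _ _
    have e3 : (u * s) * (v * t) = u * v * t * s := by
      simp only [mul_comm, mul_left_comm]
    rw [e1, MAct.mul_act, h, ← MAct.mul_act, e2, MAct.mul_act, h', ← MAct.mul_act, e3]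

/-- The localization `S⁻¹X`. -/
def Loc : Type u := Quotient (Loc.setoid S X)

variable {S X}

/-- The fraction `x / s`. -/
def Loc.mk (x : X) (s : S) : Loc S X := Quotient.mk (Loc.setoid S X) (x, s)

lemma Loc.mk_eq {x y : X} {s t : S} :
    Loc.mk x s = Loc.mk y t ↔ ∃ u ∈ S, MAct.act (u * t) x = MAct.act (u * s) y :=
  ⟨fun h => Quotient.exact h, fun h => Quotient.sound h⟩

lemma Loc.exists_mk (x : Loc S X) : ∃ a s, x = Loc.mk a s := by
  induction x using Quotient.inductionOn with
  | h a => exact ⟨a.1, a.2, rfl⟩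

lemma Loc.mk_act (x : X) (s t : S) : Loc.mk (MAct.act (t : M) x) (t * s) = Loc.mk x s := by
  refine Loc.mk_eq.2 ⟨1, S.one_mem, ?_⟩
  rw [← MAct.mul_act, one_mul, one_mul, mul_comm]
  rfl

variable {n : ℕ} {Y : Fin n → Type u} [∀ i, MAct M (Y i)]

lemma Loc.common (a : ∀ i, Y i) (s : Fin n → S) :
    ∃ (t : S) (b : ∀ i, Y i), (∀ i, ∃ r ∈ S, b i = MAct.act r (a i) ∧ t = r * s i) := by
  refine ⟨∏ i, s i, fun i => MAct.act (∏ j ∈ Finset.univ.erase i, s j : S).1 (a i), fun i =>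
    ⟨(∏ j ∈ Finset.univ.erase i, s j : S).1, (∏ j ∈ Finset.univ.erase i, s j : S).2, rfl, ?_⟩⟩
  rw [← Finset.prod_erase_mul Finset.univ s (Finset.mem_univ i)]
  rfl

/-- Finitely many fractions have a common denominator. -/
lemma Loc.exists_common (y : ∀ i, Loc S (Y i)) :
    ∃ b : (∀ i, Y i) × S, y = fun i => Loc.mk (b.1 i) b.2 := by
  choose a s h using fun i => Loc.exists_mk (y i)
  obtain ⟨t, b, hb⟩ := Loc.common a s
  refine ⟨(b, t), funext fun i => ?_⟩
  obtain ⟨r, hr, h1, h2⟩ := hb i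
  have : t = ⟨r, hr⟩ * s i := Subtype.ext h2
  show y i = Loc.mk (b i) t
  rw [h i, h1, this]
  exact (Loc.mk_act (a i) (s i) ⟨r, hr⟩).symm

variable {Z : Type u} [MAct M Z]

/-- An operation that is homogeneous in `x` and, jointly, in the family `y` extends to the
localizations by `φ (x / s) (y / t) = φ x y / (s * t)`. -/
def Loc.op (φ : X → (∀ i, Y i) → Z) (x : Loc S X) (y : ∀ i, Loc S (Y i)) : Loc S Z :=
  Loc.mk (φ (Loc.exists_mk x).choose (Loc.exists_common y).choose.1)
    ((Loc.exists_mk x).choose_spec.choose * (Loc.exists_common y).choose.2)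

lemma Loc.op_mk {φ : X → (∀ i, Y i) → Z} (h₁ : ∀ (s : M) x y, φ (MAct.act s x) y = MAct.act s (φ x y))
    (h₂ : ∀ (s : M) x y, φ x (fun i => MAct.act s (y i)) = MAct.act s (φ x y))
    (x : X) (s : S) (y : ∀ i, Y i) (t : S) :
    Loc.op φ (Loc.mk x s) (fun i => Loc.mk (y i) t) = Loc.mk (φ x y) (s * t) := by
  have key : ∀ (x' : X) (s' : S) (y' : ∀ i, Y i) (t' : S), Loc.mk x s = Loc.mk x' s' →
      (∀ i, Loc.mk (y i) t = Loc.mk (y' i) t') →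
      Loc.mk (φ x' y') (s' * t') = Loc.mk (φ x y) (s * t) := by
    intro x' s' y' t' hx hy
    obtain ⟨u, hu, hx⟩ := Loc.mk_eq.1 hx
    choose v hv hy using fun i => Loc.mk_eq.1 (hy i)
    let w : M := ∏ i, v i
    have hw : w ∈ S := S.prod_mem fun i _ => hv i
    have hy' : ∀ i, MAct.act (w * t') (y i) = MAct.act (w * t) (y' i) := by
      intro i
      have : ∀ c : M, w * c = (∏ j ∈ Finset.univ.erase i, v j) * (v i * c) := by
        intro c
        rw [← mul_assoc, Finset.prod_erase_mul _ _ (Finset.mem_univ i)]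
      rw [this, this, MAct.mul_act, hy i, ← MAct.mul_act]
    refine Loc.mk_eq.2 ⟨u * w, S.mul_mem hu hw, ?_⟩
    have e1 : u * w * ((s * t : S) : M) = (u * s) * (w * t) := by
      simp only [Submonoid.coe_mul, mul_comm, mul_left_comm]
    have e2 : u * w * ((s' * t' : S) : M) = (u * s') * (w * t') := by
      simp only [Submonoid.coe_mul, mul_comm, mul_left_comm]
    have hh : ∀ (a b : M) x y,
        MAct.act (a * b) (φ x y) = φ (MAct.act a x) (fun i => MAct.act b (y i)) := by
      intro a b x y
      rw [MAct.mul_act, ← h₂, ← h₁]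
    rw [e1, e2, hh, hh, hx]
    congr 1
    funext i
    exact (hy' i).symm
  refine key _ _ _ _ (Loc.exists_mk (Loc.mk x s)).choose_spec.choose_spec fun i => ?_
  exact congrFun (Loc.exists_common (fun i => Loc.mk (y i) t)).choose_spec i

/-- The operation `Loc.op` with the two arguments interchanged. -/
def Loc.op' (φ : (∀ i, Y i) → X → Z) (y : ∀ i, Loc S (Y i)) (x : Loc S X) : Loc S Z :=
  Loc.op (fun x y => φ y x) x y

lemma Loc.op'_mk {φ : (∀ i, Y i) → X → Z}
    (h₁ : ∀ (s : M) y x, φ y (MAct.act s x) = MAct.act s (φ y x))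
    (h₂ : ∀ (s : M) y x, φ (fun i => MAct.act s (y i)) x = MAct.act s (φ y x))
    (x : X) (s : S) (y : ∀ i, Y i) (t : S) :
    Loc.op' φ (fun i => Loc.mk (y i) t) (Loc.mk x s) = Loc.mk (φ y x) (t * s) := by
  rw [mul_comm]
  exact Loc.op_mk (φ := fun x y => φ y x) (fun s x y => h₁ s y x) (fun s x y => h₂ s y x) x s y t

/-- The monoid acts on itself. -/
abbrev MAct.self (M : Type u) [CommMonoid M] : MAct M M where
  act s t := s * t
  one_act := one_mul
  mul_act := mul_assoc

/-- A jointly homogeneous operation extends to the localizations by `φ (y / t) = φ y / t`. -/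
def Loc.op₁ (φ : (∀ i, Y i) → Z) (y : ∀ i, Loc S (Y i)) : Loc S Z :=
  letI := MAct.self M
  Loc.op (X := M) (fun s y => MAct.act s (φ y)) (Loc.mk 1 1) y

lemma Loc.op₁_mk {φ : (∀ i, Y i) → Z}
    (h : ∀ (s : M) y, φ (fun i => MAct.act s (y i)) = MAct.act s (φ y)) (y : ∀ i, Y i) (t : S) :
    Loc.op₁ φ (fun i => Loc.mk (y i) t) = Loc.mk (φ y) t := by
  let _ := MAct.self M
  refine (Loc.op_mk (X := M) (φ := fun s y => MAct.act s (φ y)) (fun s t y => MAct.mul_act s t _)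
    (fun s t y => ?_) 1 1 y t).trans ?_
  · rw [h, ← MAct.mul_act, mul_comm, MAct.mul_act]
  · rw [MAct.one_act, one_mul]

end Loc

namespace CBio

variable (P : CBio.{u}) (S : Submonoid (P.R 1))

section
variable {P S} {n m : ℕ} {k : Fin n → ℕ} (e : Split k m)

lemma loc_compR (p : P.R n) (s : S) (q : ∀ i, P.R (k i)) (t : S) :
    Loc.op (P.compR e) (Loc.mk p s) (fun i => Loc.mk (q i) t) =
      Loc.mk (P.compR e p q) (s * t) :=
  Loc.op_mk (fun s p q => P.act_compR e s p q) (fun s p q => P.compR_act e s p q) p s q t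

lemma loc_actR (p : P.R m) (s : S) (c : ∀ i, P.C (k i)) (t : S) :
    Loc.op (P.actR e) (Loc.mk p s) (fun i => Loc.mk (c i) t) =
      Loc.mk (P.actR e p c) (s * t) :=
  Loc.op_mk (fun s p q => P.act_actR e s p q) (fun s p q => P.actR_act e s p q) p s c t

lemma loc_compC (q : ∀ i, P.C (k i)) (t : S) (c : P.C n) (s : S) :
    Loc.op' (P.compC e) (fun i => Loc.mk (q i) t) (Loc.mk c s) =
      Loc.mk (P.compC e q c) (t * s) :=
  Loc.op'_mk (fun s p q => P.compC_act e s p q) (fun s p q => P.act_compC e s p q) c s q t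

lemma loc_actC (r : ∀ i, P.R (k i)) (t : S) (c : P.C m) (s : S) :
    Loc.op' (P.actC e) (fun i => Loc.mk (r i) t) (Loc.mk c s) =
      Loc.mk (P.actC e r c) (t * s) :=
  Loc.op'_mk (fun s p q => P.actC_act e s p q) (fun s p q => P.act_actC e s p q) c s r t

end

/-- The localization `S⁻¹P` of a commutative bio with respect to `S ⊆ P(1)`. -/
def loc : CBio.{u} where
  R n := Loc S (P.R n)
  C n := Loc S (P.C n)
  oneR := Loc.mk P.oneR 1
  oneC := Loc.mk P.oneC 1
  uniqueR :=
    { default := Loc.mk P.uniqueR.default 1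
      uniq := fun x => by
        obtain ⟨a, s, rfl⟩ := Loc.exists_mk x
        have := P.uniqueR
        exact Loc.mk_eq.2 ⟨1, S.one_mem, Subsingleton.elim _ _⟩ }
  uniqueC :=
    { default := Loc.mk P.uniqueC.default 1
      uniq := fun x => by
        obtain ⟨a, s, rfl⟩ := Loc.exists_mk x
        have := P.uniqueC
        exact Loc.mk_eq.2 ⟨1, S.one_mem, Subsingleton.elim _ _⟩ }
  compR e := Loc.op (P.compR e)
  compC e := Loc.op' (P.compC e)
  actR e := Loc.op (P.actR e)
  actC e := Loc.op' (P.actC e)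
  compR_one p := by
    obtain ⟨p, s, rfl⟩ := Loc.exists_mk p
    rw [loc_compR _ p s (fun _ => P.oneR), P.compR_one, mul_one]
  one_compR p := by
    obtain ⟨p, s, rfl⟩ := Loc.exists_mk p
    rw [loc_compR _ P.oneR 1 (fun _ => p), P.one_compR, one_mul]
  compC_one p := by
    obtain ⟨p, s, rfl⟩ := Loc.exists_mk p
    rw [loc_compC _ (fun _ => P.oneC), P.compC_one, one_mul]
  one_compC p := by
    obtain ⟨p, s, rfl⟩ := Loc.exists_mk p
    rw [loc_compC _ (fun _ => p), P.one_compC, mul_one]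
  actR_one p := by
    obtain ⟨p, s, rfl⟩ := Loc.exists_mk p
    rw [loc_actR _ p s (fun _ => P.oneC), P.actR_one, mul_one]
  actC_one p := by
    obtain ⟨p, s, rfl⟩ := Loc.exists_mk p
    rw [loc_actC _ (fun _ => P.oneR), P.actC_one, one_mul]
  compR_compR H p q r := by
    obtain ⟨p, s, rfl⟩ := Loc.exists_mk p
    obtain ⟨⟨q, t⟩, rfl⟩ := Loc.exists_common q
    obtain ⟨⟨r, u⟩, rfl⟩ := Loc.exists_common r
    dsimp only
    simp only [loc_compR]
    rw [P.compR_compR H, mul_assoc]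
  actR_actR H p c d := by
    obtain ⟨p, s, rfl⟩ := Loc.exists_mk p
    obtain ⟨⟨c, t⟩, rfl⟩ := Loc.exists_common c
    obtain ⟨⟨d, u⟩, rfl⟩ := Loc.exists_common d
    dsimp only
    simp only [loc_actR, loc_compC]
    rw [P.actR_actR H, mul_assoc]
  actR_compR H p q d := by
    obtain ⟨p, s, rfl⟩ := Loc.exists_mk p
    obtain ⟨⟨q, t⟩, rfl⟩ := Loc.exists_common q
    obtain ⟨⟨d, u⟩, rfl⟩ := Loc.exists_common d
    dsimp only
    simp only [loc_actR, loc_compR]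
    rw [P.actR_compR H, mul_assoc]
  actR_compR' H p q d := by
    obtain ⟨p, s, rfl⟩ := Loc.exists_mk p
    obtain ⟨⟨q, t⟩, rfl⟩ := Loc.exists_common q
    obtain ⟨⟨d, u⟩, rfl⟩ := Loc.exists_common d
    dsimp only
    simp only [loc_actR, loc_compR, loc_actC]
    rw [P.actR_compR' H, mul_assoc]
  compC_compC H c q r := by
    obtain ⟨c, s, rfl⟩ := Loc.exists_mk c
    obtain ⟨⟨q, t⟩, rfl⟩ := Loc.exists_common q
    obtain ⟨⟨r, u⟩, rfl⟩ := Loc.exists_common r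
    dsimp only
    simp only [loc_compC]
    rw [P.compC_compC H, mul_assoc]
  actC_actC H c r q := by
    obtain ⟨c, s, rfl⟩ := Loc.exists_mk c
    obtain ⟨⟨q, t⟩, rfl⟩ := Loc.exists_common q
    obtain ⟨⟨r, u⟩, rfl⟩ := Loc.exists_common r
    dsimp only
    simp only [loc_actC, loc_compR]
    rw [P.actC_actC H, mul_assoc]
  actC_compC H c d r := by
    obtain ⟨c, s, rfl⟩ := Loc.exists_mk c
    obtain ⟨⟨d, t⟩, rfl⟩ := Loc.exists_common d
    obtain ⟨⟨r, u⟩, rfl⟩ := Loc.exists_common r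
    dsimp only
    simp only [loc_actC, loc_compC]
    rw [P.actC_compC H, mul_assoc]
  actC_compC' H c d r := by
    obtain ⟨c, s, rfl⟩ := Loc.exists_mk c
    obtain ⟨⟨d, t⟩, rfl⟩ := Loc.exists_common d
    obtain ⟨⟨r, u⟩, rfl⟩ := Loc.exists_common r
    dsimp only
    simp only [loc_actC, loc_compC, loc_actR]
    rw [P.actC_compC' H, mul_assoc]
  comm_row H r q p := by
    obtain ⟨r, s, rfl⟩ := Loc.exists_mk r
    obtain ⟨⟨q, t⟩, rfl⟩ := Loc.exists_common q
    obtain ⟨⟨p, u⟩, rfl⟩ := Loc.exists_common p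
    dsimp only
    simp only [loc_actR, loc_compR]
    rw [P.comm_row H, mul_right_comm]
  comm_col H c q p := by
    obtain ⟨c, s, rfl⟩ := Loc.exists_mk c
    obtain ⟨⟨q, t⟩, rfl⟩ := Loc.exists_common q
    obtain ⟨⟨p, u⟩, rfl⟩ := Loc.exists_common p
    dsimp only
    simp only [loc_actC, loc_compC]
    rw [P.comm_col H, mul_left_comm]

end CBio

/-! ### Sections that are locally fractions -/

section Sec
variable {M : Type u} [CommMonoid M] {T : Type u} [TopologicalSpace T] (S : T → Submonoid M)

/-- `s` is locally given by a fraction. -/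
def IsLocFrac {X : Type u} [MAct M X] {U : Opens T} (s : ∀ y : U, Loc (S y) X) : Prop :=
  ∀ x : U, ∃ V : Opens T, x.1 ∈ V ∧ ∃ (a : X) (f : M),
    ∀ y : U, y.1 ∈ V → ∃ hf : f ∈ S y, s y = Loc.mk a ⟨f, hf⟩

/-- The families of elements of the localizations `(S y)⁻¹X`, `y ∈ U`, that are locally given by a
fraction. -/
def Sec (X : Type u) [MAct M X] (U : Opens T) : Type u :=
  {s : ∀ y : U, Loc (S y) X // IsLocFrac S s}

variable {S} {X : Type u} [MAct M X] {U : Opens T}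

@[ext]
lemma Sec.ext {s t : Sec S X U} (h : ∀ y, s.1 y = t.1 y) : s = t := Subtype.ext (funext h)

/-- The section given by an element of `X`. -/
def Sec.const (a : X) : Sec S X U :=
  ⟨fun _ => Loc.mk a 1, fun x => ⟨U, x.2, a, 1, fun y _ => ⟨(S y).one_mem, rfl⟩⟩⟩

/-- Restriction of sections. -/
def Sec.res {V : Opens T} (h : V ≤ U) (s : Sec S X U) : Sec S X V :=
  ⟨fun y => s.1 ⟨y, h y.2⟩, fun x => by
    obtain ⟨W, hW, a, f, H⟩ := s.2 ⟨x, h x.2⟩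
    exact ⟨W, hW, a, f, fun y hy => H ⟨y, h y.2⟩ hy⟩⟩

variable {n : ℕ} {Y : Fin n → Type u} [∀ i, MAct M (Y i)] {Z : Type u} [MAct M Z]

lemma IsLocFrac.common {y : ∀ i, Sec S (Y i) U} (x : U) :
    ∃ V : Opens T, x.1 ∈ V ∧ ∃ (b : ∀ i, Y i) (f : M),
      ∀ z : U, z.1 ∈ V → ∃ hf : f ∈ S z, ∀ i, (y i).1 z = Loc.mk (b i) ⟨f, hf⟩ := by
  choose V hV a f H using fun i => (y i).2 x
  refine ⟨⟨⋂ i, (V i : Set T), isOpen_iInter_of_finite fun i => (V i).2⟩, Set.mem_iInter.2 hV,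
    fun i => MAct.act (∏ j ∈ Finset.univ.erase i, f j) (a i), ∏ i, f i, fun z hz => ?_⟩
  have hz : ∀ i, z.1 ∈ V i := Set.mem_iInter.1 hz
  have hf : ∀ i, f i ∈ S z := fun i => (H i z (hz i)).choose
  refine ⟨(S z).prod_mem fun i _ => hf i, fun i => ?_⟩
  obtain ⟨hfi, h⟩ := H i z (hz i)
  rw [h, ← Loc.mk_act (a i) _ ⟨_, (S z).prod_mem fun j (_ : j ∈ Finset.univ.erase i) => hf j⟩]
  congr 1
  exact Subtype.ext (Finset.prod_erase_mul Finset.univ f (Finset.mem_univ i))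

/-- Pointwise operations on sections. -/
def Sec.op (φ : X → (∀ i, Y i) → Z) (h₁ : ∀ (s : M) x y, φ (MAct.act s x) y = MAct.act s (φ x y))
    (h₂ : ∀ (s : M) x y, φ x (fun i => MAct.act s (y i)) = MAct.act s (φ x y))
    (x : Sec S X U) (y : ∀ i, Sec S (Y i) U) : Sec S Z U :=
  ⟨fun z => Loc.op φ (x.1 z) (fun i => (y i).1 z), fun z => by
    obtain ⟨V, hV, a, f, H⟩ := x.2 z
    obtain ⟨W, hW, b, g, K⟩ := IsLocFrac.common (y := y) z
    refine ⟨V ⊓ W, ⟨hV, hW⟩, φ a b, f * g, fun w hw => ?_⟩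
    obtain ⟨hf, H⟩ := H w hw.1
    obtain ⟨hg, K⟩ := K w hw.2
    refine ⟨(S w).mul_mem hf hg, ?_⟩
    simp only [H, K]
    exact Loc.op_mk h₁ h₂ _ _ _ _⟩

/-- Pointwise operations on sections. -/
def Sec.op₁ (φ : (∀ i, Y i) → Z)
    (h : ∀ (s : M) y, φ (fun i => MAct.act s (y i)) = MAct.act s (φ y))
    (y : ∀ i, Sec S (Y i) U) : Sec S Z U :=
  letI := MAct.self M
  Sec.op (X := M) (fun s y => MAct.act s (φ y)) (fun s t y => MAct.mul_act s t _)
    (fun s t y => by rw [h, ← MAct.mul_act, mul_comm, MAct.mul_act]) (Sec.const 1) y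

end Sec

namespace CBio
variable (P : CBio.{u}) {T : Type u} [TopologicalSpace T] (S : T → Submonoid (P.R 1)) (U : Opens T)

/-- The commutative bio of families of elements of the localizations `(S y)⁻¹P`, `y ∈ U`, that are
locally given by fractions. -/
def sec : CBio.{u} where
  R n := Sec S (P.R n) U
  C n := Sec S (P.C n) U
  oneR := Sec.const P.oneR
  oneC := Sec.const P.oneC
  uniqueR :=
    { default := Sec.const P.uniqueR.default
      uniq := fun _ => Sec.ext fun y => (P.loc (S y)).uniqueR.uniq _ }
  uniqueC :=
    { default := Sec.const P.uniqueC.default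
      uniq := fun _ => Sec.ext fun y => (P.loc (S y)).uniqueC.uniq _ }
  compR e := Sec.op (P.compR e) (fun s p q => P.act_compR e s p q) (fun s p q => P.compR_act e s p q)
  compC e q c := Sec.op (fun c q => P.compC e q c) (fun s c q => P.compC_act e s q c)
    (fun s c q => P.act_compC e s q c) c q
  actR e := Sec.op (P.actR e) (fun s p c => P.act_actR e s p c) (fun s p c => P.actR_act e s p c)
  actC e r c := Sec.op (fun c r => P.actC e r c) (fun s c r => P.actC_act e s r c)
    (fun s c r => P.act_actC e s r c) c r
  compR_one _ := Sec.ext fun y => (P.loc (S y)).compR_one _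
  one_compR _ := Sec.ext fun y => (P.loc (S y)).one_compR _
  compC_one _ := Sec.ext fun y => (P.loc (S y)).compC_one _
  one_compC _ := Sec.ext fun y => (P.loc (S y)).one_compC _
  actR_one _ := Sec.ext fun y => (P.loc (S y)).actR_one _
  actC_one _ := Sec.ext fun y => (P.loc (S y)).actC_one _
  compR_compR H p q r := Sec.ext fun y => (P.loc (S y)).compR_compR H (p.1 y) (fun i => (q i).1 y)
    (fun i => (r i).1 y)
  actR_actR H p q r := Sec.ext fun y => (P.loc (S y)).actR_actR H (p.1 y) (fun i => (q i).1 y)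
    (fun i => (r i).1 y)
  actR_compR H p q r := Sec.ext fun y => (P.loc (S y)).actR_compR H (p.1 y) (fun i => (q i).1 y)
    (fun i => (r i).1 y)
  actR_compR' H p q r := Sec.ext fun y => (P.loc (S y)).actR_compR' H (p.1 y) (fun i => (q i).1 y)
    (fun i => (r i).1 y)
  compC_compC H p q r := Sec.ext fun y => (P.loc (S y)).compC_compC H (p.1 y) (fun i => (q i).1 y)
    (fun i => (r i).1 y)
  actC_actC H p q r := Sec.ext fun y => (P.loc (S y)).actC_actC H (p.1 y) (fun i => (q i).1 y)
    (fun i => (r i).1 y)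
  actC_compC H p q r := Sec.ext fun y => (P.loc (S y)).actC_compC H (p.1 y) (fun i => (q i).1 y)
    (fun i => (r i).1 y)
  actC_compC' H p q r := Sec.ext fun y => (P.loc (S y)).actC_compC' H (p.1 y) (fun i => (q i).1 y)
    (fun i => (r i).1 y)
  comm_row H p q r := Sec.ext fun y => (P.loc (S y)).comm_row H (p.1 y) (fun i => (q i).1 y)
    (fun i => (r i).1 y)
  comm_col H p q r := Sec.ext fun y => (P.loc (S y)).comm_col H (p.1 y) (fun i => (q i).1 y)
    (fun i => (r i).1 y)

end CBio
/-! ### Props -/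

/-- A prop: a strict symmetric monoidal category with objects the natural numbers, the monoidal
structure being addition on objects, and with `0` both initial and final. Here `A n m` is the set of
arrows from `m` to `n` (the "`n` by `m` matrices"), `comp a b = a ∘ b`, and `dsum e f a` is the direct
sum `a₀ ⊕ ⋯ ⊕ a_{N-1}` whose rows and columns are labelled through the decompositions `e` and `f`.
The symmetry is contained in this: a permutation is the direct sum of copies of the
identity of `1` with respect to two decompositions into singletons. -/
structure Prp where
  A : ℕ → ℕ → Type u
  one : ∀ n, A n n
  comp : ∀ {n k m : ℕ}, A n k → A k m → A n m
  dsum : ∀ {N n m : ℕ} {k l : Fin N → ℕ}, Split k n → Split l m → (∀ i, A (k i) (l i)) → A n m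
  uniqueLeft : ∀ m, Unique (A 0 m)
  uniqueRight : ∀ n, Unique (A n 0)
  one_comp : ∀ {n m : ℕ} (a : A n m), comp (one n) a = a
  comp_one : ∀ {n m : ℕ} (a : A n m), comp a (one m) = a
  comp_assoc : ∀ {n k l m : ℕ} (a : A n k) (b : A k l) (c : A l m),
    comp (comp a b) c = comp a (comp b c)
  dsum_one : ∀ {N n : ℕ} {k : Fin N → ℕ} (e : Split k n), dsum e e (fun i => one (k i)) = one n
  dsum_comp : ∀ {N n m r : ℕ} {k l h : Fin N → ℕ} (e : Split k n) (f : Split l m) (g : Split h r)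
    (a : ∀ i, A (k i) (l i)) (b : ∀ i, A (l i) (h i)),
    comp (dsum e f a) (dsum f g b) = dsum e g (fun i => comp (a i) (b i))
  dsum_single : ∀ {n m : ℕ} (a : A n m), dsum (Split.single n) (Split.single m) (fun _ => a) = a
  dsum_dsum : ∀ {N M n m : ℕ} {h : Fin N → ℕ} {k l : Fin M → ℕ} {k' l' : Fin N → ℕ}
    {g : Split h M} {e : Split k n} {e₁ : ∀ j, Split (fun i => k (g ⟨j, i⟩)) (k' j)}
    {e' : Split k' n} {f : Split l m} {f₁ : ∀ j, Split (fun i => l (g ⟨j, i⟩)) (l' j)}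
    {f' : Split l' m}, Split.Nested g e e₁ e' → Split.Nested g f f₁ f' →
    ∀ a : ∀ s, A (k s) (l s),
    dsum e' f' (fun j => dsum (e₁ j) (f₁ j) (fun i => a (g ⟨j, i⟩))) = dsum e f a

/-- The diagonal matrix `s ⊕ ⋯ ⊕ s`. -/
def Prp.scal (P : Prp.{u}) (s : P.A 1 1) (n : ℕ) : P.A n n :=
  P.dsum (Split.ones n) (Split.ones n) (fun _ => s)

/-- A commutative prop: scalars are central, row vectors `p` and column vectors `q` commute,
`q ∘ p = (p ⊕ ⋯ ⊕ p) ∘ σ ∘ (q ⊕ ⋯ ⊕ q)`, and the contraction of `k` copies of an arbitrary matrix `a`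
with a row vector `b` and a column vector `d` of length `k` is multiplication by `b ∘ d`,
`(b ⊕ ⋯ ⊕ b) ∘ σ ∘ (a ⊕ ⋯ ⊕ a) ∘ σ' ∘ (d ⊕ ⋯ ⊕ d) = (b ∘ d) ⬝ a`. -/
structure CPrp extends Prp.{u} where
  central : ∀ {n m : ℕ} (s : A 1 1) (a : A n m),
    comp (toPrp.scal s n) a = comp a (toPrp.scal s m)
  comm : ∀ {n m L : ℕ} {f : Split (fun _ : Fin m => n) L} {g : Split (fun _ : Fin n => m) L},
    (∀ i j, f ⟨i, j⟩ = g ⟨j, i⟩) → ∀ (q : A m 1) (p : A 1 n),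
    comp q p = comp (dsum (Split.ones m) f (fun _ => p)) (dsum g (Split.ones n) (fun _ => q))
  contract : ∀ {n m k K L : ℕ} {f : Split (fun _ : Fin n => k) K}
    {g : Split (fun _ : Fin k => n) K} {g' : Split (fun _ : Fin k => m) L}
    {f' : Split (fun _ : Fin m => k) L},
    (∀ i j, f ⟨i, j⟩ = g ⟨j, i⟩) → (∀ i j, f' ⟨i, j⟩ = g' ⟨j, i⟩) →
    ∀ (b : A 1 k) (a : A n m) (d : A k 1),
    comp (dsum (Split.ones n) f (fun _ => b))
      (comp (dsum g g' (fun _ => a)) (dsum f' (Split.ones m) (fun _ => d))) =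
      comp (toPrp.scal (comp b d) n) a

/-- A homomorphism of props. -/
@[ext]
structure Prp.Hom (P Q : Prp.{u}) where
  on : ∀ n m, P.A n m → Q.A n m
  map_one : ∀ n, on n n (P.one n) = Q.one n
  map_comp : ∀ {n k m : ℕ} (a : P.A n k) (b : P.A k m),
    on n m (P.comp a b) = Q.comp (on n k a) (on k m b)
  map_dsum : ∀ {N n m : ℕ} {k l : Fin N → ℕ} (e : Split k n) (f : Split l m)
    (a : ∀ i, P.A (k i) (l i)), on n m (P.dsum e f a) = Q.dsum e f (fun i => on _ _ (a i))

/-- The category of commutative props. -/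
instance : Category CPrp.{u} where
  Hom P Q := Prp.Hom P.toPrp Q.toPrp
  id P := ⟨fun _ _ x => x, fun _ => rfl, fun _ _ => rfl, fun _ _ _ => rfl⟩
  comp f g := ⟨fun n m x => g.on n m (f.on n m x), fun n => by rw [f.map_one, g.map_one],
    fun a b => by rw [f.map_comp, g.map_comp], fun e e' a => by rw [f.map_dsum, g.map_dsum]⟩

namespace CPrp
variable (P : CPrp.{u})

lemma scal_one_eq (s : P.A 1 1) : P.scal s 1 = s := by
  have := P.dsum_single s
  rwa [CBio.single_one] at this

lemma scal_comp (s t : P.A 1 1) (n : ℕ) :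
    P.comp (P.scal s n) (P.scal t n) = P.scal (P.comp s t) n :=
  P.dsum_comp _ _ _ _ _

lemma scal_one (n : ℕ) : P.scal (P.one 1) n = P.one n := P.dsum_one _

/-- The commutative monoid of scalars. -/
instance : CommMonoid (P.A 1 1) where
  mul s t := P.comp s t
  one := P.one 1
  mul_assoc := P.comp_assoc
  one_mul := P.one_comp
  mul_one := P.comp_one
  mul_comm s t := by
    have := P.central s t
    rw [P.scal_one_eq] at this
    exact this

/-- Scalar multiplication of matrices. -/
instance (n m : ℕ) : MAct (P.A 1 1) (P.A n m) where
  act s a := P.comp (P.scal s n) a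
  one_act a := by
    show P.comp (P.scal (P.one 1) n) a = a
    rw [P.scal_one, P.one_comp]
  mul_act s t a := by
    show P.comp (P.scal (P.comp s t) n) a = _
    rw [← P.scal_comp, P.comp_assoc]

lemma act_def {n m : ℕ} (s : P.A 1 1) (a : P.A n m) : MAct.act s a = P.comp (P.scal s n) a := rfl

lemma act_comp {n k m : ℕ} (s : P.A 1 1) (a : P.A n k) (b : P.A k m) :
    P.comp (MAct.act s a) b = MAct.act s (P.comp a b) := P.comp_assoc _ _ _

lemma comp_act {n k m : ℕ} (s : P.A 1 1) (a : P.A n k) (b : P.A k m) :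
    P.comp a (MAct.act s b) = MAct.act s (P.comp a b) := by
  rw [act_def, act_def, ← P.comp_assoc, ← P.central, P.comp_assoc]

lemma dsum_act {N n m : ℕ} {k l : Fin N → ℕ} (e : Split k n) (f : Split l m) (s : P.A 1 1)
    (a : ∀ i, P.A (k i) (l i)) :
    P.dsum e f (fun i => MAct.act s (a i)) = MAct.act s (P.dsum e f a) := by
  simp only [act_def]
  rw [← P.dsum_comp e e f]
  congr 1
  exact P.dsum_dsum (CBio.refine_ones e) (CBio.refine_ones e) (fun _ => s)

variable {P} {S : Submonoid (P.A 1 1)}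

/-- Composition of fractions. -/
def locComp {n k m : ℕ} (a : Loc S (P.A n k)) (b : Loc S (P.A k m)) : Loc S (P.A n m) :=
  Loc.op (n := 1) (fun a b => P.comp a (b 0)) a (fun _ => b)

lemma locComp_mk {n k m : ℕ} (a : P.A n k) (s : S) (b : P.A k m) (t : S) :
    locComp (Loc.mk a s) (Loc.mk b t) = Loc.mk (P.comp a b) (s * t) :=
  Loc.op_mk (n := 1) (φ := fun a (b : Fin 1 → P.A k m) => P.comp a (b 0))
    (fun s a b => P.act_comp s a (b 0)) (fun s a b => P.comp_act s a (b 0)) a s (fun _ => b) t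

lemma locDsum_mk {N n m : ℕ} {k l : Fin N → ℕ} (e : Split k n) (f : Split l m)
    (a : ∀ i, P.A (k i) (l i)) (t : S) :
    Loc.op₁ (P.dsum e f) (fun i => Loc.mk (a i) t) = Loc.mk (P.dsum e f a) t :=
  Loc.op₁_mk (fun s a => P.dsum_act e f s a) a t

variable (P S)

/-- The localization of a commutative prop as a prop. -/
def locPrp : Prp.{u} where
  A n m := Loc S (P.A n m)
  one n := Loc.mk (P.one n) 1
  comp := locComp
  dsum e f := Loc.op₁ (P.dsum e f)
  uniqueLeft m :=
    { default := Loc.mk (P.uniqueLeft m).default 1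
      uniq := fun x => by
        obtain ⟨a, s, rfl⟩ := Loc.exists_mk x
        have := P.uniqueLeft m
        exact Loc.mk_eq.2 ⟨1, S.one_mem, Subsingleton.elim _ _⟩ }
  uniqueRight n :=
    { default := Loc.mk (P.uniqueRight n).default 1
      uniq := fun x => by
        obtain ⟨a, s, rfl⟩ := Loc.exists_mk x
        have := P.uniqueRight n
        exact Loc.mk_eq.2 ⟨1, S.one_mem, Subsingleton.elim _ _⟩ }
  one_comp a := by
    obtain ⟨a, s, rfl⟩ := Loc.exists_mk a
    rw [locComp_mk, P.one_comp, one_mul]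
  comp_one a := by
    obtain ⟨a, s, rfl⟩ := Loc.exists_mk a
    rw [locComp_mk, P.comp_one, mul_one]
  comp_assoc a b c := by
    obtain ⟨a, s, rfl⟩ := Loc.exists_mk a
    obtain ⟨b, t, rfl⟩ := Loc.exists_mk b
    obtain ⟨c, u, rfl⟩ := Loc.exists_mk c
    simp only [locComp_mk, P.comp_assoc, mul_assoc]
  dsum_one e := by rw [locDsum_mk, P.dsum_one]
  dsum_comp e f g a b := by
    obtain ⟨⟨a, t⟩, rfl⟩ := Loc.exists_common a
    obtain ⟨⟨b, u⟩, rfl⟩ := Loc.exists_common b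
    dsimp only
    simp only [locComp_mk, locDsum_mk, P.dsum_comp]
  dsum_single a := by
    obtain ⟨a, s, rfl⟩ := Loc.exists_mk a
    rw [locDsum_mk _ _ (fun _ => a), P.dsum_single]
  dsum_dsum H H' a := by
    obtain ⟨⟨a, t⟩, rfl⟩ := Loc.exists_common a
    dsimp only
    simp only [locDsum_mk]
    rw [P.dsum_dsum H H']

lemma loc_scal (s : P.A 1 1) (t : S) (n : ℕ) :
    (P.locPrp S).scal (Loc.mk s t) n = Loc.mk (P.scal s n) t :=
  locDsum_mk _ _ (fun _ => s) t

/-- The localization `S⁻¹P` of a commutative prop with respect to `S ⊆ A 1 1`. -/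
def loc : CPrp.{u} where
  toPrp := P.locPrp S
  central s a := by
    obtain ⟨s, t, rfl⟩ := Loc.exists_mk s
    obtain ⟨a, u, rfl⟩ := Loc.exists_mk a
    rw [loc_scal, loc_scal]
    refine (locComp_mk _ _ _ _).trans (Eq.trans ?_ (locComp_mk _ _ _ _).symm)
    rw [P.central, mul_comm]
  comm H q p := by
    obtain ⟨q, s, rfl⟩ := Loc.exists_mk q
    obtain ⟨p, t, rfl⟩ := Loc.exists_mk p
    dsimp only [locPrp]
    rw [locDsum_mk _ _ (fun _ => p), locDsum_mk _ _ (fun _ => q), locComp_mk, locComp_mk,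
      P.comm H, mul_comm]
  contract H H' b a d := by
    obtain ⟨b, s, rfl⟩ := Loc.exists_mk b
    obtain ⟨a, t, rfl⟩ := Loc.exists_mk a
    obtain ⟨d, u, rfl⟩ := Loc.exists_mk d
    have e : (P.locPrp S).comp (Loc.mk b s) (Loc.mk d u) = Loc.mk (P.comp b d) (s * u) :=
      locComp_mk _ _ _ _
    rw [e, loc_scal]
    dsimp only [locPrp]
    rw [locDsum_mk _ _ (fun _ => b), locDsum_mk _ _ (fun _ => a), locDsum_mk _ _ (fun _ => d),
      locComp_mk, locComp_mk, locComp_mk, P.contract H H', mul_assoc, mul_comm t u]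

variable {T : Type u} [TopologicalSpace T] (S : T → Submonoid (P.A 1 1)) (U : Opens T)

/-- The prop of families of elements of the localizations `(S y)⁻¹P`, `y ∈ U`, that are locally
given by fractions. -/
def secPrp : Prp.{u} where
  A n m := Sec S (P.A n m) U
  one n := Sec.const (P.one n)
  comp {n k m} a b := Sec.op (n := 1) (X := P.A n k) (Y := fun _ => P.A k m) (Z := P.A n m)
    (fun a b => P.comp a (b 0)) (fun s a b => P.act_comp s a (b 0))
    (fun s a b => P.comp_act s a (b 0)) a (fun _ => b)
  dsum e f := Sec.op₁ (P.dsum e f) (fun s a => P.dsum_act e f s a)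
  uniqueLeft m :=
    { default := Sec.const (P.uniqueLeft m).default
      uniq := fun _ => Sec.ext fun y => ((P.loc (S y)).uniqueLeft m).uniq _ }
  uniqueRight n :=
    { default := Sec.const (P.uniqueRight n).default
      uniq := fun _ => Sec.ext fun y => ((P.loc (S y)).uniqueRight n).uniq _ }
  one_comp a := Sec.ext fun y => (P.loc (S y)).one_comp (a.1 y)
  comp_one a := Sec.ext fun y => (P.loc (S y)).comp_one (a.1 y)
  comp_assoc a b c := Sec.ext fun y => (P.loc (S y)).comp_assoc (a.1 y) (b.1 y) (c.1 y)
  dsum_one e := Sec.ext fun y => (P.loc (S y)).dsum_one e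
  dsum_comp e f g a b := Sec.ext fun y =>
    (P.loc (S y)).dsum_comp e f g (fun i => (a i).1 y) (fun i => (b i).1 y)
  dsum_single a := Sec.ext fun y => (P.loc (S y)).dsum_single (a.1 y)
  dsum_dsum H H' a := Sec.ext fun y => (P.loc (S y)).dsum_dsum H H' (fun i => (a i).1 y)

/-- The commutative prop of families of elements of the localizations `(S y)⁻¹P`, `y ∈ U`, that are
locally given by fractions. -/
def sec : CPrp.{u} where
  toPrp := P.secPrp S U
  central s a := Sec.ext fun y => (P.loc (S y)).central (s.1 y) (a.1 y)
  comm H q p := Sec.ext fun y => (P.loc (S y)).comm H (q.1 y) (p.1 y)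
  contract H H' b a d := Sec.ext fun y => (P.loc (S y)).contract H H' (b.1 y) (a.1 y) (d.1 y)

end CPrp

/-! ### The bio of row and column vectors of a prop -/

namespace Prp
variable (P : Prp.{u})

lemma ones_nested {N n : ℕ} {h : Fin N → ℕ} (g : Split h n) :
    Split.Nested g (Split.ones n) (fun j => Split.ones (h j)) g := fun _ _ _ => rfl

/-- The bio `U A` of a prop, with `P⁻(n) = A 1 n` and `P⁺(n) = A n 1`. -/
def toBio : Bio.{u} where
  R n := P.A 1 n
  C n := P.A n 1
  oneR := P.one 1
  oneC := P.one 1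
  uniqueR := P.uniqueRight 1
  uniqueC := P.uniqueLeft 1
  compR {n _ _} e p q := P.comp p (P.dsum (Split.ones n) e q)
  compC {n _ _} e q c := P.comp (P.dsum e (Split.ones n) q) c
  actR {n _ _} e p c := P.comp p (P.dsum e (Split.ones n) c)
  actC {n _ _} e r c := P.comp (P.dsum (Split.ones n) e r) c
  compR_one p := by rw [P.dsum_one, P.comp_one]
  one_compR p := by
    rw [P.one_comp, ← CBio.single_one]
    exact P.dsum_single p
  compC_one p := by rw [P.dsum_one, P.one_comp]
  one_compC p := by
    rw [P.comp_one, ← CBio.single_one]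
    exact P.dsum_single p
  actR_one p := by rw [P.dsum_one, P.comp_one]
  actC_one p := by rw [P.dsum_one, P.one_comp]
  compR_compR {N n m h k l g e f e'} H p q r := by
    rw [← P.dsum_comp (Split.ones N) g e', P.comp_assoc, P.dsum_dsum (ones_nested g) H r]
  actR_actR {N n m h k l g e f e'} H p c d := by
    rw [← P.dsum_comp e' g (Split.ones N), P.comp_assoc, P.dsum_dsum H (ones_nested g) c]
  actR_compR {N n m h k l g e f e'} H p q d := by
    rw [← P.dsum_comp (Split.ones N) e' g, P.comp_assoc, P.dsum_dsum H (ones_nested g) d]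
  actR_compR' {N n m h k l g e f e'} H p q d := by
    rw [← P.dsum_comp g e' (Split.ones N), P.comp_assoc, P.dsum_dsum (ones_nested g) H q]
  compC_compC {N n m h k l g e f e'} H c q r := by
    rw [← P.dsum_comp e' g (Split.ones N), ← P.comp_assoc, P.dsum_dsum H (ones_nested g) r]
  actC_actC {N n m h k l g e f e'} H c r q := by
    rw [← P.dsum_comp (Split.ones N) g e', ← P.comp_assoc, P.dsum_dsum (ones_nested g) H r]
  actC_compC {N n m h k l g e f e'} H c d r := by
    rw [← P.dsum_comp g e' (Split.ones N), ← P.comp_assoc, P.dsum_dsum (ones_nested g) H r]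
  actC_compC' {N n m h k l g e f e'} H c d r := by
    rw [← P.dsum_comp (Split.ones N) e' g, ← P.comp_assoc, P.dsum_dsum H (ones_nested g) d]

end Prp

namespace CPrp
variable (P : CPrp.{u})

lemma comm_congr {n m L : ℕ} {nn : Fin m → ℕ} {mm : Fin n → ℕ} (hn : ∀ i, nn i = n)
    (hm : ∀ j, mm j = m) {f : Split nn L} {g : Split mm L}
    (H : ∀ i j, f ⟨i, Fin.cast (hn i).symm j⟩ = g ⟨j, Fin.cast (hm j).symm i⟩)
    (q : P.A m 1) (p : P.A 1 n) (q' : ∀ j, P.A (mm j) 1) (p' : ∀ i, P.A 1 (nn i))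
    (hq : ∀ j, q' j ≍ q) (hp : ∀ i, p' i ≍ p) :
    P.comp (P.dsum (Split.ones m) f p') (P.dsum g (Split.ones n) q') = P.comp q p := by
  obtain rfl : nn = fun _ => n := funext hn
  obtain rfl : mm = fun _ => m := funext hm
  obtain rfl : q' = fun _ => q := funext fun j => eq_of_heq (hq j)
  obtain rfl : p' = fun _ => p := funext fun i => eq_of_heq (hp i)
  exact (P.comm H q p).symm

/-- The interchange law at several places. -/
lemma comm_family {l M N L : ℕ} {m n : Fin l → ℕ} {e : Split m M} {e₂ : Split n N}
    {e₃ : Split (fun s => n (e.symm s).1) L} {e₄ : Split (fun t => m (e₂.symm t).1) L}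
    (H : Split.Interchange e e₂ e₃ e₄) (q : ∀ x, P.A (m x) 1) (p : ∀ x, P.A 1 (n x)) :
    P.comp (P.dsum (Split.ones M) e₃ (fun s => p (e.symm s).1))
      (P.dsum e₄ (Split.ones N) (fun t => q (e₂.symm t).1)) =
      P.comp (P.dsum e (Split.ones l) q) (P.dsum (Split.ones l) e₂ p) := by
  have hn : ∀ x i, n (e.symm (e ⟨x, i⟩)).1 = n x := fun x i => by rw [Equiv.symm_apply_apply]
  have hm : ∀ x j, m (e₂.symm (e₂ ⟨x, j⟩)).1 = m x := fun x j => by rw [Equiv.symm_apply_apply]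
  let F₁ : ∀ x, Split (fun i => n (e.symm (e ⟨x, i⟩)).1) (m x * n x) := fun x =>
    (Equiv.sigmaCongrRight fun i => finCongr (hn x i)).trans
      ((Equiv.sigmaEquivProd _ _).trans finProdFinEquiv)
  let G₁ : ∀ x, Split (fun j => m (e₂.symm (e₂ ⟨x, j⟩)).1) (m x * n x) := fun x =>
    (Equiv.sigmaCongrRight fun j => finCongr (hm x j)).trans
      (((Equiv.sigmaEquivProd _ _).trans (Equiv.prodComm _ _)).trans finProdFinEquiv)
  let F : Split (fun x => m x * n x) L :=
    (Equiv.sigmaCongrRight fun x => (F₁ x).symm).trans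
      ((Equiv.sigmaAssoc (fun x i => Fin (n (e.symm (e ⟨x, i⟩)).1))).symm.trans
        ((Equiv.sigmaCongrLeft (β := fun s => Fin (n (e.symm s).1)) e).trans e₃))
  have hF : Split.Nested e e₃ F₁ F := by
    intro x i t
    simp only [F, Equiv.trans_apply, Equiv.sigmaCongrRight_apply]
    rw [Equiv.symm_apply_apply]
    rfl
  have hFG : ∀ x i j, F₁ x ⟨i, Fin.cast (hn x i).symm j⟩ = G₁ x ⟨j, Fin.cast (hm x j).symm i⟩ :=
    fun x i j => rfl
  have hval : ∀ x (z : Fin (m x)), ((e.symm (e ⟨x, z⟩)).2 : ℕ) = z := by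
    intro x z
    rw [Equiv.symm_apply_apply]
  have hG : Split.Nested e₂ e₄ G₁ F := by
    intro x j t
    have h1 := hFG x (Fin.cast (hm x j) t) j
    have h2 := hF x (Fin.cast (hm x j) t) (Fin.cast (hn x _).symm j)
    have h3 := H (e ⟨x, Fin.cast (hm x j) t⟩) (e₂ ⟨x, j⟩) (by simp)
    have h4 : G₁ x ⟨j, t⟩ = F₁ x ⟨Fin.cast (hm x j) t, Fin.cast (hn x _).symm j⟩ := h1.symm
    rw [h4, ← h2]
    refine Eq.trans ?_ (h3.symm.trans ?_)
    · congr 2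
      exact Fin.ext (hval x (Fin.cast (hm x j) t)).symm
    · congr 2
      refine Fin.ext ?_
      simp only [Fin.val_cast]
      rw [Equiv.symm_apply_apply]
  rw [← P.dsum_dsum (Prp.ones_nested e) hF, ← P.dsum_dsum hG (Prp.ones_nested e₂), P.dsum_comp,
    P.dsum_comp]
  congr 1
  funext x
  refine P.comm_congr (hn x) (hm x) (hFG x) (q x) (p x) _ _ (fun j => ?_) (fun i => ?_)
  · rw [Equiv.symm_apply_apply]
  · rw [Equiv.symm_apply_apply]

/-- The commutative bio of row and column vectors of a commutative prop. -/
def toCBio : CBio.{u} where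
  toBio := P.toPrp.toBio
  comm_row H r q p := by
    exact (P.comp_assoc _ _ _).trans ((congrArg (P.comp r) (P.comm_family H q p).symm).trans
      (P.comp_assoc _ _ _).symm)
  comm_col H c q p := by
    exact (P.comp_assoc _ _ _).symm.trans ((congrArg (fun x => P.comp x c)
      (P.comm_family H q p).symm).trans (P.comp_assoc _ _ _))

end CPrp

/-- The functor `U` from commutative props to commutative bios. -/
def bioOfProp : CPrp.{u} ⥤ CBio.{u} where
  obj P := P.toCBio
  map {_ Q} f :=
    { onR := fun n => Prp.Hom.on f 1 n
      onC := fun n => Prp.Hom.on f n 1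
      map_oneR := Prp.Hom.map_one f 1
      map_oneC := Prp.Hom.map_one f 1
      map_compR := fun {n _ _} e _ q => (Prp.Hom.map_comp f _ _).trans
        (congrArg (Q.comp _) (Prp.Hom.map_dsum f (Split.ones n) e q))
      map_compC := fun {n _ _} e q _ => (Prp.Hom.map_comp f _ _).trans
        (congrArg (fun x => Q.comp x _) (Prp.Hom.map_dsum f e (Split.ones n) q))
      map_actR := fun {n _ _} e _ c => (Prp.Hom.map_comp f _ _).trans
        (congrArg (Q.comp _) (Prp.Hom.map_dsum f e (Split.ones n) c))
      map_actC := fun {n _ _} e r _ => (Prp.Hom.map_comp f _ _).trans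
        (congrArg (fun x => Q.comp x _) (Prp.Hom.map_dsum f (Split.ones n) e r)) }
  map_id _ := rfl
  map_comp _ _ := rfl

/-! ### Matrices over a commutative ring -/

section Matrices
variable (R : Type u) [CommRing R]

lemma blockDiagonal'_const {R : Type u} [CommRing R] {N n m p q : ℕ}
    (e : Split (fun _ : Fin N => p) n) (f : Split (fun _ : Fin N => q) m)
    (a : Matrix (Fin p) (Fin q) R) (i j : Fin N) (x : Fin p) (y : Fin q) :
    Matrix.reindex e f (Matrix.blockDiagonal' fun _ => a) (e ⟨i, x⟩) (f ⟨j, y⟩) =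
      if i = j then a x y else 0 := by
  rw [Matrix.reindex_apply, Matrix.submatrix_apply, Equiv.symm_apply_apply, Equiv.symm_apply_apply]
  split_ifs with h
  · subst h
    exact Matrix.blockDiagonal'_apply_eq _ _ _ _
  · exact Matrix.blockDiagonal'_apply_ne _ _ _ h

/-- The prop of matrices over `R`, with matrix multiplication and block direct sums. -/
def matPrp : Prp.{u} where
  A n m := Matrix (Fin n) (Fin m) R
  one _ := 1
  comp a b := a * b
  dsum e f a := Matrix.reindex e f (Matrix.blockDiagonal' a)
  uniqueLeft _ := ⟨⟨0⟩, fun _ => Subsingleton.elim _ _⟩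
  uniqueRight _ := ⟨⟨0⟩, fun _ => Subsingleton.elim _ _⟩
  one_comp := Matrix.one_mul
  comp_one := Matrix.mul_one
  comp_assoc := Matrix.mul_assoc
  dsum_one e := by
    rw [Matrix.reindex_apply, show (fun i => (1 : Matrix (Fin _) (Fin _) R)) = 1 from rfl,
      Matrix.blockDiagonal'_one, Matrix.submatrix_one_equiv]
  dsum_comp e f g a b := by
    rw [Matrix.reindex_apply, Matrix.reindex_apply, Matrix.submatrix_mul_equiv,
      ← Matrix.blockDiagonal'_mul, Matrix.reindex_apply]
  dsum_single a := by
    ext i j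
    exact (blockDiagonal'_const (Split.single _) (Split.single _) a 0 0 i j).trans (if_pos rfl)
  dsum_dsum {N M n m h k l k' l' g e e₁ e' f f₁ f'} H H' a := by
    ext r c
    obtain ⟨⟨s, t⟩, rfl⟩ := e.surjective r
    obtain ⟨⟨s', t'⟩, rfl⟩ := f.surjective c
    obtain ⟨⟨j, i⟩, rfl⟩ := g.surjective s
    obtain ⟨⟨j', i'⟩, rfl⟩ := g.surjective s'
    simp only [Matrix.reindex_apply, Matrix.submatrix_apply, Equiv.symm_apply_apply]
    rw [H j i t, H' j' i' t']
    simp only [Equiv.symm_apply_apply]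
    by_cases hj : j = j'
    · subst hj
      rw [Matrix.blockDiagonal'_apply_eq, Matrix.submatrix_apply, Equiv.symm_apply_apply,
        Equiv.symm_apply_apply]
      by_cases hi : i = i'
      · subst hi
        rw [Matrix.blockDiagonal'_apply_eq, Matrix.blockDiagonal'_apply_eq]
      · rw [Matrix.blockDiagonal'_apply_ne _ _ _ hi, Matrix.blockDiagonal'_apply_ne]
        intro h
        exact hi (by simpa using g.injective h)
    · rw [Matrix.blockDiagonal'_apply_ne _ _ _ hj, Matrix.blockDiagonal'_apply_ne]
      intro h
      exact hj (congrArg Sigma.fst (g.injective h))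

section
variable {R}

lemma mat_scal (s : Matrix (Fin 1) (Fin 1) R) (n : ℕ) :
    Matrix.reindex (Split.ones n) (Split.ones n) (Matrix.blockDiagonal' fun _ => s) =
      (s 0 0 • 1 : Matrix (Fin n) (Fin n) R) := by
  ext i j
  refine (blockDiagonal'_const (Split.ones n) (Split.ones n) s i j 0 0).trans ?_
  rw [Matrix.smul_apply, Matrix.one_apply]
  split_ifs <;> simp

lemma mat_comm {n m L : ℕ} {f : Split (fun _ : Fin m => n) L} {g : Split (fun _ : Fin n => m) L}
    (H : ∀ i j, f ⟨i, j⟩ = g ⟨j, i⟩) (q : Matrix (Fin m) (Fin 1) R) (p : Matrix (Fin 1) (Fin n) R) :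
    q * p = Matrix.reindex (Split.ones m) f (Matrix.blockDiagonal' fun _ => p) *
      Matrix.reindex g (Split.ones n) (Matrix.blockDiagonal' fun _ => q) := by
  ext i j
  have h1 := fun x y => blockDiagonal'_const (Split.ones m) f p i x 0 y
  have h2 := fun x y => blockDiagonal'_const g (Split.ones n) q x j y 0
  simp only [show (Split.ones m) ⟨i, 0⟩ = i from rfl] at h1
  simp only [show (Split.ones n) ⟨j, 0⟩ = j from rfl] at h2
  rw [Matrix.mul_apply, Matrix.mul_apply, ← f.sum_comp, Fintype.sum_sigma]
  simp only [h1]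
  simp only [H, h2]
  simp [mul_comm]

lemma mat_contract {n m k K L : ℕ} {f : Split (fun _ : Fin n => k) K}
    {g : Split (fun _ : Fin k => n) K} {g' : Split (fun _ : Fin k => m) L}
    {f' : Split (fun _ : Fin m => k) L} (H : ∀ i j, f ⟨i, j⟩ = g ⟨j, i⟩)
    (H' : ∀ i j, f' ⟨i, j⟩ = g' ⟨j, i⟩) (b : Matrix (Fin 1) (Fin k) R)
    (a : Matrix (Fin n) (Fin m) R) (d : Matrix (Fin k) (Fin 1) R) :
    Matrix.reindex (Split.ones n) f (Matrix.blockDiagonal' fun _ => b) *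
      (Matrix.reindex g g' (Matrix.blockDiagonal' fun _ => a) *
        Matrix.reindex f' (Split.ones m) (Matrix.blockDiagonal' fun _ => d)) =
      Matrix.reindex (Split.ones n) (Split.ones n) (Matrix.blockDiagonal' fun _ => b * d) * a := by
  rw [mat_scal, Matrix.smul_mul, Matrix.one_mul]
  ext i j
  have h1 := fun x y => blockDiagonal'_const (Split.ones n) f b i x 0 y
  have h2 := fun x y x' y' => blockDiagonal'_const g g' a x y x' y'
  have h3 := fun x y => blockDiagonal'_const f' (Split.ones m) d x j y 0
  simp only [show (Split.ones n) ⟨i, 0⟩ = i from rfl] at h1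
  simp only [show (Split.ones m) ⟨j, 0⟩ = j from rfl] at h3
  rw [Matrix.mul_apply, ← f.sum_comp, Fintype.sum_sigma, Matrix.smul_apply, smul_eq_mul,
    Matrix.mul_apply (M := b), Finset.sum_mul]
  simp only [h1, Matrix.mul_apply (M := Matrix.reindex g g' _)]
  simp only [← f'.sum_comp, Fintype.sum_sigma, h3]
  simp only [H, H', h2]
  simp [mul_comm, mul_left_comm]

end

/-- The commutative prop of matrices over a commutative ring. -/
def matCPrp : CPrp.{u} where
  toPrp := matPrp R
  central {n m} s a := by
    have h : ∀ (s : Matrix (Fin 1) (Fin 1) R) (a : Matrix (Fin n) (Fin m) R),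
        Matrix.reindex (Split.ones n) (Split.ones n) (Matrix.blockDiagonal' fun _ => s) * a =
        a * Matrix.reindex (Split.ones m) (Split.ones m) (Matrix.blockDiagonal' fun _ => s) := by
      intro s a
      rw [mat_scal, mat_scal]
      simp
    exact h s a
  comm H q p := mat_comm H q p
  contract H H' b a d := mat_contract H H' b a d

end Matrices

/-- The functor from commutative rings to commutative props, sending a ring to its matrices. -/
def propOfRing : CommRingCat.{u} ⥤ CPrp.{u} where
  obj R := matCPrp R
  map {R S} φ :=
    { on := fun n m (a : Matrix (Fin n) (Fin m) R) => (a.map φ.hom : Matrix (Fin n) (Fin m) S)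
      map_one := fun n => Matrix.map_one (n := Fin n) _ (map_zero φ.hom) (map_one φ.hom)
      map_comp := fun _ _ => Matrix.map_mul
      map_dsum := fun {N _ _ k l} e f a =>
        congrArg (Matrix.reindex e f) (Matrix.blockDiagonal'_map (o := Fin N)
          (m' := fun i => Fin (k i)) (n' := fun i => Fin (l i)) a φ.hom (map_zero φ.hom)) }
  map_id _ := rfl
  map_comp _ _ := rfl

/-- The functor from commutative rings to commutative bios. -/
abbrev bioOfRing : CommRingCat.{u} ⥤ CBio.{u} := propOfRing ⋙ bioOfProp

/-! ### Primes and the spectrum -/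

namespace CBio
variable (P Q : CBio.{u})

/-- The element `b ∘ (a₀ ⊕ ⋯ ⊕ a_{n-1}) ∘ d` of `P(1)`. -/
def contr {n : ℕ} (b : P.R n) (a : Fin n → P.R 1) (d : P.C n) : P.R 1 :=
  P.actR (Split.single n) (P.compR (Split.ones n) b a) (fun _ => d)

/-- An ideal of a commutative bio: a subset of `P(1)` closed under `a ↦ b ∘ (⊕ aᵢ) ∘ d`. -/
def IsIdeal (I : Set (P.R 1)) : Prop :=
  ∀ (n : ℕ) (b : P.R n) (a : Fin n → P.R 1) (d : P.C n), (∀ i, a i ∈ I) → P.contr b a d ∈ I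

/-- A maximal ideal: a proper ideal that is maximal among the proper ideals. -/
def IsMaxIdeal (I : Set (P.R 1)) : Prop :=
  Maximal (fun J => P.IsIdeal J ∧ (1 : P.R 1) ∉ J) I

/-- A prime ideal: an ideal whose complement is a submonoid of `P(1)`. -/
structure Prime where
  carrier : Set (P.R 1)
  isIdeal : P.IsIdeal carrier
  one_notMem : (1 : P.R 1) ∉ carrier
  mem_or_mem : ∀ s t : P.R 1, s * t ∈ carrier → s ∈ carrier ∨ t ∈ carrier

/-- The commutative bio is local: it has a unique maximal ideal. -/
def IsLocal : Prop := ∃! I : Set (P.R 1), P.IsMaxIdeal I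

/-- The complement of a prime ideal. -/
def Prime.compl {P : CBio.{u}} (x : P.Prime) : Submonoid (P.R 1) where
  carrier := {s | s ∉ x.carrier}
  one_mem' := x.one_notMem
  mul_mem' {s t} hs ht h := (x.mem_or_mem s t h).elim hs ht

/-- The Zariski topology: the sets `D(f) = {x | f ∉ x}` form a basis of the open sets. -/
instance : TopologicalSpace P.Prime :=
  TopologicalSpace.generateFrom (Set.range fun f : P.R 1 => {x : P.Prime | f ∉ x.carrier})

variable {P Q}

/-- The homomorphism of monoids `P(1) → Q(1)`. -/
def homOne (φ : P ⟶ Q) : P.R 1 →* Q.R 1 where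
  toFun := Bio.Hom.onR φ 1
  map_one' := Bio.Hom.map_oneR φ
  map_mul' s t := Bio.Hom.map_compR φ _ s (fun _ => t)

lemma onR_act (φ : P ⟶ Q) {n : ℕ} (s : P.R 1) (p : P.R n) :
    Bio.Hom.onR φ n (MAct.act s p) = MAct.act (homOne φ s) (Bio.Hom.onR φ n p) :=
  Bio.Hom.map_compR φ _ s (fun _ => p)

lemma onC_act (φ : P ⟶ Q) {n : ℕ} (s : P.R 1) (c : P.C n) :
    Bio.Hom.onC φ n (MAct.act s c) = MAct.act (homOne φ s) (Bio.Hom.onC φ n c) :=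
  Bio.Hom.map_actC φ _ (fun _ => s) c

/-- The preimage of a prime ideal. -/
def Prime.comap (φ : P ⟶ Q) (y : Q.Prime) : P.Prime where
  carrier := homOne φ ⁻¹' y.carrier
  isIdeal n b a d h := by
    have e : homOne φ (P.contr b a d) =
        Q.contr (Bio.Hom.onR φ n b) (fun i => homOne φ (a i)) (Bio.Hom.onC φ n d) :=
      (Bio.Hom.map_actR φ _ _ _).trans (congrArg (fun z => Q.actR (Split.single n) z _)
        (Bio.Hom.map_compR φ _ _ _))
    show homOne φ (P.contr b a d) ∈ y.carrier
    rw [e]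
    exact y.isIdeal n _ _ _ h
  one_notMem h := y.one_notMem (by rwa [Set.mem_preimage, map_one] at h)
  mem_or_mem s t h := y.mem_or_mem _ _ (by rwa [Set.mem_preimage, map_mul] at h)

lemma Prime.continuous_comap (φ : P ⟶ Q) : Continuous (Prime.comap φ) := by
  refine continuous_generateFrom_iff.2 ?_
  rintro _ ⟨f, rfl⟩
  exact TopologicalSpace.isOpen_generateFrom_of_mem ⟨homOne φ f, rfl⟩

variable (P) in
/-- The topological space `spec P`. -/
def spec : TopCat.{u} := TopCat.of P.Prime

/-- The continuous map `spec Q ⟶ spec P` induced by `P ⟶ Q`. -/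
def specMap (φ : P ⟶ Q) : Q.spec ⟶ P.spec := TopCat.ofHom ⟨Prime.comap φ, Prime.continuous_comap φ⟩

end CBio

section
variable {M M' : Type u} [CommMonoid M] [CommMonoid M'] (μ : M →* M') {X X' : Type u} [MAct M X]
  [MAct M' X'] (φ : X → X') (hφ : ∀ s x, φ (MAct.act s x) = MAct.act (μ s) (φ x))

/-- The map `x / s ↦ φ x / μ s` of localizations. -/
def Loc.map {S : Submonoid M} {S' : Submonoid M'} (h : ∀ s ∈ S, μ s ∈ S') :
    Loc S X → Loc S' X' :=
  Quotient.map (fun a => (φ a.1, ⟨μ a.2, h _ a.2.2⟩)) (by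
    rintro ⟨x, s⟩ ⟨y, t⟩ ⟨u, hu, H⟩
    refine ⟨μ u, h u hu, ?_⟩
    dsimp only at *
    rw [← map_mul, ← map_mul, ← hφ, ← hφ, H])

/-- The map on sections induced by a continuous map `g` and by `φ`. -/
def Sec.map {T T' : Type u} [TopologicalSpace T] [TopologicalSpace T'] {S : T → Submonoid M}
    {S' : T' → Submonoid M'} (g : C(T', T)) (h : ∀ y, ∀ s ∈ S (g y), μ s ∈ S' y) (U : Opens T)
    (s : Sec S X U) : Sec S' X' (U.comap g) :=
  ⟨fun y => Loc.map μ φ hφ (h y.1) (s.1 ⟨g y.1, y.2⟩), fun x => by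
    obtain ⟨V, hV, a, f, H⟩ := s.2 ⟨g x.1, x.2⟩
    refine ⟨V.comap g, hV, φ a, μ f, fun y hy => ?_⟩
    obtain ⟨hf, e⟩ := H ⟨g y.1, y.2⟩ hy
    refine ⟨h _ _ hf, ?_⟩
    exact congrArg (Loc.map μ φ hφ (h y.1)) e⟩

lemma Loc.map_mk {S : Submonoid M} {S' : Submonoid M'} (h : ∀ s ∈ S, μ s ∈ S') (x : X) (s : S) :
    Loc.map μ φ hφ h (Loc.mk x s) = Loc.mk (φ x) ⟨μ s, h s s.2⟩ := rfl

lemma Loc.map_mk_one {S : Submonoid M} {S' : Submonoid M'} (h : ∀ s ∈ S, μ s ∈ S') (x : X) :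
    Loc.map μ φ hφ h (Loc.mk x 1) = Loc.mk (φ x) 1 := by
  rw [Loc.map_mk]
  congr 1
  exact Subtype.ext (map_one μ)

variable {n : ℕ} {Y Y' : Fin n → Type u} [∀ i, MAct M (Y i)] [∀ i, MAct M' (Y' i)]
  {Z Z' : Type u} [MAct M Z] [MAct M' Z'] (ψ : ∀ i, Y i → Y' i)
  (hψ : ∀ i s x, ψ i (MAct.act s x) = MAct.act (μ s) (ψ i x)) (χ : Z → Z')
  (hχ : ∀ s x, χ (MAct.act s x) = MAct.act (μ s) (χ x))

lemma Loc.map_op {S : Submonoid M} {S' : Submonoid M'} (h : ∀ s ∈ S, μ s ∈ S')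
    {o : X → (∀ i, Y i) → Z} {o' : X' → (∀ i, Y' i) → Z'}
    (ho : ∀ x y, χ (o x y) = o' (φ x) (fun i => ψ i (y i)))
    (h₁ : ∀ (s : M) x y, o (MAct.act s x) y = MAct.act s (o x y))
    (h₂ : ∀ (s : M) x y, o x (fun i => MAct.act s (y i)) = MAct.act s (o x y))
    (h₁' : ∀ (s : M') x y, o' (MAct.act s x) y = MAct.act s (o' x y))
    (h₂' : ∀ (s : M') x y, o' x (fun i => MAct.act s (y i)) = MAct.act s (o' x y))
    (x : Loc S X) (y : ∀ i, Loc S (Y i)) :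
    Loc.map μ χ hχ h (Loc.op o x y) =
      Loc.op o' (Loc.map μ φ hφ h x) (fun i => Loc.map μ (ψ i) (hψ i) h (y i)) := by
  obtain ⟨x, s, rfl⟩ := Loc.exists_mk x
  obtain ⟨⟨y, t⟩, rfl⟩ := Loc.exists_common y
  dsimp only
  rw [Loc.op_mk h₁ h₂]
  simp only [Loc.map_mk]
  rw [Loc.op_mk h₁' h₂', ho]
  congr 1
  exact Subtype.ext (map_mul μ _ _)

lemma Loc.map_op₁ {S : Submonoid M} {S' : Submonoid M'} (h : ∀ s ∈ S, μ s ∈ S')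
    {o : (∀ i, Y i) → Z} {o' : (∀ i, Y' i) → Z'}
    (ho : ∀ y, χ (o y) = o' (fun i => ψ i (y i)))
    (h₁ : ∀ (s : M) y, o (fun i => MAct.act s (y i)) = MAct.act s (o y))
    (h₁' : ∀ (s : M') y, o' (fun i => MAct.act s (y i)) = MAct.act s (o' y))
    (y : ∀ i, Loc S (Y i)) :
    Loc.map μ χ hχ h (Loc.op₁ o y) = Loc.op₁ o' (fun i => Loc.map μ (ψ i) (hψ i) h (y i)) := by
  obtain ⟨⟨y, t⟩, rfl⟩ := Loc.exists_common y
  dsimp only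
  rw [Loc.op₁_mk h₁]
  simp only [Loc.map_mk]
  rw [Loc.op₁_mk h₁', ho]

end

/-! ### The affine spectra of commutative bios -/

namespace CBio

/-- The structure presheaf of `spec P`: the sections over `U` are the families of elements of the
localizations at the points of `U` that are locally given by fractions. -/
def presheaf (P : CBio.{u}) : P.spec.Presheaf CBio.{u} where
  obj U := P.sec (T := P.Prime) Prime.compl U.unop
  map i :=
    { onR := fun _ => Sec.res i.unop.le
      onC := fun _ => Sec.res i.unop.le
      map_oneR := rfl
      map_oneC := rfl
      map_compR := fun _ _ _ => rfl
      map_compC := fun _ _ _ => rfl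
      map_actR := fun _ _ _ => rfl
      map_actC := fun _ _ _ => rfl }
  map_id _ := rfl
  map_comp _ _ := rfl

/-- The space `spec P` with its structure presheaf. -/
def specPS (P : CBio.{u}) : PresheafedSpace CBio.{u} where
  carrier := P.spec
  presheaf := P.presheaf

variable {P Q : CBio.{u}}

lemma compl_comap (φ : P ⟶ Q) (y : Q.Prime) (s : P.R 1)
    (h : s ∈ (Prime.comap φ y).compl) : homOne φ s ∈ y.compl := h

/-- The pull-back of sections `O_P(U) → O_Q(f⁻¹ U)` induced by `φ : P ⟶ Q`. -/
def secMap (φ : P ⟶ Q) (U : Opens P.Prime) :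
    P.sec Prime.compl U ⟶
      Q.sec Prime.compl (U.comap ⟨Prime.comap φ, Prime.continuous_comap φ⟩) :=
  { onR := fun n => Sec.map (homOne φ) (Bio.Hom.onR φ n) (onR_act φ)
      ⟨Prime.comap φ, Prime.continuous_comap φ⟩ (compl_comap φ) U
    onC := fun n => Sec.map (homOne φ) (Bio.Hom.onC φ n) (onC_act φ)
      ⟨Prime.comap φ, Prime.continuous_comap φ⟩ (compl_comap φ) U
    map_oneR := Sec.ext fun y => (Loc.map_mk_one _ _ (onR_act φ) (compl_comap φ y.1) _).trans
      (congrArg (fun z => Loc.mk z 1) (Bio.Hom.map_oneR φ))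
    map_oneC := Sec.ext fun y => (Loc.map_mk_one _ _ (onC_act φ) (compl_comap φ y.1) _).trans
      (congrArg (fun z => Loc.mk z 1) (Bio.Hom.map_oneC φ))
    map_compR := fun e _ _ => Sec.ext fun y =>
      Loc.map_op (homOne φ) (Bio.Hom.onR φ _) (onR_act φ) (fun _ => Bio.Hom.onR φ _)
        (fun _ => onR_act φ) (Bio.Hom.onR φ _) (onR_act φ) (compl_comap φ y.1)
        (Bio.Hom.map_compR φ e) (fun s p q => P.act_compR e s p q)
        (fun s p q => P.compR_act e s p q) (fun s p q => Q.act_compR e s p q)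
        (fun s p q => Q.compR_act e s p q) _ _
    map_compC := fun e _ _ => Sec.ext fun y =>
      Loc.map_op (homOne φ) (Bio.Hom.onC φ _) (onC_act φ) (fun _ => Bio.Hom.onC φ _)
        (fun _ => onC_act φ) (Bio.Hom.onC φ _) (onC_act φ) (compl_comap φ y.1)
        (o := fun c q => P.compC e q c) (o' := fun c q => Q.compC e q c)
        (fun c q => Bio.Hom.map_compC φ e q c) (fun s c q => P.compC_act e s q c)
        (fun s c q => P.act_compC e s q c) (fun s c q => Q.compC_act e s q c)
        (fun s c q => Q.act_compC e s q c) _ _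
    map_actR := fun e _ _ => Sec.ext fun y =>
      Loc.map_op (homOne φ) (Bio.Hom.onR φ _) (onR_act φ) (fun _ => Bio.Hom.onC φ _)
        (fun _ => onC_act φ) (Bio.Hom.onR φ _) (onR_act φ) (compl_comap φ y.1)
        (Bio.Hom.map_actR φ e) (fun s p q => P.act_actR e s p q)
        (fun s p q => P.actR_act e s p q) (fun s p q => Q.act_actR e s p q)
        (fun s p q => Q.actR_act e s p q) _ _
    map_actC := fun e _ _ => Sec.ext fun y =>
      Loc.map_op (homOne φ) (Bio.Hom.onC φ _) (onC_act φ) (fun _ => Bio.Hom.onR φ _)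
        (fun _ => onR_act φ) (Bio.Hom.onC φ _) (onC_act φ) (compl_comap φ y.1)
        (o := fun c q => P.actC e q c) (o' := fun c q => Q.actC e q c)
        (fun c q => Bio.Hom.map_actC φ e q c) (fun s c q => P.actC_act e s q c)
        (fun s c q => P.act_actC e s q c) (fun s c q => Q.actC_act e s q c)
        (fun s c q => Q.act_actC e s q c) _ _ : Bio.Hom _ _ }

/-- The map `spec Q ⟶ spec P` induced by `φ : P ⟶ Q`. -/
def specPSMap (φ : P ⟶ Q) : Q.specPS ⟶ P.specPS where
  base := specMap φ
  c :=
    { app := fun U => secMap φ U.unop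
      naturality := fun _ _ _ => by
        refine Bio.Hom.ext ?_ ?_
        · rfl
        · rfl }

end CBio

lemma Loc.map_id' {M : Type u} [CommMonoid M] {X : Type u} [MAct M X] {S : Submonoid M}
    (h : ∀ s ∈ S, MonoidHom.id M s ∈ S) (x : Loc S X) :
    Loc.map (MonoidHom.id M) (fun x : X => x) (fun _ _ => rfl) h x = x := by
  obtain ⟨x, s, rfl⟩ := Loc.exists_mk x
  rfl

lemma Loc.map_map {M M' M'' : Type u} [CommMonoid M] [CommMonoid M'] [CommMonoid M'']
    {X X' X'' : Type u} [MAct M X] [MAct M' X'] [MAct M'' X''] {S : Submonoid M}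
    {S' : Submonoid M'} {S'' : Submonoid M''} (μ : M →* M') (μ' : M' →* M'') (φ : X → X')
    (φ' : X' → X'') (hφ : ∀ s x, φ (MAct.act s x) = MAct.act (μ s) (φ x))
    (hφ' : ∀ s x, φ' (MAct.act s x) = MAct.act (μ' s) (φ' x)) (h : ∀ s ∈ S, μ s ∈ S')
    (h' : ∀ s ∈ S', μ' s ∈ S'') (μ'' : M →* M'') (φ'' : X → X'')
    (hφ'' : ∀ s x, φ'' (MAct.act s x) = MAct.act (μ'' s) (φ'' x)) (h'' : ∀ s ∈ S, μ'' s ∈ S'')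
    (e : ∀ s, μ'' s = μ' (μ s)) (e' : ∀ x, φ'' x = φ' (φ x)) (x : Loc S X) :
    Loc.map μ'' φ'' hφ'' h'' x = Loc.map μ' φ' hφ' h' (Loc.map μ φ hφ h x) := by
  obtain ⟨x, s, rfl⟩ := Loc.exists_mk x
  simp only [Loc.map_mk, e, e']

/-- The affine spectrum of commutative bios, as a functor to presheafed spaces. -/
def specBio : CBio.{u}ᵒᵖ ⥤ PresheafedSpace CBio.{u} where
  obj P := P.unop.specPS
  map φ := CBio.specPSMap φ.unop
  map_id P := by
    refine PresheafedSpace.ext _ _ (TopCat.hom_ext (ContinuousMap.ext fun y => by rfl)) ?_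
    refine NatTrans.ext (funext fun U => ?_)
    refine Bio.Hom.ext (funext fun n => funext fun s => Sec.ext fun y => ?_)
      (funext fun n => funext fun s => Sec.ext fun y => ?_)
    · exact Loc.map_id' (fun _ h => h) _
    · exact Loc.map_id' (fun _ h => h) _
  map_comp φ ψ := by
    refine PresheafedSpace.ext _ _ (TopCat.hom_ext (ContinuousMap.ext fun y => by rfl)) ?_
    refine NatTrans.ext (funext fun U => ?_)
    refine Bio.Hom.ext (funext fun n => funext fun s => Sec.ext fun y => ?_)
      (funext fun n => funext fun s => Sec.ext fun y => ?_)
    · exact Loc.map_map (CBio.homOne ψ.unop) (CBio.homOne φ.unop) (Bio.Hom.onR ψ.unop n)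
        (Bio.Hom.onR φ.unop n) (CBio.onR_act ψ.unop) (CBio.onR_act φ.unop)
        (CBio.compl_comap _ _) (CBio.compl_comap _ _) (CBio.homOne (φ ≫ ψ).unop)
        (Bio.Hom.onR (φ ≫ ψ).unop n) (CBio.onR_act (φ ≫ ψ).unop) (CBio.compl_comap _ _)
        (fun _ => rfl) (fun _ => rfl) _
    · exact Loc.map_map (CBio.homOne ψ.unop) (CBio.homOne φ.unop) (Bio.Hom.onC ψ.unop n)
        (Bio.Hom.onC φ.unop n) (CBio.onC_act ψ.unop) (CBio.onC_act φ.unop)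
        (CBio.compl_comap _ _) (CBio.compl_comap _ _) (CBio.homOne (φ ≫ ψ).unop)
        (Bio.Hom.onC (φ ≫ ψ).unop n) (CBio.onC_act (φ ≫ ψ).unop) (CBio.compl_comap _ _)
        (fun _ => rfl) (fun _ => rfl) _

/-! ### The affine spectra of commutative props -/

namespace CPrp

lemma mul_toCBio (P : CPrp.{u}) (s t : P.A 1 1) :
    HMul.hMul (α := P.toCBio.R 1) (β := P.toCBio.R 1) (γ := P.toCBio.R 1) s t = P.comp s t := by
  have := P.dsum_single t
  nth_rw 1 [CBio.single_one] at this
  exact congrArg (P.comp s) this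

/-- The complement of a prime ideal, as a submonoid of `A 1 1`. -/
def compl {P : CPrp.{u}} (x : P.toCBio.Prime) : Submonoid (P.A 1 1) where
  carrier := {s | s ∉ x.carrier}
  one_mem' := x.compl.one_mem
  mul_mem' {s t} hs ht := by
    have := x.compl.mul_mem hs ht
    rwa [mul_toCBio] at this

/-- The structure presheaf on `spec P = spec (U P)` of a commutative prop: the sections over `U` are
the families of elements of the localizations at the points of `U` that are locally given by
fractions. -/
def presheaf (P : CPrp.{u}) : P.toCBio.spec.Presheaf CPrp.{u} where
  obj U := P.sec (T := P.toCBio.Prime) compl U.unop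
  map i :=
    { on := fun _ _ => Sec.res i.unop.le
      map_one := fun _ => rfl
      map_comp := fun _ _ => rfl
      map_dsum := fun _ _ _ => rfl }
  map_id _ := rfl
  map_comp _ _ := rfl

/-- The space `spec P` with its structure presheaf. -/
def specPS (P : CPrp.{u}) : PresheafedSpace CPrp.{u} where
  carrier := P.toCBio.spec
  presheaf := P.presheaf

variable {P Q : CPrp.{u}}

/-- The homomorphism of monoids `P 1 1 → Q 1 1`. -/
def homOne (φ : P ⟶ Q) : P.A 1 1 →* Q.A 1 1 where
  toFun := Prp.Hom.on φ 1 1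
  map_one' := Prp.Hom.map_one φ 1
  map_mul' s t := Prp.Hom.map_comp φ s t

lemma on_act (φ : P ⟶ Q) {n m : ℕ} (s : P.A 1 1) (a : P.A n m) :
    Prp.Hom.on φ n m (MAct.act s a) = MAct.act (homOne φ s) (Prp.Hom.on φ n m a) :=
  (Prp.Hom.map_comp φ _ _).trans (congrArg (fun z => Q.comp z _) (Prp.Hom.map_dsum φ _ _ _))

/-- The continuous map `spec Q → spec P`. -/
def comapC (φ : P ⟶ Q) : C(Q.toCBio.Prime, P.toCBio.Prime) :=
  ⟨CBio.Prime.comap (bioOfProp.map φ), CBio.Prime.continuous_comap (bioOfProp.map φ)⟩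

lemma compl_comap (φ : P ⟶ Q) (y : Q.toCBio.Prime) (s : P.A 1 1)
    (h : s ∈ compl (comapC φ y)) : homOne φ s ∈ compl y := h

/-- The pull-back of sections `O_P(U) → O_Q(f⁻¹ U)` induced by `φ : P ⟶ Q`. -/
def secMap (φ : P ⟶ Q) (U : Opens P.toCBio.Prime) :
    P.sec compl U ⟶ Q.sec compl (U.comap (comapC φ)) :=
  { on := fun n m => Sec.map (homOne φ) (Prp.Hom.on φ n m) (on_act φ) (comapC φ)
      (compl_comap φ) U
    map_one := fun n => Sec.ext fun y => (Loc.map_mk_one _ _ (on_act φ) (compl_comap φ y.1) _).trans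
      (congrArg (fun z => Loc.mk z 1) (Prp.Hom.map_one φ n))
    map_comp := fun {n k m} _ _ => Sec.ext fun y =>
      Loc.map_op (n := 1) (Y := fun _ => P.A k m) (Y' := fun _ => Q.A k m)
        (homOne φ) (Prp.Hom.on φ n k) (on_act φ) (fun _ => Prp.Hom.on φ k m)
        (fun _ => on_act φ) (Prp.Hom.on φ n m) (on_act φ) (compl_comap φ y.1)
        (o := fun a b => P.comp a (b 0)) (o' := fun a b => Q.comp a (b 0))
        (fun a b => Prp.Hom.map_comp φ a (b 0)) (fun s a b => P.act_comp s a (b 0))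
        (fun s a b => P.comp_act s a (b 0)) (fun s a b => Q.act_comp s a (b 0))
        (fun s a b => Q.comp_act s a (b 0)) _ _
    map_dsum := fun e f _ => Sec.ext fun y =>
      Loc.map_op₁ (homOne φ) (fun _ => Prp.Hom.on φ _ _) (fun _ => on_act φ)
        (Prp.Hom.on φ _ _) (on_act φ) (compl_comap φ y.1) (Prp.Hom.map_dsum φ e f)
        (fun s a => P.dsum_act e f s a) (fun s a => Q.dsum_act e f s a) _ : Prp.Hom _ _ }

/-- The map `spec Q ⟶ spec P` induced by `φ : P ⟶ Q`. -/
def specPSMap (φ : P ⟶ Q) : Q.specPS ⟶ P.specPS where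
  base := CBio.specMap (bioOfProp.map φ)
  c :=
    { app := fun U => secMap φ U.unop
      naturality := fun _ _ _ => Prp.Hom.ext rfl }

end CPrp

/-- The affine spectrum of commutative props, as a functor to presheafed spaces. -/
def specProp : CPrp.{u}ᵒᵖ ⥤ PresheafedSpace CPrp.{u} where
  obj P := P.unop.specPS
  map φ := CPrp.specPSMap φ.unop
  map_id P := by
    refine PresheafedSpace.ext _ _ (TopCat.hom_ext (ContinuousMap.ext fun y => by rfl)) ?_
    refine NatTrans.ext (funext fun U => ?_)
    refine Prp.Hom.ext (funext fun n => funext fun m => funext fun s => Sec.ext fun y => ?_)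
    exact Loc.map_id' (fun _ h => h) _
  map_comp φ ψ := by
    refine PresheafedSpace.ext _ _ (TopCat.hom_ext (ContinuousMap.ext fun y => by rfl)) ?_
    refine NatTrans.ext (funext fun U => ?_)
    refine Prp.Hom.ext (funext fun n => funext fun m => funext fun s => Sec.ext fun y => ?_)
    exact Loc.map_map (CPrp.homOne ψ.unop) (CPrp.homOne φ.unop) (Prp.Hom.on ψ.unop n m)
      (Prp.Hom.on φ.unop n m) (CPrp.on_act ψ.unop) (CPrp.on_act φ.unop)
      (CPrp.compl_comap _ _) (CPrp.compl_comap _ _) (CPrp.homOne (φ ≫ ψ).unop)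
      (Prp.Hom.on (φ ≫ ψ).unop n m) (CPrp.on_act (φ ≫ ψ).unop) (CPrp.compl_comap _ _)
      (fun _ => rfl) (fun _ => rfl) _


/-! ### Spaces with a sheaf of commutative bios or props with local stalks, and schemes -/

namespace CBio

/-- A homomorphism (of local bios) is local: it maps the maximal ideal into the maximal ideal. -/
def IsLocalMap {P Q : CBio.{u}} (φ : P ⟶ Q) : Prop :=
  ∀ I J, P.IsMaxIdeal I → Q.IsMaxIdeal J → Set.MapsTo (homOne φ) I J

lemma homOne_comp {P Q R : CBio.{u}} (φ : P ⟶ Q) (ψ : Q ⟶ R) (s : P.R 1) :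
    homOne (φ ≫ ψ) s = homOne ψ (homOne φ s) := rfl

lemma IsIdeal.preimage {P Q : CBio.{u}} (φ : P ⟶ Q) {J : Set (Q.R 1)}
    (hJ : Q.IsIdeal J ∧ (1 : Q.R 1) ∉ J) :
    P.IsIdeal (homOne φ ⁻¹' J) ∧ (1 : P.R 1) ∉ homOne φ ⁻¹' J := by
  refine ⟨fun n b a d h => ?_, fun h => hJ.2 (by rwa [Set.mem_preimage, map_one] at h)⟩
  have e : homOne φ (P.contr b a d) =
      Q.contr (Bio.Hom.onR φ n b) (fun i => homOne φ (a i)) (Bio.Hom.onC φ n d) :=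
    (Bio.Hom.map_actR φ _ _ _).trans (congrArg (fun z => Q.actR (Split.single n) z _)
      (Bio.Hom.map_compR φ _ _ _))
  rw [Set.mem_preimage, e]
  exact hJ.1 n _ _ _ h

lemma IsMaxIdeal.preimage {P Q : CBio.{u}} (φ : P ≅ Q) {J : Set (Q.R 1)} (hJ : Q.IsMaxIdeal J) :
    P.IsMaxIdeal (homOne φ.hom ⁻¹' J) := by
  refine ⟨IsIdeal.preimage φ.hom hJ.prop, fun K hK h s hs => ?_⟩
  have key : J ⊆ homOne φ.inv ⁻¹' K := by
    intro t ht
    apply h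
    show homOne φ.hom (homOne φ.inv t) ∈ J
    rw [← homOne_comp, φ.inv_hom_id]
    exact ht
  apply hJ.le_of_ge (IsIdeal.preimage φ.inv hK) key
  show homOne φ.inv (homOne φ.hom s) ∈ K
  rw [← homOne_comp, φ.hom_inv_id]
  exact hs

lemma isLocalMap_of_iso {P Q : CBio.{u}} (hP : P.IsLocal) (φ : P ≅ Q) : IsLocalMap φ.hom := by
  intro I J hI hJ s hs
  rw [hP.unique hI (IsMaxIdeal.preimage φ hJ)] at hs
  exact hs

lemma isLocalMap_of_iso' {P Q : CBio.{u}} (hQ : Q.IsLocal) (φ : P ≅ Q) : IsLocalMap φ.hom := by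
  intro I J hI hJ s hs
  have := hQ.unique hJ (IsMaxIdeal.preimage φ.symm hI)
  rw [this]
  show homOne φ.inv (homOne φ.hom s) ∈ I
  rw [← homOne_comp, φ.hom_inv_id]
  exact hs

lemma IsLocalMap.comp {P Q R : CBio.{u}} {φ : P ⟶ Q} {ψ : Q ⟶ R} (hφ : IsLocalMap φ)
    (hψ : IsLocalMap ψ) (hQ : Q.IsLocal) : IsLocalMap (φ ≫ ψ) := by
  intro I J hI hJ s hs
  obtain ⟨K, hK, -⟩ := hQ
  exact hψ K J hK hJ (hφ I K hI hK hs)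

end CBio

section LocSp
universe v
variable {C : Type v} [Category.{u} C]

/-- The sections of `X` over the open neighbourhoods of `x`. A stalk of `X` at `x` is a colimit of
this diagram. -/
def stalkDiagram (X : PresheafedSpace.{u} C) (x : X) : (OpenNhds x)ᵒᵖ ⥤ C :=
  (OpenNhds.inclusion x).op ⋙ X.presheaf

/-- The cocone of the maps `O_Y(U) → O_X(f⁻¹ U) → d`, for a cocone `d` at `x`. -/
def stalkCocone {X Y : PresheafedSpace.{u} C} (f : X ⟶ Y) (x : X) (d : Cocone (stalkDiagram X x)) :
    Cocone (stalkDiagram Y (f.base x)) where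
  pt := d.pt
  ι :=
    { app := fun U => f.c.app (op U.unop.1) ≫ d.ι.app (op ((OpenNhds.map f.base x).obj U.unop))
      naturality := fun U V i => by
        refine Eq.trans ?_ (Category.comp_id _).symm
        refine (Category.assoc _ _ _).symm.trans ?_
        refine (congrArg (fun z => z ≫ d.ι.app (op ((OpenNhds.map f.base x).obj V.unop)))
          (f.c.naturality ((OpenNhds.inclusion (f.base x)).op.map i))).trans ?_
        refine (Category.assoc _ _ _).trans ?_
        exact congrArg _ (d.w ((OpenNhds.map f.base x).op.map i)) }

/-- The map `O_{Y, f x} → O_{X, x}` of stalks induced by `f`. -/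
def stalkMap {X Y : PresheafedSpace.{u} C} (f : X ⟶ Y) (x : X) {c : Cocone (stalkDiagram Y (f.base x))}
    (hc : IsColimit c) (d : Cocone (stalkDiagram X x)) : c.pt ⟶ d.pt :=
  hc.desc (stalkCocone f x d)

variable (U : C ⥤ CBio.{u})

/-- A space with a sheaf of objects of `C` whose stalks are local, where locality is read off the
underlying commutative bio, given by the functor `U`. -/
structure LocSp extends SheafedSpace.{v, u, u} C where
  local_stalks : ∀ x : carrier, ∃ c : Cocone (stalkDiagram toPresheafedSpace x),
    Nonempty (IsColimit c) ∧ (U.obj c.pt).IsLocal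

/-- The maps on all stalks induced by `f` are local. -/
def IsLocalOnStalks {X Y : PresheafedSpace.{u} C} (f : X ⟶ Y) : Prop :=
  ∀ (x : X) (c : Cocone (stalkDiagram Y (f.base x))) (hc : IsColimit c)
    (d : Cocone (stalkDiagram X x)), Nonempty (IsColimit d) →
    CBio.IsLocalMap (U.map (stalkMap f x hc d))

variable {U}

/-- The morphisms: a continuous map with a pull-back of sections inducing local maps on stalks. -/
@[ext]
structure LocSp.Hom (X Y : LocSp U) where
  hom : X.toPresheafedSpace ⟶ Y.toPresheafedSpace
  isLocal : IsLocalOnStalks U hom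

lemma isLocalOnStalks_id (X : LocSp U) : IsLocalOnStalks U (𝟙 X.toPresheafedSpace) := by
  intro x c₀ hc₀ d hd
  let c : Cocone (stalkDiagram X.toPresheafedSpace x) := c₀
  let hc : IsColimit c := hc₀
  obtain ⟨hd⟩ := hd
  obtain ⟨e, ⟨he⟩, hl⟩ := X.local_stalks x
  have key : stalkMap (𝟙 X.toPresheafedSpace) x hc₀ d =
      (hc.coconePointUniqueUpToIso he).hom ≫ (he.coconePointUniqueUpToIso hd).hom := by
    refine hc.hom_ext fun V => ?_
    refine (hc₀.fac (stalkCocone (𝟙 X.toPresheafedSpace) x d) V).trans ?_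
    refine (Category.id_comp (d.ι.app V)).trans ?_
    rw [← Category.assoc, hc.comp_coconePointUniqueUpToIso_hom,
      he.comp_coconePointUniqueUpToIso_hom]
  refine (congrArg (fun z => CBio.IsLocalMap (U.map z)) key).mpr ?_
  rw [U.map_comp]
  exact (CBio.isLocalMap_of_iso' hl (U.mapIso (hc.coconePointUniqueUpToIso he))).comp
    (CBio.isLocalMap_of_iso hl (U.mapIso (he.coconePointUniqueUpToIso hd))) hl

lemma isLocalOnStalks_comp {X Y Z : LocSp U} {f : X.toPresheafedSpace ⟶ Y.toPresheafedSpace}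
    {g : Y.toPresheafedSpace ⟶ Z.toPresheafedSpace} (hf : IsLocalOnStalks U f)
    (hg : IsLocalOnStalks U g) : IsLocalOnStalks U (f ≫ g) := by
  intro x c₀ hc₀ d hd
  let c : Cocone (stalkDiagram Z.toPresheafedSpace (g.base (f.base x))) := c₀
  let hc : IsColimit c := hc₀
  obtain ⟨e, ⟨he⟩, hl⟩ := Y.local_stalks (f.base x)
  have key : stalkMap (f ≫ g) x hc₀ d = stalkMap g (f.base x) hc e ≫ stalkMap f x he d := by
    refine hc.hom_ext fun V => ?_
    refine (hc₀.fac (stalkCocone (f ≫ g) x d) V).trans ?_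
    refine Eq.trans ?_ (Category.assoc _ _ _)
    refine Eq.trans ?_ (congrArg (fun z => z ≫ stalkMap f x he d)
      (hc.fac (stalkCocone g (f.base x) e) V)).symm
    refine Eq.trans ?_ (Category.assoc _ _ _).symm
    refine Eq.trans ?_ (congrArg (fun z => g.c.app (op V.unop.1) ≫ z)
      (he.fac (stalkCocone f x d) (op ((OpenNhds.map g.base (f.base x)).obj V.unop)))).symm
    exact Category.assoc _ _ _
  refine (congrArg (fun z => CBio.IsLocalMap (U.map z)) key).mpr ?_
  rw [U.map_comp]
  exact (hg _ c hc e ⟨he⟩).comp (hf x e he d hd) hl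

instance : Category (LocSp U) where
  Hom := LocSp.Hom
  id X := ⟨𝟙 _, isLocalOnStalks_id X⟩
  comp f g := ⟨f.hom ≫ g.hom, isLocalOnStalks_comp f.isLocal g.isLocal⟩
  id_comp f := LocSp.Hom.ext (Category.id_comp f.hom)
  comp_id f := LocSp.Hom.ext (Category.comp_id f.hom)
  assoc f g h := LocSp.Hom.ext (Category.assoc f.hom g.hom h.hom)

variable (U) in
/-- The underlying space with its presheaf. -/
def LocSp.forget : LocSp U ⥤ PresheafedSpace.{u} C where
  obj X := X.toPresheafedSpace
  map f := LocSp.Hom.hom f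
  map_id _ := rfl
  map_comp _ _ := rfl

variable (U) in
/-- The spaces that are locally isomorphic to the affine spectra `Sp.obj A`. -/
def LocSp.IsLocallyAffine (Sp : Cᵒᵖ ⥤ PresheafedSpace.{u} C) : ObjectProperty (LocSp U) :=
  fun X => ∀ x : X.carrier, ∃ (W : Opens X.carrier) (A : C), x ∈ W ∧
    Nonempty (X.toPresheafedSpace.restrict W.isOpenEmbedding ≅ Sp.obj (op A))

end LocSp

/-- The category of spaces with a sheaf of commutative bios with local stalks. -/
abbrev LocBioSp := LocSp (𝟭 CBio.{u})

/-- The category of spaces with a sheaf of commutative props with local stalks. -/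
abbrev LocPropSp := LocSp bioOfProp.{u}

/-- The category of bio schemes. -/
abbrev BSch := (LocSp.IsLocallyAffine (𝟭 CBio.{u}) specBio.{u}).FullSubcategory

/-- The category of prop schemes. -/
abbrev PSch := (LocSp.IsLocallyAffine bioOfProp.{u} specProp.{u}).FullSubcategory

/-- The inclusion of bio schemes into locally bio-ed spaces. -/
abbrev bschIncl : BSch.{u} ⥤ LocBioSp.{u} := ObjectProperty.ι _

/-- The inclusion of prop schemes into locally prop-ed spaces. -/
abbrev pschIncl : PSch.{u} ⥤ LocPropSp.{u} := ObjectProperty.ι _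

/-- The underlying presheafed space of a locally ringed space. -/
abbrev lrsForget : LocallyRingedSpace.{u} ⥤ PresheafedSpace.{u} CommRingCat.{u} :=
  LocallyRingedSpace.forgetToSheafedSpace ⋙ SheafedSpace.forgetToPresheafedSpace

end GenGeom

end

noncomputable section

namespace GenGeom

/-! ### Categories of finitary algebraic structures -/

/-! Rings, props and bios are finitary many-sorted algebras defined by equations. `AlgCat` expresses
this by one closure property and yields limits, colimits, and filtered colimits computed on
elements. `Geo U` adds what geometry needs over the underlying bios `U`: scalars act, every
operation is homogeneous of some degree, localizations exist, and there are linear combinations `lc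
b d x`, which over a ring are the sums `∑ bᵢ dᵢ xᵢ`. The law `lc b d (sᵢ • x) = (b ∘ (⊕ sᵢ) ∘ d) •
x` follows from commutativity for bios and from the contraction axiom for props, and it takes the
place of addition. The geometry is then developed once and applied to the identity of bios and to
`bioOfProp`.

Affine spectra. Zorn's lemma gives primes that avoid a multiplicative set (`CBio.exists_prime`), and
locality turns into a statement about units (`CBio.isLocal_iff`, `CBio.isLocalMap_iff`). The
predicate `IsSpec` describes a spectrum by its points, unit loci and stalks. Two facts carry the
theory. A space `W` with local stalks maps to the spectrum of `A` exactly as `A` maps to the global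
sections of `W` (`IsSpec.exists_lift`, `IsSpec.hom_ext`): a point goes to the prime of the elements
whose germ there is not invertible. And the global sections of the spectrum are `A` itself
(`IsSpec.isIso`): the scalars that equalize two elements form an ideal, and local fractions are
glued by `lc` from an expression of `1` as a contraction of the denominators. Together they make
`spec` fully faithful.

Limits. Spaces with a presheaf have limits: the limit of the topological spaces with the colimit of
the pulled back sections. Such a limit has neither local stalks nor local projections. Both are
repaired by localization at those primes of the stalks that lie over all the maximal ideals of the
factors (`exists_localization`), a construction that also produces a sheaf. For schemes, affine
opens are described by the morphisms that land in them; the spectrum of a pushout is then an affine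
open of the fiber product, so schemes are closed under pullbacks. The spectrum of the initial object
is terminal.

Comparison. An element of a matrix prop, or of the bio of a prop, is a finite family of elements
(`Elementwise`), so stalks and the sheaf property pass through both functors. A homomorphism between
bios of matrices preserves addition because `a + b` is the row `(a, b)` composed with the column
`(1, 1)`, and a matrix is determined by its products with rows and columns; hence rings embed fully.
Since a `1 × 1` matrix is invertible exactly when its entry is, local morphisms correspond too. The
squares with the affine spectra commute because the matrices over `Spec R`, and the rows and columns
of a prop spectrum, again satisfy `IsSpec`. -/

/-- A finitary many-sorted signature. -/
structure Sig where
  K : Type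
  Op : Type
  ar : Op → Type
  fin : ∀ o, Finite (ar o)
  dom : ∀ o, ar o → K
  cod : Op → K

attribute [instance] Sig.fin

/-- A structure for a signature. -/
structure Str (S : Sig) where
  carrier : S.K → Type u
  op : ∀ o, (∀ a, carrier (S.dom o a)) → carrier (S.cod o)

/-- A homomorphism of structures. -/
@[ext]
structure Str.Hom {S : Sig} (A B : Str.{u} S) where
  app : ∀ k, A.carrier k → B.carrier k
  map_op : ∀ o x, app _ (A.op o x) = B.op o (fun a => app _ (x a))

instance (S : Sig) : Category (Str.{u} S) where
  Hom := Str.Hom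
  id A := ⟨fun _ x => x, fun _ _ => rfl⟩
  comp f g := ⟨fun k x => g.app k (f.app k x), fun o x => by rw [f.map_op, g.map_op]⟩

/-- Every finite family of elements of `B` is the image of a family of elements of a structure that
satisfies the equations of the structures in the image of `E`, up to equations that hold in `B`. -/
def Str.IsLike {S : Sig} {C : Type (u + 1)} [Category.{u} C] (E : C ⥤ Str.{u} S) (B : Str.{u} S) :
    Prop :=
  ∀ (ι : Type) [Finite ι] (k : ι → S.K) (x : ∀ i, B.carrier (k i)),
    ∃ (B' : Str.{u} S) (h : Str.Hom B' B) (x' : ∀ i, B'.carrier (k i)),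
      (∀ i, h.app _ (x' i) = x i) ∧ ∀ k (y y' : B'.carrier k),
        (∀ (A : C) (g : Str.Hom B' (E.obj A)), g.app k y = g.app k y') → h.app k y = h.app k y'

/-- A category of algebraic structures that is closed under products, substructures, and
quotients. -/
class AlgCat (C : Type (u + 1)) [Category.{u} C] where
  S : Sig
  E : C ⥤ Str.{u} S
  ff : E.FullyFaithful
  closed : ∀ B, Str.IsLike E B → ∃ A, Nonempty (E.obj A ≅ B)

section AlgCat

variable {C : Type (u + 1)} [Category.{u} C] [AlgCat C]

/-- The elements of sort `k` of an object. -/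
def El (k : (AlgCat.S C).K) (A : C) : Type u := (AlgCat.E.obj A).carrier k

/-- The action of a morphism on elements. -/
def ap {A B : C} (f : A ⟶ B) {k : (AlgCat.S C).K} (x : El k A) : El k B :=
  Str.Hom.app (AlgCat.E.map f) k x

/-- The operations of an object. -/
def opE {A : C} (o : (AlgCat.S C).Op) (x : ∀ a, El ((AlgCat.S C).dom o a) A) :
    El ((AlgCat.S C).cod o) A :=
  (AlgCat.E.obj A).op o x

lemma ap_op {A B : C} (f : A ⟶ B) (o : (AlgCat.S C).Op) (x : ∀ a, El ((AlgCat.S C).dom o a) A) :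
    ap f (opE o x) = opE o (fun a => ap f (x a)) :=
  Str.Hom.map_op _ o x

@[simp]
lemma ap_id {A : C} {k : (AlgCat.S C).K} (x : El k A) : ap (𝟙 A) x = x := by
  unfold ap
  rw [AlgCat.E.map_id]
  rfl

@[simp]
lemma ap_comp {A B D : C} (f : A ⟶ B) (g : B ⟶ D) {k : (AlgCat.S C).K} (x : El k A) :
    ap (f ≫ g) x = ap g (ap f x) := by
  unfold ap
  rw [AlgCat.E.map_comp]
  rfl

lemma hom_ext_ap {A B : C} {f g : A ⟶ B} (h : ∀ k (x : El k A), ap f x = ap g x) : f = g :=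
  AlgCat.ff.map_injective (Str.Hom.ext (funext fun k => funext fun x => h k x))

lemma exists_hom {A B : C} (φ : ∀ k, El k A → El k B)
    (h : ∀ o x, φ _ (opE o x) = opE o (fun a => φ _ (x a))) :
    ∃ f : A ⟶ B, ∀ k (x : El k A), ap f x = φ k x := by
  refine ⟨AlgCat.ff.preimage ⟨φ, h⟩, fun k x => ?_⟩
  unfold ap
  rw [AlgCat.ff.map_preimage]

lemma exists_obj (B : Str.{u} (AlgCat.S C)) (hB : Str.IsLike (C := C) AlgCat.E B) :
    ∃ (A : C) (i : ∀ k, El k A ≃ B.carrier k),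
      ∀ o x, i _ (opE o x) = B.op o (fun a => i _ (x a)) := by
  obtain ⟨A, ⟨i⟩⟩ := AlgCat.closed B hB
  refine ⟨A, fun k => ⟨Str.Hom.app i.hom k, Str.Hom.app i.inv k, fun x => ?_, fun x => ?_⟩,
    fun o x => Str.Hom.map_op i.hom o x⟩
  · exact congrArg (fun f => Str.Hom.app f k x) i.hom_inv_id
  · exact congrArg (fun f => Str.Hom.app f k x) i.inv_hom_id

/-- If homomorphisms to objects of `C` separate elements, then `B` is its own cover in the sense of
`Str.IsLike`. Substructures and limits are of this kind. -/
lemma exists_obj_of_separated (B : Str.{u} (AlgCat.S C))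
    (h : ∀ k (y y' : B.carrier k), (∀ (A : C) (g : Str.Hom B (AlgCat.E.obj A)),
      g.app k y = g.app k y') → y = y') :
    ∃ (A : C) (i : ∀ k, El k A ≃ B.carrier k),
      ∀ o x, i _ (opE o x) = B.op o (fun a => i _ (x a)) :=
  exists_obj B fun _ _ _ x => ⟨B, 𝟙 B, x, fun _ => rfl, h⟩

/-- A morphism with image in the image of an injective morphism factors through it. -/
lemma exists_factor {A B D : C} (i : B ⟶ D) (hi : ∀ k, Function.Injective (ap i (k := k)))
    (f : A ⟶ D) (h : ∀ k (x : El k A), ∃ y, ap i y = ap f x) : ∃ g : A ⟶ B, g ≫ i = f := by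
  choose φ hφ using h
  obtain ⟨g, hg⟩ := exists_hom φ fun o x => hi _ (by
    rw [hφ, ap_op, ap_op]
    simp only [hφ])
  exact ⟨g, hom_ext_ap fun k x => by rw [ap_comp, hg, hφ]⟩

/-- Substructures. -/
lemma exists_sub (D : C) (Q : ∀ k, Set (El k D))
    (hQ : ∀ o (x : ∀ a, El ((AlgCat.S C).dom o a) D), (∀ a, x a ∈ Q _) → opE o x ∈ Q _) :
    ∃ (B : C) (i : B ⟶ D), (∀ k, Function.Injective (ap i (k := k))) ∧
      ∀ k x, x ∈ Q k ↔ ∃ y, ap i y = x := by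
  let B : Str.{u} (AlgCat.S C) := ⟨fun k => Q k, fun o x => ⟨_, hQ o _ fun a => (x a).2⟩⟩
  obtain ⟨A, i, hi⟩ := exists_obj_of_separated B fun k y y' h =>
    Subtype.ext (h D ⟨fun _ x => x.1, fun _ _ => rfl⟩)
  obtain ⟨f, hf⟩ := exists_hom (A := A) (B := D) (fun k x => (i k x).1) fun o x => by
    rw [hi]
  refine ⟨A, f, fun k x y h => ?_, fun k x => ⟨fun h => ⟨(i k).symm ⟨x, h⟩, ?_⟩, ?_⟩⟩
  · rw [hf, hf] at h
    exact (i k).injective (Subtype.ext h)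
  · rw [hf, Equiv.apply_symm_apply]
  · rintro ⟨y, rfl⟩
    rw [hf]
    exact (i k y).2

/-- The inverse respects the operations automatically: it is the factorization of the identity
through an injective morphism. -/
lemma isIso_of_bijective {A B : C} (f : A ⟶ B) (h : ∀ k, Function.Bijective (ap f (k := k))) :
    IsIso f := by
  obtain ⟨g, hg⟩ := exists_factor f (fun k => (h k).1) (𝟙 B) fun k x => by
    rw [ap_id]
    exact (h k).2 x
  exact ⟨g, hom_ext_ap fun k x => (h k).1 (by
    rw [← ap_comp, Category.assoc, hg, Category.comp_id, ap_id]), hg⟩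

lemma bijective_of_isIso {A B : C} (f : A ⟶ B) [IsIso f] (k : (AlgCat.S C).K) :
    Function.Bijective (ap f (k := k)) := by
  refine Function.bijective_iff_has_inverse.2 ⟨ap (inv f), fun x => ?_, fun x => ?_⟩
  · rw [← ap_comp, IsIso.hom_inv_id, ap_id]
  · rw [← ap_comp, IsIso.inv_hom_id, ap_id]

/-- The functor of elements of sort `k`. -/
def elFunctor (k : (AlgCat.S C).K) : C ⥤ Type u where
  obj A := El k A
  map f := TypeCat.ofHom (ap f)

/-! #### Limits -/

section Limits
variable {J : Type u} [Category.{u} J] (D : J ⥤ C)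

lemma isLimit_of_elements {D : J ⥤ C} (c : Cone D)
    (h₁ : ∀ k (x y : El k c.pt), (∀ j, ap (c.π.app j) x = ap (c.π.app j) y) → x = y)
    (h₂ : ∀ k (x : ∀ j, El k (D.obj j)), (∀ {i j} (f : i ⟶ j), ap (D.map f) (x i) = x j) →
      ∃ y : El k c.pt, ∀ j, ap (c.π.app j) y = x j) : Nonempty (IsLimit c) := by
  have key : ∀ s : Cone D, ∃ l : s.pt ⟶ c.pt, ∀ j, l ≫ c.π.app j = s.π.app j := by
    intro s
    choose φ hφ using fun k (x : El k s.pt) => h₂ k (fun j => ap (s.π.app j) x)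
      fun {i j} f => by rw [← ap_comp, s.w]
    obtain ⟨l, hl⟩ := exists_hom φ fun o x => h₁ _ _ _ fun j => by
      rw [hφ, ap_op, ap_op]
      simp only [hφ]
    exact ⟨l, fun j => hom_ext_ap fun k x => by rw [ap_comp, hl, hφ]⟩
  choose l hl using key
  exact ⟨{ lift := l
           fac := hl
           uniq := fun s m hm => hom_ext_ap fun k x => h₁ _ _ _ fun j => by
            rw [← ap_comp, ← ap_comp, hm, hl] }⟩

lemma exists_limit_elements : ∃ c : Cone D,
    (∀ k (x y : El k c.pt), (∀ j, ap (c.π.app j) x = ap (c.π.app j) y) → x = y) ∧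
    (∀ k (x : ∀ j, El k (D.obj j)), (∀ {i j} (f : i ⟶ j), ap (D.map f) (x i) = x j) →
      ∃ y : El k c.pt, ∀ j, ap (c.π.app j) y = x j) := by
  let B : Str.{u} (AlgCat.S C) :=
    ⟨fun k => {x : ∀ j, El k (D.obj j) // ∀ {i j} (f : i ⟶ j), ap (D.map f) (x i) = x j},
      fun o x => ⟨fun j => opE o (fun a => (x a).1 j), fun f => by
        rw [ap_op]
        exact congrArg _ (funext fun a => (x a).2 f)⟩⟩
  obtain ⟨A, i, hi⟩ := exists_obj_of_separated B fun k y y' h =>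
    Subtype.ext (funext fun j => h (D.obj j) ⟨fun _ x => x.1 j, fun _ _ => rfl⟩)
  choose p hp using fun j => exists_hom (A := A) (B := D.obj j) (fun k x => (i k x).1 j)
    fun o x => by
      rw [hi]
  refine ⟨⟨A, ⟨p, fun j j' f => hom_ext_ap fun k x => ?_⟩⟩, fun k x y h => ?_, fun k x h => ?_⟩
  · simp only [Functor.const_obj_obj, Functor.const_obj_map, Category.id_comp, ap_comp]
    rw [hp, hp]
    exact ((i k x).2 f).symm
  · refine (i k).injective (Subtype.ext (funext fun j => ?_))
    rw [← hp, ← hp]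
    exact h j
  · refine ⟨(i k).symm ⟨x, h⟩, fun j => ?_⟩
    dsimp only
    rw [hp, Equiv.apply_symm_apply]

instance : HasLimits C where
  has_limits_of_shape J _ :=
    { has_limit := fun D => by
        obtain ⟨c, h₁, h₂⟩ := exists_limit_elements D
        obtain ⟨hc⟩ := isLimit_of_elements c h₁ h₂
        exact ⟨⟨c, hc⟩⟩ }

instance (k : (AlgCat.S C).K) : PreservesLimitsOfSize.{u, u} (elFunctor (C := C) k) where
  preservesLimitsOfShape {J} _ :=
    { preservesLimit := fun {D} => by
        obtain ⟨c, h₁, h₂⟩ := exists_limit_elements D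
        obtain ⟨hc⟩ := isLimit_of_elements c h₁ h₂
        refine preservesLimit_of_preserves_limit_cone hc ?_
        refine ((Types.isLimit_iff _).2 fun s hs => ?_).some
        obtain ⟨y, hy⟩ := h₂ k s (fun f => hs f)
        exact ⟨y, hy, fun z hz => h₁ k _ _ fun j => (hz j).trans (hy j).symm⟩ }

lemma limit_elements_ext {D : J ⥤ C} {c : Cone D} (hc : IsLimit c) {k : (AlgCat.S C).K}
    {x y : El k c.pt} (h : ∀ j, ap (c.π.app j) x = ap (c.π.app j) y) : x = y := by
  obtain ⟨c', h₁, h₂⟩ := exists_limit_elements D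
  obtain ⟨hc'⟩ := isLimit_of_elements c' h₁ h₂
  have hi := bijective_of_isIso (hc.conePointUniqueUpToIso hc').hom k
  refine hi.1 (h₁ _ _ _ fun j => ?_)
  rw [← ap_comp, ← ap_comp, hc.conePointUniqueUpToIso_hom_comp]
  exact h j

lemma limit_elements_exists {D : J ⥤ C} {c : Cone D} (hc : IsLimit c) {k : (AlgCat.S C).K}
    (x : ∀ j, El k (D.obj j)) (h : ∀ {i j} (f : i ⟶ j), ap (D.map f) (x i) = x j) :
    ∃ y : El k c.pt, ∀ j, ap (c.π.app j) y = x j := by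
  obtain ⟨c', h₁, h₂⟩ := exists_limit_elements D
  obtain ⟨hc'⟩ := isLimit_of_elements c' h₁ h₂
  obtain ⟨y, hy⟩ := h₂ k x h
  refine ⟨ap (hc.conePointUniqueUpToIso hc').inv y, fun j => ?_⟩
  rw [← ap_comp, hc.conePointUniqueUpToIso_inv_comp, hy]

/-- Products. -/
lemma exists_product {I : Type u} (X : I → C) : ∃ (P : C) (p : ∀ i, P ⟶ X i),
    (∀ k (x y : El k P), (∀ i, ap (p i) x = ap (p i) y) → x = y) ∧
    (∀ k (x : ∀ i, El k (X i)), ∃ y, ∀ i, ap (p i) y = x i) ∧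
    ∀ (A : C) (f : ∀ i, A ⟶ X i), ∃ g : A ⟶ P, ∀ i, g ≫ p i = f i := by
  refine ⟨∏ᶜ X, Pi.π X, fun k x y h => ?_, fun k x => ?_, fun A f => ⟨Pi.lift f, fun i => ?_⟩⟩
  · exact limit_elements_ext (limit.isLimit (Discrete.functor X)) fun j => h j.as
  · obtain ⟨y, hy⟩ := limit_elements_exists (limit.isLimit (Discrete.functor X))
      (fun j => x j.as) (by
        rintro ⟨i⟩ ⟨j⟩ ⟨⟨rfl : i = j⟩⟩
        exact (congrArg (fun f => ap f (x i)) ((Discrete.functor X).map_id ⟨i⟩)).trans (ap_id _))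
    exact ⟨y, fun i => hy ⟨i⟩⟩
  · simp

end Limits

/-! #### Colimits -/

section Colimits

/-- Terms of a signature. -/
inductive Term (S : Sig) (G : S.K → Type u) : S.K → Type u
  | var {k : S.K} (x : G k) : Term S G k
  | op (o : S.Op) (x : ∀ a, Term S G (S.dom o a)) : Term S G (S.cod o)

/-- The structure of terms. -/
def termStr (S : Sig) (G : S.K → Type u) : Str.{u} S := ⟨Term S G, Term.op⟩

/-- Evaluation of terms. -/
def Term.eval {S : Sig} {G : S.K → Type u} {B : Str.{u} S} (v : ∀ k, G k → B.carrier k) {k : S.K} :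
    Term S G k → B.carrier k
  | .var x => v _ x
  | .op o x => B.op o (fun a => (x a).eval v)

variable {J : Type u} [Category.{u} J] (D : J ⥤ C)

/-- The valuation of the elements of a diagram in a cocone. -/
def coconeVal (s : Cocone D) (k : (AlgCat.S C).K) (x : Σ j, El k (D.obj j)) :
    (AlgCat.E.obj s.pt).carrier k :=
  ap (s.ι.app x.1) x.2

/-- Terms are identified if they have the same value in all cocones. -/
def termSetoid (k : (AlgCat.S C).K) :
    Setoid (Term (AlgCat.S C) (fun k => Σ j, El k (D.obj j)) k) where
  r t t' := ∀ s : Cocone D, t.eval (coconeVal D s) = t'.eval (coconeVal D s)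
  iseqv := ⟨fun _ _ => rfl, fun h s => (h s).symm, fun h h' s => (h s).trans (h' s)⟩

/-- The structure generated by a diagram. -/
def colimStr : Str.{u} (AlgCat.S C) where
  carrier k := Quotient (termSetoid D k)
  op o x := Quotient.mk _ (.op o (fun a => (x a).out))

lemma colimStr_op (o : (AlgCat.S C).Op) (x : ∀ a, Term (AlgCat.S C) (fun k => Σ j, El k (D.obj j))
    ((AlgCat.S C).dom o a)) :
    (colimStr D).op o (fun a => Quotient.mk (termSetoid D _) (x a)) =
      Quotient.mk (termSetoid D _) (.op o x) := by
  refine Quotient.sound fun s => ?_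
  simp only [Term.eval]
  congr 1
  funext a
  exact Quotient.mk_out (s := termSetoid D _) (x a) s

/-- The colimit consists of terms in the elements of the diagram, modulo the equations that hold in
every cocone. Since the congruence is defined by all cocones at once, maps out of the quotient come
for free, and no generating set of relations is needed. -/
lemma exists_colimit : ∃ c : Cocone D, Nonempty (IsColimit c) := by
  -- The cover is the algebra of terms: two terms that agree under all homomorphisms to objects of
  -- `C` agree in particular under evaluation in each cocone, which is equality in the quotient.
  obtain ⟨A, i, hi⟩ := exists_obj (C := C) (colimStr D) fun ι _ k x =>
    ⟨termStr _ _, ⟨fun k t => Quotient.mk (termSetoid D k) t, fun o t => (colimStr_op D o t).symm⟩,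
      fun i => (x i).out, fun i => Quotient.out_eq _, fun k y y' h => Quotient.sound fun s =>
        h s.pt ⟨fun k t => t.eval (coconeVal D s), fun o t => rfl⟩⟩
  change ∀ k, El k A ≃ Quotient (termSetoid D k) at i
  have hs : ∀ o x, (i _).symm (Quotient.mk (termSetoid D _) (.op o x)) =
      opE o (fun a => (i _).symm (Quotient.mk (termSetoid D _) (x a))) := fun o x =>
    (i _).injective (by
      rw [Equiv.apply_symm_apply]
      refine ((hi o _).trans ?_).symm
      exact (congrArg ((colimStr D).op o) (funext fun a => (i _).apply_symm_apply _)).trans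
        (colimStr_op D o x))
  let v : ∀ j k, El k (D.obj j) → El k A := fun j k x =>
    (i k).symm (Quotient.mk (termSetoid D k) (.var ⟨j, x⟩))
  have hv : ∀ j o x, v j _ (opE o x) = opE o (fun a => v j _ (x a)) := by
    intro j o x
    simp only [v]
    rw [← hs]
    refine congrArg _ (Quotient.sound fun s => ?_)
    exact ap_op _ _ _
  choose ι hι using fun j => exists_hom (v j) (hv j)
  let c : Cocone D := ⟨A, ⟨ι, fun j j' f => hom_ext_ap fun k x => by
    simp only [Functor.const_obj_obj, Functor.const_obj_map, Category.comp_id, ap_comp]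
    rw [hι, hι]
    refine congrArg _ (Quotient.sound fun s => ?_)
    show ap (s.ι.app j') (ap (D.map f) x) = ap (s.ι.app j) x
    rw [← ap_comp, s.w]⟩⟩
  have key : ∀ s : Cocone D, ∃ l : A ⟶ s.pt, ∀ j, ι j ≫ l = s.ι.app j := by
    intro s
    let φ : ∀ k, El k A → El k s.pt := fun k x =>
      Quotient.lift (s := termSetoid D k) (fun t => t.eval (coconeVal D s)) (fun t t' h => h s)
        (i k x)
    have hφ : ∀ k t, φ k ((i k).symm (Quotient.mk (termSetoid D k) t)) =
        t.eval (coconeVal D s) := by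
      intro k t
      exact congrArg (Quotient.lift (s := termSetoid D k) (fun t => t.eval (coconeVal D s))
        (fun t t' h => h s)) ((i k).apply_symm_apply _)
    obtain ⟨l, hl⟩ := exists_hom φ fun o x => by
      have : ∀ a, ∃ t, x a = (i _).symm (Quotient.mk (termSetoid D _) t) := fun a =>
        ⟨(i _ (x a)).out, by
          rw [Equiv.eq_symm_apply]
          exact (Quotient.out_eq _).symm⟩
      choose t ht using this
      obtain rfl : x = _ := funext ht
      rw [← hs, hφ]
      simp only [hφ]
      rfl
    refine ⟨l, fun j => hom_ext_ap fun k x => ?_⟩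
    rw [ap_comp, hι, hl, hφ]
    rfl
  choose l hl using key
  refine ⟨c, ⟨⟨l, hl, fun s m hm => hom_ext_ap fun k x => ?_⟩⟩⟩
  have main : ∀ k (t : Term (AlgCat.S C) (fun k => Σ j, El k (D.obj j)) k),
      ap m ((i k).symm (Quotient.mk (termSetoid D k) t)) =
        ap (l s) ((i k).symm (Quotient.mk (termSetoid D k) t)) := by
    intro k t
    induction t with
    | var x =>
      have h1 := congrArg (fun f => ap f x.2) ((hm x.1).trans (hl s x.1).symm)
      simp only [c, ap_comp, hι] at h1
      exact h1
    | op o x ih =>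
      rw [hs, ap_op, ap_op]
      simp only [ih]
  have := main k (i k x).out
  rwa [Quotient.out_eq, Equiv.symm_apply_apply] at this

instance : HasColimits C where
  has_colimits_of_shape J _ :=
    { has_colimit := fun D => by
        obtain ⟨c, ⟨hc⟩⟩ := exists_colimit D
        exact ⟨⟨c, hc⟩⟩ }

end Colimits

/-! #### Filtered colimits -/

section Filtered

variable {J : Type u} [Category.{u} J] [IsFiltered J] (D : J ⥤ C)

/-- Elements of a filtered diagram are identified if they become equal at a later stage. -/
def filtSetoid (k : (AlgCat.S C).K) : Setoid (Σ j, El k (D.obj j)) where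
  r x y := ∃ (l : J) (f : x.1 ⟶ l) (g : y.1 ⟶ l), ap (D.map f) x.2 = ap (D.map g) y.2
  iseqv := by
    refine ⟨fun x => ⟨x.1, 𝟙 _, 𝟙 _, rfl⟩, fun ⟨l, f, g, h⟩ => ⟨l, g, f, h.symm⟩, ?_⟩
    rintro x y z ⟨l, f, g, h⟩ ⟨l', f', g', h'⟩
    obtain ⟨m, a, b, e⟩ := IsFiltered.span g f'
    refine ⟨m, f ≫ a, g' ≫ b, ?_⟩
    rw [D.map_comp, D.map_comp, ap_comp, ap_comp, h, ← h', ← ap_comp, ← ap_comp, ← D.map_comp,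
      ← D.map_comp, e]

variable {D}

/-- The class of an element. -/
def filtMk (j : J) {k : (AlgCat.S C).K} (x : El k (D.obj j)) : Quotient (filtSetoid D k) :=
  Quotient.mk _ ⟨j, x⟩

lemma filtMk_map {i j : J} (f : i ⟶ j) {k : (AlgCat.S C).K} (x : El k (D.obj i)) :
    filtMk j (ap (D.map f) x) = filtMk i x :=
  Quotient.sound ⟨j, 𝟙 j, f, by rw [D.map_id, ap_id]⟩

lemma filtMk_eq {j : J} {k : (AlgCat.S C).K} {x y : El k (D.obj j)} (h : filtMk j x = filtMk j y) :
    ∃ (l : J) (f : j ⟶ l), ap (D.map f) x = ap (D.map f) y := by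
  obtain ⟨l, f, g, h⟩ := Quotient.exact h
  -- The two arrows that make the elements equal may differ; coequalizing them leaves a single one.
  refine ⟨_, f ≫ IsFiltered.coeqHom f g, ?_⟩
  nth_rw 2 [IsFiltered.coeq_condition]
  rw [D.map_comp, D.map_comp, ap_comp, ap_comp]
  exact congrArg _ h

lemma filt_common {ι : Type} [Finite ι] {k : ι → (AlgCat.S C).K}
    (x : ∀ i, Quotient (filtSetoid D (k i))) :
    ∃ (j : J) (y : ∀ i, El (k i) (D.obj j)), x = fun i => filtMk j (y i) := by
  classical
  have := Fintype.ofFinite ι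
  obtain ⟨j, hj⟩ := IsFiltered.sup_objs_exists (Finset.univ.image fun i => (x i).out.1)
  have f : ∀ i, Nonempty ((x i).out.1 ⟶ j) := fun i =>
    hj (Finset.mem_image_of_mem _ (Finset.mem_univ i))
  refine ⟨j, fun i => ap (D.map (f i).some) (x i).out.2, funext fun i => ?_⟩
  rw [filtMk_map]
  exact (Quotient.out_eq (x i)).symm

lemma filt_eq {ι : Type} [Finite ι] {k : ι → (AlgCat.S C).K} {j : J}
    (x y : ∀ i, El (k i) (D.obj j)) (h : ∀ i, filtMk j (x i) = filtMk j (y i)) :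
    ∃ (l : J) (f : j ⟶ l), ∀ i, ap (D.map f) (x i) = ap (D.map f) (y i) := by
  classical
  have := Fintype.ofFinite ι
  have : ∀ s : Finset ι, ∃ (l : J) (f : j ⟶ l),
      ∀ i ∈ s, ap (D.map f) (x i) = ap (D.map f) (y i) := by
    intro s
    induction s using Finset.induction_on with
    | empty => exact ⟨j, 𝟙 j, fun i hi => absurd hi (Finset.notMem_empty i)⟩
    | insert a s _ ih =>
      obtain ⟨l, f, hf⟩ := ih
      obtain ⟨m, g, hg⟩ := filtMk_eq (x := ap (D.map f) (x a)) (y := ap (D.map f) (y a)) (by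
        rw [filtMk_map, filtMk_map, h])
      refine ⟨m, f ≫ g, fun i hi => ?_⟩
      rw [D.map_comp, ap_comp, ap_comp]
      obtain rfl | hi := Finset.mem_insert.1 hi
      · exact hg
      · rw [hf i hi]
  obtain ⟨l, f, hf⟩ := this Finset.univ
  exact ⟨l, f, fun i => hf i (Finset.mem_univ i)⟩

variable (D) in
/-- The filtered colimit of structures. -/
def filtStr : Str.{u} (AlgCat.S C) where
  carrier k := Quotient (filtSetoid D k)
  op o x := filtMk (filt_common x).choose (opE o (filt_common x).choose_spec.choose)

/-- The operation was defined through a chosen common stage of its arguments. Two stages, with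
finitely many equations between representatives, can be compared at a later one; this is where
finite arity enters. -/
lemma filtStr_op (o : (AlgCat.S C).Op) (j : J) (x : ∀ a, El ((AlgCat.S C).dom o a) (D.obj j)) :
    (filtStr D).op o (fun a => filtMk j (x a)) = filtMk j (opE o x) := by
  let x' := fun a => filtMk j (x a)
  have h := (filt_common x').choose_spec.choose_spec
  set j' := (filt_common x').choose
  set y := (filt_common x').choose_spec.choose
  show filtMk j' (opE o y) = _
  obtain ⟨m, f, g, -⟩ := IsFilteredOrEmpty.cocone_objs j j'
  obtain ⟨l, e, he⟩ := filt_eq (D := D) (fun a => ap (D.map f) (x a)) (fun a => ap (D.map g) (y a))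
    (fun a => by
      rw [filtMk_map, filtMk_map]
      exact congrFun h a)
  rw [← filtMk_map (f ≫ e), ← filtMk_map (g ≫ e), ap_op, ap_op]
  simp only [D.map_comp, ap_comp, he]

/-- Two representatives of an element agree at a later stage, so a cocone induces a well-defined
map. It is a homomorphism because the finitely many arguments of an operation live at one stage. -/
lemma isColimit_of_elements (c : Cocone D)
    (h₁ : ∀ k (y : El k c.pt), ∃ j x, ap (c.ι.app j) x = y)
    (h₂ : ∀ k j (x y : El k (D.obj j)), ap (c.ι.app j) x = ap (c.ι.app j) y →
      ∃ (l : J) (f : j ⟶ l), ap (D.map f) x = ap (D.map f) y) : Nonempty (IsColimit c) := by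
  have hc : ∀ {i j : J} (f : i ⟶ j) {k} (x : El k (D.obj i)),
      ap (c.ι.app j) (ap (D.map f) x) = ap (c.ι.app i) x := fun f k x => by
    rw [← ap_comp, c.w]
  have common : ∀ {ι : Type} [Finite ι] (k : ι → (AlgCat.S C).K) (y : ∀ i, El (k i) c.pt),
      ∃ (j : J) (x : ∀ i, El (k i) (D.obj j)), y = fun i => ap (c.ι.app j) (x i) := by
    intro ι _ k y
    choose j x hx using fun i => h₁ _ (y i)
    obtain ⟨l, z, hz⟩ := filt_common (fun i => filtMk (j i) (x i))
    refine ⟨l, z, funext fun i => ?_⟩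
    obtain ⟨m, f, g, e⟩ := Quotient.exact (congrFun hz i)
    rw [← hx, ← hc f, ← hc g]
    exact congrArg _ e
  have key : ∀ s : Cocone D, ∃ l : c.pt ⟶ s.pt, ∀ j, c.ι.app j ≫ l = s.ι.app j := by
    intro s
    have hs : ∀ {i j : J} (f : i ⟶ j) {k} (x : El k (D.obj i)),
        ap (s.ι.app j) (ap (D.map f) x) = ap (s.ι.app i) x := fun f k x => by
      rw [← ap_comp, s.w]
    choose j x hx using h₁
    let φ : ∀ k, El k c.pt → El k s.pt := fun k y => ap (s.ι.app (j k y)) (x k y)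
    have hφ : ∀ k i (z : El k (D.obj i)), φ k (ap (c.ι.app i) z) = ap (s.ι.app i) z := by
      intro k i z
      obtain ⟨m, f, g, -⟩ := IsFilteredOrEmpty.cocone_objs (j k (ap (c.ι.app i) z)) i
      obtain ⟨l, e, he⟩ := h₂ k m (ap (D.map f) (x k (ap (c.ι.app i) z))) (ap (D.map g) z) (by
        rw [hc, hc, hx])
      show ap (s.ι.app _) (x k _) = _
      rw [← hs f, ← hs e, he, hs, hs]
    obtain ⟨l, hl⟩ := exists_hom φ fun o y => by
      obtain ⟨i, z, rfl⟩ := common _ y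
      rw [← ap_op, hφ, ap_op]
      simp only [hφ]
    exact ⟨l, fun i => hom_ext_ap fun k z => by rw [ap_comp, hl, hφ]⟩
  choose l hl using key
  refine ⟨⟨l, hl, fun s m hm => hom_ext_ap fun k y => ?_⟩⟩
  obtain ⟨j, x, rfl⟩ := h₁ k y
  rw [← ap_comp, ← ap_comp, hm, hl]

variable (D) in
lemma exists_filtered_colimit : ∃ c : Cocone D,
    (∀ k (y : El k c.pt), ∃ j x, ap (c.ι.app j) x = y) ∧
    (∀ k j (x y : El k (D.obj j)), ap (c.ι.app j) x = ap (c.ι.app j) y →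
      ∃ (l : J) (f : j ⟶ l), ap (D.map f) x = ap (D.map f) y) := by
  -- A finite family comes from a single stage, and that stage is the required cover: it is an
  -- object of `C`, so its identity already separates elements.
  obtain ⟨A, i, hi⟩ := exists_obj (C := C) (filtStr D) fun ι _ k x => by
    obtain ⟨j, y, rfl⟩ := filt_common (D := D) x
    exact ⟨AlgCat.E.obj (D.obj j), ⟨fun k x => filtMk j x, fun o x => (filtStr_op o j x).symm⟩, y,
      fun _ => rfl, fun k y y' h => congrArg (filtMk j) (h (D.obj j) ⟨fun _ x => x, fun _ _ => rfl⟩)⟩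
  change ∀ k, El k A ≃ Quotient (filtSetoid D k) at i
  choose ι hι using fun j => exists_hom (A := D.obj j) (B := A)
    (fun k x => (i k).symm (filtMk j x)) fun o x => by
      refine (i _).injective ?_
      rw [Equiv.apply_symm_apply]
      refine ((hi o _).trans ?_).symm
      exact (congrArg ((filtStr D).op o) (funext fun a => (i _).apply_symm_apply _)).trans
        (filtStr_op o j x)
  refine ⟨⟨A, ⟨ι, fun j j' f => hom_ext_ap fun k x => ?_⟩⟩, fun k y => ?_, fun k j x y h => ?_⟩
  · simp only [Functor.const_obj_obj, Functor.const_obj_map, Category.comp_id, ap_comp]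
    rw [hι, hι, filtMk_map]
  · refine ⟨(i k y).out.1, (i k y).out.2, ?_⟩
    dsimp only
    rw [hι, Equiv.symm_apply_eq]
    exact Quotient.out_eq (i k y)
  · dsimp only at h
    rw [hι, hι] at h
    exact filtMk_eq ((i k).symm.injective h)

variable {c : Cocone D} (hc : IsColimit c)
include hc

lemma filtered_surj {k : (AlgCat.S C).K} (y : El k c.pt) : ∃ j x, ap (c.ι.app j) x = y := by
  obtain ⟨c', h₁, h₂⟩ := exists_filtered_colimit D
  obtain ⟨hc'⟩ := isColimit_of_elements c' h₁ h₂
  obtain ⟨z, rfl⟩ := (bijective_of_isIso (hc'.coconePointUniqueUpToIso hc).hom k).2 y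
  obtain ⟨j, x, rfl⟩ := h₁ k z
  exact ⟨j, x, by rw [← ap_comp, hc'.comp_coconePointUniqueUpToIso_hom]⟩

lemma filtered_inj {k : (AlgCat.S C).K} {j : J} {x y : El k (D.obj j)}
    (h : ap (c.ι.app j) x = ap (c.ι.app j) y) :
    ∃ (l : J) (f : j ⟶ l), ap (D.map f) x = ap (D.map f) y := by
  obtain ⟨c', h₁, h₂⟩ := exists_filtered_colimit D
  obtain ⟨hc'⟩ := isColimit_of_elements c' h₁ h₂
  apply h₂
  rw [← hc.comp_coconePointUniqueUpToIso_hom hc', ap_comp, h, ← ap_comp]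

end Filtered

end AlgCat

/-! ### Bios and props as algebraic structures -/

section Like

variable {S : Sig} {C : Type (u + 1)} [Category.{u} C] {E : C ⥤ Str.{u} S} {B : Str.{u} S}

/-- Each law of bios and props involves at most one element and two finite families. Lifting them to
a common cover allows the law to be checked in the objects of `C` and pushed down to `B`. -/
lemma Str.IsLike.family (hB : Str.IsLike E B) {k : S.K} (p : B.carrier k) {a b : ℕ}
    {k₁ : Fin a → S.K} (q : ∀ i, B.carrier (k₁ i)) {k₂ : Fin b → S.K} (r : ∀ i, B.carrier (k₂ i)) :
    ∃ (B' : Str.{u} S) (h : Str.Hom B' B) (p' : B'.carrier k) (q' : ∀ i, B'.carrier (k₁ i))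
      (r' : ∀ i, B'.carrier (k₂ i)), p = h.app _ p' ∧ q = (fun i => h.app _ (q' i)) ∧
      r = (fun i => h.app _ (r' i)) ∧ ∀ k (y y' : B'.carrier k),
        (∀ (A : C) (g : Str.Hom B' (E.obj A)), g.app k y = g.app k y') → h.app k y = h.app k y' := by
  obtain ⟨B', h, x', hx, ker⟩ := hB (Option (Fin a ⊕ Fin b))
    (fun | none => k | some (.inl i) => k₁ i | some (.inr i) => k₂ i)
    (fun | none => p | some (.inl i) => q i | some (.inr i) => r i)
  exact ⟨B', h, x' none, fun i => x' (some (.inl i)), fun i => x' (some (.inr i)),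
    (hx none).symm, funext fun i => (hx (some (.inl i))).symm,
    funext fun i => (hx (some (.inr i))).symm, ker⟩

lemma Str.IsLike.triple (hB : Str.IsLike E B) {k k₁ k₂ : S.K} (p : B.carrier k)
    (q : B.carrier k₁) (r : B.carrier k₂) :
    ∃ (B' : Str.{u} S) (h : Str.Hom B' B) (p' : B'.carrier k) (q' : B'.carrier k₁)
      (r' : B'.carrier k₂), p = h.app _ p' ∧ q = h.app _ q' ∧
      r = h.app _ r' ∧ ∀ k (y y' : B'.carrier k),
        (∀ (A : C) (g : Str.Hom B' (E.obj A)), g.app k y = g.app k y') → h.app k y = h.app k y' := by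
  obtain ⟨B', h, p', q', r', hp, hq, hr, ker⟩ :=
    hB.family p (a := 1) (fun _ => q) (b := 1) (fun _ => r)
  exact ⟨B', h, p', q' 0, r' 0, hp, congrFun hq 0, congrFun hr 0, ker⟩

end Like

/-- The operations of a bio. -/
inductive BioOp
  | oneR
  | oneC
  | zeroR
  | zeroC
  | compR {n m : ℕ} (k : Fin n → ℕ) (e : Split k m)
  | compC {n m : ℕ} (k : Fin n → ℕ) (e : Split k m)
  | actR {n m : ℕ} (k : Fin n → ℕ) (e : Split k m)
  | actC {n m : ℕ} (k : Fin n → ℕ) (e : Split k m)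

/-- The arities of the operations of a bio. -/
abbrev BioOp.ar : BioOp → Type
  | .oneR => Empty
  | .oneC => Empty
  | .zeroR => Empty
  | .zeroC => Empty
  | .compR (n := n) _ _ => Option (Fin n)
  | .compC (n := n) _ _ => Option (Fin n)
  | .actR (n := n) _ _ => Option (Fin n)
  | .actC (n := n) _ _ => Option (Fin n)

/-- The input sorts of the operations of a bio. -/
abbrev BioOp.dom : ∀ o : BioOp, o.ar → ℕ ⊕ ℕ
  | .oneR, a => a.elim
  | .oneC, a => a.elim
  | .zeroR, a => a.elim
  | .zeroC, a => a.elim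
  | .compR (n := n) k _, a => a.casesOn (.inl n) (fun i => .inl (k i))
  | .compC (n := n) k _, a => a.casesOn (.inr n) (fun i => .inr (k i))
  | .actR (m := m) k _, a => a.casesOn (.inl m) (fun i => .inr (k i))
  | .actC (m := m) k _, a => a.casesOn (.inr m) (fun i => .inl (k i))

/-- The output sorts of the operations of a bio. -/
abbrev BioOp.cod : BioOp → ℕ ⊕ ℕ
  | .oneR => .inl 1
  | .oneC => .inr 1
  | .zeroR => .inl 0
  | .zeroC => .inr 0
  | .compR (m := m) _ _ => .inl m
  | .compC (m := m) _ _ => .inr m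
  | .actR (n := n) _ _ => .inl n
  | .actC (n := n) _ _ => .inr n

/-- The signature of bios. -/
abbrev bioSig : Sig where
  K := ℕ ⊕ ℕ
  Op := BioOp
  ar := BioOp.ar
  fin o := by cases o <;> (dsimp only [BioOp.ar]; infer_instance)
  dom := BioOp.dom
  cod := BioOp.cod

/-- The structure underlying a bio. -/
abbrev Bio.str (P : Bio.{u}) : Str.{u} bioSig where
  carrier := Sum.elim P.R P.C
  op
    | .oneR, _ => P.oneR
    | .oneC, _ => P.oneC
    | .zeroR, _ => P.uniqueR.default
    | .zeroC, _ => P.uniqueC.default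
    | .compR _ e, x => P.compR e (x none) (fun i => x (some i))
    | .compC _ e, x => P.compC e (fun i => x (some i)) (x none)
    | .actR _ e, x => P.actR e (x none) (fun i => x (some i))
    | .actC _ e, x => P.actC e (fun i => x (some i)) (x none)

/-- The homomorphism of structures underlying a homomorphism of bios. -/
def Bio.Hom.str {P Q : Bio.{u}} (φ : Bio.Hom P Q) : Str.Hom P.str Q.str where
  app
    | .inl n => φ.onR n
    | .inr n => φ.onC n
  map_op
    | .oneR, _ => φ.map_oneR
    | .oneC, _ => φ.map_oneC
    | .zeroR, _ => Q.uniqueR.uniq _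
    | .zeroC, _ => Q.uniqueC.uniq _
    | .compR _ e, _ => φ.map_compR e _ _
    | .compC _ e, _ => φ.map_compC e _ _
    | .actR _ e, _ => φ.map_actR e _ _
    | .actC _ e, _ => φ.map_actC e _ _

/-- The functor from bios to structures. -/
def bioStr : CBio.{u} ⥤ Str.{u} bioSig where
  obj P := P.toBio.str
  map φ := Bio.Hom.str φ
  map_id P := Str.Hom.ext (funext fun k => by cases k <;> rfl)
  map_comp φ ψ := Str.Hom.ext (funext fun k => by cases k <;> rfl)

namespace Str
variable (A B : Str.{u} bioSig) (h : Str.Hom A B) {n m : ℕ} {k : Fin n → ℕ} (e : Split k m)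

/-- The operation `compR` of a structure. -/
def cR (p : B.carrier (.inl n)) (q : ∀ i, B.carrier (.inl (k i))) : B.carrier (.inl m) :=
  B.op (.compR k e) (Option.rec p q)
/-- The operation `compC` of a structure. -/
def cC (q : ∀ i, B.carrier (.inr (k i))) (p : B.carrier (.inr n)) : B.carrier (.inr m) :=
  B.op (.compC k e) (Option.rec p q)
/-- The operation `actR` of a structure. -/
def aR (p : B.carrier (.inl m)) (q : ∀ i, B.carrier (.inr (k i))) : B.carrier (.inl n) :=
  B.op (.actR k e) (Option.rec p q)
/-- The operation `actC` of a structure. -/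
def aC (q : ∀ i, B.carrier (.inl (k i))) (p : B.carrier (.inr m)) : B.carrier (.inr n) :=
  B.op (.actC k e) (Option.rec p q)

variable {A B}

lemma map_cR (p : A.carrier (.inl n)) (q : ∀ i, A.carrier (.inl (k i))) :
    h.app (.inl m) (A.cR e p q) = B.cR e (h.app _ p) (fun i => h.app _ (q i)) :=
  (h.map_op (.compR k e) _).trans (congrArg _ (funext fun a => by cases a <;> rfl))
lemma map_cC (p : A.carrier (.inr n)) (q : ∀ i, A.carrier (.inr (k i))) :
    h.app (.inr m) (A.cC e q p) = B.cC e (fun i => h.app _ (q i)) (h.app _ p) :=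
  (h.map_op (.compC k e) _).trans (congrArg _ (funext fun a => by cases a <;> rfl))
lemma map_aR (p : A.carrier (.inl m)) (q : ∀ i, A.carrier (.inr (k i))) :
    h.app (.inl n) (A.aR e p q) = B.aR e (h.app _ p) (fun i => h.app _ (q i)) :=
  (h.map_op (.actR k e) _).trans (congrArg _ (funext fun a => by cases a <;> rfl))
lemma map_aC (p : A.carrier (.inr m)) (q : ∀ i, A.carrier (.inl (k i))) :
    h.app (.inr n) (A.aC e q p) = B.aC e (fun i => h.app _ (q i)) (h.app _ p) :=
  (h.map_op (.actC k e) _).trans (congrArg _ (funext fun a => by cases a <;> rfl))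
lemma map_oneR : h.app (.inl 1) (A.op .oneR Empty.rec) = B.op .oneR Empty.rec :=
  (h.map_op .oneR _).trans (congrArg _ (funext fun a => a.elim))
lemma map_oneC : h.app (.inr 1) (A.op .oneC Empty.rec) = B.op .oneC Empty.rec :=
  (h.map_op .oneC _).trans (congrArg _ (funext fun a => a.elim))
lemma map_zeroR : h.app (.inl 0) (A.op .zeroR Empty.rec) = B.op .zeroR Empty.rec :=
  (h.map_op .zeroR _).trans (congrArg _ (funext fun a => a.elim))
lemma map_zeroC : h.app (.inr 0) (A.op .zeroC Empty.rec) = B.op .zeroC Empty.rec :=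
  (h.map_op .zeroC _).trans (congrArg _ (funext fun a => a.elim))

variable (hB : IsLike bioStr B)

/-- A structure that satisfies the equations of bios is a bio. -/
def IsLike.toBio : CBio.{u} where
  R n := B.carrier (.inl n)
  C n := B.carrier (.inr n)
  oneR := B.op .oneR Empty.rec
  oneC := B.op .oneC Empty.rec
  uniqueR :=
    { default := B.op .zeroR Empty.rec
      uniq := fun x => by
        obtain ⟨B', φ, p, q, r, rfl, -, -, ker⟩ := hB.triple x x x
        have := ker _ p (B'.op .zeroR Empty.rec) (fun A ψ => A.uniqueR.uniq _ |>.trans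
          (A.uniqueR.uniq _).symm)
        simpa only [map_zeroR] using this }
  uniqueC :=
    { default := B.op .zeroC Empty.rec
      uniq := fun x => by
        obtain ⟨B', φ, p, q, r, rfl, -, -, ker⟩ := hB.triple x x x
        have := ker _ p (B'.op .zeroC Empty.rec) (fun A ψ => A.uniqueC.uniq _ |>.trans
          (A.uniqueC.uniq _).symm)
        simpa only [map_zeroC] using this }
  compR e p q := B.cR e p q
  compC e q p := B.cC e q p
  actR e p q := B.aR e p q
  actC e q p := B.aC e q p
  compR_one {n} x := by
    obtain ⟨B', φ, p, q, r, rfl, -, -, ker⟩ := hB.triple x x x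
    have := ker _ (B'.cR (Split.ones n) p (fun _ => B'.op .oneR Empty.rec)) p (fun A ψ => by
      simp only [map_cR, map_oneR]
      exact A.compR_one _)
    simpa only [map_cR, map_oneR] using this
  one_compR {n} x := by
    obtain ⟨B', φ, p, q, r, rfl, -, -, ker⟩ := hB.triple x x x
    have := ker _ (B'.cR (Split.single n) (B'.op .oneR Empty.rec) (fun _ => p)) p (fun A ψ => by
      simp only [map_cR, map_oneR]
      exact A.one_compR _)
    simpa only [map_cR, map_oneR] using this
  compC_one {n} x := by
    obtain ⟨B', φ, p, q, r, rfl, -, -, ker⟩ := hB.triple x x x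
    have := ker _ (B'.cC (Split.ones n) (fun _ => B'.op .oneC Empty.rec) p) p (fun A ψ => by
      simp only [map_cC, map_oneC]
      exact A.compC_one _)
    simpa only [map_cC, map_oneC] using this
  one_compC {n} x := by
    obtain ⟨B', φ, p, q, r, rfl, -, -, ker⟩ := hB.triple x x x
    have := ker _ (B'.cC (Split.single n) (fun _ => p) (B'.op .oneC Empty.rec)) p (fun A ψ => by
      simp only [map_cC, map_oneC]
      exact A.one_compC _)
    simpa only [map_cC, map_oneC] using this
  actR_one {n} x := by
    obtain ⟨B', φ, p, q, r, rfl, -, -, ker⟩ := hB.triple x x x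
    have := ker _ (B'.aR (Split.ones n) p (fun _ => B'.op .oneC Empty.rec)) p (fun A ψ => by
      simp only [map_aR, map_oneC]
      exact A.actR_one _)
    simpa only [map_aR, map_oneC] using this
  actC_one {n} x := by
    obtain ⟨B', φ, p, q, r, rfl, -, -, ker⟩ := hB.triple x x x
    have := ker _ (B'.aC (Split.ones n) (fun _ => B'.op .oneR Empty.rec) p) p (fun A ψ => by
      simp only [map_aC, map_oneR]
      exact A.actC_one _)
    simpa only [map_aC, map_oneR] using this
  compR_compR {N n m h k l g e f e'} H p q r := by
    obtain ⟨B', φ, p, q, r, rfl, rfl, rfl, ker⟩ := hB.family p q r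
    have := ker _ (B'.cR e (B'.cR g p q) r)
      (B'.cR e' p (fun j => B'.cR (f j) (q j) (fun i => r (g ⟨j, i⟩)))) (fun A ψ => by
        simp only [map_cR]
        exact A.compR_compR H _ _ _)
    simpa only [map_cR] using this
  actR_actR {N n m h k l g e f e'} H p c d := by
    obtain ⟨B', φ, p, c, d, rfl, rfl, rfl, ker⟩ := hB.family p c d
    have := ker _ (B'.aR g (B'.aR e p c) d)
      (B'.aR e' p (fun j => B'.cC (f j) (fun i => c (g ⟨j, i⟩)) (d j))) (fun A ψ => by
        simp only [map_aR, map_cC]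
        exact A.actR_actR H _ _ _)
    simpa only [map_aR, map_cC] using this
  actR_compR {N n m h k l g e f e'} H p q d := by
    obtain ⟨B', φ, p, q, d, rfl, rfl, rfl, ker⟩ := hB.family p q d
    have := ker _ (B'.aR e (B'.cR e' p q) d)
      (B'.cR g p (fun j => B'.aR (f j) (q j) (fun i => d (g ⟨j, i⟩)))) (fun A ψ => by
        simp only [map_aR, map_cR]
        exact A.actR_compR H _ _ _)
    simpa only [map_aR, map_cR] using this
  actR_compR' {N n m h k l g e f e'} H p q d := by
    obtain ⟨B', φ, p, q, d, rfl, rfl, rfl, ker⟩ := hB.family p q d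
    have := ker _ (B'.aR e' (B'.cR e p q) d)
      (B'.aR g p (fun j => B'.aC (f j) (fun i => q (g ⟨j, i⟩)) (d j))) (fun A ψ => by
        simp only [map_aR, map_cR, map_aC]
        exact A.actR_compR' H _ _ _)
    simpa only [map_aR, map_cR, map_aC] using this
  compC_compC {N n m h k l g e f e'} H c q r := by
    obtain ⟨B', φ, c, q, r, rfl, rfl, rfl, ker⟩ := hB.family c q r
    have := ker _ (B'.cC e r (B'.cC g q c))
      (B'.cC e' (fun j => B'.cC (f j) (fun i => r (g ⟨j, i⟩)) (q j)) c) (fun A ψ => by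
        simp only [map_cC]
        exact A.compC_compC H _ _ _)
    simpa only [map_cC] using this
  actC_actC {N n m h k l g e f e'} H c r q := by
    obtain ⟨B', φ, c, r, q, rfl, rfl, rfl, ker⟩ := hB.family c r q
    have := ker _ (B'.aC g q (B'.aC e r c))
      (B'.aC e' (fun j => B'.cR (f j) (q j) (fun i => r (g ⟨j, i⟩))) c) (fun A ψ => by
        simp only [map_aC, map_cR]
        exact A.actC_actC H _ _ _)
    simpa only [map_aC, map_cR] using this
  actC_compC {N n m h k l g e f e'} H c d r := by
    obtain ⟨B', φ, c, d, r, rfl, rfl, rfl, ker⟩ := hB.family c d r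
    have := ker _ (B'.aC e r (B'.cC e' d c))
      (B'.cC g (fun j => B'.aC (f j) (fun i => r (g ⟨j, i⟩)) (d j)) c) (fun A ψ => by
        simp only [map_aC, map_cC]
        exact A.actC_compC H _ _ _)
    simpa only [map_aC, map_cC] using this
  actC_compC' {N n m h k l g e f e'} H c d r := by
    obtain ⟨B', φ, c, d, r, rfl, rfl, rfl, ker⟩ := hB.family c d r
    have := ker _ (B'.aC e' r (B'.cC e d c))
      (B'.aC g (fun j => B'.aR (f j) (r j) (fun i => d (g ⟨j, i⟩))) c) (fun A ψ => by
        simp only [map_aC, map_cC, map_aR]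
        exact A.actC_compC' H _ _ _)
    simpa only [map_aC, map_cC, map_aR] using this
  comm_row {l M N L m n e e₂ e₃ e₄} H r q p := by
    obtain ⟨B', φ, r, q, p, rfl, rfl, rfl, ker⟩ := hB.family r q p
    have := ker _ (B'.cR e₂ (B'.aR e r q) p)
      (B'.aR e₄ (B'.cR e₃ r (fun s => p (e.symm s).1)) (fun t => q (e₂.symm t).1)) (fun A ψ => by
        simp only [map_aR, map_cR]
        exact A.comm_row H _ _ _)
    simpa only [map_aR, map_cR] using this
  comm_col {l M N L m n e e₂ e₃ e₄} H c q p := by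
    obtain ⟨B', φ, c, q, p, rfl, rfl, rfl, ker⟩ := hB.family c q p
    have := ker _ (B'.cC e q (B'.aC e₂ p c))
      (B'.aC e₃ (fun s => p (e.symm s).1) (B'.cC e₄ (fun t => q (e₂.symm t).1) c)) (fun A ψ => by
        simp only [map_aC, map_cC]
        exact A.comm_col H _ _ _)
    simpa only [map_aC, map_cC] using this

end Str

instance : AlgCat CBio.{u} where
  S := bioSig
  E := bioStr
  ff :=
    { preimage := fun {P Q} g =>
        { onR := fun n => Str.Hom.app g (.inl n)
          onC := fun n => Str.Hom.app g (.inr n)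
          map_oneR := Str.Hom.map_op g .oneR Empty.rec
          map_oneC := Str.Hom.map_op g .oneC Empty.rec
          map_compR := fun e p q => Str.map_cR g e p q
          map_compC := fun e q p => Str.map_cC g e p q
          map_actR := fun e p q => Str.map_aR g e p q
          map_actC := fun e q p => Str.map_aC g e p q }
      map_preimage := fun g => Str.Hom.ext (funext fun k => by cases k <;> rfl)
      preimage_map := fun f => rfl }
  closed B hB := by
    refine ⟨hB.toBio, ⟨⟨⟨Sum.rec (fun _ x => x) (fun _ x => x), ?_⟩,
      ⟨Sum.rec (fun _ x => x) (fun _ x => x), ?_⟩,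
      Str.Hom.ext (funext fun k => by cases k <;> rfl),
      Str.Hom.ext (funext fun k => by cases k <;> rfl)⟩⟩⟩
    · rintro (_ | _) x <;>
        exact congrArg (B.op _) (funext fun a => by cases a <;> rfl)
    · rintro (_ | _) x <;>
        exact congrArg (B.op _) (funext fun a => by cases a <;> rfl)

/-- The operations of a prop. -/
inductive PrpOp
  | one (n : ℕ)
  | zeroLeft (m : ℕ)
  | zeroRight (n : ℕ)
  | comp (n k m : ℕ)
  | dsum {N n m : ℕ} (k l : Fin N → ℕ) (e : Split k n) (f : Split l m)

/-- The arities of the operations of a prop. -/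
abbrev PrpOp.ar : PrpOp → Type
  | .one _ => Empty
  | .zeroLeft _ => Empty
  | .zeroRight _ => Empty
  | .comp _ _ _ => Bool
  | .dsum (N := N) _ _ _ _ => Fin N

/-- The input sorts of the operations of a prop. -/
abbrev PrpOp.dom : ∀ o : PrpOp, o.ar → ℕ × ℕ
  | .one _, a => a.elim
  | .zeroLeft _, a => a.elim
  | .zeroRight _, a => a.elim
  | .comp n k m, a => a.casesOn (n, k) (k, m)
  | .dsum k l _ _, a => (k a, l a)

/-- The output sorts of the operations of a prop. -/
abbrev PrpOp.cod : PrpOp → ℕ × ℕ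
  | .one n => (n, n)
  | .zeroLeft m => (0, m)
  | .zeroRight n => (n, 0)
  | .comp n _ m => (n, m)
  | .dsum (n := n) (m := m) _ _ _ _ => (n, m)

/-- The signature of props. -/
abbrev prpSig : Sig where
  K := ℕ × ℕ
  Op := PrpOp
  ar := PrpOp.ar
  fin o := by cases o <;> (dsimp only [PrpOp.ar]; infer_instance)
  dom := PrpOp.dom
  cod := PrpOp.cod

/-- The structure underlying a prop. -/
abbrev Prp.str (P : Prp.{u}) : Str.{u} prpSig where
  carrier k := P.A k.1 k.2
  op
    | .one n, _ => P.one n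
    | .zeroLeft m, _ => (P.uniqueLeft m).default
    | .zeroRight n, _ => (P.uniqueRight n).default
    | .comp _ _ _, x => P.comp (x false) (x true)
    | .dsum _ _ e f, x => P.dsum e f x

/-- The homomorphism of structures underlying a homomorphism of props. -/
def Prp.Hom.str {P Q : Prp.{u}} (φ : Prp.Hom P Q) : Str.Hom P.str Q.str where
  app k := φ.on k.1 k.2
  map_op
    | .one n, _ => φ.map_one n
    | .zeroLeft m, _ => (Q.uniqueLeft m).uniq _
    | .zeroRight n, _ => (Q.uniqueRight n).uniq _
    | .comp _ _ _, _ => φ.map_comp _ _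
    | .dsum _ _ e f, x => φ.map_dsum e f x

/-- The functor from props to structures. -/
def prpStr : CPrp.{u} ⥤ Str.{u} prpSig where
  obj P := P.toPrp.str
  map φ := Prp.Hom.str φ

namespace Str
variable (A B : Str.{u} prpSig) (h : Str.Hom A B)

/-- The composition of a structure. -/
def mComp {n k m : ℕ} (a : B.carrier (n, k)) (b : B.carrier (k, m)) : B.carrier (n, m) :=
  B.op (.comp n k m) (Bool.rec a b)

/-- The direct sum of a structure. -/
def mSum {N n m : ℕ} {k l : Fin N → ℕ} (e : Split k n) (f : Split l m)
    (a : ∀ i, B.carrier (k i, l i)) : B.carrier (n, m) :=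
  B.op (.dsum k l e f) a

/-- The identity matrices of a structure. -/
def mOne (n : ℕ) : B.carrier (n, n) := B.op (.one n) Empty.rec

variable {A B}

lemma map_mComp {n k m : ℕ} (a : A.carrier (n, k)) (b : A.carrier (k, m)) :
    h.app (n, m) (A.mComp a b) = B.mComp (h.app _ a) (h.app _ b) :=
  (h.map_op (.comp n k m) _).trans (congrArg _ (funext fun a => by cases a <;> rfl))

lemma map_mSum {N n m : ℕ} {k l : Fin N → ℕ} (e : Split k n) (f : Split l m)
    (a : ∀ i, A.carrier (k i, l i)) :
    h.app (n, m) (A.mSum e f a) = B.mSum e f (fun i => h.app _ (a i)) :=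
  h.map_op (.dsum k l e f) a

lemma map_mOne (n : ℕ) : h.app (n, n) (A.mOne n) = B.mOne n :=
  (h.map_op (.one n) _).trans (congrArg _ (funext fun a => a.elim))

variable (hB : IsLike prpStr B)

/-- A structure that satisfies the equations of props is a prop. -/
def IsLike.toPrp : CPrp.{u} where
  A n m := B.carrier (n, m)
  one n := B.mOne n
  comp a b := B.mComp a b
  dsum e f a := B.mSum e f a
  uniqueLeft m :=
    { default := B.op (.zeroLeft m) Empty.rec
      uniq := fun x => by
        obtain ⟨B', φ, p, q, r, rfl, hq, -, ker⟩ := hB.triple x (B.op (.zeroLeft m) Empty.rec) x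
        rw [hq]
        exact ker _ _ _ fun A ψ => ((A.uniqueLeft m).uniq _).trans ((A.uniqueLeft m).uniq _).symm }
  uniqueRight n :=
    { default := B.op (.zeroRight n) Empty.rec
      uniq := fun x => by
        obtain ⟨B', φ, p, q, r, rfl, hq, -, ker⟩ := hB.triple x (B.op (.zeroRight n) Empty.rec) x
        rw [hq]
        exact ker _ _ _ fun A ψ =>
          ((A.uniqueRight n).uniq _).trans ((A.uniqueRight n).uniq _).symm }
  one_comp {n m} a := by
    obtain ⟨B', φ, a, -, -, rfl, -, -, ker⟩ := hB.triple a a a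
    have := ker _ (B'.mComp (B'.mOne n) a) a (fun A ψ => by
      simp only [map_mComp, map_mOne]
      exact A.one_comp _)
    simpa only [map_mComp, map_mOne] using this
  comp_one {n m} a := by
    obtain ⟨B', φ, a, -, -, rfl, -, -, ker⟩ := hB.triple a a a
    have := ker _ (B'.mComp a (B'.mOne m)) a (fun A ψ => by
      simp only [map_mComp, map_mOne]
      exact A.comp_one _)
    simpa only [map_mComp, map_mOne] using this
  comp_assoc a b c := by
    obtain ⟨B', φ, a, b, c, rfl, rfl, rfl, ker⟩ := hB.triple a b c
    have := ker _ (B'.mComp (B'.mComp a b) c) (B'.mComp a (B'.mComp b c)) (fun A ψ => by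
      simp only [map_mComp]
      exact A.comp_assoc _ _ _)
    simpa only [map_mComp] using this
  dsum_one {N n k} e := by
    -- This law has no variables; the elements lifted here only serve to produce a cover.
    obtain ⟨B', φ, a, b, c, -, -, -, ker⟩ := hB.triple (B.mOne 0) (B.mOne 0) (B.mOne 0)
    have := ker _ (B'.mSum e e (fun i => B'.mOne (k i))) (B'.mOne n) (fun A ψ => by
      simp only [map_mSum, map_mOne]
      exact A.dsum_one _)
    simpa only [map_mSum, map_mOne] using this
  dsum_comp e f g a b := by
    obtain ⟨B', φ, -, a, b, -, rfl, rfl, ker⟩ := hB.family (B.mOne 0) a b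
    have := ker _ (B'.mComp (B'.mSum e f a) (B'.mSum f g b))
      (B'.mSum e g (fun i => B'.mComp (a i) (b i))) (fun A ψ => by
      simp only [map_mSum, map_mComp]
      exact A.dsum_comp _ _ _ _ _)
    simpa only [map_mSum, map_mComp] using this
  dsum_single {n m} a := by
    obtain ⟨B', φ, a, -, -, rfl, -, -, ker⟩ := hB.triple a a a
    have := ker _ (B'.mSum (Split.single n) (Split.single m) (fun _ => a)) a (fun A ψ => by
      simp only [map_mSum]
      exact A.dsum_single _)
    simpa only [map_mSum] using this
  dsum_dsum {N M n m h k l k' l' g e e₁ e' f f₁ f'} H H' a := by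
    obtain ⟨B', φ, -, a, -, -, rfl, -, ker⟩ := hB.family (B.mOne 0) a a
    have := ker _ (B'.mSum e' f' (fun j => B'.mSum (e₁ j) (f₁ j) (fun i => a (g ⟨j, i⟩))))
      (B'.mSum e f a) (fun A ψ => by
      simp only [map_mSum]
      exact A.dsum_dsum H H' (fun s => ψ.app _ (a s)))
    simpa only [map_mSum] using this
  central {n m} s a := by
    obtain ⟨B', φ, s, a, -, rfl, rfl, -, ker⟩ := hB.triple s a a
    have := ker _ (B'.mComp (B'.mSum (Split.ones n) (Split.ones n) (fun _ => s)) a)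
      (B'.mComp a (B'.mSum (Split.ones m) (Split.ones m) (fun _ => s))) (fun A ψ => by
      simp only [map_mSum, map_mComp]
      exact A.central _ _)
    simp only [map_mSum, map_mComp] at this
    exact this
  comm {n m L f g} H q p := by
    obtain ⟨B', φ, q, p, -, rfl, rfl, -, ker⟩ := hB.triple q p p
    have := ker _ (B'.mComp q p) (B'.mComp (B'.mSum (Split.ones m) f (fun _ => p))
      (B'.mSum g (Split.ones n) (fun _ => q))) (fun A ψ => by
      simp only [map_mSum, map_mComp]
      exact A.comm H _ _)
    simpa only [map_mSum, map_mComp] using this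
  contract {n m k K L f g g' f'} H H' b a d := by
    obtain ⟨B', φ, b, a, d, rfl, rfl, rfl, ker⟩ := hB.triple b a d
    have := ker _ (B'.mComp (B'.mSum (Split.ones n) f (fun _ => b))
      (B'.mComp (B'.mSum g g' (fun _ => a)) (B'.mSum f' (Split.ones m) (fun _ => d))))
      (B'.mComp (B'.mSum (Split.ones n) (Split.ones n) (fun _ => B'.mComp b d)) a) (fun A ψ => by
      simp only [map_mSum, map_mComp]
      exact A.contract H H' _ _ _)
    simp only [map_mSum, map_mComp] at this
    exact this

end Str

instance : AlgCat CPrp.{u} where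
  S := prpSig
  E := prpStr
  ff :=
    { preimage := fun {P Q} g =>
        { on := fun n m => Str.Hom.app g (n, m)
          map_one := fun n => Str.Hom.map_op g (.one n) Empty.rec
          map_comp := fun {n k m} a b => Str.map_mComp g a b
          map_dsum := fun {N n m k l} e f a => Str.Hom.map_op g (.dsum k l e f) a }
      map_preimage := fun g => rfl
      preimage_map := fun f => rfl }
  closed B hB := by
    refine ⟨hB.toPrp, ⟨⟨⟨fun _ x => x, ?_⟩, ⟨fun _ x => x, ?_⟩, rfl, rfl⟩⟩⟩
    · rintro (_ | _) x <;>
        exact congrArg (B.op _) (funext fun a => by first | rfl | (cases a <;> rfl))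
    · rintro (_ | _) x <;>
        exact congrArg (B.op _) (funext fun a => by first | rfl | (cases a <;> rfl))

/-! ### Ideals and primes of bios -/

namespace CBio
variable {P Q : CBio.{u}}

lemma mul_eq_act (s t : P.R 1) : s * t = MAct.act s t := rfl

lemma contr_mul {n : ℕ} (b : P.R n) (a : Fin n → P.R 1) (d : P.C n) (s : P.R 1) :
    P.contr b (fun i => s * a i) d = s * P.contr b a d := by
  have h : P.compR (Split.ones n) b (fun i => s * a i) =
      MAct.act s (P.compR (Split.ones n) b a) := P.compR_act (Split.ones n) s b a
  rw [contr, h, P.act_actR]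
  rfl

lemma contr_single (a : P.R 1) : P.contr P.oneR (fun _ => a) P.oneC = a := by
  rw [contr, ← single_one, P.one_compR, single_one, P.actR_one]

/-- A contraction of contractions is a contraction, by composing the inner rows with the outer row
and the inner columns with the outer column. Hence the contractions of elements of a set form an
ideal, without further closure. -/
lemma contr_contr {n : ℕ} (b : P.R n) (d : P.C n) (k : Fin n → ℕ) (b' : ∀ i, P.R (k i))
    (a : ∀ i, Fin (k i) → P.R 1) (d' : ∀ i, P.C (k i)) {m : ℕ} (e : Split k m) :
    P.contr b (fun i => P.contr (b' i) (a i) (d' i)) d =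
      P.contr (P.compR e b b') (fun j => a (e.symm j).1 (e.symm j).2) (P.compC e d' d) := by
  have h : P.compR (Split.ones m) (P.compR e b b') (fun j => a (e.symm j).1 (e.symm j).2) =
      P.compR e b (fun i => P.compR (Split.ones (k i)) (b' i) (a i)) := by
    rw [P.compR_compR (g := e) (e := Split.ones m) (f := fun j => Split.ones (k j)) (e' := e)
      (fun _ _ _ => rfl)]
    refine congrArg _ (funext fun i => congrArg _ (funext fun j => ?_))
    exact congrArg (fun x : Σ i, Fin (k i) => a x.1 x.2) (e.symm_apply_apply ⟨i, j⟩)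
  unfold contr
  rw [h]
  refine Eq.trans (congrArg (fun z => P.actR (Split.single n) z _) (P.actR_compR
    (g := Split.ones n) (e := e) (f := fun i => Split.single (k i)) (e' := e) (fun _ _ _ => rfl)
    b _ d').symm) ?_
  exact P.actR_actR (g := Split.single n) (e := e) (f := fun _ => e) (e' := Split.single m)
    (fun _ _ _ => rfl) _ d' (fun _ => d)

/-- The ideal generated by a set. -/
def span (A : Set (P.R 1)) : Set (P.R 1) :=
  {s | ∃ (n : ℕ) (b : P.R n) (a : Fin n → P.R 1) (d : P.C n), (∀ i, a i ∈ A) ∧ s = P.contr b a d}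

lemma isIdeal_span (A : Set (P.R 1)) : P.IsIdeal (span A) := by
  intro n b a d h
  choose k b' a' d' ha h using h
  obtain rfl : a = _ := funext h
  let e : Split k (∑ i, k i) := finSigmaFinEquiv
  exact ⟨_, P.compR e b b', _, P.compC e d' d, fun j => ha _ _, contr_contr b d k b' a' d' e⟩

lemma subset_span (A : Set (P.R 1)) : A ⊆ span A := fun s hs =>
  ⟨1, P.oneR, fun _ => s, P.oneC, fun _ => hs, (contr_single s).symm⟩

/-- A scalar is a row of length one, to be contracted with the unit column. -/
lemma IsIdeal.mul_mem {I : Set (P.R 1)} (hI : P.IsIdeal I) (s : P.R 1) {t : P.R 1} (ht : t ∈ I) :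
    s * t ∈ I := by
  have := hI 1 s (fun _ => t) P.oneC (fun _ => ht)
  have e : P.contr s (fun _ => t) P.oneC = s * t := by
    rw [contr, ← single_one, single_one, P.actR_one, ← single_one]
    rfl
  rwa [e] at this

/-- A contraction involves finitely many elements, which lie in one member of the chain. -/
lemma isIdeal_sUnion {c : Set (Set (P.R 1))} (hc : IsChain (· ⊆ ·) c) (hne : c.Nonempty)
    (h : ∀ I ∈ c, P.IsIdeal I) : P.IsIdeal (⋃₀ c) := by
  intro n b a d ha
  choose I hI haI using ha
  have hdir : DirectedOn (· ⊆ ·) c := fun I hI J hJ => by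
    obtain h | h := hc.total hI hJ
    · exact ⟨J, hJ, h, subset_rfl⟩
    · exact ⟨I, hI, subset_rfl, h⟩
  obtain ⟨J, hJ, hle⟩ := DirectedOn.exists_mem_subset_of_finite_of_subset_sUnion hne hdir
    (Set.finite_range a) (by rintro _ ⟨i, rfl⟩; exact ⟨I i, hI i, haI i⟩)
  exact ⟨J, hJ, h J hJ n b a d fun i => hle ⟨i, rfl⟩⟩

/-- An ideal that does not meet a submonoid is contained in a prime that does not meet it. -/
lemma exists_prime {I : Set (P.R 1)} (hI : P.IsIdeal I) (S : Submonoid (P.R 1))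
    (hS : ∀ s ∈ S, s ∉ I) : ∃ x : P.Prime, I ⊆ x.carrier ∧ ∀ s ∈ S, s ∉ x.carrier := by
  obtain ⟨J, hIJ, hJ⟩ := zorn_subset_nonempty {J | P.IsIdeal J ∧ ∀ s ∈ S, s ∉ J}
    (fun c hc hch hne => ⟨⋃₀ c, ⟨isIdeal_sUnion hch hne fun _ hI => (hc hI).1,
      fun s hs ⟨_, hK, h⟩ => (hc hK).2 s hs h⟩, fun _ hK => Set.subset_sUnion_of_mem hK⟩)
    I ⟨hI, hS⟩
  -- By maximality of `J`, the ideal generated by `J` and one further element meets `S`.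
  have key : ∀ s, s ∉ J → ∃ u ∈ S, ∃ (n : ℕ) (b : P.R n) (a : Fin n → P.R 1) (d : P.C n),
      (∀ i, a i ∈ insert s J) ∧ u = P.contr b a d := by
    intro s hs
    by_contra hcon
    push Not at hcon
    refine hs (hJ.le_of_ge (y := span (insert s J)) ⟨isIdeal_span _, fun u hu hmem => ?_⟩
      ((Set.subset_insert s J).trans (subset_span _)) (subset_span _ (Set.mem_insert s J)))
    obtain ⟨n, b, a, d, ha, h⟩ := hmem
    exact hcon u hu n b a d ha h
  refine ⟨⟨J, hJ.prop.1, hJ.prop.2 1 S.one_mem, fun s t hst => ?_⟩, hIJ, hJ.prop.2⟩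
  by_contra hcon
  push Not at hcon
  obtain ⟨u, hu, n, b, a, d, ha, rfl⟩ := key s hcon.1
  obtain ⟨v, hv, m, b', a', d', ha', rfl⟩ := key t hcon.2
  -- The product of the two contractions lies in `S`. Moving scalars into the contractions expands
  -- it into entries that are either `s * t` or a multiple of an element of `J`, so it also lies in
  -- `J`.
  refine hJ.prop.2 _ (S.mul_mem hv hu) ?_
  rw [← contr_mul]
  refine hJ.prop.1 n b _ d fun i => ?_
  obtain h | h := ha i
  · rw [h, mul_comm, ← contr_mul]
    refine hJ.prop.1 m b' _ d' fun j => ?_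
    obtain h' | h' := ha' j
    · rw [h']
      exact hst
    · exact hJ.prop.1.mul_mem _ h'
  · exact hJ.prop.1.mul_mem _ h

/-- Principal ideals need no sums: a common factor of the entries can be pulled out of a
contraction. -/
lemma isIdeal_multiples (s : P.R 1) : P.IsIdeal {t | ∃ r, t = s * r} := by
  intro n b a d h
  choose r hr using h
  obtain rfl : a = _ := funext hr
  exact ⟨_, contr_mul b r d s⟩

lemma exists_isMaxIdeal {I : Set (P.R 1)} (hI : P.IsIdeal I) (h1 : (1 : P.R 1) ∉ I) :
    ∃ J, I ⊆ J ∧ P.IsMaxIdeal J :=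
  zorn_subset_nonempty {J | P.IsIdeal J ∧ (1 : P.R 1) ∉ J}
    (fun c hc hch hne => ⟨⋃₀ c, ⟨isIdeal_sUnion hch hne fun _ hI => (hc hI).1,
      fun ⟨_, hK, h⟩ => (hc hK).2 h⟩, fun _ hK => Set.subset_sUnion_of_mem hK⟩) I ⟨hI, h1⟩

lemma IsMaxIdeal.notMem_of_isUnit {I : Set (P.R 1)} (hI : P.IsMaxIdeal I) {s : P.R 1}
    (hs : IsUnit s) : s ∉ I := by
  intro h
  obtain ⟨t, ht⟩ := hs.exists_left_inv
  have := hI.prop.1.mul_mem t h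
  rw [ht] at this
  exact hI.prop.2 this

lemma exists_isMaxIdeal_of_not_isUnit {s : P.R 1} (hs : ¬ IsUnit s) :
    ∃ J, s ∈ J ∧ P.IsMaxIdeal J := by
  obtain ⟨J, h, hJ⟩ := exists_isMaxIdeal (isIdeal_multiples s) (by
    rintro ⟨r, hr⟩
    exact hs (IsUnit.of_mul_eq_one r hr.symm))
  exact ⟨J, h ⟨1, (mul_one s).symm⟩, hJ⟩

lemma IsLocal.mem_iff (hP : P.IsLocal) {I : Set (P.R 1)} (hI : P.IsMaxIdeal I) (s : P.R 1) :
    s ∈ I ↔ ¬ IsUnit s := by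
  refine ⟨fun h hs => hI.notMem_of_isUnit hs h, fun h => ?_⟩
  obtain ⟨J, hs, hJ⟩ := exists_isMaxIdeal_of_not_isUnit h
  rwa [hP.unique hI hJ]

/-- The multiples of a nonunit form a proper ideal, so each nonunit lies in a maximal ideal, while
no unit does. A unique maximal ideal must therefore be the set of nonunits. -/
lemma isLocal_iff : P.IsLocal ↔ P.IsIdeal {s | ¬ IsUnit s} := by
  constructor
  · intro h
    obtain ⟨I, hI, -⟩ := id h
    have : I = {s | ¬ IsUnit s} := Set.ext fun s => h.mem_iff hI s
    rw [← this]
    exact hI.prop.1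
  · intro h
    have hm : P.IsMaxIdeal {s | ¬ IsUnit s} := ⟨⟨h, fun h => h isUnit_one⟩, fun J hJ _ s hs hu => by
      obtain ⟨t, ht⟩ := hu.exists_left_inv
      have := hJ.1.mul_mem t hs
      rw [ht] at this
      exact hJ.2 this⟩
    refine ⟨_, hm, fun J hJ => ?_⟩
    have hle : J ⊆ {s | ¬ IsUnit s} := fun s hs hu => hJ.notMem_of_isUnit hu hs
    exact Set.Subset.antisymm hle (hJ.le_of_ge hm.prop hle)

/-- Both maximal ideals are the sets of nonunits. From here on local maps are handled by reflection
of units, without mention of ideals. -/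
lemma isLocalMap_iff (hP : P.IsLocal) (hQ : Q.IsLocal) (φ : P ⟶ Q) :
    IsLocalMap φ ↔ ∀ s, IsUnit (homOne φ s) → IsUnit s := by
  obtain ⟨I, hI, -⟩ := id hP
  obtain ⟨J, hJ, -⟩ := id hQ
  constructor
  · intro h s hs
    by_contra hn
    exact (hQ.mem_iff hJ _).1 (h I J hI hJ ((hP.mem_iff hI s).2 hn)) hs
  · intro h I J hI hJ s hs
    exact (hQ.mem_iff hJ _).2 fun hu => (hP.mem_iff hI s).1 hs (h s hu)

lemma homOne_contr (φ : P ⟶ Q) {n : ℕ} (b : P.R n) (a : Fin n → P.R 1) (d : P.C n) :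
    homOne φ (P.contr b a d) =
      Q.contr (Bio.Hom.onR φ n b) (fun i => homOne φ (a i)) (Bio.Hom.onC φ n d) :=
  (Bio.Hom.map_actR φ _ _ _).trans (congrArg (fun z => Q.actR (Split.single n) z _)
    (Bio.Hom.map_compR φ _ _ _))

lemma Prime.ext {x y : P.Prime} (h : x.carrier = y.carrier) : x = y := by
  cases x
  cases y
  cases h
  rfl

/-- The prime of nonunits of a local bio, pulled back along `φ`. -/
def IsLocal.prime (hQ : Q.IsLocal) (φ : P ⟶ Q) : P.Prime :=
  Prime.comap φ ⟨{s | ¬ IsUnit s}, isLocal_iff.1 hQ, fun h => h isUnit_one, fun s t h => by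
    by_contra hn
    simp only [Set.mem_ofPred_eq, not_or, not_not] at hn
    exact h (hn.1.mul hn.2)⟩

lemma IsLocal.mem_prime (hQ : Q.IsLocal) (φ : P ⟶ Q) (s : P.R 1) :
    s ∈ (hQ.prime φ).carrier ↔ ¬ IsUnit (homOne φ s) := Iff.rfl

lemma isTopologicalBasis_basicOpen :
    TopologicalSpace.IsTopologicalBasis (Set.range fun f : P.R 1 => {x : P.Prime | f ∉ x.carrier}) where
  exists_subset_inter := by
    rintro _ ⟨f, rfl⟩ _ ⟨g, rfl⟩ x ⟨hf, hg⟩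
    refine ⟨_, ⟨f * g, rfl⟩, fun h => (x.mem_or_mem f g h).elim hf hg, fun y hy => ⟨fun h => ?_,
      fun h => ?_⟩⟩
    · refine hy ?_
      rw [mul_comm]
      exact y.isIdeal.mul_mem g h
    · exact hy (y.isIdeal.mul_mem f h)
  sUnion_eq := Set.eq_univ_of_forall fun x => ⟨_, ⟨1, rfl⟩, x.one_notMem⟩
  eq_generateFrom := rfl

end CBio

/-! ### Algebraic structures over commutative bios -/

/-- The map on scalars induced by a morphism. -/
abbrev sc {C : Type (u + 1)} [Category.{u} C] (U : C ⥤ CBio.{u}) {A B : C} (f : A ⟶ B) :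
    (U.obj A).R 1 →* (U.obj B).R 1 :=
  CBio.homOne (U.map f)

section Scalars
variable {C : Type (u + 1)} [Category.{u} C] {U : C ⥤ CBio.{u}}

@[simp]
lemma sc_id (A : C) (s : (U.obj A).R 1) : sc U (𝟙 A) s = s := by
  change Bio.Hom.onR (U.map (𝟙 A)) 1 s = s
  rw [U.map_id]
  rfl

@[simp]
lemma sc_comp {A B D : C} (f : A ⟶ B) (g : B ⟶ D) (s : (U.obj A).R 1) :
    sc U (f ≫ g) s = sc U g (sc U f s) := by
  change Bio.Hom.onR (U.map (f ≫ g)) 1 s = Bio.Hom.onR (U.map g) 1 (Bio.Hom.onR (U.map f) 1 s)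
  rw [U.map_comp]
  rfl

lemma hom_ext_sc {A B : C} {f g : A ⟶ B} (h : f = g) (s : (U.obj A).R 1) : sc U f s = sc U g s := by
  rw [h]

end Scalars

/-- A category of algebraic structures over commutative bios: the scalars of the underlying bio
act, compatibly with all operations, and localizations exist. -/
class Geo {C : Type (u + 1)} [Category.{u} C] [AlgCat C] (U : C ⥤ CBio.{u}) where
  act : ∀ {A : C} {k : (AlgCat.S C).K}, (U.obj A).R 1 → El k A → El k A
  one_act : ∀ {A : C} {k : (AlgCat.S C).K} (x : El k A), act 1 x = x
  mul_act : ∀ {A : C} {k : (AlgCat.S C).K} (s t : (U.obj A).R 1) (x : El k A),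
    act (s * t) x = act s (act t x)
  ap_act : ∀ {A B : C} (f : A ⟶ B) {k : (AlgCat.S C).K} (s : (U.obj A).R 1) (x : El k A),
    ap f (act s x) = act (sc U f s) (ap f x)
  -- The degree of the operation: for bios and props it is 0 for constants, 2 for compositions and
  -- actions, and 1 for the direct sum of matrices.
  op_act : ∀ o : (AlgCat.S C).Op, ∃ d : ℕ, ∀ (A : C) (s : (U.obj A).R 1)
    (x : ∀ a, El ((AlgCat.S C).dom o a) A), opE o (fun a => act s (x a)) = act (s ^ d) (opE o x)
  row : ℕ → (AlgCat.S C).K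
  col : ℕ → (AlgCat.S C).K
  rowE : ∀ (n : ℕ) (A : C), El (row n) A ≃ (U.obj A).R n
  colE : ∀ (n : ℕ) (A : C), El (col n) A ≃ (U.obj A).C n
  rowE_ap : ∀ (n : ℕ) {A B : C} (f : A ⟶ B) (x : El (row n) A),
    rowE n B (ap f x) = Bio.Hom.onR (U.map f) n (rowE n A x)
  colE_ap : ∀ (n : ℕ) {A B : C} (f : A ⟶ B) (x : El (col n) A),
    colE n B (ap f x) = Bio.Hom.onC (U.map f) n (colE n A x)
  rowE_act : ∀ (n : ℕ) {A : C} (s : (U.obj A).R 1) (x : El (row n) A),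
    rowE n A (act s x) = MAct.act s (rowE n A x)
  colE_act : ∀ (n : ℕ) {A : C} (s : (U.obj A).R 1) (x : El (col n) A),
    colE n A (act s x) = MAct.act s (colE n A x)
  -- For matrices over a ring this is `∑ bᵢ dᵢ xᵢ`. The two laws that follow are all of additivity
  -- that the gluing of sections uses.
  lc : ∀ {A : C} {k : (AlgCat.S C).K} {n : ℕ}, (U.obj A).R n → (U.obj A).C n → (Fin n → El k A) →
    El k A
  lc_act : ∀ {A : C} {k : (AlgCat.S C).K} {n : ℕ} (b : (U.obj A).R n) (d : (U.obj A).C n)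
    (s : (U.obj A).R 1) (x : Fin n → El k A), lc b d (fun i => act s (x i)) = act s (lc b d x)
  act_lc : ∀ {A : C} {k : (AlgCat.S C).K} {n : ℕ} (b : (U.obj A).R n) (d : (U.obj A).C n)
    (s : Fin n → (U.obj A).R 1) (x : El k A),
    lc b d (fun i => act (s i) x) = act ((U.obj A).contr b s d) x
  loc : ∀ A : C, Submonoid ((U.obj A).R 1) → C
  locHom : ∀ (A : C) (S : Submonoid ((U.obj A).R 1)), A ⟶ loc A S
  isUnit_locHom : ∀ (A : C) (S : Submonoid ((U.obj A).R 1)), ∀ s ∈ S, IsUnit (sc U (locHom A S) s)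
  locHom_surj : ∀ (A : C) (S : Submonoid ((U.obj A).R 1)) (k) (y : El k (loc A S)),
    ∃ s ∈ S, ∃ x, act (sc U (locHom A S) s) y = ap (locHom A S) x
  locHom_eq : ∀ (A : C) (S : Submonoid ((U.obj A).R 1)) (k) (x x' : El k A),
    ap (locHom A S) x = ap (locHom A S) x' → ∃ s ∈ S, act s x = act s x'

section Geo
variable {C : Type (u + 1)} [Category.{u} C] [AlgCat C] {U : C ⥤ CBio.{u}} [Geo U]

instance (A : C) (k : (AlgCat.S C).K) : MulAction ((U.obj A).R 1) (El k A) where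
  smul s x := Geo.act (U := U) s x
  one_smul := Geo.one_act
  mul_smul := Geo.mul_act

lemma ap_smul {A B : C} (f : A ⟶ B) {k : (AlgCat.S C).K} (s : (U.obj A).R 1) (x : El k A) :
    ap f (s • x) = sc U f s • ap f x :=
  Geo.ap_act f s x

variable (U) in
lemma exists_op_smul (o : (AlgCat.S C).Op) : ∃ d : ℕ, ∀ (A : C) (s : (U.obj A).R 1)
    (x : ∀ a, El ((AlgCat.S C).dom o a) A), opE o (fun a => s • x a) = s ^ d • opE o x :=
  Geo.op_act o

variable (U) in
/-- Scalars as elements. -/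
def toEl {A : C} : (U.obj A).R 1 ≃ El (Geo.row U 1) A := (Geo.rowE 1 A).symm

lemma ap_toEl {A B : C} (f : A ⟶ B) (s : (U.obj A).R 1) :
    ap f (toEl U s) = toEl U (sc U f s) := by
  refine (Geo.rowE 1 B).injective ((Geo.rowE_ap 1 f _).trans ?_)
  simp only [toEl, Equiv.apply_symm_apply]
  rfl

lemma smul_toEl {A : C} (s t : (U.obj A).R 1) : s • toEl U t = toEl U (s * t) := by
  refine (Geo.rowE 1 A).injective ((Geo.rowE_act 1 _ _).trans ?_)
  simp only [toEl, Equiv.apply_symm_apply]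
  rfl

lemma ap_toEl_symm {A B : C} (f : A ⟶ B) (x : El (Geo.row U 1) A) :
    (toEl U).symm (ap f x) = sc U f ((toEl U).symm x) := by
  rw [Equiv.symm_apply_eq, ← ap_toEl, Equiv.apply_symm_apply]

/-- The morphism `φ` is a localization with respect to `S`. -/
structure IsLocz {A L : C} (φ : A ⟶ L) (S : Submonoid ((U.obj A).R 1)) : Prop where
  isUnit : ∀ s ∈ S, IsUnit (sc U φ s)
  surj : ∀ k (y : El k L), ∃ s ∈ S, ∃ x, sc U φ s • y = ap φ x
  eq : ∀ k (x x' : El k A), ap φ x = ap φ x' → ∃ s ∈ S, s • x = s • x'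

variable (U) in
lemma isLocz_locHom (A : C) (S : Submonoid ((U.obj A).R 1)) : IsLocz (Geo.locHom A S) S :=
  ⟨Geo.isUnit_locHom A S, Geo.locHom_surj A S, Geo.locHom_eq A S⟩

namespace IsLocz
variable {A L : C} {φ : A ⟶ L} {S : Submonoid ((U.obj A).R 1)} (hφ : IsLocz φ S)
include hφ

lemma surj_family {ι : Type} [Finite ι] {k : ι → (AlgCat.S C).K} (y : ∀ i, El (k i) L) :
    ∃ s ∈ S, ∃ x : ∀ i, El (k i) A, ∀ i, sc U φ s • y i = ap φ (x i) := by
  classical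
  have := Fintype.ofFinite ι
  choose s hs x hx using fun i => hφ.surj _ (y i)
  refine ⟨∏ i, s i, S.prod_mem fun i _ => hs i,
    fun i => (∏ j ∈ Finset.univ.erase i, s j) • x i, fun i => ?_⟩
  rw [ap_smul, ← hx, smul_smul, ← map_mul, Finset.prod_erase_mul _ _ (Finset.mem_univ i)]

lemma surj_sc (y : (U.obj L).R 1) : ∃ s ∈ S, ∃ x, sc U φ s * y = sc U φ x := by
  obtain ⟨s, hs, x, hx⟩ := hφ.surj _ (toEl U y)
  refine ⟨s, hs, (toEl U).symm x, (toEl U).injective ?_⟩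
  rw [← smul_toEl, hx, ← ap_toEl, Equiv.apply_symm_apply]

lemma eq_sc (x x' : (U.obj A).R 1) (h : sc U φ x = sc U φ x') : ∃ s ∈ S, s * x = s * x' := by
  obtain ⟨s, hs, h⟩ := hφ.eq _ (toEl U x) (toEl U x') (by rw [ap_toEl, ap_toEl, h])
  refine ⟨s, hs, (toEl U).injective ?_⟩
  rw [← smul_toEl, h, smul_toEl]

lemma hom_ext {D : C} {f g : L ⟶ D} (h : φ ≫ f = φ ≫ g) : f = g := by
  refine hom_ext_ap fun k y => ?_
  obtain ⟨s, hs, x, hx⟩ := hφ.surj k y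
  have hu : IsUnit (sc U (φ ≫ f) s) := by
    rw [sc_comp]
    exact (hφ.isUnit s hs).map (sc U f)
  refine hu.smul_left_cancel.1 ?_
  rw [sc_comp, ← ap_smul, hx, ← ap_comp, h, ap_comp, ← hx, ap_smul, ← sc_comp, ← sc_comp, h]

/-- A fraction is sent to the image of its numerator divided by the image of its denominator. This
respects an operation of degree `d` because arguments with common denominator `s` give a result with
denominator `s ^ d`. -/
lemma exists_desc {D : C} (ψ : A ⟶ D) (hψ : ∀ s ∈ S, IsUnit (sc U ψ s)) :
    ∃ g : L ⟶ D, φ ≫ g = ψ := by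
  -- The value is characterized by every representation of `y` as a fraction, so that it can later
  -- be evaluated on the denominators that operations produce.
  have key : ∀ k (y : El k L), ∃ z : El k D, ∀ s x, sc U φ s • y = ap φ x →
      IsUnit (sc U ψ s) → sc U ψ s • z = ap ψ x := by
    intro k y
    obtain ⟨s, hs, x, hx⟩ := hφ.surj k y
    obtain ⟨v, hv⟩ := hψ s hs
    refine ⟨(↑v⁻¹ : (U.obj D).R 1) • ap ψ x, fun t x' hx' ht => ?_⟩
    have : ap φ (t • x) = ap φ (s • x') := by
      rw [ap_smul, ap_smul, ← hx, ← hx', smul_smul, smul_smul, mul_comm]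
    obtain ⟨w, hw, h⟩ := hφ.eq k _ _ this
    have h2 : ap ψ (t • x) = ap ψ (s • x') := by
      refine (hψ w hw).smul_left_cancel.1 ?_
      rw [← ap_smul, h, ap_smul]
    rw [ap_smul, ap_smul, ← hv] at h2
    refine v.isUnit.smul_left_cancel.1 ?_
    rw [← h2, smul_smul, smul_smul, mul_right_comm, v.mul_inv, one_mul]
  choose θ hθ using key
  have hu := hψ
  obtain ⟨g, hg⟩ := exists_hom θ fun o y => by
    obtain ⟨s, hs, x, hx⟩ := hφ.surj_family y
    obtain ⟨d, hd⟩ := exists_op_smul U o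
    refine ((hψ s hs).pow d).smul_left_cancel.1 ?_
    rw [← hd, ← map_pow, hθ _ (opE o y) (s ^ d) (opE o x), ap_op]
    · congr 1
      funext a
      exact (hθ _ (y a) s (x a) (hx a) (hψ s hs)).symm
    · rw [map_pow, ← hd, ap_op]
      congr 1
      funext a
      exact hx a
    · exact hψ _ (S.pow_mem hs d)
  refine ⟨g, hom_ext_ap fun k x => ?_⟩
  rw [ap_comp, hg]
  have := hθ k (ap φ x) 1 x (by rw [map_one, one_smul]) (by rw [map_one]; exact isUnit_one)
  rwa [map_one, one_smul] at this

/-- If an element of the prime became invertible, clearing denominators would exhibit an element of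
the complement as a multiple of it. -/
lemma isUnit_iff_of_prime {x : (U.obj A).Prime} (hS : S = x.compl) (s : (U.obj A).R 1) :
    IsUnit (sc U φ s) ↔ s ∉ x.carrier := by
  refine ⟨fun h hs => ?_, fun h => hφ.isUnit s (hS ▸ h)⟩
  obtain ⟨y, hy⟩ := h.exists_right_inv
  obtain ⟨t, ht, r, hr⟩ := hφ.surj_sc y
  have : sc U φ (s * r) = sc U φ t := by
    rw [map_mul, ← hr, mul_left_comm, hy, mul_one]
  obtain ⟨w, hw, h⟩ := hφ.eq_sc _ _ this
  have h1 : w * t ∈ x.compl := hS ▸ S.mul_mem hw ht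
  refine h1 ?_
  rw [← h, mul_left_comm, mul_comm]
  exact x.isIdeal.mul_mem _ hs

end IsLocz

/-- The row, the entries and the column contribute one factor each. -/
lemma contr_act {P : CBio.{u}} {n : ℕ} (s : P.R 1) (b : P.R n) (a : Fin n → P.R 1) (d : P.C n) :
    P.contr (MAct.act s b) (fun i => s * a i) (MAct.act s d) = s ^ 3 * P.contr b a d := by
  rw [CBio.contr_mul]
  unfold CBio.contr
  rw [P.act_compR, P.act_actR, P.actR_act]
  simp only [← CBio.mul_eq_act, ← mul_assoc, pow_succ, pow_zero, one_mul]

/-- After clearing denominators, a contraction of nonunits is the image of a contraction of elements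
of the prime, hence not a unit. -/
lemma IsLocz.isLocal {A L : C} {φ : A ⟶ L} {x : (U.obj A).Prime} (hφ : IsLocz φ x.compl) :
    (U.obj L).IsLocal := by
  refine CBio.isLocal_iff.2 fun n b a d h => ?_
  -- One denominator for the row, the column and all entries together.
  obtain ⟨s, hs, y, hy⟩ := hφ.surj_family (ι := Option (Option (Fin n)))
    (k := fun | none => Geo.row U n | some none => Geo.col U n | some (some _) => Geo.row U 1)
    (fun | none => (Geo.rowE n L).symm b | some none => (Geo.colE n L).symm d
         | some (some i) => toEl U (a i))
  have hb : MAct.act (sc U φ s) b = Bio.Hom.onR (U.map φ) n (Geo.rowE n A (y none)) := by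
    rw [← Geo.rowE_ap, ← hy none]
    refine Eq.trans ?_ (Geo.rowE_act n _ _).symm
    simp only [Equiv.apply_symm_apply]
  have hd : MAct.act (sc U φ s) d = Bio.Hom.onC (U.map φ) n (Geo.colE n A (y (some none))) := by
    rw [← Geo.colE_ap, ← hy (some none)]
    refine Eq.trans ?_ (Geo.colE_act n _ _).symm
    simp only [Equiv.apply_symm_apply]
  have ha : ∀ i, sc U φ s * a i = sc U φ ((toEl U).symm (y (some (some i)))) := by
    intro i
    rw [← ap_toEl_symm, ← hy (some (some i)), Equiv.eq_symm_apply, smul_toEl]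
  have key := contr_act (sc U φ s) b a d
  rw [hb, hd] at key
  simp only [ha] at key
  rw [← CBio.homOne_contr] at key
  have hu : IsUnit (sc U φ s ^ 3) := (hφ.isUnit s hs).pow 3
  intro hc
  refine (hφ.isUnit_iff_of_prime rfl _).1 (key ▸ hu.mul hc) (x.isIdeal _ _ _ _ fun i => ?_)
  by_contra hn
  refine h i ?_
  have := (hφ.isUnit_iff_of_prime rfl _).2 hn
  rw [← ha] at this
  exact isUnit_of_mul_isUnit_right this

end Geo

/-! ### Localization and linear combinations in bios -/

namespace CBio
variable (P : CBio.{u})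

/-- The morphism to the localization. -/
def locHom (S : Submonoid (P.R 1)) : P ⟶ P.loc S :=
  { onR := fun _ x => Loc.mk x 1
    onC := fun _ x => Loc.mk x 1
    map_oneR := rfl
    map_oneC := rfl
    map_compR := fun e p q => ((loc_compR e p 1 q 1).trans (by rw [mul_one])).symm
    map_compC := fun e q c => ((loc_compC e q 1 c 1).trans (by rw [mul_one])).symm
    map_actR := fun e p q => ((loc_actR e p 1 q 1).trans (by rw [mul_one])).symm
    map_actC := fun e q c => ((loc_actC e q 1 c 1).trans (by rw [mul_one])).symm : Bio.Hom _ _ }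

lemma loc_actR_mk {S : Submonoid (P.R 1)} {n : ℕ} (s : P.R 1) (t : S) (x : P.R n) (v : S) :
    (MAct.act (M := (P.loc S).R 1) (X := (P.loc S).R n) (Loc.mk s t) (Loc.mk x v)) =
      (Loc.mk (MAct.act s x) (t * v) : Loc S (P.R n)) :=
  loc_compR (Split.single n) s t (fun _ => x) v

lemma loc_actC_mk {S : Submonoid (P.R 1)} {n : ℕ} (s : P.R 1) (t : S) (x : P.C n) (v : S) :
    (MAct.act (M := (P.loc S).R 1) (X := (P.loc S).C n) (Loc.mk s t) (Loc.mk x v)) =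
      (Loc.mk (MAct.act s x) (t * v) : Loc S (P.C n)) :=
  loc_actC (Split.ones n) (fun _ => s) t x v

lemma isUnit_locHom {S : Submonoid (P.R 1)} (s : S) : IsUnit (homOne (P.locHom S) s) := by
  refine IsUnit.of_mul_eq_one (Loc.mk (1 : P.R 1) s : Loc S (P.R 1)) ?_
  refine (P.loc_actR_mk s.1 1 (1 : P.R 1) s).trans ?_
  rw [one_mul]
  have := Loc.mk_act (1 : P.R 1) 1 s
  rwa [mul_one] at this

/-- The row vector of the linear combinations of row vectors. -/
def lcR {k n : ℕ} (b : P.R k) (d : P.C k) (x : Fin k → P.R n) : P.R n :=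
  P.actR (((Equiv.sigmaEquivProd _ _).trans (Equiv.prodComm _ _)).trans finProdFinEquiv :
    Split (fun _ : Fin n => k) (k * n))
    (P.compR ((Equiv.sigmaEquivProd _ _).trans finProdFinEquiv : Split (fun _ : Fin k => n) (k * n))
      b x) (fun _ => d)

/-- The column vector of the linear combinations of column vectors. -/
def lcC {k n : ℕ} (b : P.R k) (d : P.C k) (x : Fin k → P.C n) : P.C n :=
  P.actC (((Equiv.sigmaEquivProd _ _).trans (Equiv.prodComm _ _)).trans finProdFinEquiv :
    Split (fun _ : Fin n => k) (k * n)) (fun _ => b)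
    (P.compC ((Equiv.sigmaEquivProd _ _).trans finProdFinEquiv : Split (fun _ : Fin k => n) (k * n))
      x d)

/-- Associativity gathers the scalars into the row `b ∘ (⊕ sᵢ)`. The interchange law for the row `x`
and the column `d` then contracts with `d` before composing with `x`. -/
lemma act_lcR {k n : ℕ} (b : P.R k) (d : P.C k) (s : Fin k → P.R 1) (x : P.R n) :
    P.lcR b d (fun i => MAct.act (s i) x) = MAct.act (P.contr b s d) x := by
  have h := P.compR_compR (g := Split.ones k)
    (e := ((Equiv.sigmaEquivProd _ _).trans finProdFinEquiv : Split (fun _ : Fin k => n) (k * n)))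
    (f := fun _ => Split.single n)
    (e' := ((Equiv.sigmaEquivProd _ _).trans finProdFinEquiv : Split (fun _ : Fin k => n) (k * n)))
    (fun _ _ _ => rfl) b s (fun _ => x)
  have h' := P.comm_row (l := 1) (m := fun _ => k) (n := fun _ => n) (e := Split.single k)
    (e₂ := Split.single n)
    (e₃ := ((Equiv.sigmaEquivProd _ _).trans finProdFinEquiv : Split (fun _ : Fin k => n) (k * n)))
    (e₄ := (((Equiv.sigmaEquivProd _ _).trans (Equiv.prodComm _ _)).trans finProdFinEquiv :
      Split (fun _ : Fin n => k) (k * n))) (fun _ _ _ => rfl) (P.compR (Split.ones k) b s)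
    (fun _ => d) (fun _ => x)
  exact (congrArg (fun z => P.actR _ z _) h.symm).trans h'.symm

/-- Dual to `act_lcR`, with the scalars gathered into the column `(⊕ sᵢ) ∘ d`. -/
lemma act_lcC {k n : ℕ} (b : P.R k) (d : P.C k) (s : Fin k → P.R 1) (x : P.C n) :
    P.lcC b d (fun i => MAct.act (s i) x) = MAct.act (P.contr b s d) x := by
  have h := P.compC_compC (g := Split.ones k)
    (e := ((Equiv.sigmaEquivProd _ _).trans finProdFinEquiv : Split (fun _ : Fin k => n) (k * n)))
    (f := fun _ => Split.single n)
    (e' := ((Equiv.sigmaEquivProd _ _).trans finProdFinEquiv : Split (fun _ : Fin k => n) (k * n)))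
    (fun _ _ _ => rfl) d (fun i => P.toC (s i)) (fun _ => x)
  simp only [P.central_col, P.compC_toC] at h
  have h' := P.comm_col (l := 1) (m := fun _ => n) (n := fun _ => k) (e := Split.single n)
    (e₂ := Split.single k)
    (e₃ := (((Equiv.sigmaEquivProd _ _).trans (Equiv.prodComm _ _)).trans finProdFinEquiv :
      Split (fun _ : Fin n => k) (k * n)))
    (e₄ := ((Equiv.sigmaEquivProd _ _).trans finProdFinEquiv : Split (fun _ : Fin k => n) (k * n)))
    (fun _ _ _ => rfl) (P.actC (Split.ones k) s d) (fun _ => x) (fun _ => b)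
  refine (congrArg (fun z => P.actC _ _ z) h.symm).trans (h'.symm.trans ?_)
  rw [actC_def, ← P.central_col]
  refine congrArg _ ?_
  -- The contraction was defined through rows; this identifies the same scalar computed through
  -- columns with its image in `P⁺(1)`.
  have h1 := P.actC_compC' (g := Split.single 1) (e := Split.single k) (f := fun _ => Split.single k)
    (e' := Split.single k) (fun _ _ _ => rfl) P.oneC (fun _ => d)
    (fun _ => P.compR (Split.ones k) b s)
  rw [P.one_compC] at h1
  refine Eq.trans ?_ h1
  exact P.actC_actC (g := Split.single k) (e := Split.ones k) (f := fun _ => Split.ones k)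
    (e' := Split.single k) (fun _ _ _ => rfl) d s (fun _ => b)

end CBio

instance : Geo (𝟭 CBio.{u}) where
  act {A k} := match k with
    | .inl n => fun s x => (MAct.act (M := A.R 1) (X := A.R n) s x : A.R n)
    | .inr n => fun s x => (MAct.act (M := A.R 1) (X := A.C n) s x : A.C n)
  one_act {A k} := match k with
    | .inl n => fun x => MAct.one_act (M := A.R 1) (X := A.R n) x
    | .inr n => fun x => MAct.one_act (M := A.R 1) (X := A.C n) x
  mul_act {A k} := match k with
    | .inl n => fun s t x => MAct.mul_act (M := A.R 1) (X := A.R n) s t x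
    | .inr n => fun s t x => MAct.mul_act (M := A.R 1) (X := A.C n) s t x
  ap_act f k := match k with
    | .inl _ => fun s x => CBio.onR_act f s x
    | .inr _ => fun s x => CBio.onC_act f s x
  op_act
    | .oneR => ⟨0, fun A s x => by
        rw [pow_zero]; exact (MAct.one_act (M := A.R 1) (X := A.R 1) A.oneR).symm⟩
    | .oneC => ⟨0, fun A s x => by
        rw [pow_zero]; exact (MAct.one_act (M := A.R 1) (X := A.C 1) A.oneC).symm⟩
    | .zeroR => ⟨0, fun A s x => (A.uniqueR.uniq _).symm⟩
    | .zeroC => ⟨0, fun A s x => (A.uniqueC.uniq _).symm⟩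
    | .compR (m := m) k e => ⟨2, fun A s x => by
        rw [pow_two]
        exact (A.act_compR e s (x none) _).trans ((congrArg _ (A.compR_act e s (x none) _)).trans
          (MAct.mul_act (M := A.R 1) (X := A.R m) _ _ _).symm)⟩
    | .compC (m := m) k e => ⟨2, fun A s x => by
        rw [pow_two]
        exact (A.act_compC e s _ _).trans ((congrArg _ (A.compC_act e s _ (x none))).trans
          (MAct.mul_act (M := A.R 1) (X := A.C m) _ _ _).symm)⟩
    | .actR (n := m) k e => ⟨2, fun A s x => by
        rw [pow_two]
        exact (A.act_actR e s (x none) _).trans ((congrArg _ (A.actR_act e s (x none) _)).trans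
          (MAct.mul_act (M := A.R 1) (X := A.R m) _ _ _).symm)⟩
    | .actC (n := m) k e => ⟨2, fun A s x => by
        rw [pow_two]
        exact (A.act_actC e s _ _).trans ((congrArg _ (A.actC_act e s _ (x none))).trans
          (MAct.mul_act (M := A.R 1) (X := A.C m) _ _ _).symm)⟩
  row := .inl
  col := .inr
  rowE _ _ := Equiv.refl _
  colE _ _ := Equiv.refl _
  rowE_ap _ _ _ _ _ := rfl
  colE_ap _ _ _ _ _ := rfl
  rowE_act _ _ _ _ := rfl
  colE_act _ _ _ _ := rfl
  lc {A k n} := match k with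
    | .inl m => fun b d x => A.lcR (n := m) b d x
    | .inr m => fun b d x => A.lcC (n := m) b d x
  lc_act {A k n} := match k with
    | .inl m => fun b d s x => (congrArg (fun z => A.actR _ z _) (A.compR_act _ s b x)).trans
        (A.act_actR _ s _ _)
    | .inr m => fun b d s x => (congrArg (fun z => A.actC _ _ z) (A.act_compC _ s x d)).trans
        (A.actC_act _ s _ _)
  act_lc {A k n} := match k with
    | .inl m => fun b d s x => A.act_lcR b d s x
    | .inr m => fun b d s x => A.act_lcC b d s x
  loc A S := A.loc S
  locHom A S := A.locHom S
  isUnit_locHom A S s hs := A.isUnit_locHom ⟨s, hs⟩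
  locHom_surj A S := by
    change Submonoid (A.R 1) at S
    rintro (n | n) y
    · obtain ⟨x, s, rfl⟩ := Loc.exists_mk (show Loc S (A.R n) from y)
      refine ⟨s.1, s.2, x, (CBio.loc_actR_mk A s.1 1 x s).trans ?_⟩
      have := Loc.mk_act (M := A.R 1) (X := A.R n) (S := S) x 1 s
      rw [mul_one] at this
      rw [one_mul]
      exact this
    · obtain ⟨x, s, rfl⟩ := Loc.exists_mk (show Loc S (A.C n) from y)
      refine ⟨s.1, s.2, x, (CBio.loc_actC_mk A s.1 1 x s).trans ?_⟩
      have := Loc.mk_act (M := A.R 1) (X := A.C n) (S := S) x 1 s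
      rw [mul_one] at this
      rw [one_mul]
      exact this
  locHom_eq A S := by
    change Submonoid (A.R 1) at S
    have key : ∀ {X : Type u} [MAct (A.R 1) X] (x x' : X),
        (Loc.mk x 1 : Loc S X) = Loc.mk x' 1 → ∃ s ∈ S, MAct.act s x = MAct.act s x' := by
      intro X _ x x' h
      obtain ⟨w, hw, h⟩ := Loc.mk_eq.1 h
      refine ⟨w, hw, ?_⟩
      rwa [OneMemClass.coe_one, mul_one] at h
    rintro (n | n) x x' h
    · exact key (X := A.R n) x x' h
    · exact key (X := A.C n) x x' h

/-! ### Localization and linear combinations in props -/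

namespace CPrp
variable (P : CPrp.{u})

/-- The morphism to the localization. -/
def locHom (S : Submonoid (P.A 1 1)) : P ⟶ P.loc S :=
  { on := fun _ _ x => Loc.mk x 1
    map_one := fun _ => rfl
    map_comp := fun a b => ((locComp_mk a 1 b 1).trans (by rw [mul_one])).symm
    map_dsum := fun e f a => (locDsum_mk e f a 1).symm : Prp.Hom _ _ }

lemma loc_act_mk {S : Submonoid (P.A 1 1)} {n m : ℕ} (s : P.A 1 1) (t : S) (x : P.A n m) (v : S) :
    (MAct.act (M := (P.loc S).A 1 1) (X := (P.loc S).A n m) (Loc.mk s t) (Loc.mk x v)) =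
      (Loc.mk (MAct.act s x) (t * v) : Loc S (P.A n m)) :=
  (congrArg (fun z => locComp z _) (P.loc_scal S s t n)).trans (locComp_mk _ _ _ _)

/-- The product in the bio inserts a direct sum with a single summand, so the two monoid structures
agree by a law of props and not by definition. -/
lemma isUnit_iff_toCBio (s : P.A 1 1) : IsUnit (M := P.toCBio.R 1) s ↔ IsUnit s := by
  have h : ∀ t : P.A 1 1, HMul.hMul (α := P.toCBio.R 1) (β := P.toCBio.R 1) (γ := P.toCBio.R 1) s t
      = (1 : P.toCBio.R 1) ↔ s * t = 1 := fun t => by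
    rw [mul_toCBio]
    rfl
  refine ⟨fun hs => ?_, fun hs => ?_⟩
  · obtain ⟨t, ht⟩ := hs.exists_right_inv
    exact IsUnit.of_mul_eq_one t ((h t).1 ht)
  · obtain ⟨t, ht⟩ := hs.exists_right_inv
    exact IsUnit.of_mul_eq_one (M := P.toCBio.R 1) t ((h t).2 ht)

lemma isUnit_locHom {S : Submonoid (P.A 1 1)} (s : S) : IsUnit (homOne (P.locHom S) s) := by
  refine IsUnit.of_mul_eq_one (Loc.mk (1 : P.A 1 1) s : Loc S (P.A 1 1)) ?_
  have h : MAct.act (M := P.A 1 1) (X := P.A 1 1) s.1 1 = s.1 := by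
    rw [act_def, scal_one_eq]
    exact P.comp_one _
  refine (locComp_mk s.1 1 (1 : P.A 1 1) s).trans ?_
  have h' := Loc.mk_act (1 : P.A 1 1) 1 s
  rw [h, mul_one] at h'
  rw [one_mul]
  refine Eq.trans ?_ h'
  exact congrArg (fun z => Loc.mk z s) (P.comp_one _)

/-- The matrix of the linear combinations of matrices. -/
def lc {k n m : ℕ} (b : P.A 1 k) (d : P.A k 1) (x : Fin k → P.A n m) : P.A n m :=
  P.comp (P.dsum (Split.ones n) (((Equiv.sigmaEquivProd _ _).trans (Equiv.prodComm _ _)).trans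
      finProdFinEquiv : Split (fun _ : Fin n => k) (k * n)) (fun _ => b))
    (P.comp (P.dsum ((Equiv.sigmaEquivProd _ _).trans finProdFinEquiv :
      Split (fun _ : Fin k => n) (k * n)) ((Equiv.sigmaEquivProd _ _).trans finProdFinEquiv :
      Split (fun _ : Fin k => m) (k * m)) x)
    (P.dsum (((Equiv.sigmaEquivProd _ _).trans (Equiv.prodComm _ _)).trans
      finProdFinEquiv : Split (fun _ : Fin m => k) (k * m)) (Split.ones m) (fun _ => d)))

lemma lc_act {k n m : ℕ} (b : P.A 1 k) (d : P.A k 1) (s : P.A 1 1) (x : Fin k → P.A n m) :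
    P.lc b d (fun i => MAct.act s (x i)) = MAct.act s (P.lc b d x) := by
  unfold lc
  rw [P.dsum_act, P.act_comp, P.comp_act]

/-- Both sides are the same diagonal matrix of size `K`, grouped in two ways: `k` blocks that are
constant, or `n` copies of the diagonal matrix of the `s i`. -/
lemma dsum_diag {k n K : ℕ} (s : Fin k → P.A 1 1) (g : Split (fun _ : Fin k => n) K)
    (f : Split (fun _ : Fin n => k) K) (h : ∀ i j, f ⟨i, j⟩ = g ⟨j, i⟩) :
    P.dsum g g (fun i => P.scal (s i) n) =
      P.dsum f f (fun _ => P.dsum (Split.ones k) (Split.ones k) s) := by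
  have h1 := P.dsum_dsum (h := fun _ : Fin k => n) (g := g) (e := Split.ones K)
    (e₁ := fun _ => Split.ones n) (e' := g) (f := Split.ones K) (f₁ := fun _ => Split.ones n)
    (f' := g) (fun _ _ _ => rfl) (fun _ _ _ => rfl) (fun t => s (g.symm t).1)
  have h2 := P.dsum_dsum (h := fun _ : Fin n => k) (g := f) (e := Split.ones K)
    (e₁ := fun _ => Split.ones k) (e' := f) (f := Split.ones K) (f₁ := fun _ => Split.ones k)
    (f' := f) (fun _ _ _ => rfl) (fun _ _ _ => rfl) (fun t => s (g.symm t).1)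
  simp only [h, Equiv.symm_apply_apply] at h1 h2
  exact h1.trans h2.symm

/-- The scalars are moved from the copies of `x` to the row `b`, by regrouping a diagonal matrix.
What remains is the contraction axiom for the row `b ∘ diag(s)` and the column `d`. -/
lemma act_lc {k n m : ℕ} (b : P.A 1 k) (d : P.A k 1) (s : Fin k → P.A 1 1) (x : P.A n m) :
    P.lc b d (fun i => MAct.act (s i) x) =
      MAct.act (P.comp (P.comp b (P.dsum (Split.ones k) (Split.ones k) s)) d) x := by
  refine Eq.trans ?_ (P.contract (f := (((Equiv.sigmaEquivProd _ _).trans (Equiv.prodComm _ _)).trans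
      finProdFinEquiv : Split (fun _ : Fin n => k) (k * n)))
    (g := ((Equiv.sigmaEquivProd _ _).trans finProdFinEquiv : Split (fun _ : Fin k => n) (k * n)))
    (g' := ((Equiv.sigmaEquivProd _ _).trans finProdFinEquiv : Split (fun _ : Fin k => m) (k * m)))
    (f' := (((Equiv.sigmaEquivProd _ _).trans (Equiv.prodComm _ _)).trans
      finProdFinEquiv : Split (fun _ : Fin m => k) (k * m))) (fun _ _ => rfl) (fun _ _ => rfl)
      (P.comp b (P.dsum (Split.ones k) (Split.ones k) s)) x d)
  unfold lc
  simp only [act_def]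
  rw [← P.dsum_comp _ ((Equiv.sigmaEquivProd _ _).trans finProdFinEquiv :
    Split (fun _ : Fin k => n) (k * n)) _ (fun i => P.scal (s i) n) (fun _ => x),
    P.dsum_diag s _ (((Equiv.sigmaEquivProd _ _).trans (Equiv.prodComm _ _)).trans
      finProdFinEquiv : Split (fun _ : Fin n => k) (k * n)) (fun _ _ => rfl), P.comp_assoc,
    ← P.comp_assoc, P.dsum_comp]

variable {P} in
/-- A submonoid of the scalars of the underlying bio, as a submonoid of `A 1 1`. -/
def scalars (S : Submonoid (P.toCBio.R 1)) : Submonoid (P.A 1 1) where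
  carrier := {s : P.A 1 1 | Membership.mem (γ := Submonoid (P.toCBio.R 1)) S s}
  one_mem' := S.one_mem
  mul_mem' {s t} hs ht := Eq.mp (congrArg (fun z => z ∈ S) (P.mul_toCBio s t)) (S.mul_mem hs ht)

end CPrp

instance : Geo bioOfProp.{u} where
  act {A k} s x := MAct.act (M := A.A 1 1) (X := A.A k.1 k.2) s x
  one_act {A k} x := MAct.one_act (M := A.A 1 1) (X := A.A k.1 k.2) x
  mul_act {A k} s t x := (congrArg (fun r => MAct.act (M := A.A 1 1) (X := A.A k.1 k.2) r x)
    (CPrp.mul_toCBio A s t)).trans (MAct.mul_act (M := A.A 1 1) (X := A.A k.1 k.2) s t x)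
  ap_act f k s x := CPrp.on_act f s x
  op_act
    | .one n => ⟨0, fun A s x => by
        rw [pow_zero]; exact (MAct.one_act (M := A.A 1 1) (X := A.A n n) (A.one n)).symm⟩
    | .zeroLeft m => ⟨0, fun A s x => ((A.uniqueLeft m).uniq _).symm⟩
    | .zeroRight n => ⟨0, fun A s x => ((A.uniqueRight n).uniq _).symm⟩
    | .comp n k m => ⟨2, fun A s x => by
        rw [pow_two]
        refine (A.act_comp s (x false) _).trans ?_
        refine (congrArg _ (A.comp_act s (x false) (x true))).trans ?_
        exact ((congrArg (fun r => MAct.act (M := A.A 1 1) (X := A.A n m) r _)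
          (CPrp.mul_toCBio A s s)).trans
            (MAct.mul_act (M := A.A 1 1) (X := A.A n m) s s _)).symm⟩
    | .dsum k l e f => ⟨1, fun A s x => by
        rw [pow_one]
        exact A.dsum_act e f s x⟩
  row n := (1, n)
  col n := (n, 1)
  rowE _ _ := Equiv.refl _
  colE _ _ := Equiv.refl _
  rowE_ap _ _ _ _ _ := rfl
  colE_ap _ _ _ _ _ := rfl
  rowE_act n A s x := by
    refine (congrArg (fun z => A.comp z x) (A.scal_one_eq s)).trans ?_
    refine congrArg (fun z => A.comp s z) ?_
    have := A.dsum_single (n := 1) (m := n) x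
    nth_rw 1 [CBio.single_one] at this
    exact this.symm
  colE_act n A s x := rfl
  lc {A k n} b d x := A.lc b d x
  lc_act {A k n} b d s x := A.lc_act b d s x
  act_lc {A k n} b d s x := by
    refine (A.act_lc b d s x).trans ?_
    have := A.dsum_single (show A.A n 1 from d)
    rw [CBio.single_one] at this
    exact congrArg (fun z => MAct.act (M := A.A 1 1) (X := A.A k.1 k.2)
      (A.comp (A.comp b (A.dsum (Split.ones n) (Split.ones n) s)) z) x) this.symm
  loc A S := A.loc (CPrp.scalars S)
  locHom A S := A.locHom (CPrp.scalars S)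
  isUnit_locHom A S s hs :=
    (CPrp.isUnit_iff_toCBio _ _).2 (A.isUnit_locHom (S := CPrp.scalars S) ⟨s, hs⟩)
  locHom_surj A S := by
    rintro ⟨n, m⟩ y
    obtain ⟨x, s, rfl⟩ := Loc.exists_mk (show Loc (CPrp.scalars S) (A.A n m) from y)
    refine ⟨s.1, s.2, x, (CPrp.loc_act_mk A s.1 1 x s).trans ?_⟩
    have := Loc.mk_act (M := A.A 1 1) (X := A.A n m) (S := CPrp.scalars S) x 1 s
    rw [mul_one] at this
    rw [one_mul]
    exact this
  locHom_eq A S := by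
    rintro ⟨n, m⟩ x x' h
    change A.A n m at x x'
    obtain ⟨w, hw, h⟩ := Loc.mk_eq.1
      (show (Loc.mk x 1 : Loc (CPrp.scalars S) (A.A n m)) = Loc.mk x' 1 from h)
    refine ⟨w, hw, ?_⟩
    rw [OneMemClass.coe_one, mul_one] at h
    exact h

/-! ### Germs -/

section Sections
variable {C : Type (u + 1)} [Category.{u} C]

/-- Spaces with a presheaf. -/
abbrev PSp (C : Type (u + 1)) [Category.{u} C] := PresheafedSpace.{u, u + 1, u} C

/-- The sections of `X` over `V`. -/
abbrev Sect (X : PSp C) (V : Opens X) : C := X.presheaf.obj (op V)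

/-- Restriction of sections. -/
def rs (X : PSp C) {V W : Opens X} (h : W ≤ V) : Sect X V ⟶ Sect X W :=
  X.presheaf.map (homOfLE h).op

/-- The preimage of an open set. -/
def pre {X Y : PSp C} (f : X ⟶ Y) (V : Opens Y) : Opens X :=
  (Opens.map f.base).obj V

lemma mem_pre {X Y : PSp C} {f : X ⟶ Y} {V : Opens Y} {x : X} :
    x ∈ pre f V ↔ f.base x ∈ V := Iff.rfl

lemma pre_mono {X Y : PSp C} (f : X ⟶ Y) {V W : Opens Y} (h : W ≤ V) :
    pre f W ≤ pre f V := fun _ hx => h hx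

/-- Pull-back of sections. -/
def pb {X Y : PSp C} (f : X ⟶ Y) (V : Opens Y) : Sect Y V ⟶ Sect X (pre f V) :=
  f.c.app (op V)

@[simp]
lemma rs_self (X : PSp C) {V : Opens X} (h : V ≤ V) : rs X h = 𝟙 _ :=
  X.presheaf.map_id _

@[simp]
lemma rs_rs (X : PSp C) {V W T : Opens X} (h : W ≤ V) (h' : T ≤ W) :
    rs X h ≫ rs X h' = rs X (h'.trans h) :=
  (X.presheaf.map_comp _ _).symm

lemma rs_pb {X Y : PSp C} (f : X ⟶ Y) {V W : Opens Y} (h : W ≤ V) :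
    rs Y h ≫ pb f W = pb f V ≫ rs X (pre_mono f h) :=
  f.c.naturality (homOfLE h).op

lemma pb_id {X : PSp C} (V : Opens X) : pb (𝟙 X) V = 𝟙 _ := rfl

end Sections

section Germs
variable {C : Type (u + 1)} [Category.{u} C] [AlgCat C]

/-- Stalks of `X`, described by germs of sections. -/
structure Germs (X : PSp C) where
  L : X → C
  ev : ∀ (V : Opens X) (x : X), x ∈ V → (Sect X V ⟶ L x)
  rs_ev : ∀ {V W : Opens X} (h : W ≤ V) (x : X) (hx : x ∈ W), rs X h ≫ ev W x hx = ev V x (h hx)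
  surj : ∀ {x : X} {k : (AlgCat.S C).K} (y : El k (L x)), ∃ V hx a, ap (ev V x hx) a = y
  near : ∀ {V : Opens X} {x : X} {hx : x ∈ V} {k : (AlgCat.S C).K} {a b : El k (Sect X V)},
    ap (ev V x hx) a = ap (ev V x hx) b → ∃ (W : Opens X) (h : W ≤ V), x ∈ W ∧
      ap (rs X h) a = ap (rs X h) b

namespace Germs

section
variable {X : PSp C} (G : Germs X)

lemma ev_rs {V W : Opens X} (h : W ≤ V) {x : X} (hx : x ∈ W) {k : (AlgCat.S C).K}
    (a : El k (Sect X V)) : ap (G.ev W x hx) (ap (rs X h) a) = ap (G.ev V x (h hx)) a := by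
  rw [← ap_comp, G.rs_ev]

/-- The cocone of germs. -/
def cocone (x : X) : Cocone (stalkDiagram X x) where
  pt := G.L x
  ι :=
    { app := fun V => G.ev V.unop.1 x V.unop.2
      naturality := fun V W i =>
        (G.rs_ev (leOfHom i.unop) x W.unop.2).trans (Category.comp_id _).symm }

lemma nonempty_isColimit (x : X) : Nonempty (IsColimit (G.cocone x)) := by
  refine isColimit_of_elements (D := stalkDiagram X x) _ (fun k y => ?_) (fun k j a b h => ?_)
  · obtain ⟨V, hx, a, rfl⟩ := G.surj y
    exact ⟨op ⟨V, hx⟩, a, rfl⟩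
  · obtain ⟨W, hW, hx, h⟩ := G.near h
    exact ⟨op ⟨W, hx⟩, Quiver.Hom.op (homOfLE hW), h⟩

/-- The stalks are colimits. -/
def isColimit (x : X) : IsColimit (G.cocone x) := (G.nonempty_isColimit x).some

lemma exists_desc (x : X) (D : C) (m : ∀ V : Opens X, x ∈ V → (Sect X V ⟶ D))
    (hm : ∀ {V W : Opens X} (h : W ≤ V) (hx : x ∈ W), rs X h ≫ m W hx = m V (h hx)) :
    ∃ g : G.L x ⟶ D, ∀ V hx, G.ev V x hx ≫ g = m V hx := by
  let c : Cocone (stalkDiagram X x) := ⟨D,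
    { app := fun V => m V.unop.1 V.unop.2
      naturality := fun V W i =>
        (hm (leOfHom i.unop) W.unop.2).trans (Category.comp_id _).symm }⟩
  exact ⟨(G.isColimit x).desc c, fun V hx => (G.isColimit x).fac c (op ⟨V, hx⟩)⟩

lemma hom_ext {x : X} {D : C} {f g : G.L x ⟶ D} (h : ∀ V hx, G.ev V x hx ≫ f = G.ev V x hx ≫ g) :
    f = g :=
  (G.isColimit x).hom_ext fun V => h V.unop.1 V.unop.2

end

/-- The stalks given by colimits. -/
def ofColimits {X : PSp C} (c : ∀ x, Cocone (stalkDiagram X x))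
    (hc : ∀ x, IsColimit (c x)) : Germs X where
  L x := (c x).pt
  ev V x hx := (c x).ι.app (op ⟨V, hx⟩)
  rs_ev {V W} h x hx := (c x).w (Quiver.Hom.op (X := (⟨W, hx⟩ : OpenNhds x)) (Y := ⟨V, h hx⟩) (homOfLE (show (⟨W, hx⟩ : OpenNhds x) ≤ ⟨V, h hx⟩ from h)))
  surj {x k} y := by
    obtain ⟨j, a, h⟩ := filtered_surj (hc x) y
    exact ⟨j.unop.1, j.unop.2, a, h⟩
  near {V x hx k a b} h := by
    obtain ⟨l, f, h⟩ := filtered_inj (hc x) (j := op ⟨V, hx⟩) h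
    exact ⟨l.unop.1, leOfHom f.unop, l.unop.2, h⟩

/-- The canonical stalks. -/
def canonical (X : PSp C) : Germs X :=
  ofColimits (fun x => colimit.cocone (stalkDiagram X x)) (fun x => colimit.isColimit _)

section
variable {X Y : PSp C} (G : Germs X) (H : Germs Y) (f : X ⟶ Y)

lemma exists_smap (x : X) : ∃ g : H.L (f.base x) ⟶ G.L x,
    ∀ V hx, H.ev V (f.base x) hx ≫ g = pb f V ≫ G.ev _ x (mem_pre.2 hx) :=
  H.exists_desc _ _ (fun V hx => pb f V ≫ G.ev _ x (mem_pre.2 hx)) fun h hx => by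
    rw [← Category.assoc, rs_pb, Category.assoc, G.rs_ev _ _ (mem_pre.2 hx)]

/-- The map on stalks. -/
def smap (x : X) : H.L (f.base x) ⟶ G.L x := (G.exists_smap H f x).choose

lemma ev_smap (V : Opens Y) (x : X) (hx : f.base x ∈ V) :
    H.ev V (f.base x) hx ≫ G.smap H f x = pb f V ≫ G.ev _ x (mem_pre.2 hx) :=
  (G.exists_smap H f x).choose_spec V hx

lemma ap_ev_smap {V : Opens Y} {x : X} (hx : f.base x ∈ V) {k : (AlgCat.S C).K}
    (a : El k (Sect Y V)) : ap (G.smap H f x) (ap (H.ev V (f.base x) hx) a) =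
      ap (G.ev (pre f V) x (mem_pre.2 hx)) (ap (pb f V) a) := by
  rw [← ap_comp, ev_smap, ap_comp]

end

section Units
variable {U : C ⥤ CBio.{u}} [Geo U]
variable {X Y : PSp C} (G : Germs X) (H : Germs Y)

lemma ev_rs_sc {V W : Opens X} (h : W ≤ V) {x : X} (hx : x ∈ W) (s : (U.obj (Sect X V)).R 1) :
    sc U (G.ev W x hx) (sc U (rs X h) s) = sc U (G.ev V x (h hx)) s := by
  rw [← sc_comp, G.rs_ev]

variable (U) in
lemma surj_sc {x : X} (y : (U.obj (G.L x)).R 1) : ∃ V hx a, sc U (G.ev V x hx) a = y := by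
  obtain ⟨V, hx, a, h⟩ := G.surj (toEl U y)
  refine ⟨V, hx, (toEl U).symm a, ?_⟩
  rw [← ap_toEl_symm, h, Equiv.symm_apply_apply]

lemma near_sc {V : Opens X} {x : X} {hx : x ∈ V} {a b : (U.obj (Sect X V)).R 1}
    (h : sc U (G.ev V x hx) a = sc U (G.ev V x hx) b) : ∃ (W : Opens X) (h : W ≤ V), x ∈ W ∧
      sc U (rs X h) a = sc U (rs X h) b := by
  obtain ⟨W, hW, hx, h⟩ := G.near (a := toEl U a) (b := toEl U b) (by rw [ap_toEl, ap_toEl, h])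
  refine ⟨W, hW, hx, (toEl U).injective ?_⟩
  rw [← ap_toEl, h, ap_toEl]

/-- A section with invertible germ is invertible near the point. -/
lemma isUnit_near {V : Opens X} {x : X} {hx : x ∈ V} {s : (U.obj (Sect X V)).R 1}
    (h : IsUnit (sc U (G.ev V x hx) s)) :
    ∃ (W : Opens X) (h : W ≤ V), x ∈ W ∧ IsUnit (sc U (rs X h) s) := by
  obtain ⟨y, hy⟩ := h.exists_right_inv
  obtain ⟨T, hT, t, rfl⟩ := G.surj_sc U y
  have : sc U (G.ev (V ⊓ T) x (Opens.mem_inf.2 ⟨hx, hT⟩)) (sc U (rs X inf_le_left) s * sc U (rs X inf_le_right) t) =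
      sc U (G.ev (V ⊓ T) x (Opens.mem_inf.2 ⟨hx, hT⟩)) 1 := by
    rw [map_mul, ev_rs_sc, ev_rs_sc, hy, map_one]
  obtain ⟨W, hW, hxW, h⟩ := G.near_sc this
  refine ⟨W, hW.trans inf_le_left, hxW, ?_⟩
  rw [map_mul, map_one, ← sc_comp, rs_rs] at h
  exact IsUnit.of_mul_eq_one _ h

lemma isUnit_ev_iff {V : Opens X} {x : X} {hx : x ∈ V} {s : (U.obj (Sect X V)).R 1} :
    IsUnit (sc U (G.ev V x hx) s) ↔
      ∃ (W : Opens X) (h : W ≤ V), x ∈ W ∧ IsUnit (sc U (rs X h) s) := by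
  refine ⟨G.isUnit_near, ?_⟩
  rintro ⟨W, hW, hx, h⟩
  rw [← G.ev_rs_sc hW hx]
  exact h.map _

lemma isUnit_ev_of_le {V W : Opens X} {h : W ≤ V} {x : X} (hx : x ∈ W)
    {s : (U.obj (Sect X V)).R 1} (hs : IsUnit (sc U (rs X h) s)) :
    IsUnit (sc U (G.ev V x (h hx)) s) :=
  G.isUnit_ev_iff.2 ⟨W, h, hx, hs⟩

lemma sc_ev_smap (f : X ⟶ Y) {V : Opens Y} {x : X} (hx : f.base x ∈ V)
    (s : (U.obj (Sect Y V)).R 1) : sc U (G.smap H f x) (sc U (H.ev V (f.base x) hx) s) =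
      sc U (G.ev (pre f V) x (mem_pre.2 hx)) (sc U (pb f V) s) := by
  rw [← sc_comp, ev_smap, sc_comp]

variable (U) in
/-- The morphism `f` is local: it reflects invertibility of germs. -/
def IsLocalHom (f : X ⟶ Y) : Prop :=
  ∀ (x : X) (V : Opens Y) (hx : f.base x ∈ V) (s : (U.obj (Sect Y V)).R 1),
    IsUnit (sc U (G.ev (pre f V) x (mem_pre.2 hx)) (sc U (pb f V) s)) →
      IsUnit (sc U (H.ev V (f.base x) hx) s)

lemma isLocalHom_iff (f : X ⟶ Y) : G.IsLocalHom U H f ↔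
    ∀ x (y : (U.obj (H.L (f.base x))).R 1), IsUnit (sc U (G.smap H f x) y) → IsUnit y := by
  constructor
  · intro h x y hy
    obtain ⟨V, hx, a, rfl⟩ := H.surj_sc U y
    rw [sc_ev_smap] at hy
    exact h x V hx a hy
  · intro h x V hx s hs
    rw [← G.sc_ev_smap H] at hs
    exact h x _ hs
    exact hx

end Units

section Sheaf
variable {X : PSp C} (G : Germs X)

/-- Sections are determined by their germs, and families of elements of the stalks that are locally
given by sections are given by sections. -/
structure IsSheaf : Prop where
  sep : ∀ {V : Opens X} {k : (AlgCat.S C).K} {a b : El k (Sect X V)},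
    (∀ x hx, ap (G.ev V x hx) a = ap (G.ev V x hx) b) → a = b
  glue : ∀ {V : Opens X} {k : (AlgCat.S C).K} (s : ∀ x, x ∈ V → El k (G.L x)),
    (∀ x, x ∈ V → ∃ (W : Opens X) (h : W ≤ V), x ∈ W ∧ ∃ a : El k (Sect X W), ∀ y hy,
      ap (G.ev W y hy) a = s y (h hy)) → ∃ a : El k (Sect X V), ∀ x hx, ap (G.ev V x hx) a = s x hx

/-- The functor of elements of a given sort preserves limits, so these elements form a sheaf of
sets, and sections can be glued along a cover indexed by the points of `V`. -/
lemma exists_rs_eq (h : TopCat.Presheaf.IsSheaf X.presheaf) (k : (AlgCat.S C).K) {V : Opens X}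
    (W : V → Opens X) (hW : ∀ x, W x ≤ V) (hx : ∀ x, x.1 ∈ W x) (a : ∀ x, El k (Sect X (W x)))
    (hc : ∀ x y, ap (rs X inf_le_left : Sect X (W x) ⟶ Sect X (W x ⊓ W y)) (a x) =
      ap (rs X inf_le_right) (a y)) :
    (∃ b : El k (Sect X V), ∀ x, ap (rs X (hW x)) b = a x) ∧
      ∀ b c : El k (Sect X V), (∀ x, ap (rs X (hW x)) b = ap (rs X (hW x)) c) → b = c := by
  have hs : TopCat.Presheaf.IsSheaf (X.presheaf ⋙ elFunctor k) :=
    CategoryTheory.Presheaf.isSheaf_comp_of_isSheaf _ _ _ h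
  have e : iSup W = V := le_antisymm (iSup_le hW) fun x hxV =>
    Opens.mem_iSup.2 ⟨⟨x, hxV⟩, hx ⟨x, hxV⟩⟩
  have hle : ∀ x, W x ≤ iSup W := fun x => le_iSup W x
  have key := TopCat.Presheaf.IsSheaf.isSheafUniqueGluing_types hs (U := W)
  constructor
  · obtain ⟨s, h1, -⟩ := key a hc
    change El k (Sect X (iSup W)) at s
    change ∀ x, ap (rs X (hle x)) s = a x at h1
    refine ⟨ap (rs X e.ge) s, fun x => ?_⟩
    rw [← ap_comp, rs_rs, h1]
  · intro b c hbc
    obtain ⟨s, -, h2⟩ := key (fun x => ap (rs X (hW x)) c) (fun x y => by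
      change ap (rs X inf_le_left) (ap (rs X (hW x)) c) =
        ap (rs X inf_le_right) (ap (rs X (hW y)) c)
      rw [← ap_comp, ← ap_comp, rs_rs, rs_rs])
    have hb := h2 (ap (rs X e.le) b) (fun x => by
      change ap (rs X (hle x)) (ap (rs X e.le) b) = ap (rs X (hW x)) c
      rw [← ap_comp, rs_rs, hbc])
    have hc := h2 (ap (rs X e.le) c) (fun x => by
      change ap (rs X (hle x)) (ap (rs X e.le) c) = ap (rs X (hW x)) c
      rw [← ap_comp, rs_rs])
    have := congrArg (ap (rs X e.ge)) (hb.trans hc.symm)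
    rwa [← ap_comp, ← ap_comp, rs_rs, rs_self, ap_id, ap_id] at this

lemma isSheaf_of_isSheaf (h : TopCat.Presheaf.IsSheaf X.presheaf) : G.IsSheaf where
  sep {V k a b} hab := by
    choose W hW hx h' using fun x : V => G.near (hab x.1 x.2)
    refine (exists_rs_eq h k W hW hx (fun x => ap (rs X (hW x)) a) fun x y => ?_).2 a b h'
    rw [← ap_comp, ← ap_comp, rs_rs, rs_rs]
  glue {V k} s hs := by
    choose W hW hx a ha using fun x : V => hs x.1 x.2
    have sep : ∀ {V : Opens X} {a b : El k (Sect X V)},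
        (∀ x hx, ap (G.ev V x hx) a = ap (G.ev V x hx) b) → a = b := fun {V a b} hab => by
      choose W hW hx h' using fun x : V => G.near (hab x.1 x.2)
      refine (exists_rs_eq h k W hW hx (fun x => ap (rs X (hW x)) a) fun x y => ?_).2 a b h'
      rw [← ap_comp, ← ap_comp, rs_rs, rs_rs]
    obtain ⟨b, hb⟩ := (exists_rs_eq h k W hW hx a fun x y => sep fun z hz => by
      rw [ev_rs, ev_rs, ha, ha]).1
    refine ⟨b, fun x hxV => ?_⟩
    rw [← ha ⟨x, hxV⟩ x (hx _), ← hb, ev_rs]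

namespace IsSheaf
variable {G} (hG : G.IsSheaf)
include hG

lemma hom_ext {A : C} {V : Opens X} {f g : A ⟶ Sect X V}
    (h : ∀ x hx, f ≫ G.ev V x hx = g ≫ G.ev V x hx) : f = g :=
  hom_ext_ap fun k a => hG.sep fun x hx => by rw [← ap_comp, h, ap_comp]

/-- The sections over `V` are the subobject of the product of the stalks that consists of the
families locally given by sections. A family of morphisms with values of this kind factors through
it. -/
lemma exists_lift {A : C} {V : Opens X} (f : ∀ x, x ∈ V → (A ⟶ G.L x))
    (h : ∀ k (a : El k A) x, x ∈ V → ∃ (W : Opens X) (h : W ≤ V), x ∈ W ∧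
      ∃ b : El k (Sect X W), ∀ y hy, ap (G.ev W y hy) b = ap (f y (h hy)) a) :
    ∃ g : A ⟶ Sect X V, ∀ x hx, g ≫ G.ev V x hx = f x hx := by
  obtain ⟨P, p, hp, -, hl⟩ := exists_product (fun x : V => G.L x.1)
  obtain ⟨i, hi⟩ := hl (Sect X V) (fun x => G.ev V x.1 x.2)
  obtain ⟨j, hj⟩ := hl A (fun x => f x.1 x.2)
  obtain ⟨g, hg⟩ := exists_factor i (fun k a b hab => hG.sep fun x hx => by
    rw [← hi ⟨x, hx⟩, ap_comp, ap_comp, hab]) j fun k a => by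
    obtain ⟨b, hb⟩ := hG.glue (fun x hx => ap (f x hx) a) (h k a)
    refine ⟨b, hp _ _ _ fun x => ?_⟩
    rw [← ap_comp, ← ap_comp, hi, hj, hb]
  refine ⟨g, fun x hx => ?_⟩
  rw [← hi ⟨x, hx⟩, ← Category.assoc, hg, hj]

/-- The sheaf condition is tested on morphisms from an arbitrary object. A compatible family of them
determines a morphism to each stalk, through any member of the cover that contains the point, and
these morphisms lift to sections. -/
lemma isSheaf : TopCat.Presheaf.IsSheaf X.presheaf := by
  intro A
  refine (TopCat.Presheaf.isSheaf_iff_isSheafUniqueGluing_types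
    (X.presheaf ⋙ coyoneda.obj (op A))).2 ?_ |> fun h => (isSheaf_iff_isSheaf_of_type _ _).1 h
  intro ι W f hf
  change ∀ i, A ⟶ Sect X (W i) at f
  have hle : ∀ i, W i ≤ iSup W := fun i => le_iSup W i
  change ∀ i j, f i ≫ rs X (inf_le_left : W i ⊓ W j ≤ _) = f j ≫ rs X inf_le_right at hf
  have hx : ∀ x : X, x ∈ iSup W → ∃ i, x ∈ W i := fun x h => Opens.mem_iSup.1 h
  choose i hi using hx
  have key : ∀ x (hx : x ∈ iSup W) j (hj : x ∈ W j),
      f (i x hx) ≫ G.ev _ x (hi x hx) = f j ≫ G.ev _ x hj := by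
    intro x hx j hj
    rw [← G.rs_ev inf_le_left x (Opens.mem_inf.2 ⟨hi x hx, hj⟩), ← Category.assoc, hf,
      Category.assoc, G.rs_ev]
  obtain ⟨g, hg⟩ := hG.exists_lift (A := A) (V := iSup W) (fun x hx => f (i x hx) ≫ G.ev _ x (hi x hx))
    fun k a x hx => ⟨W (i x hx), hle _, hi x hx, ap (f (i x hx)) a, fun y hy => by
      rw [key _ _ (i x hx) hy, ap_comp]⟩
  refine ⟨g, fun j => hG.hom_ext fun x hx => ?_, fun g' hg' => hG.hom_ext fun x hx => ?_⟩
  · change (g ≫ rs X (hle j)) ≫ G.ev _ x hx = _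
    rw [Category.assoc, G.rs_ev, hg, key _ _ j hx]
  · change ∀ j, g' ≫ rs X (hle j) = f j at hg'
    rw [hg, ← hg' (i x hx), Category.assoc, G.rs_ev]

end IsSheaf

end Sheaf
end Germs
end Germs

/-! ### Locally bio-ed spaces and germs -/

lemma CBio.IsLocal.of_iso {P Q : CBio.{u}} (hP : P.IsLocal) (φ : P ≅ Q) : Q.IsLocal := by
  have inv : ∀ s, homOne φ.hom (homOne φ.inv s) = s := fun s => by
    rw [← homOne_comp, φ.inv_hom_id]
    rfl
  refine isLocal_iff.2 fun n b a d h hu => isLocal_iff.1 hP n (Bio.Hom.onR φ.inv n b)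
    (fun i => homOne φ.inv (a i)) (Bio.Hom.onC φ.inv n d) (fun i hi => h i ?_) ?_
  · rw [← inv (a i)]
    exact hi.map _
  · rw [← homOne_contr]
    exact hu.map _

section
variable {C : Type (u + 1)} [Category.{u} C] [AlgCat C]

lemma ap_pb_rs {X Y : PSp C} (f : X ⟶ Y) {V W : Opens Y} (h : W ≤ V) {k : (AlgCat.S C).K}
    (a : El k (Sect Y V)) : ap (pb f W) (ap (rs Y h) a) = ap (rs X (pre_mono f h)) (ap (pb f V) a) := by
  rw [← ap_comp, rs_pb, ap_comp]

omit [AlgCat C] in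
lemma sc_pb_rs {U : C ⥤ CBio.{u}} {X Y : PSp C} (f : X ⟶ Y) {V W : Opens Y} (h : W ≤ V)
    (s : (U.obj (Sect Y V)).R 1) :
    sc U (pb f W) (sc U (rs Y h) s) = sc U (rs X (pre_mono f h)) (sc U (pb f V) s) := by
  rw [← sc_comp, rs_pb, sc_comp]

lemma ap_pb_comp {X Y Z : PSp C} (f : X ⟶ Y) (g : Y ⟶ Z) {V : Opens Z} {k : (AlgCat.S C).K}
    (a : El k (Sect Z V)) :
    ap (B := Sect X (pre f (pre g V))) (pb (f ≫ g) V) a = ap (pb f (pre g V)) (ap (pb g V) a) :=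
  ap_comp (pb g V) (pb f (pre g V)) a

omit [AlgCat C] in
lemma sc_pb_comp {U : C ⥤ CBio.{u}} {X Y Z : PSp C} (f : X ⟶ Y) (g : Y ⟶ Z) {V : Opens Z}
    (s : (U.obj (Sect Z V)).R 1) :
    sc U (B := Sect X (pre f (pre g V))) (pb (f ≫ g) V) s =
      sc U (pb f (pre g V)) (sc U (pb g V) s) :=
  sc_comp (pb g V) (pb f (pre g V)) s

namespace Germs
variable {X Y : PSp C} (G : Germs X) (H : Germs Y)

/-- The definition of local morphisms quantifies over all colimit cocones; this reduces it to one
convenient choice of stalks. -/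
lemma exists_iso_stalkMap (f : X ⟶ Y) (x : X) {c : Cocone (stalkDiagram Y (f.base x))} (hc : IsColimit c)
    {d : Cocone (stalkDiagram X x)} (hd : IsColimit d) :
    ∃ (e : c.pt ≅ H.L (f.base x)) (e' : d.pt ≅ G.L x),
      stalkMap f x hc d ≫ e'.hom = e.hom ≫ G.smap H f x := by
  refine ⟨hc.coconePointUniqueUpToIso (H.isColimit _), hd.coconePointUniqueUpToIso (G.isColimit x),
    hc.hom_ext fun V => ?_⟩
  have h1 : c.ι.app V ≫ stalkMap f x hc d =
      f.c.app (op V.unop.1) ≫ d.ι.app (op ((OpenNhds.map f.base x).obj V.unop)) := hc.fac _ V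
  have h2 := hd.comp_coconePointUniqueUpToIso_hom (G.isColimit x)
    (op ((OpenNhds.map f.base x).obj V.unop))
  have h3 := hc.comp_coconePointUniqueUpToIso_hom (H.isColimit _) V
  refine (Category.assoc _ _ _).symm.trans ((congrArg (fun z => z ≫ _) h1).trans ?_)
  refine (Category.assoc _ _ _).trans ((congrArg (fun z => _ ≫ z) h2).trans ?_)
  refine Eq.symm ((Category.assoc _ _ _).symm.trans ((congrArg (fun z => z ≫ _) h3).trans ?_))
  exact G.ev_smap H f V.unop.1 x V.unop.2

/-- The main device for constructing morphisms: prescribe points and maps on stalks, and let the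
sheaf property of `X` assemble the pull-back of sections from its germs. -/
lemma exists_homOfStalks (hG : G.IsSheaf) (p : X → Y) (hp : Continuous p)
    (h : ∀ x, H.L (p x) ⟶ G.L x)
    (hloc : ∀ (V : Opens Y) (k : (AlgCat.S C).K) (a : El k (Sect Y V)) (x : X), p x ∈ V →
      ∃ (W : Opens X) (hW : ∀ y ∈ W, p y ∈ V), x ∈ W ∧ ∃ b : El k (Sect X W), ∀ y hy,
        ap (G.ev W y hy) b = ap (h y) (ap (H.ev V (p y) (hW y hy)) a)) :
    ∃ (f : X ⟶ Y) (hb : ∀ x, f.base x = p x), ∀ (V : Opens Y) (x : X) (hx : f.base x ∈ V),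
      pb f V ≫ G.ev (pre f V) x (mem_pre.2 hx) = H.ev V (p x) (hb x ▸ hx) ≫ h x := by
  let q : X.carrier ⟶ Y.carrier := TopCat.ofHom ⟨p, hp⟩
  have key : ∀ V : Opens Y, ∃ g : Sect Y V ⟶ Sect X ((Opens.map q).obj V), ∀ x hx,
      g ≫ G.ev _ x hx = H.ev V (p x) hx ≫ h x := fun V => by
    refine hG.exists_lift (V := (Opens.map q).obj V) (fun x hx => H.ev V (p x) hx ≫ h x)
      fun k a x hx => ?_
    obtain ⟨W, hW, hxW, b, hb⟩ := hloc V k a x hx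
    exact ⟨W, hW, hxW, b, fun y hy => by rw [hb, ap_comp]⟩
  choose g hg using key
  refine ⟨⟨q, ⟨fun V => g V.unop, fun V W i => hG.hom_ext fun x hx => ?_⟩⟩, fun x => rfl, hg⟩
  have e1 := hg W.unop x hx
  have e2 := hg V.unop x (leOfHom i.unop hx)
  refine (Category.assoc _ _ _).trans ((congrArg (fun z => Y.presheaf.map i ≫ z) e1).trans ?_)
  refine ((Category.assoc _ _ _).symm.trans (congrArg (fun z => z ≫ h x)
    (H.rs_ev (leOfHom i.unop) (p x) hx))).trans ?_
  refine e2.symm.trans (Eq.trans ?_ (Category.assoc _ _ _).symm)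
  exact congrArg (fun z => g V.unop ≫ z) (G.rs_ev (leOfHom ((Opens.map q).map i.unop)) x hx).symm

variable {G} in
lemma IsSheaf.hom_ext_stalks (hG : G.IsSheaf) {f g : X ⟶ Y} (hb : ∀ x, f.base x = g.base x)
    (hs : ∀ (V : Opens Y) (k : (AlgCat.S C).K) (a : El k (Sect Y V)) (x : X) (hf : f.base x ∈ V)
      (hg : g.base x ∈ V), ap (G.ev (pre f V) x (mem_pre.2 hf)) (ap (pb f V) a) =
        ap (G.ev (pre g V) x (mem_pre.2 hg)) (ap (pb g V) a)) : f = g := by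
  have hb' : f.base = g.base := TopCat.hom_ext (ContinuousMap.ext hb)
  obtain ⟨b, c⟩ := f
  obtain ⟨b', c'⟩ := g
  dsimp only at hb'
  subst hb'
  congr 1
  refine NatTrans.ext (funext fun V => hG.hom_ext fun x hx => hom_ext_ap fun k a => ?_)
  rw [ap_comp, ap_comp]
  exact hs V.unop k a x hx hx

variable {U : C ⥤ CBio.{u}} [Geo U]

/-- The germ of `s` at `x` is invertible. -/
def UnitAt {V : Opens X} (x : X) (s : (U.obj (Sect X V)).R 1) : Prop :=
  ∃ hx : x ∈ V, IsUnit (sc U (G.ev V x hx) s)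

lemma isOpen_unitAt {V : Opens X} (s : (U.obj (Sect X V)).R 1) : IsOpen {x | G.UnitAt x s} := by
  refine isOpen_iff_forall_mem_open.2 fun x ⟨hx, h⟩ => ?_
  obtain ⟨W, hW, hxW, h⟩ := G.isUnit_near h
  exact ⟨W, fun y hy => ⟨hW hy, G.isUnit_ev_of_le hy h⟩, W.2, hxW⟩

lemma unitAt_rs {V W : Opens X} (h : W ≤ V) {x : X} (hx : x ∈ W) (s : (U.obj (Sect X V)).R 1) :
    G.UnitAt x (sc U (rs X h) s) ↔ G.UnitAt x s := by
  constructor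
  · rintro ⟨hx, hs⟩
    rw [G.ev_rs_sc] at hs
    exact ⟨_, hs⟩
  · rintro ⟨_, hs⟩
    exact ⟨hx, by rwa [G.ev_rs_sc]⟩

lemma isLocalHom_iff_unitAt (f : X ⟶ Y) : G.IsLocalHom U H f ↔ ∀ x (V : Opens Y)
    (s : (U.obj (Sect Y V)).R 1), G.UnitAt x (sc U (pb f V) s) → H.UnitAt (f.base x) s :=
  ⟨fun h x V s ⟨hx, hs⟩ => ⟨hx, h x V hx s hs⟩,
    fun h x V hx s hs => (h x V s ⟨mem_pre.2 hx, hs⟩).choose_spec⟩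

lemma unitAt_pb (f : X ⟶ Y) {x : X} {V : Opens Y} {s : (U.obj (Sect Y V)).R 1}
    (h : H.UnitAt (f.base x) s) : G.UnitAt x (sc U (pb f V) s) := by
  obtain ⟨hx, h⟩ := h
  refine ⟨mem_pre.2 hx, ?_⟩
  rw [← G.sc_ev_smap H]
  exact h.map _

omit [Geo U] in
lemma unitAt_comp {Z : PSp C} (f : X ⟶ Y) (g : Y ⟶ Z) {x : X} {V : Opens Z}
    (s : (U.obj (Sect Z V)).R 1) :
    G.UnitAt x (sc U (pb (f ≫ g) V) s) ↔ G.UnitAt x (sc U (pb f (pre g V)) (sc U (pb g V) s)) :=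
  iff_of_eq (congrArg (G.UnitAt (V := pre f (pre g V)) x) (sc_pb_comp f g s))

lemma IsLocalHom.unitAt_iff {f : X ⟶ Y} (hf : G.IsLocalHom U H f) {x : X} {V : Opens Y}
    {s : (U.obj (Sect Y V)).R 1} : G.UnitAt x (sc U (pb f V) s) ↔ H.UnitAt (f.base x) s :=
  ⟨(G.isLocalHom_iff_unitAt H f).1 hf x V s, G.unitAt_pb H f⟩

end Germs

variable {U : C ⥤ CBio.{u}} [Geo U]

lemma LocSp.isSheaf (X : LocSp U) (G : Germs X.toPresheafedSpace) : G.IsSheaf :=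
  G.isSheaf_of_isSheaf X.IsSheaf

lemma LocSp.isLocal (X : LocSp U) (G : Germs X.toPresheafedSpace) (x : X.toPresheafedSpace) :
    (U.obj (G.L x)).IsLocal := by
  obtain ⟨c, ⟨hc⟩, h⟩ := X.local_stalks x
  exact h.of_iso (U.mapIso (hc.coconePointUniqueUpToIso (G.isColimit x)))

lemma isUnit_sc_iso {A B : C} (e : A ≅ B) (s : (U.obj A).R 1) :
    IsUnit (sc U e.hom s) ↔ IsUnit s := by
  refine ⟨fun h => ?_, fun h => h.map _⟩
  have := h.map (sc U e.inv)
  rwa [← sc_comp, e.hom_inv_id, sc_id] at this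

/-- All stalks of both spaces are local, so local maps are those that reflect units, and this may be
tested on any chosen stalks. -/
lemma LocSp.isLocalOnStalks_iff {X Y : LocSp U} (G : Germs X.toPresheafedSpace)
    (H : Germs Y.toPresheafedSpace) (f : X.toPresheafedSpace ⟶ Y.toPresheafedSpace) :
    IsLocalOnStalks U f ↔ G.IsLocalHom U H f := by
  have key : ∀ (x : X.toPresheafedSpace) (c : Cocone (stalkDiagram Y.toPresheafedSpace (f.base x)))
      (hc : IsColimit c) (d : Cocone (stalkDiagram X.toPresheafedSpace x)) (hd : IsColimit d),
      CBio.IsLocalMap (U.map (stalkMap f x hc d)) ↔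
        ∀ y : (U.obj (H.L (f.base x))).R 1, IsUnit (sc U (G.smap H f x) y) → IsUnit y := by
    intro x c hc d hd
    obtain ⟨e, e', h⟩ := G.exists_iso_stalkMap H f x hc hd
    rw [CBio.isLocalMap_iff ((Y.isLocal H (f.base x)).of_iso (U.mapIso e.symm))
      ((X.isLocal G x).of_iso (U.mapIso e'.symm))]
    have h2 : ∀ s : (U.obj c.pt).R 1, sc U e'.hom (sc U (stalkMap f x hc d) s) =
        sc U (G.smap H f x) (sc U e.hom s) := fun s => by
      rw [← sc_comp, ← sc_comp, h]
    constructor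
    · intro h y hy
      have hy' : sc U e.hom (sc U e.inv y) = y := by rw [← sc_comp, e.inv_hom_id, sc_id]
      rw [← hy'] at hy ⊢
      refine (isUnit_sc_iso e _).2 (h _ ?_)
      rw [← h2] at hy
      exact (isUnit_sc_iso e' _).1 hy
    · intro h s hs
      refine (isUnit_sc_iso e s).1 (h _ ?_)
      rw [← h2]
      exact IsUnit.map _ hs
  rw [G.isLocalHom_iff H]
  constructor
  · intro h x
    exact (key x _ (H.isColimit _) _ (G.isColimit x)).1 (h x _ _ _ ⟨G.isColimit x⟩)
  · intro h x c hc d ⟨hd⟩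
    exact (key x c hc d hd).2 (h x)

/-- A space with a sheaf with local stalks. -/
def LocSp.ofGerms {X : PSp C} (G : Germs X) (hG : G.IsSheaf)
    (hl : ∀ x, (U.obj (G.L x)).IsLocal) : LocSp U where
  toPresheafedSpace := X
  IsSheaf := hG.isSheaf
  local_stalks x := ⟨G.cocone x, ⟨G.isColimit x⟩, hl x⟩

/-! ### Relative localizations -/

/-- The space `Z` is obtained from `Y` by localization at a set of primes of its stalks. -/
structure IsFrac (U : C ⥤ CBio.{u}) [Geo U] {Z Y : PSp C} (G : Germs Z) (H : Germs Y) (π : Z ⟶ Y) :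
    Prop where
  locz : ∀ z, IsLocz (U := U) (G.smap H π z)
    ((IsUnit.submonoid ((U.obj (G.L z)).R 1)).comap (sc U (G.smap H π z)))
  nhds : ∀ (V : Opens Z) (z : Z), z ∈ V → ∃ (V' : Opens Y) (f : (U.obj (Sect Y V')).R 1),
    G.UnitAt z (sc U (pb π V') f) ∧ ∀ z', G.UnitAt z' (sc U (pb π V') f) → z' ∈ V
  sep : ∀ z z', π.base z = π.base z' → (∀ (V' : Opens Y) (f : (U.obj (Sect Y V')).R 1),
    G.UnitAt z (sc U (pb π V') f) ↔ G.UnitAt z' (sc U (pb π V') f)) → z = z'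

namespace IsFrac
variable {Z Y : PSp C} {G : Germs Z} {H : Germs Y} {π : Z ⟶ Y} (hπ : IsFrac U G H π)
include hπ

/-- In the stalk at `z` the section is a fraction. Numerator and denominator are germs of sections
of `Y`, which restrict to a common open set, and the equation between germs spreads to a
neighbourhood of `z`. -/
lemma exists_frac {V : Opens Z} {k : (AlgCat.S C).K} (a : El k (Sect Z V)) {z : Z} (hz : z ∈ V) :
    ∃ (V' : Opens Y) (f : (U.obj (Sect Y V')).R 1) (b : El k (Sect Y V')) (T : Opens Z) (hT : T ≤ V)
      (hT' : T ≤ pre π V'), z ∈ T ∧ G.UnitAt z (sc U (pb π V') f) ∧ ∀ z' (h : z' ∈ T),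
        sc U (G.ev _ z' (hT' h)) (sc U (pb π V') f) • ap (G.ev V z' (hT h)) a =
          ap (G.ev _ z' (hT' h)) (ap (pb π V') b) := by
  obtain ⟨s, hs, x, hx⟩ := (hπ.locz z).surj k (ap (G.ev V z hz) a)
  obtain ⟨V₁, h₁, f, rfl⟩ := H.surj_sc U s
  obtain ⟨V₂, h₂, b, rfl⟩ := H.surj x
  change IsUnit _ at hs
  rw [G.sc_ev_smap] at hs hx
  rw [G.ap_ev_smap] at hx
  let V' := V₁ ⊓ V₂
  have hzV : z ∈ pre π V' := mem_pre.2 (Opens.mem_inf.2 ⟨h₁, h₂⟩)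
  let f' := sc U (rs Y (inf_le_left : V' ≤ V₁)) f
  let b' := ap (rs Y (inf_le_right : V' ≤ V₂)) b
  have hf : sc U (pb π V') f' = sc U (rs Z (pre_mono π inf_le_left)) (sc U (pb π V₁) f) := by
    exact sc_pb_rs π _ f
  have hb : ap (pb π V') b' = ap (rs Z (pre_mono π inf_le_right)) (ap (pb π V₂) b) := by
    exact ap_pb_rs π _ b
  let T := V ⊓ pre π V'
  have hzT : z ∈ T := Opens.mem_inf.2 ⟨hz, hzV⟩
  obtain ⟨W, hW, hzW, h⟩ := G.near (V := T) (x := z) (hx := hzT)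
    (a := sc U (rs Z (inf_le_right : T ≤ _)) (sc U (pb π V') f') •
      ap (rs Z (inf_le_left : T ≤ V)) a)
    (b := ap (rs Z (inf_le_right : T ≤ _)) (ap (pb π V') b')) (by
      rw [ap_smul, G.ev_rs_sc, G.ev_rs, G.ev_rs, hf, hb, G.ev_rs_sc, G.ev_rs]
      exact hx)
  refine ⟨V', f', b', W, hW.trans inf_le_left, hW.trans inf_le_right, hzW, ⟨hzV, ?_⟩,
    fun z' hz' => ?_⟩
  · rw [hf, G.ev_rs_sc]
    exact hs
  · have := congrArg (ap (G.ev W z' hz')) h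
    rwa [ap_smul, ap_smul, G.ev_rs_sc, G.ev_rs_sc, G.ev_rs, G.ev_rs, G.ev_rs, G.ev_rs] at this

/-- The condition on units does all the work. It makes `p` continuous, as the unit loci of sections
of `Y` form a basis in `Z`; it provides maps on stalks, by the universal property of localizations;
and it makes them local. -/
lemma exists_lift {W : PSp C} (K : Germs W) (hK : K.IsSheaf) (φ : W ⟶ Y) (p : W → Z)
    (hp : ∀ w, π.base (p w) = φ.base w)
    (hu : ∀ w (V : Opens Y) (f : (U.obj (Sect Y V)).R 1),
      G.UnitAt (p w) (sc U (pb π V) f) ↔ K.UnitAt w (sc U (pb φ V) f)) :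
    ∃ ψ : W ⟶ Z, ψ ≫ π = φ ∧ K.IsLocalHom U G ψ ∧ ∀ w, ψ.base w = p w := by
  have hcont : Continuous p := by
    refine continuous_def.2 fun V hV => isOpen_iff_forall_mem_open.2 fun w hw => ?_
    obtain ⟨V', f, h₁, h₂⟩ := hπ.nhds ⟨V, hV⟩ (p w) hw
    exact ⟨_, fun w' hw' => h₂ _ ((hu _ _ _).2 hw'), K.isOpen_unitAt _, (hu _ _ _).1 h₁⟩
  have hmem : ∀ {w} {V : Opens Y}, π.base (p w) ∈ V → w ∈ pre φ V := fun {w V} h =>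
    mem_pre.2 (hp w ▸ h)
  have hstalk : ∀ w, ∃ h : G.L (p w) ⟶ K.L w, ∀ (V : Opens Y) (hV : π.base (p w) ∈ V),
      pb π V ≫ G.ev _ (p w) (mem_pre.2 hV) ≫ h = pb φ V ≫ K.ev _ w (hmem hV) := by
    intro w
    obtain ⟨m, hm⟩ := H.exists_desc (π.base (p w)) (K.L w)
      (fun V hV => pb φ V ≫ K.ev _ w (hmem hV)) fun h hx => by
        rw [← Category.assoc, rs_pb, Category.assoc, K.rs_ev _ _ (hmem hx)]
    obtain ⟨h, hh⟩ := (hπ.locz (p w)).exists_desc m fun s hs => by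
      obtain ⟨V, hV, f, rfl⟩ := H.surj_sc U s
      change IsUnit _ at hs
      rw [G.sc_ev_smap] at hs
      obtain ⟨_, h⟩ := (hu w V f).1 ⟨_, hs⟩
      rwa [← sc_comp, hm, sc_comp]
    refine ⟨h, fun V hV => ?_⟩
    rw [← Category.assoc, ← G.ev_smap H π V _ hV, Category.assoc, hh, hm]
  choose h hh using hstalk
  have hap : ∀ {w} {V : Opens Y} (hV : p w ∈ pre π V) {k : (AlgCat.S C).K} (a : El k (Sect Y V)),
      ap (h w) (ap (G.ev _ (p w) hV) (ap (pb π V) a)) = ap (K.ev _ w (hmem hV)) (ap (pb φ V) a) := by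
    intro w V hV k a
    rw [← ap_comp, ← ap_comp, ← ap_comp]
    exact congrArg (fun z => ap z a) (hh w V hV)
  have hsc : ∀ {w} {V : Opens Y} (hV : p w ∈ pre π V) (s : (U.obj (Sect Y V)).R 1),
      sc U (h w) (sc U (G.ev _ (p w) hV) (sc U (pb π V) s)) =
        sc U (K.ev _ w (hmem hV)) (sc U (pb φ V) s) := by
    intro w V hV s
    rw [← sc_comp, ← sc_comp, ← sc_comp]
    exact congrArg (fun z => sc U z s) (hh w V hV)
  obtain ⟨ψ, hb, hψ⟩ := K.exists_homOfStalks G hK p hcont h fun V k a w hw => by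
    obtain ⟨V', f, b, T, hT, hT', hwT, hf, hfr⟩ := hπ.exists_frac a hw
    obtain ⟨hw', hf⟩ := (hu _ _ _).1 hf
    obtain ⟨W₁, hW₁, hwW, hf⟩ := K.isUnit_near hf
    let W₂ : Opens W := W₁ ⊓ ⟨p ⁻¹' T, T.2.preimage hcont⟩
    have hW₂ : W₂ ≤ W₁ := inf_le_left
    have hW₂T : ∀ y ∈ W₂, p y ∈ T := fun y hy => (Opens.mem_inf.1 hy).2
    have hf₂ : IsUnit (sc U (rs W (hW₂.trans hW₁)) (sc U (pb φ V') f)) := by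
      have := hf.map (sc U (rs W hW₂))
      rwa [← sc_comp, rs_rs] at this
    obtain ⟨v, hv⟩ := hf₂
    -- The pull-back of the fraction `b / f`, which makes sense because `f` has become invertible on
    -- `W₂`.
    refine ⟨W₂, fun y hy => hT (hW₂T y hy), Opens.mem_inf.2 ⟨hwW, hwT⟩,
      (↑v⁻¹ : (U.obj (Sect W W₂)).R 1) • ap (rs W (hW₂.trans hW₁)) (ap (pb φ V') b),
      fun y hy => ?_⟩
    have h1 := congrArg (ap (h y)) (hfr (p y) (hW₂T y hy))
    rw [ap_smul, hsc, hap, ← K.ev_rs_sc (hW₂.trans hW₁) hy, ← hv] at h1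
    refine (v.isUnit.map (sc U (K.ev W₂ y hy))).smul_left_cancel.1 ?_
    rw [h1, ← ap_smul, smul_smul, v.mul_inv, one_smul, K.ev_rs]
  refine ⟨ψ, ?_, ?_, hb⟩
  · refine hK.hom_ext_stalks (fun w => ?_) fun V k a w hf hg => ?_
    · exact (congrArg π.base (hb w)).trans (hp w)
    · have hV : π.base (p w) ∈ V := by rwa [hp w]
      rw [← hap (mem_pre.2 hV)]
      have := congrArg (fun z => ap z (ap (pb π V) a)) (hψ (pre π V) w (by rw [hb w]; exact hV))
      rw [ap_comp, ap_comp] at this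
      exact Eq.trans (congrArg (ap (K.ev (pre ψ (pre π V)) w (mem_pre.2 hf))) (ap_comp _ _ _)) this
  · intro w V hw s hs
    have e : sc U (K.ev (pre ψ V) w (mem_pre.2 hw)) (sc U (pb ψ V) s) =
        sc U (h w) (sc U (G.ev V (p w) (hb w ▸ hw)) s) := by
      rw [← sc_comp, ← sc_comp]
      exact congrArg (fun z => sc U z s) (hψ V w hw)
    rw [e] at hs
    -- Up to a unit `t`, the germ comes from a section of `Y`, for which the invertibility at `p w`
    -- and at `w` are equivalent by hypothesis.
    obtain ⟨t, ht, x, hx⟩ := (hπ.locz (p w)).surj_sc (sc U (G.ev V (p w) (hb w ▸ hw)) s)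
    obtain ⟨V', hV', b, rfl⟩ := H.surj_sc U x
    change IsUnit _ at ht
    have h1 := (ht.map (sc U (h w))).mul hs
    rw [← map_mul, hx, G.sc_ev_smap H π hV', hsc] at h1
    obtain ⟨_, h2⟩ := (hu w V' b).2 ⟨_, h1⟩
    rw [← G.sc_ev_smap H π hV', ← hx] at h2
    have h3 : ∀ z (e : z = p w) (hz : z ∈ V), IsUnit (sc U (G.ev V z hz) s) := by
      rintro z rfl hz
      exact isUnit_of_mul_isUnit_right h2
    exact h3 _ (hb w) hw

/-- The points agree because they have the same image in `Y` and the same units. A section of `Z` is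
locally a fraction of sections of `Y` whose denominator becomes invertible on `W`, so its pull-back
is determined by the composite with `π`. -/
lemma hom_ext {W : PSp C} (K : Germs W) (hK : K.IsSheaf) {ψ ψ' : W ⟶ Z}
    (h : K.IsLocalHom U G ψ) (h' : K.IsLocalHom U G ψ') (e : ψ ≫ π = ψ' ≫ π) : ψ = ψ' := by
  have hu : ∀ w (V : Opens Y) (f : (U.obj (Sect Y V)).R 1), G.UnitAt (ψ.base w) (sc U (pb π V) f) ↔
      K.UnitAt w (sc U (pb (ψ ≫ π) V) f) := by
    intro w V f
    rw [← h.unitAt_iff, K.unitAt_comp]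
  have hu' : ∀ w (V : Opens Y) (f : (U.obj (Sect Y V)).R 1),
      G.UnitAt (ψ'.base w) (sc U (pb π V) f) ↔ K.UnitAt w (sc U (pb (ψ' ≫ π) V) f) := by
    intro w V f
    rw [← h'.unitAt_iff, K.unitAt_comp]
  have hb : ∀ w, ψ.base w = ψ'.base w := fun w => hπ.sep _ _
    (congrArg (fun z : W ⟶ Y => z.base w) e) fun V f => by rw [hu, hu', e]
  have key : ∀ (ψ : W ⟶ Z) (w : W) (V' : Opens Y) (f : (U.obj (Sect Y V')).R 1) 
      (hw : π.base (ψ.base w) ∈ V') {k : (AlgCat.S C).K} (b : El k (Sect Y V')) (V : Opens Z)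
      (hV : ψ.base w ∈ V) (a : El k (Sect Z V)), sc U (G.ev _ (ψ.base w) (mem_pre.2 hw))
        (sc U (pb π V') f) • ap (G.ev V (ψ.base w) hV) a =
          ap (G.ev _ (ψ.base w) (mem_pre.2 hw)) (ap (pb π V') b) →
      sc U (K.ev (pre (ψ ≫ π) V') w (mem_pre.2 hw)) (sc U (pb (ψ ≫ π) V') f) •
        ap (K.ev (pre ψ V) w (mem_pre.2 hV)) (ap (pb ψ V) a) =
          ap (K.ev (pre (ψ ≫ π) V') w (mem_pre.2 hw)) (ap (pb (ψ ≫ π) V') b) := by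
    intro ψ w V' f hw k b V hV a hab
    have := congrArg (ap (K.smap G ψ w)) hab
    rw [ap_smul, K.sc_ev_smap, K.ap_ev_smap, K.ap_ev_smap] at this
    refine Eq.trans (congrArg (fun z => z • _)
      (congrArg (sc U (K.ev (pre ψ (pre π V')) w (mem_pre.2 (mem_pre.2 hw)))) (sc_pb_comp ψ π f))) ?_
    exact this.trans (congrArg (ap (K.ev (pre ψ (pre π V')) w (mem_pre.2 (mem_pre.2 hw))))
      (ap_pb_comp ψ π b)).symm
  refine hK.hom_ext_stalks hb fun V k a w hV hV' => ?_
  obtain ⟨V', f, b, T, hT, hT', hwT, hf, hfr⟩ := hπ.exists_frac a hV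
  have hwT' : ψ'.base w ∈ T := hb w ▸ hwT
  have h1 := key ψ w V' f (hT' hwT) b V hV a (hfr _ hwT)
  have h2 := key ψ' w V' f (hT' hwT') b V hV' a (hfr _ hwT')
  obtain ⟨hw', hunit⟩ := (hu w V' f).1 hf
  refine hunit.smul_left_cancel.1 ?_
  rw [h1]
  have e' : ∀ (φ : W ⟶ Y) (hφ : φ = ψ ≫ π) (hx : w ∈ pre φ V') (hx' : w ∈ pre (ψ ≫ π) V'),
      ap (K.ev (pre φ V') w hx) (ap (pb φ V') b) =
        ap (K.ev (pre (ψ ≫ π) V') w hx') (ap (pb (ψ ≫ π) V') b) ∧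
      sc U (K.ev (pre φ V') w hx) (sc U (pb φ V') f) =
        sc U (K.ev (pre (ψ ≫ π) V') w hx') (sc U (pb (ψ ≫ π) V') f) := by
    rintro φ rfl hx hx'
    exact ⟨rfl, rfl⟩
  obtain ⟨e1, e2⟩ := e' (ψ' ≫ π) e.symm (hT' hwT') hw'
  rw [← e1, ← e2]
  exact h2.symm

end IsFrac

end

/-! ### Affine spectra -/

section
variable {C : Type (u + 1)} [Category.{u} C] [AlgCat C]

/-- The one-point space with the constant presheaf `A`. -/
def ptSp (A : C) : PSp C where
  carrier := TopCat.of PUnit.{u + 1}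
  presheaf := (Functor.const _).obj A

/-- The stalk of the one-point space. -/
def ptGerms (A : C) : Germs (ptSp A) where
  L _ := A
  ev _ _ _ := 𝟙 A
  rs_ev _ _ _ := Category.id_comp _
  surj y := ⟨⊤, trivial, y, ap_id y⟩
  near {V x hx k a b} h := ⟨V, le_rfl, hx, by
    obtain rfl : a = b := (ap_id a).symm.trans (h.trans (ap_id b))
    rfl⟩

/-- The map to the one-point space given by `A ⟶ Γ(W)`. -/
def toPt {W : PSp C} {A : C} (φ : A ⟶ Sect W ⊤) : W ⟶ ptSp A where
  base := TopCat.ofHom ⟨fun _ => PUnit.unit, continuous_const⟩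
  c :=
    { app := fun V => φ ≫ rs W le_top
      naturality := fun V V' i => by
        refine (Category.id_comp _).trans ?_
        exact (congrArg (fun z => φ ≫ z) (rs_rs W le_top _).symm).trans (Category.assoc _ _ _).symm }

lemma pb_toPt_top {W : PSp C} {A : C} (φ : A ⟶ Sect W ⊤) :
    @Eq (A ⟶ Sect W ⊤) (pb (toPt φ) ⊤) φ :=
  (congrArg (fun z => φ ≫ z) (rs_self W le_rfl)).trans (Category.comp_id φ)

lemma eq_toPt {W : PSp C} {A : C} (f : W ⟶ ptSp A) : f = toPt (W := W) (pb f ⊤) := by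
  have hb : f.base = (toPt (W := W) (pb f ⊤)).base := rfl
  refine PresheafedSpace.ext _ _ hb (NatTrans.ext (funext fun V => ?_))
  have := rs_pb f (le_top : V.unop ≤ ⊤)
  have h := (Category.id_comp (pb f V.unop)).symm.trans this
  refine Eq.trans ?_ h
  exact (congrArg (fun z => pb f V.unop ≫ z) (W.presheaf.map_id _)).trans (Category.comp_id _)

variable {U : C ⥤ CBio.{u}} [Geo U]

lemma sc_pb_toPt {W : PSp C} {A : C} (φ : A ⟶ Sect W ⊤) (V : Opens (ptSp A))
    (s : (U.obj A).R 1) :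
    sc U (A := A) (pb (toPt φ) V) s = sc U (rs W le_top) (sc U φ s) := sc_comp _ _ _

lemma unitAt_toPt {W : PSp C} {A : C} (K : Germs W) (φ : A ⟶ Sect W ⊤) (V : Opens (ptSp A))
    (s : (U.obj (Sect (ptSp A) V)).R 1) {w : W} : K.UnitAt w (sc U (pb (toPt φ) V) s) ↔
      PUnit.unit ∈ V ∧ K.UnitAt w (sc U φ s) := by
  refine (iff_of_eq (congrArg (K.UnitAt w) (sc_pb_toPt φ V s))).trans ?_
  constructor
  · rintro ⟨hw, h⟩
    exact ⟨hw, (K.unitAt_rs _ hw _).1 ⟨hw, h⟩⟩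
  · rintro ⟨hw, h⟩
    exact (K.unitAt_rs (W := pre (toPt φ) V) le_top hw _).2 h

/-- `X`, with stalks `G`, is the affine spectrum of `A`. -/
structure IsSpec (U : C ⥤ CBio.{u}) [Geo U] {A : C} {X : PSp C} (G : Germs X) (φ : A ⟶ Sect X ⊤) :
    Prop where
  isSheaf : G.IsSheaf
  isLocal : ∀ x, (U.obj (G.L x)).IsLocal
  locz : ∀ x, IsLocz (U := U) (φ ≫ G.ev ⊤ x trivial)
    ((IsUnit.submonoid ((U.obj (G.L x)).R 1)).comap (sc U (φ ≫ G.ev ⊤ x trivial)))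
  nhds : ∀ (V : Opens X) (x : X), x ∈ V → ∃ f : (U.obj A).R 1,
    G.UnitAt x (sc U φ f) ∧ ∀ y, G.UnitAt y (sc U φ f) → y ∈ V
  sep : ∀ x y, (∀ f, G.UnitAt x (sc U φ f) ↔ G.UnitAt y (sc U φ f)) → x = y
  exists_point : ∀ p : (U.obj A).Prime, ∃ x, ∀ f, G.UnitAt x (sc U φ f) ↔ f ∉ p.carrier

lemma unitAt_top {X : PSp C} (G : Germs X) {A : C} (φ : A ⟶ Sect X ⊤) {x : X} (f : (U.obj A).R 1) :
    G.UnitAt x (sc U φ f) ↔ IsUnit (sc U (φ ≫ G.ev ⊤ x trivial) f) := by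
  rw [sc_comp]
  exact ⟨fun ⟨_, h⟩ => h, fun h => ⟨_, h⟩⟩

namespace IsSpec
variable {A : C} {X : PSp C} {G : Germs X} {φ : A ⟶ Sect X ⊤} (hX : IsSpec U G φ)
include hX

/-- A spectrum is the localization of the one-point space with value `A` at all its primes. Its
universal property becomes a case of that of relative localizations. -/
lemma isFrac : IsFrac U G (ptGerms A) (toPt φ) where
  locz x := by
    have : G.smap (ptGerms A) (toPt φ) x = φ ≫ G.ev ⊤ x trivial := by
      have := G.ev_smap (ptGerms A) (toPt φ) ⊤ x trivial
      refine (Category.id_comp _).symm.trans (this.trans ?_)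
      exact congrArg (fun z => z ≫ G.ev ⊤ x trivial) (pb_toPt_top φ)
    rw [this]
    exact hX.locz x
  nhds V x hx := by
    obtain ⟨f, h₁, h₂⟩ := hX.nhds V x hx
    exact ⟨⊤, f, (unitAt_toPt _ _ _ _).2 ⟨trivial, h₁⟩, fun y hy =>
      h₂ y ((unitAt_toPt _ _ _ _).1 hy).2⟩
  sep x y _ h := hX.sep x y fun f => by
    have := h ⊤ f
    exact ⟨fun hx => ((unitAt_toPt _ _ _ _).1 (this.1 ((unitAt_toPt _ _ _ _).2 ⟨trivial, hx⟩))).2,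
      fun hx => ((unitAt_toPt _ _ _ _).1 (this.2 ((unitAt_toPt _ _ _ _).2 ⟨trivial, hx⟩))).2⟩

/-- With `hom_ext`, this says that morphisms to a spectrum are the same as maps to global sections.
-/
lemma exists_lift {W : PSp C} (K : Germs W) (hK : K.IsSheaf) (hl : ∀ w, (U.obj (K.L w)).IsLocal)
    (θ : A ⟶ Sect W ⊤) :
    ∃ ψ : W ⟶ X, K.IsLocalHom U G ψ ∧ φ ≫ pb ψ ⊤ = θ := by
  -- The point `w` goes to the prime of those elements of `A` whose germ at `w` is not invertible.
  choose p hp using fun w => hX.exists_point ((hl w).prime (U.map (θ ≫ K.ev ⊤ w trivial)))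
  obtain ⟨ψ, h₁, h₂, -⟩ := hX.isFrac.exists_lift K hK (toPt θ) p (fun _ => rfl) fun w V f => by
    refine (unitAt_toPt _ _ _ _).trans (Iff.trans ?_ (unitAt_toPt _ _ _ _).symm)
    refine and_congr_right fun _ => (hp w f).trans (Iff.trans ?_ (unitAt_top _ _ _).symm)
    exact not_not
  refine ⟨ψ, h₂, ?_⟩
  have h : ∀ f : W ⟶ ptSp A, f = toPt θ → ∀ (e : A ⟶ Sect W ⊤), e = pb f ⊤ → e = θ := by
    rintro f rfl e rfl
    exact pb_toPt_top θ
  refine h _ h₁ _ ?_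
  exact congrArg (fun z => z ≫ pb ψ ⊤) (pb_toPt_top φ).symm

lemma hom_ext {W : PSp C} (K : Germs W) (hK : K.IsSheaf) {ψ ψ' : W ⟶ X} (h : K.IsLocalHom U G ψ)
    (h' : K.IsLocalHom U G ψ') (e : φ ≫ pb ψ ⊤ = φ ≫ pb ψ' ⊤) : ψ = ψ' := by
  refine hX.isFrac.hom_ext K hK h h' ?_
  have key : ∀ ψ : W ⟶ X, ψ ≫ toPt φ = toPt (W := W) (φ ≫ pb ψ ⊤) := fun ψ => by
    rw [eq_toPt (ψ ≫ toPt φ)]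
    exact congrArg (fun z => toPt (W := W) (z ≫ pb ψ ⊤)) (pb_toPt_top φ)
  rw [key, key]
  exact congrArg (fun z => toPt (W := W) z) e

lemma exists_prime_of_isUnit (x : X) : ∃ p : (U.obj A).Prime, ∀ f, G.UnitAt x (sc U φ f) ↔
    f ∉ p.carrier :=
  ⟨(hX.isLocal x).prime (U.map (φ ≫ G.ev ⊤ x trivial)), fun f =>
    (unitAt_top G φ f).trans not_not.symm⟩

/-- The scalars that equalize `a` and `b` form an ideal, by the laws of linear combinations. If it
contained no power of `f`, it would lie in a prime without `f`, contrary to the equality of `a` and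
`b` in the localization there. -/
lemma exists_pow_smul {k : (AlgCat.S C).K} {a b : El k A} (f : (U.obj A).R 1)
    (h : ∀ x, G.UnitAt x (sc U φ f) →
      ap (φ ≫ G.ev ⊤ x trivial) a = ap (φ ≫ G.ev ⊤ x trivial) b) : ∃ N, f ^ N • a = f ^ N • b := by
  by_contra hN
  have hI : (U.obj A).IsIdeal {s | s • a = s • b} := fun n b' s d hs =>
    (Geo.act_lc b' d s a).symm.trans ((congrArg (Geo.lc b' d) (funext hs)).trans (Geo.act_lc b' d s b))
  obtain ⟨p, hp, hf⟩ := CBio.exists_prime hI (Submonoid.powers f) (by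
    rintro _ ⟨N, rfl⟩ h
    exact hN ⟨N, h⟩)
  obtain ⟨x, hx⟩ := hX.exists_point p
  obtain ⟨s, hs, hab⟩ := (hX.locz x).eq k a b
    (h x ((hx f).2 (hf f (Submonoid.mem_powers f))))
  exact (hx s).1 ((unitAt_top G φ s).2 hs) (hp hab)

/-- Otherwise the ideal generated by `F` would lie in a prime, and no element of `F` would be
invertible at its point. Since a contraction has finitely many entries, this is also the
quasi-compactness of the spectrum. -/
lemma one_mem_span {F : Set ((U.obj A).R 1)} (hF : ∀ x, ∃ f ∈ F, G.UnitAt x (sc U φ f)) :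
    1 ∈ CBio.span F := by
  by_contra h
  obtain ⟨p, hp, -⟩ := CBio.exists_prime (CBio.isIdeal_span F) ⊥ (by
    rintro s hs
    rwa [Submonoid.mem_bot.1 hs])
  obtain ⟨x, hx⟩ := hX.exists_point p
  obtain ⟨f, hf, hfx⟩ := hF x
  exact (hx f).1 hfx (hp (CBio.subset_span F hf))

/-- The classical argument: write the section locally as fractions, use finitely many denominators
that generate the unit ideal, pass to powers so that the numerators match, and combine the
numerators with the coefficients of an expression of `1`. -/
lemma exists_global {k : (AlgCat.S C).K} (y : El k (Sect X ⊤)) : ∃ a : El k A, ap φ a = y := by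
  -- The denominators `f` for which `y` is a fraction with denominator `f` wherever `f` is
  -- invertible.
  let F : Set ((U.obj A).R 1) := {f | ∃ a : El k A, ∀ x, G.UnitAt x (sc U φ f) →
    sc U (φ ≫ G.ev ⊤ x trivial) f • ap (G.ev ⊤ x trivial) y = ap (φ ≫ G.ev ⊤ x trivial) a}
  have hF : ∀ x, ∃ f ∈ F, G.UnitAt x (sc U φ f) := by
    intro x
    obtain ⟨s, hs, a, h⟩ := (hX.locz x).surj k (ap (G.ev ⊤ x trivial) y)
    rw [ap_comp, sc_comp, ← ap_smul] at h
    obtain ⟨W, hW, hxW, h⟩ := G.near h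
    obtain ⟨f, hf, hfW⟩ := hX.nhds W x hxW
    have hs' := (unitAt_top G φ s).2 hs
    -- The equation `s • y = a` is known only on `W`; the factor `f` confines the unit locus of the
    -- denominator to `W`.
    refine ⟨f * s, ⟨f • a, fun z hz => ?_⟩, ?_⟩
    · have hzf : G.UnitAt z (sc U φ f) := by
        rw [unitAt_top, map_mul] at hz
        rw [unitAt_top]
        exact isUnit_of_mul_isUnit_left hz
      have := congrArg (ap (G.ev W z (hfW z hzf))) h
      rw [G.ev_rs, G.ev_rs, ap_smul] at this
      rw [map_mul, mul_smul, ap_smul]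
      congr 1
      rw [sc_comp, ap_comp]
      exact this
    · rw [unitAt_top] at hf hs' ⊢
      rw [map_mul]
      exact hf.mul hs'
  obtain ⟨n, b, f, d, hf, h1⟩ := hX.one_mem_span hF
  choose a ha using hf
  have hij : ∀ i j, ∃ N, (f i * f j) ^ N • f j • a i = (f i * f j) ^ N • f i • a j := fun i j =>
    hX.exists_pow_smul _ fun x hx => by
      rw [unitAt_top, map_mul] at hx
      have hi := ha i x ((unitAt_top G φ _).2 (isUnit_of_mul_isUnit_left hx))
      have hj := ha j x ((unitAt_top G φ _).2 (isUnit_of_mul_isUnit_right hx))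
      rw [ap_smul, ap_smul, ← hi, ← hj, smul_smul, smul_smul, mul_comm]
  choose N hN using hij
  -- One exponent that dominates all `N i j`.
  let M := ∑ i, ∑ j, N i j
  have hM : ∀ i j, (f i * f j) ^ M • f j • a i = (f i * f j) ^ M • f i • a j := by
    intro i j
    obtain ⟨r, hr⟩ := Nat.exists_eq_add_of_le (show N i j ≤ M from
      (Finset.single_le_sum (f := fun j => N i j) (fun _ _ => Nat.zero_le _)
        (Finset.mem_univ j)).trans (Finset.single_le_sum (f := fun i => ∑ j, N i j)
        (fun _ _ => Nat.zero_le _) (Finset.mem_univ i)))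
    rw [hr, add_comm, pow_add, mul_smul, hN, ← mul_smul]
  -- Powers have the same unit loci, so they again generate the unit ideal, in general by another
  -- contraction, with its own indices `σ`.
  have h1' : 1 ∈ CBio.span (Set.range fun i => f i ^ (M + 1)) := by
    refine hX.one_mem_span fun x => ?_
    obtain ⟨p, hp⟩ := hX.exists_prime_of_isUnit x
    by_contra h
    push Not at h
    have : ∀ i, f i ∈ p.carrier := fun i => by
      by_contra hi
      refine h _ ⟨i, rfl⟩ ?_
      have := (hp _).2 hi
      rw [unitAt_top] at this ⊢
      rw [map_pow]
      exact this.pow _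
    refine p.one_notMem ?_
    rw [h1]
    exact p.isIdeal _ _ _ _ this
  obtain ⟨n', b', f', d', hf', h1'⟩ := h1'
  choose σ hσ using hf'
  have hcov : ∀ x, ∃ i, G.UnitAt x (sc U φ (f i)) := by
    intro x
    obtain ⟨p, hp⟩ := hX.exists_prime_of_isUnit x
    by_contra h
    push Not at h
    refine p.one_notMem ?_
    rw [h1]
    exact p.isIdeal _ _ _ _ fun i => by
      by_contra hi
      exact h i ((hp _).2 hi)
  -- Over a ring this is `∑ⱼ b'ⱼ d'ⱼ fⱼ ^ M aⱼ`, where `∑ⱼ b'ⱼ d'ⱼ fⱼ ^ (M + 1) = 1`.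
  refine ⟨Geo.lc b' d' (fun j => f (σ j) ^ M • a (σ j)), hX.isSheaf.sep fun x hx => ?_⟩
  obtain ⟨i, hi⟩ := hcov x
  -- By `hM`, the terms `f i ^ (M + 1) • f j ^ M • a j` and `f j ^ (M + 1) • f i ^ M • a i` agree.
  -- The law `act_lc` then takes the fixed element `f i ^ M • a i` out of the combination, with
  -- coefficient `1`.
  have e : f i ^ (M + 1) • Geo.lc b' d' (fun j => f (σ j) ^ M • a (σ j)) = f i ^ M • a i := by
    refine (Geo.lc_act b' d' _ _).symm.trans ?_
    refine (congrArg (Geo.lc b' d') (funext fun j => ?_)).trans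
      ((Geo.act_lc b' d' f' (f i ^ M • a i)).trans ?_)
    · change f i ^ (M + 1) • f (σ j) ^ M • a (σ j) = f' j • f i ^ M • a i
      rw [← hσ]
      dsimp only
      have := hM i (σ j)
      rw [smul_smul, smul_smul] at this ⊢
      refine (congrArg (fun z => z • a (σ j)) ?_).trans (this.symm.trans
        (congrArg (fun z => z • a i) ?_)) <;> rw [mul_pow, pow_succ] <;> ac_rfl
    · exact (congrArg (fun z => Geo.act z _) h1'.symm).trans (Geo.one_act _)
  have hix := hi
  rw [unitAt_top] at hi
  refine (hi.pow (M + 1)).smul_left_cancel.1 ?_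
  rw [← ap_comp, ← map_pow, ← ap_smul, e, ap_smul, ← ha i x hix, smul_smul, ← map_mul, pow_succ]

/-- The global sections of the affine spectrum. -/
lemma isIso : IsIso φ := by
  refine isIso_of_bijective φ fun k => ⟨fun a b h => ?_, fun y => hX.exists_global y⟩
  obtain ⟨N, h⟩ := hX.exists_pow_smul (a := a) (b := b) 1 fun x _ => by rw [ap_comp, h, ap_comp]
  rwa [one_pow, one_smul, one_smul] at h

end IsSpec

/-- Up to units, all germs of `Z` come from `Y`, so reflection of units need only be tested on
sections of `Y`. -/
lemma IsFrac.isLocalHom {Z Y W : PSp C} {G : Germs Z} {H : Germs Y} {π : Z ⟶ Y}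
    (hπ : IsFrac U G H π) (K : Germs W) (ψ : W ⟶ Z)
    (h : ∀ w (V : Opens Y) (f : (U.obj (Sect Y V)).R 1),
      K.UnitAt w (sc U (pb (ψ ≫ π) V) f) → G.UnitAt (ψ.base w) (sc U (pb π V) f)) :
    K.IsLocalHom U G ψ := by
  rw [K.isLocalHom_iff]
  intro w s hs
  obtain ⟨t, ht, x, hx⟩ := (hπ.locz (ψ.base w)).surj_sc s
  obtain ⟨V, hV, f, rfl⟩ := H.surj_sc U x
  have h1 := (IsUnit.map (sc U (K.smap G ψ w)) (show IsUnit _ from ht)).mul hs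
  rw [← map_mul, hx, G.sc_ev_smap H π hV, K.sc_ev_smap G ψ (mem_pre.2 hV)] at h1
  obtain ⟨_, h2⟩ := h w V f ((K.unitAt_comp ψ π f).2 ⟨mem_pre.2 (mem_pre.2 hV), h1⟩)
  rw [← G.sc_ev_smap H π hV, ← hx] at h2
  exact isUnit_of_mul_isUnit_right h2

end

/-! ### The structure sheaves of the affine spectra -/

section
variable {M : Type u} [CommMonoid M] {T : Type u} [TopologicalSpace T] {S : T → Submonoid M}
  {X : Type u} [MAct M X]

lemma Sec.exists_germ (hS : ∀ f, IsOpen {y | f ∈ S y}) {x : T} (y : Loc (S x) X) :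
    ∃ (V : Opens T) (hx : x ∈ V) (s : Sec S X V), s.1 ⟨x, hx⟩ = y := by
  obtain ⟨a, f, rfl⟩ := Loc.exists_mk y
  exact ⟨⟨_, hS f.1⟩, f.2, ⟨fun z => Loc.mk a ⟨f.1, z.2⟩, fun z =>
    ⟨⟨_, hS f.1⟩, z.2, a, f.1, fun y _ => ⟨y.2, rfl⟩⟩⟩, rfl⟩

lemma Sec.exists_res_eq (hS : ∀ f, IsOpen {y | f ∈ S y}) {V : Opens T} {x : T} {hx : x ∈ V}
    {s t : Sec S X V} (h : s.1 ⟨x, hx⟩ = t.1 ⟨x, hx⟩) :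
    ∃ (W : Opens T) (h : W ≤ V), x ∈ W ∧ s.res h = t.res h := by
  obtain ⟨V₁, hx₁, a, f, h₁⟩ := s.2 ⟨x, hx⟩
  obtain ⟨V₂, hx₂, b, g, h₂⟩ := t.2 ⟨x, hx⟩
  obtain ⟨hf, e₁⟩ := h₁ ⟨x, hx⟩ hx₁
  obtain ⟨hg, e₂⟩ := h₂ ⟨x, hx⟩ hx₂
  rw [e₁, e₂] at h
  obtain ⟨w, hw, h⟩ := Loc.mk_eq.1 h
  refine ⟨V ⊓ (V₁ ⊓ (V₂ ⊓ ⟨_, hS w⟩)), inf_le_left, ⟨hx, hx₁, hx₂, hw⟩, Sec.ext fun y => ?_⟩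
  obtain ⟨hf, e₁⟩ := h₁ ⟨y.1, y.2.1⟩ y.2.2.1
  obtain ⟨hg, e₂⟩ := h₂ ⟨y.1, y.2.1⟩ y.2.2.2.1
  exact e₁.trans (Eq.trans (Loc.mk_eq.2 ⟨w, y.2.2.2.2, h⟩) e₂.symm)

lemma Sec.exists_glue {V : Opens T} (s : ∀ x, x ∈ V → Loc (S x) X)
    (h : ∀ x, x ∈ V → ∃ (W : Opens T) (h : W ≤ V), x ∈ W ∧ ∃ t : Sec S X W, ∀ y hy,
      t.1 ⟨y, hy⟩ = s y (h hy)) : ∃ t : Sec S X V, ∀ x hx, t.1 ⟨x, hx⟩ = s x hx := by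
  refine ⟨⟨fun y => s y.1 y.2, fun y => ?_⟩, fun _ _ => rfl⟩
  obtain ⟨W, hW, hy, t, ht⟩ := h y.1 y.2
  obtain ⟨T, hT, a, f, H⟩ := t.2 ⟨y.1, hy⟩
  refine ⟨W ⊓ T, ⟨hy, hT⟩, a, f, fun z hz => ?_⟩
  obtain ⟨hf, e⟩ := H ⟨z.1, hz.1⟩ hz.2
  exact ⟨hf, (ht z.1 hz.1).symm.trans e⟩

end

lemma CBio.isOpen_notMem (P : CBio.{u}) (f : P.R 1) : IsOpen {x : P.Prime | f ∈ x.compl} :=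
  TopologicalSpace.isOpen_generateFrom_of_mem ⟨f, rfl⟩

section
variable {C : Type (u + 1)} [Category.{u} C] [AlgCat C] {U : C ⥤ CBio.{u}} [Geo U]

/-- The denominators may be enlarged to everything that becomes invertible. This saturated form
depends on the morphism only, and is the one recorded in `IsFrac` and `IsSpec`. -/
lemma IsLocz.comap_units {A L : C} {φ : A ⟶ L} {S : Submonoid ((U.obj A).R 1)} (h : IsLocz φ S) :
    IsLocz φ ((IsUnit.submonoid ((U.obj L).R 1)).comap (sc U φ)) where
  isUnit _ hs := hs
  surj k y := by
    obtain ⟨s, hs, x, hx⟩ := h.surj k y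
    exact ⟨s, h.isUnit s hs, x, hx⟩
  eq k x x' hx := by
    obtain ⟨s, hs, hx⟩ := h.eq k x x' hx
    exact ⟨s, h.isUnit s hs, hx⟩

lemma IsLocz.unitAt_iff {A : C} {X : PSp C} {G : Germs X} {φ : A ⟶ Sect X ⊤} {x : X}
    {p : (U.obj A).Prime} (h : IsLocz (U := U) (φ ≫ G.ev ⊤ x trivial) p.compl) (f : (U.obj A).R 1) :
    G.UnitAt x (sc U φ f) ↔ f ∉ p.carrier :=
  (unitAt_top G φ f).trans (h.isUnit_iff_of_prime rfl f)

lemma IsSpec.isLocalHom {A : C} {X W : PSp C} {G : Germs X} {φ : A ⟶ Sect X ⊤} (hX : IsSpec U G φ)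
    (K : Germs W) (ψ : W ⟶ X) (h : ∀ w (f : (U.obj A).R 1),
      K.UnitAt w (sc U (φ ≫ pb ψ ⊤) f) → G.UnitAt (ψ.base w) (sc U φ f)) :
    K.IsLocalHom U G ψ := by
  refine hX.isFrac.isLocalHom K ψ fun w V f hf => ?_
  have hf := (K.unitAt_comp ψ (toPt φ) f).1 hf
  obtain ⟨hw, -⟩ := id hf
  refine (unitAt_toPt _ _ _ _).2 ⟨hw, h w f ?_⟩
  have e : sc U (pb ψ (pre (toPt φ) V)) (sc U (pb (toPt φ) V) f) =
      sc U (rs W (pre_mono ψ le_top)) (sc U (φ ≫ pb ψ ⊤) f) := by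
    refine (congrArg (sc U (pb ψ (pre (toPt φ) V))) (sc_pb_toPt φ V f)).trans ?_
    exact (sc_pb_rs ψ le_top _).trans (congrArg _ (sc_comp φ (pb ψ ⊤) f).symm)
  exact (K.unitAt_rs (V := ⊤) (W := pre ψ (pre (toPt φ) V)) le_top hw _).1 (e ▸ hf)

/-- The criterion by which every concrete spectrum is recognized. The bijection with primes has to
be open only, since the unit loci of sections are open in any case. -/
lemma IsSpec.of_equiv {A : C} {X : PSp C} {G : Germs X} {φ : A ⟶ Sect X ⊤} (hG : G.IsSheaf)
    (pt : X ≃ (U.obj A).Prime) (hpt : ∀ V : Opens X, IsOpen (pt '' (V : Set X)))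
    (hl : ∀ x, IsLocz (U := U) (φ ≫ G.ev ⊤ x trivial) (pt x).compl) : IsSpec U G φ := by
  have key : ∀ x f, G.UnitAt x (sc U φ f) ↔ f ∉ (pt x).carrier := fun x f =>
    (hl x).unitAt_iff f
  refine ⟨hG, fun x => (hl x).isLocal, fun x => (hl x).comap_units, fun V x hx => ?_,
    fun x y h => pt.injective (CBio.Prime.ext (Set.ext fun f => ?_)), fun p => ⟨pt.symm p, fun f => ?_⟩⟩
  · obtain ⟨_, ⟨f, rfl⟩, hf, hV⟩ := CBio.isTopologicalBasis_basicOpen.exists_subset_of_mem_open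
      (Set.mem_image_of_mem pt hx) (hpt V)
    refine ⟨f, (key x f).2 hf, fun y hy => ?_⟩
    exact (pt.injective.mem_set_image).1 (hV ((key y f).1 hy))
  · have := h f
    rw [key, key] at this
    exact not_iff_not.1 this
  · rw [key, Equiv.apply_symm_apply]

/-- The functor `Sp` sends `A` to its affine spectrum. -/
class AffSpec (U : C ⥤ CBio.{u}) [Geo U] (Sp : Cᵒᵖ ⥤ PSp C) where
  germs : ∀ A, Germs (Sp.obj (op A))
  unit : ∀ A, A ⟶ Sect (Sp.obj (op A)) ⊤
  isSpec : ∀ A, IsSpec U (germs A) (unit A)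
  unit_map : ∀ {A B : C} (f : A ⟶ B), unit A ≫ pb (Sp.map f.op) ⊤ = f ≫ unit B
  isLocalHom_map : ∀ {A B : C} (f : A ⟶ B), (germs B).IsLocalHom U (germs A) (Sp.map f.op)

end

/-! ### Spectra of commutative bios -/

namespace CBio
variable (P : CBio.{u})

/-- The stalks of the affine spectrum. -/
def specGerms : Germs P.specPS where
  L x := P.loc (Prime.compl x)
  ev V x hx :=
    { onR := fun n s => s.1 ⟨x, hx⟩
      onC := fun n s => s.1 ⟨x, hx⟩
      map_oneR := rfl
      map_oneC := rfl
      map_compR := fun _ _ _ => rfl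
      map_compC := fun _ _ _ => rfl
      map_actR := fun _ _ _ => rfl
      map_actC := fun _ _ _ => rfl }
  rs_ev _ _ _ := rfl
  surj {x k} := match k with
    | .inl _ => fun y => Sec.exists_germ P.isOpen_notMem y
    | .inr _ => fun y => Sec.exists_germ P.isOpen_notMem y
  near {V x hx k} := match k with
    | .inl _ => fun h => Sec.exists_res_eq P.isOpen_notMem h
    | .inr _ => fun h => Sec.exists_res_eq P.isOpen_notMem h

lemma isSheaf_specGerms : P.specGerms.IsSheaf where
  sep {V k} := match k with
    | .inl _ => fun h => Sec.ext fun y => h y.1 y.2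
    | .inr _ => fun h => Sec.ext fun y => h y.1 y.2
  glue {V k} := match k with
    | .inl _ => fun s h => Sec.exists_glue s h
    | .inr _ => fun s h => Sec.exists_glue s h

/-- The elements of `P` as global sections. -/
def specUnit : P ⟶ Sect P.specPS ⊤ :=
  { onR := fun n s => Sec.const s
    onC := fun n s => Sec.const s
    map_oneR := rfl
    map_oneC := rfl
    map_compR := fun e p q => Sec.ext fun y => Bio.Hom.map_compR (P.locHom (Prime.compl y.1)) e p q
    map_compC := fun e p q => Sec.ext fun y => Bio.Hom.map_compC (P.locHom (Prime.compl y.1)) e p q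
    map_actR := fun e p q => Sec.ext fun y => Bio.Hom.map_actR (P.locHom (Prime.compl y.1)) e p q
    map_actC := fun e p q => Sec.ext fun y =>
      Bio.Hom.map_actC (P.locHom (Prime.compl y.1)) e p q : Bio.Hom _ _ }

lemma isLocz_specUnit (x : P.Prime) :
    IsLocz (U := 𝟭 CBio.{u}) (P.specUnit ≫ P.specGerms.ev ⊤ x trivial) (Prime.compl (P := P) x) :=
  isLocz_locHom (𝟭 CBio.{u}) P (Prime.compl (P := P) x)

lemma isSpec : IsSpec (𝟭 CBio.{u}) P.specGerms P.specUnit :=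
  IsSpec.of_equiv P.isSheaf_specGerms (Equiv.refl P.Prime)
    (fun V => (congrArg IsOpen (Set.image_id (V.1 : Set P.Prime))).mpr V.2)
    P.isLocz_specUnit

lemma specUnit_map {P Q : CBio.{u}} (f : P ⟶ Q) :
    P.specUnit ≫ pb (specPSMap f) ⊤ = f ≫ Q.specUnit :=
  Bio.Hom.ext (funext fun _ => funext fun s => Sec.ext fun y =>
      Loc.map_mk_one _ _ (onR_act f) (compl_comap f y.1) s)
    (funext fun _ => funext fun s => Sec.ext fun y =>
      Loc.map_mk_one _ _ (onC_act f) (compl_comap f y.1) s)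

end CBio

instance : AffSpec (𝟭 CBio.{u}) specBio.{u} where
  germs P := P.specGerms
  unit P := P.specUnit
  isSpec P := P.isSpec
  unit_map f := CBio.specUnit_map f
  isLocalHom_map {P Q} f := P.isSpec.isLocalHom Q.specGerms _ fun w s hs => by
    have e := (hom_ext_sc (U := 𝟭 CBio.{u}) (CBio.specUnit_map f) s).trans (sc_comp f Q.specUnit s)
    refine ((P.isLocz_specUnit _).unitAt_iff s).2 ?_
    exact ((Q.isLocz_specUnit w).unitAt_iff _).1
      (Eq.mp (congrArg (Q.specGerms.UnitAt (U := 𝟭 CBio.{u}) w) e) hs)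

/-! ### Spectra of commutative props -/

namespace CPrp
variable (P : CPrp.{u})

lemma isOpen_notMem (f : P.A 1 1) : IsOpen {x : P.toCBio.Prime | f ∈ compl x} :=
  P.toCBio.isOpen_notMem f

/-- The stalks of the affine spectrum. -/
def specGerms : Germs P.specPS where
  L x := P.loc (compl x)
  ev V x hx :=
    { on := fun n m s => s.1 ⟨x, hx⟩
      map_one := fun _ => rfl
      map_comp := fun _ _ => rfl
      map_dsum := fun _ _ _ => rfl }
  rs_ev _ _ _ := rfl
  surj y := Sec.exists_germ P.isOpen_notMem y
  near h := Sec.exists_res_eq P.isOpen_notMem h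

lemma isSheaf_specGerms : P.specGerms.IsSheaf where
  sep h := Sec.ext fun y => h y.1 y.2
  glue s h := Sec.exists_glue s h

/-- The elements of `P` as global sections. -/
def specUnit : P ⟶ Sect P.specPS ⊤ :=
  { on := fun _ _ s => Sec.const s
    map_one := fun _ => rfl
    map_comp := fun a b => Sec.ext fun y => Prp.Hom.map_comp (P.locHom (compl y.1)) a b
    map_dsum := fun e f a => Sec.ext fun y =>
      Prp.Hom.map_dsum (P.locHom (compl y.1)) e f a : Prp.Hom _ _ }

lemma isLocz_specUnit (x : P.toCBio.Prime) :
    IsLocz (U := bioOfProp.{u}) (P.specUnit ≫ P.specGerms.ev ⊤ x trivial)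
      (CBio.Prime.compl (P := P.toCBio) x) :=
  isLocz_locHom bioOfProp.{u} P (CBio.Prime.compl (P := P.toCBio) x)

lemma isSpec : IsSpec bioOfProp.{u} P.specGerms P.specUnit :=
  IsSpec.of_equiv P.isSheaf_specGerms (Equiv.refl P.toCBio.Prime)
    (fun V => (congrArg IsOpen (Set.image_id (V.1 : Set P.toCBio.Prime))).mpr V.2)
    P.isLocz_specUnit

lemma specUnit_map {P Q : CPrp.{u}} (f : P ⟶ Q) :
    P.specUnit ≫ pb (specPSMap f) ⊤ = f ≫ Q.specUnit :=
  Prp.Hom.ext (funext fun _ => funext fun _ => funext fun s => Sec.ext fun y =>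
      Loc.map_mk_one _ _ (on_act f) (compl_comap f y.1) s)

end CPrp

instance : AffSpec bioOfProp.{u} specProp.{u} where
  germs P := P.specGerms
  unit P := P.specUnit
  isSpec P := P.isSpec
  unit_map f := CPrp.specUnit_map f
  isLocalHom_map {P Q} f := P.isSpec.isLocalHom Q.specGerms _ fun w s hs => by
    have e := (hom_ext_sc (U := bioOfProp.{u}) (CPrp.specUnit_map f) s).trans (sc_comp f Q.specUnit s)
    refine ((P.isLocz_specUnit _).unitAt_iff s).2 ?_
    exact ((Q.isLocz_specUnit w).unitAt_iff _).1
      (Eq.mp (congrArg (Q.specGerms.UnitAt (U := bioOfProp.{u}) w) e) hs)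

/-! ### The full embedding of affine spectra -/

section
variable {C : Type (u + 1)} [Category.{u} C] [AlgCat C] {U : C ⥤ CBio.{u}} [Geo U]
  (Sp : Cᵒᵖ ⥤ PSp C) [AffSpec U Sp]

variable (U) in
/-- The affine spectrum as a functor to the spaces with a sheaf with local stalks. -/
def spec : Cᵒᵖ ⥤ LocSp U where
  obj A := LocSp.ofGerms (U := U) (X := Sp.obj A) (AffSpec.germs U A.unop)
    (AffSpec.isSpec (U := U) (Sp := Sp) A.unop).isSheaf
    (AffSpec.isSpec (U := U) (Sp := Sp) A.unop).isLocal
  map f := ⟨Sp.map f, (LocSp.isLocalOnStalks_iff _ _ _).2 (AffSpec.isLocalHom_map f.unop)⟩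
  map_id A := LocSp.Hom.ext (Sp.map_id A)
  map_comp f g := LocSp.Hom.ext (Sp.map_comp f g)

variable {Sp} in
lemma exists_homToSpec {A : C} {W : LocSp U} (θ : A ⟶ Sect W.toPresheafedSpace ⊤) :
    ∃ ψ : W ⟶ (spec U Sp).obj (op A), AffSpec.unit U (Sp := Sp) A ≫ pb ψ.hom ⊤ = θ := by
  obtain ⟨ψ, h, e⟩ := (AffSpec.isSpec (U := U) (Sp := Sp) A).exists_lift _
    (W.isSheaf (Germs.canonical _)) (W.isLocal (Germs.canonical _)) θ
  exact ⟨⟨ψ, (LocSp.isLocalOnStalks_iff (Germs.canonical _) _ _).2 h⟩, e⟩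

variable {Sp} in
lemma homToSpec_ext {A : C} {W : LocSp U} {ψ ψ' : W ⟶ (spec U Sp).obj (op A)}
    (h : AffSpec.unit U (Sp := Sp) A ≫ pb ψ.hom ⊤ = AffSpec.unit U (Sp := Sp) A ≫ pb ψ'.hom ⊤) :
    ψ = ψ' :=
  LocSp.Hom.ext ((AffSpec.isSpec (U := U) (Sp := Sp) A).hom_ext (Germs.canonical _)
    (W.isSheaf _) ((LocSp.isLocalOnStalks_iff (Germs.canonical _) _ _).1 ψ.isLocal)
    ((LocSp.isLocalOnStalks_iff (Germs.canonical _) _ _).1 ψ'.isLocal) h)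

lemma isIso_unit (A : C) : IsIso (AffSpec.unit U (Sp := Sp) A) := (AffSpec.isSpec A).isIso

instance : (spec U Sp).Faithful where
  map_injective {A B f g} h := by
    obtain ⟨A⟩ := A
    obtain ⟨B⟩ := B
    have h' : Sp.map f = Sp.map g := congrArg LocSp.Hom.hom h
    have e := (AffSpec.unit_map (U := U) (Sp := Sp) f.unop).symm.trans
      ((congrArg (β := B ⟶ Sect (Sp.obj (op A)) ⊤) (fun z : Sp.obj (op A) ⟶ Sp.obj (op B) =>
        AffSpec.unit U (Sp := Sp) B ≫ pb z ⊤) h').trans (AffSpec.unit_map g.unop))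
    have := isIso_unit (U := U) Sp B
    have := isIso_unit (U := U) Sp A
    exact Quiver.Hom.unop_inj ((cancel_mono (AffSpec.unit U (Sp := Sp) A)).1 e)

instance : (spec U Sp).Full where
  map_surjective {A B} ψ := by
    obtain ⟨A⟩ := A
    obtain ⟨B⟩ := B
    have := isIso_unit (U := U) Sp A
    -- The map on global sections, read as a morphism to `A` through the isomorphism of `A` with the
    -- sections of its spectrum. A morphism to a spectrum is determined by it.
    let θ : B ⟶ Sect (Sp.obj (op A)) ⊤ := AffSpec.unit U (Sp := Sp) B ≫ pb ψ.hom ⊤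
    let f : B ⟶ A := θ ≫ inv (AffSpec.unit U (Sp := Sp) A)
    refine ⟨f.op, homToSpec_ext ?_⟩
    refine (AffSpec.unit_map (U := U) (Sp := Sp) f).trans ?_
    exact (Category.assoc _ _ _).trans ((congrArg (fun z => θ ≫ z) (IsIso.inv_hom_id _)).trans
      (Category.comp_id θ))

variable (U) in
/-- The schemes. -/
abbrev Sch := (LocSp.IsLocallyAffine U Sp).FullSubcategory

lemma isLocallyAffine_spec (A : Cᵒᵖ) : LocSp.IsLocallyAffine U Sp ((spec U Sp).obj A) :=
  fun x => ⟨⊤, A.unop, trivial, ⟨PresheafedSpace.restrictTopIso _⟩⟩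

variable (U) in
/-- The affine spectrum as a functor to schemes. -/
def specSch : Cᵒᵖ ⥤ Sch U Sp :=
  (LocSp.IsLocallyAffine U Sp).lift (spec U Sp) (isLocallyAffine_spec Sp)

instance : (specSch U Sp).Full := inferInstanceAs (ObjectProperty.lift _ _ _).Full
instance : (specSch U Sp).Faithful := inferInstanceAs (ObjectProperty.lift _ _ _).Faithful

lemma specSch_forget :
    Nonempty (specSch U Sp ⋙ ObjectProperty.ι _ ⋙ LocSp.forget U ≅ Sp) :=
  ⟨Iso.refl _⟩

end

/-! ### Localization of a space at primes of its stalks -/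

section
variable {C : Type (u + 1)} [Category.{u} C] [AlgCat C]

/-- Objects of sections are cut out of a product of stalks by a predicate `Q` stable under the
operations. In an abstract `C` this is the way to define a structure by its elements. -/
lemma exists_sections {ι : Type u} (N : ι → C) (Q : ∀ k, Set (∀ i, El k (N i)))
    (hQ : ∀ o (x : ∀ a i, El ((AlgCat.S C).dom o a) (N i)), (∀ a, x a ∈ Q _) →
      (fun i => opE o (fun a => x a i)) ∈ Q _) :
    ∃ (B : C) (e : ∀ i, B ⟶ N i), (∀ k (a b : El k B), (∀ i, ap (e i) a = ap (e i) b) → a = b) ∧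
      (∀ k s, s ∈ Q k ↔ ∃ b, ∀ i, ap (e i) b = s i) ∧
      ∀ (A : C) (f : ∀ i, A ⟶ N i), (∀ k (a : El k A), (fun i => ap (f i) a) ∈ Q k) →
        ∃ g : A ⟶ B, ∀ i, g ≫ e i = f i := by
  obtain ⟨P, p, hp, hs, hl⟩ := exists_product N
  obtain ⟨B, j, hj, hB⟩ := exists_sub P (fun k => {x | (fun i => ap (p i) x) ∈ Q k}) fun o x hx => by
    have := hQ o (fun a i => ap (p i) (x a)) hx
    simpa only [Set.mem_ofPred_eq, ap_op] using this
  refine ⟨B, fun i => j ≫ p i, fun k a b h => hj k (hp _ _ _ fun i => ?_), fun k s => ?_,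
    fun A f hf => ?_⟩
  · rw [← ap_comp, h, ap_comp]
  · obtain ⟨x, hx⟩ := hs k s
    obtain rfl : (fun i => ap (p i) x) = s := funext hx
    refine (hB k x).trans (exists_congr fun b => ⟨fun h i => by rw [ap_comp, h], fun h =>
      hp _ _ _ fun i => ?_⟩)
    rw [← ap_comp, h]
  · obtain ⟨g, hg⟩ := hl A f
    obtain ⟨g', hg'⟩ := exists_factor j hj g fun k x => (hB k _).1 (by
      change (fun i => ap (p i) (ap g x)) ∈ Q k
      simp only [← ap_comp, hg]
      exact hf k x)
    exact ⟨g', fun i => by rw [← Category.assoc, hg', hg]⟩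

variable {U : C ⥤ CBio.{u}} [Geo U]

namespace Germs
variable {Y : PSp C} (H : Germs Y) (M : ∀ t, Set ((U.obj (H.L t)).Prime))

/-- A point `t` of `Y` with a prime of the stalk at `t` from the set `M t`. -/
structure FracPt where
  pt : Y
  prime : (U.obj (H.L pt)).Prime
  mem : prime ∈ M pt

namespace FracPt
variable {H M} (z : FracPt H M)

/-- The localization of the stalk at the prime. -/
def stalk : C := Geo.loc (U := U) (H.L z.pt) z.prime.compl

/-- The morphism to the localization. -/
def loc : H.L z.pt ⟶ z.stalk := Geo.locHom (U := U) (H.L z.pt) z.prime.compl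

lemma isLocz : IsLocz (U := U) z.loc z.prime.compl := isLocz_locHom U _ _

/-- The localized germs of sections. -/
def ev (V : Opens Y) (hz : z.pt ∈ V) : Sect Y V ⟶ z.stalk := H.ev V z.pt hz ≫ z.loc

lemma ap_ev_rs {V W : Opens Y} (h : W ≤ V) (hz : z.pt ∈ W) {k : (AlgCat.S C).K}
    (a : El k (Sect Y V)) : ap (z.ev W hz) (ap (rs Y h) a) = ap (z.ev V (h hz)) a := by
  rw [ev, ap_comp, H.ev_rs, ← ap_comp]
  rfl

lemma sc_ev_rs {V W : Opens Y} (h : W ≤ V) (hz : z.pt ∈ W) (f : (U.obj (Sect Y V)).R 1) :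
    sc U (z.ev W hz) (sc U (rs Y h) f) = sc U (z.ev V (h hz)) f := by
  rw [ev, sc_comp, H.ev_rs_sc, ← sc_comp]
  rfl

/-- The localized germ of `f` is invertible. -/
def Unit {V : Opens Y} (f : (U.obj (Sect Y V)).R 1) : Prop :=
  ∃ hz : z.pt ∈ V, IsUnit (sc U (z.ev V hz) f)

lemma unit_iff {V : Opens Y} (f : (U.obj (Sect Y V)).R 1) :
    z.Unit f ↔ ∃ hz : z.pt ∈ V, sc U (H.ev V z.pt hz) f ∉ z.prime.carrier := by
  refine exists_congr fun hz => ?_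
  rw [ev, sc_comp]
  exact z.isLocz.isUnit_iff_of_prime rfl _

lemma unit_rs {V W : Opens Y} (h : W ≤ V) (f : (U.obj (Sect Y V)).R 1) :
    z.Unit (sc U (rs Y h) f) ↔ z.pt ∈ W ∧ z.Unit f := by
  constructor
  · rintro ⟨hz, hf⟩
    rw [sc_ev_rs] at hf
    exact ⟨hz, _, hf⟩
  · rintro ⟨hz, _, hf⟩
    exact ⟨hz, by rwa [sc_ev_rs]⟩

lemma unit_mul {V : Opens Y} (f g : (U.obj (Sect Y V)).R 1) :
    z.Unit (f * g) ↔ z.Unit f ∧ z.Unit g := by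
  constructor
  · rintro ⟨hz, h⟩
    rw [map_mul] at h
    exact ⟨⟨hz, isUnit_of_mul_isUnit_left h⟩, ⟨hz, isUnit_of_mul_isUnit_right h⟩⟩
  · rintro ⟨⟨hz, h⟩, ⟨_, h'⟩⟩
    exact ⟨hz, by rw [map_mul]; exact h.mul h'⟩

lemma unit_one {V : Opens Y} : z.Unit (1 : (U.obj (Sect Y V)).R 1) ↔ z.pt ∈ V :=
  ⟨fun h => h.1, fun h => ⟨h, by rw [map_one]; exact isUnit_one⟩⟩

end FracPt

instance : TopologicalSpace (FracPt H M) :=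
  TopologicalSpace.generateFrom {s | ∃ (V : Opens Y) (f : (U.obj (Sect Y V)).R 1), s = {z | z.Unit f}}

variable {H M}

lemma isOpen_fracUnit {V : Opens Y} (f : (U.obj (Sect Y V)).R 1) :
    IsOpen {z : FracPt H M | z.Unit f} :=
  TopologicalSpace.isOpen_generateFrom_of_mem ⟨V, f, rfl⟩

lemma exists_fracUnit_subset {O : Set (FracPt H M)} (hO : IsOpen O) {z : FracPt H M} (hz : z ∈ O) :
    ∃ (V : Opens Y) (f : (U.obj (Sect Y V)).R 1), z.Unit f ∧ ∀ w : FracPt H M, w.Unit f → w ∈ O := by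
  have hb : TopologicalSpace.IsTopologicalBasis {s : Set (FracPt H M) |
      ∃ (V : Opens Y) (f : (U.obj (Sect Y V)).R 1), s = {z | z.Unit f}} :=
    { exists_subset_inter := by
        rintro _ ⟨V, f, rfl⟩ _ ⟨W, g, rfl⟩ x ⟨hf, hg⟩
        refine ⟨_, ⟨V ⊓ W, sc U (rs Y inf_le_left) f * sc U (rs Y inf_le_right) g, rfl⟩,
          (x.unit_mul _ _).2 ⟨(x.unit_rs _ _).2 ⟨Opens.mem_inf.2 ⟨hf.1, hg.1⟩, hf⟩,
            (x.unit_rs _ _).2 ⟨Opens.mem_inf.2 ⟨hf.1, hg.1⟩, hg⟩⟩, fun y hy => ?_⟩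
        obtain ⟨h₁, h₂⟩ := (y.unit_mul _ _).1 hy
        exact ⟨((y.unit_rs _ _).1 h₁).2, ((y.unit_rs _ _).1 h₂).2⟩
      sUnion_eq := Set.eq_univ_of_forall fun z => Set.mem_sUnion.2
        ⟨_, ⟨⊤, 1, rfl⟩, z.unit_one.2 trivial⟩
      eq_generateFrom := rfl }
  obtain ⟨_, ⟨V, f, rfl⟩, hf, h⟩ := hb.exists_subset_of_mem_open hz hO
  exact ⟨V, f, hf, h⟩

/-- The family is locally given by fractions. -/
def IsFracSec (O : Opens (FracPt H M)) {k : (AlgCat.S C).K} (s : ∀ z : O, El k z.1.stalk) : Prop :=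
  ∀ z : O, ∃ (V : Opens Y) (f : (U.obj (Sect Y V)).R 1) (b : El k (Sect Y V)), z.1.Unit f ∧
    ∀ (w : O) (hw : w.1.pt ∈ V), w.1.Unit f → sc U (w.1.ev V hw) f • s w = ap (w.1.ev V hw) b

/-- Finitely many sections have a common denominator near a point, the product of the individual
ones; each numerator is multiplied by the other denominators. -/
lemma IsFracSec.exists_common {O : Opens (FracPt H M)} {ι : Type} [Finite ι]
    {k : ι → (AlgCat.S C).K} {s : ∀ a (z : O), El (k a) z.1.stalk} (hs : ∀ a, IsFracSec O (s a))
    (z : O) : ∃ (V : Opens Y) (f : (U.obj (Sect Y V)).R 1) (b : ∀ a, El (k a) (Sect Y V)),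
      z.1.Unit f ∧ ∀ (w : O) (hw : w.1.pt ∈ V), w.1.Unit f → ∀ a,
        sc U (w.1.ev V hw) f • s a w = ap (w.1.ev V hw) (b a) := by
  classical
  have := Fintype.ofFinite ι
  choose V f b hf hb using fun a => hs a z
  let V' : Opens Y := ⟨⋂ a, (V a : Set Y), isOpen_iInter_of_finite fun a => (V a).2⟩
  have hV : ∀ a, V' ≤ V a := fun a => Set.iInter_subset _ a
  have hmem : ∀ {w : FracPt H M}, (∀ a, w.pt ∈ V a) → w.pt ∈ V' := fun h => Set.mem_iInter.2 h
  have key : ∀ (w : FracPt H M) (F : Finset ι), (∀ a ∈ F, w.Unit (f a)) → w.pt ∈ V' →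
      w.Unit (∏ a ∈ F, sc U (rs Y (hV a)) (f a)) := fun w F h hw =>
    ⟨hw, by
      rw [map_prod, IsUnit.prod_iff]
      intro a ha
      exact ((w.unit_rs (hV a) _).2 ⟨hw, h a ha⟩).choose_spec⟩
  refine ⟨V', ∏ a, sc U (rs Y (hV a)) (f a), fun a => (∏ a' ∈ Finset.univ.erase a,
    sc U (rs Y (hV a')) (f a')) • ap (rs Y (hV a)) (b a), key _ _ (fun a _ => hf a)
      (hmem fun a => (hf a).1), fun w hw hu a => ?_⟩
  have hua : w.1.Unit (f a) := by
    rw [← Finset.prod_erase_mul _ _ (Finset.mem_univ a)] at hu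
    exact ((w.1.unit_rs _ _).1 ((w.1.unit_mul _ _).1 hu).2).2
  rw [ap_smul, w.1.ap_ev_rs, ← hb a w (hV a hw) hua, smul_smul, ← w.1.sc_ev_rs (hV a) hw,
    ← map_mul, Finset.prod_erase_mul _ _ (Finset.mem_univ a)]

/-- Families that are locally fractions are stable under operations: with common denominator `f`, an
operation of degree `d` yields a fraction with denominator `f ^ d`. -/
lemma exists_fracSections (O : Opens (FracPt H M)) :
    ∃ (B : C) (e : ∀ z : O, B ⟶ z.1.stalk),
      (∀ k (a b : El k B), (∀ i, ap (e i) a = ap (e i) b) → a = b) ∧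
      (∀ k (s : ∀ z : O, El k z.1.stalk), IsFracSec O s ↔ ∃ b, ∀ i, ap (e i) b = s i) ∧
      ∀ (A : C) (f : ∀ z : O, A ⟶ z.1.stalk), (∀ k (a : El k A), IsFracSec O fun z => ap (f z) a) →
        ∃ g : A ⟶ B, ∀ i, g ≫ e i = f i := by
  refine exists_sections _ (fun k => {s | IsFracSec O s}) fun o x hx z => ?_
  obtain ⟨V, f, b, hf, h⟩ := IsFracSec.exists_common (O := O) (s := fun a => x a) hx z
  obtain ⟨d, hd⟩ := exists_op_smul U o
  -- The additional factor `f` keeps the exponent positive, so that the denominator is invertible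
  -- only where `f` is, even when `d = 0`.
  refine ⟨V, f ^ (d + 1), f • opE o b, ⟨hf.choose, ?_⟩, fun w hw hu => ?_⟩
  · rw [map_pow]
    exact hf.choose_spec.pow _
  · have hu : w.1.Unit f := by
      obtain ⟨_, hu⟩ := hu
      rw [map_pow, isUnit_pow_iff (Nat.succ_ne_zero d)] at hu
      exact ⟨hw, hu⟩
    rw [map_pow, pow_succ', mul_smul, ← hd, ap_smul, ap_op]
    congr 2
    exact funext (h w hw hu)

/-- The sections that are locally given by fractions. -/
def fracSect (O : Opens (FracPt H M)) : C := (exists_fracSections O).choose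

/-- The value of a section at a point. -/
def fracEv (O : Opens (FracPt H M)) (z : FracPt H M) (hz : z ∈ O) : fracSect O ⟶ z.stalk :=
  (exists_fracSections O).choose_spec.choose ⟨z, hz⟩

lemma fracSect_ext {O : Opens (FracPt H M)} {k : (AlgCat.S C).K} {a b : El k (fracSect O)}
    (h : ∀ z hz, ap (fracEv O z hz) a = ap (fracEv O z hz) b) : a = b :=
  (exists_fracSections O).choose_spec.choose_spec.1 k a b fun z => h z.1 z.2

lemma fracSect_hom_ext {O : Opens (FracPt H M)} {A : C} {f g : A ⟶ fracSect O}
    (h : ∀ z hz, f ≫ fracEv O z hz = g ≫ fracEv O z hz) : f = g :=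
  hom_ext_ap fun k a => fracSect_ext fun z hz => by rw [← ap_comp, h, ap_comp]

lemma isFracSec_fracEv {O : Opens (FracPt H M)} {k : (AlgCat.S C).K} (a : El k (fracSect O)) :
    IsFracSec O fun z => ap (fracEv O z.1 z.2) a :=
  ((exists_fracSections O).choose_spec.choose_spec.2.1 k _).2 ⟨a, fun _ => rfl⟩

lemma exists_fracSect {O : Opens (FracPt H M)} {k : (AlgCat.S C).K} {s : ∀ z : O, El k z.1.stalk}
    (hs : IsFracSec O s) : ∃ a : El k (fracSect O), ∀ z hz, ap (fracEv O z hz) a = s ⟨z, hz⟩ := by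
  obtain ⟨a, ha⟩ := ((exists_fracSections O).choose_spec.choose_spec.2.1 k _).1 hs
  exact ⟨a, fun z hz => ha ⟨z, hz⟩⟩

lemma exists_toFracSect {O : Opens (FracPt H M)} {A : C} (f : ∀ z : O, A ⟶ z.1.stalk)
    (h : ∀ k (a : El k A), IsFracSec O fun z => ap (f z) a) :
    ∃ g : A ⟶ fracSect O, ∀ z hz, g ≫ fracEv O z hz = f ⟨z, hz⟩ := by
  obtain ⟨g, hg⟩ := (exists_fracSections O).choose_spec.choose_spec.2.2 A f h
  exact ⟨g, fun z hz => hg ⟨z, hz⟩⟩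

lemma IsFracSec.mono {O O' : Opens (FracPt H M)} (h : O' ≤ O) {k : (AlgCat.S C).K}
    {s : ∀ z : O, El k z.1.stalk} (hs : IsFracSec O s) : IsFracSec O' fun z => s ⟨z.1, h z.2⟩ :=
  fun z => by
    obtain ⟨V, f, b, hf, hb⟩ := hs ⟨z.1, h z.2⟩
    exact ⟨V, f, b, hf, fun w hw hu => hb ⟨w.1, h w.2⟩ hw hu⟩

lemma exists_fracRes {O O' : Opens (FracPt H M)} (h : O' ≤ O) :
    ∃ g : fracSect O ⟶ fracSect O', ∀ z hz, g ≫ fracEv O' z hz = fracEv O z (h hz) :=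
  exists_toFracSect (fun z => fracEv O z.1 (h z.2)) fun _ a => (isFracSec_fracEv a).mono h

variable (H M) in
/-- The space obtained by localization at the primes from `M`. -/
def fracSp : PSp C where
  carrier := TopCat.of (FracPt H M)
  presheaf :=
    { obj := fun O => fracSect O.unop
      map := fun i => (exists_fracRes (leOfHom i.unop)).choose
      map_id := fun O => fracSect_hom_ext fun z hz =>
        ((exists_fracRes (leOfHom (𝟙 O : O ⟶ O).unop)).choose_spec z hz).trans
          (Category.id_comp _).symm
      map_comp := fun {O O' O''} i j => fracSect_hom_ext fun z hz => by
        rw [Category.assoc, (exists_fracRes (leOfHom (i ≫ j).unop)).choose_spec z hz,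
          (exists_fracRes (leOfHom j.unop)).choose_spec z hz,
          (exists_fracRes (leOfHom i.unop)).choose_spec z (leOfHom j.unop hz)] }

lemma fracRes_ev {O O' : Opens (FracPt H M)} (h : O' ≤ O) (z : FracPt H M) (hz : z ∈ O') :
    rs (fracSp H M) h ≫ fracEv O' z hz = fracEv O z (h hz) :=
  (exists_fracRes h).choose_spec z hz

lemma ap_fracRes_ev {O O' : Opens (FracPt H M)} (h : O' ≤ O) (z : FracPt H M) (hz : z ∈ O')
    {k : (AlgCat.S C).K} (a : El k (fracSect O)) :
    ap (fracEv O' z hz) (ap (rs (fracSp H M) h) a) = ap (fracEv O z (h hz)) a :=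
  (ap_comp _ _ _).symm.trans (congrArg (fun g => ap g a) (fracRes_ev h z hz))

lemma exists_fracGerm {z : FracPt H M} {k : (AlgCat.S C).K} (y : El k z.stalk) :
    ∃ (O : Opens (FracPt H M)) (hz : z ∈ O) (a : El k (fracSect O)), ap (fracEv O z hz) a = y := by
  obtain ⟨s, hs, x, hx⟩ := z.isLocz.surj k y
  obtain ⟨V, hV, f, rfl⟩ := H.surj_sc U s
  obtain ⟨W, hW, b, rfl⟩ := H.surj x
  have hVW : z.pt ∈ V ⊓ W := Opens.mem_inf.2 ⟨hV, hW⟩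
  let g := sc U (rs Y (inf_le_left : V ⊓ W ≤ V)) f
  let c := ap (rs Y (inf_le_right : V ⊓ W ≤ W)) b
  have hg : z.Unit g := (z.unit_rs _ _).2 ⟨hVW, (z.unit_iff f).2 ⟨hV, hs⟩⟩
  have hgy : sc U (z.ev _ hg.choose) g • y = ap (z.ev _ hg.choose) c := by
    rw [z.sc_ev_rs, z.ap_ev_rs, FracPt.ev, FracPt.ev, sc_comp, ap_comp, hx]
  have hu : ∀ w : (⟨_, isOpen_fracUnit g⟩ : Opens (FracPt H M)), w.1.Unit g := fun w => w.2
  -- The section `c / g` on the open set where `g` is invertible; at `z` it equals `y`.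
  obtain ⟨a, ha⟩ := exists_fracSect (O := ⟨_, isOpen_fracUnit g⟩)
    (s := fun w => (↑(hu w).choose_spec.unit⁻¹ : (U.obj w.1.stalk).R 1) • ap (w.1.ev _ (hu w).choose) c)
    fun w => ⟨_, g, c, hu w, fun w' hw' hu' => by
      rw [smul_smul, IsUnit.mul_val_inv, one_smul]⟩
  refine ⟨_, hg, a, hg.choose_spec.smul_left_cancel.1 ?_⟩
  rw [ha z hg, hgy, smul_smul, IsUnit.mul_val_inv, one_smul]

/-- Write both sections with a common denominator `f`. If they agree at `z`, some `g` outside the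
prime equalizes the numerators, first in the stalk of `Y` and then on an open set. The sections
agree where `f` and `g` are both invertible. -/
lemma exists_fracRes_eq {O : Opens (FracPt H M)} {z : FracPt H M} {hz : z ∈ O} {k : (AlgCat.S C).K}
    {a b : El k (fracSect O)} (h : ap (fracEv O z hz) a = ap (fracEv O z hz) b) :
    ∃ (O' : Opens (FracPt H M)) (h : O' ≤ O), z ∈ O' ∧
      ap (rs (fracSp H M) h) a = ap (rs (fracSp H M) h) b := by
  obtain ⟨V, f, c, hf, hc⟩ := IsFracSec.exists_common (O := O) (ι := Bool) (k := fun _ => k)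
    (s := fun i w => ap (fracEv O w.1 w.2) (if i then a else b))
    (fun i => isFracSec_fracEv _) ⟨z, hz⟩
  have hV : z.pt ∈ V := hf.1
  have e : ap (z.ev V hV) (c true) = ap (z.ev V hV) (c false) := by
    rw [← hc ⟨z, hz⟩ hV hf true, ← hc ⟨z, hz⟩ hV hf false]
    exact congrArg _ h
  rw [FracPt.ev, ap_comp, ap_comp] at e
  obtain ⟨s, hs, e⟩ := z.isLocz.eq k _ _ e
  obtain ⟨V₁, hV₁, g, rfl⟩ := H.surj_sc U s
  have hVV : z.pt ∈ V ⊓ V₁ := Opens.mem_inf.2 ⟨hV, hV₁⟩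
  rw [← H.ev_rs_sc (inf_le_right : V ⊓ V₁ ≤ V₁) hVV, ← H.ev_rs (inf_le_left : V ⊓ V₁ ≤ V) hVV,
    ← H.ev_rs (inf_le_left : V ⊓ V₁ ≤ V) hVV, ← ap_smul, ← ap_smul] at e
  obtain ⟨W, hW, hzW, e⟩ := H.near e
  rw [ap_smul, ap_smul, ← sc_comp, ← ap_comp, ← ap_comp, rs_rs, rs_rs] at e
  let f' := sc U (rs Y (hW.trans inf_le_left)) f
  let g' := sc U (rs Y (hW.trans inf_le_right)) g
  have hg : z.Unit g := (z.unit_iff g).2 ⟨hV₁, hs⟩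
  refine ⟨O ⊓ ⟨_, isOpen_fracUnit (f' * g')⟩, inf_le_left, ⟨hz, (z.unit_mul _ _).2
    ⟨(z.unit_rs _ _).2 ⟨hzW, hf⟩, (z.unit_rs _ _).2 ⟨hzW, hg⟩⟩⟩, fracSect_ext fun w hw => ?_⟩
  obtain ⟨hwO, hu⟩ := hw
  obtain ⟨huf, hug⟩ := (w.unit_mul _ _).1 hu
  obtain ⟨hwW, huf⟩ := (w.unit_rs _ _).1 huf
  have hwV : w.pt ∈ V := huf.1
  refine (ap_fracRes_ev inf_le_left w ⟨hwO, hu⟩ a).trans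
    (Eq.trans ?_ (ap_fracRes_ev inf_le_left w ⟨hwO, hu⟩ b).symm)
  refine hug.choose_spec.smul_left_cancel.1 (huf.choose_spec.smul_left_cancel.1 ?_)
  have e1 := hc ⟨w, hwO⟩ hwV huf true
  have e2 := hc ⟨w, hwO⟩ hwV huf false
  have e3 := congrArg (ap (w.ev W hwW)) e
  rw [ap_smul, ap_smul, w.ap_ev_rs, w.ap_ev_rs, ← e1, ← e2] at e3
  rw [smul_comm, smul_comm _ _ (ap _ b)]
  exact e3

variable (H M) in
/-- The stalks of the localized space. -/
def fracGerms : Germs (fracSp H M) where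
  L z := FracPt.stalk z
  ev O z hz := fracEv O z hz
  rs_ev h z hz := fracRes_ev h z hz
  surj y := exists_fracGerm y
  near h := exists_fracRes_eq h

/-- A fraction that represents a section over `W` is valid on `W` only. Multiplying numerator and
denominator by some `g` with unit locus inside `W` makes it a fraction over `O`. -/
lemma isFracSec_of_locally {O : Opens (FracPt H M)} {k : (AlgCat.S C).K}
    {s : ∀ z : O, El k z.1.stalk} (hs : ∀ z : O, ∃ (W : Opens (FracPt H M)) (h : W ≤ O), z.1 ∈ W ∧
      ∃ a : El k (fracSect W), ∀ w hw, ap (fracEv W w hw) a = s ⟨w, h hw⟩) : IsFracSec O s := by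
  intro z
  obtain ⟨W, hW, hz, a, ha⟩ := hs z
  obtain ⟨V, f, b, hf, hb⟩ := isFracSec_fracEv a ⟨z.1, hz⟩
  obtain ⟨V', g, hg, hgW⟩ := exists_fracUnit_subset W.2 hz
  have hVV : z.1.pt ∈ V ⊓ V' := Opens.mem_inf.2 ⟨hf.1, hg.1⟩
  refine ⟨V ⊓ V', sc U (rs Y (inf_le_right : V ⊓ V' ≤ V')) g *
    sc U (rs Y (inf_le_left : V ⊓ V' ≤ V)) f,
    sc U (rs Y (inf_le_right : V ⊓ V' ≤ V')) g • ap (rs Y (inf_le_left : V ⊓ V' ≤ V)) b,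
    (z.1.unit_mul _ _).2 ⟨(z.1.unit_rs _ _).2 ⟨hVV, hg⟩, (z.1.unit_rs _ _).2 ⟨hVV, hf⟩⟩,
    fun w hw hu => ?_⟩
  obtain ⟨hug, huf⟩ := (w.1.unit_mul _ _).1 hu
  have hwW : w.1 ∈ W := hgW _ ((w.1.unit_rs _ _).1 hug).2
  have := hb ⟨w.1, hwW⟩ (Opens.mem_inf.1 hw).1 ((w.1.unit_rs _ _).1 huf).2
  rw [map_mul, mul_smul, ap_smul, w.1.sc_ev_rs inf_le_left, w.1.ap_ev_rs, ← this]
  exact congrArg _ (congrArg _ (ha w.1 hwW).symm)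

lemma isSheaf_fracGerms : (fracGerms H M).IsSheaf where
  sep h := fracSect_ext h
  glue {O k} s hs := exists_fracSect (s := fun z => s z.1 z.2)
    (isFracSec_of_locally fun z => hs z.1 z.2)

variable (H M)

lemma continuous_fracPt : Continuous fun z : FracPt H M => z.pt :=
  continuous_def.2 fun V hV => by
    have : (fun z : FracPt H M => z.pt) ⁻¹' V =
        {z | z.Unit (1 : (U.obj (Sect Y ⟨V, hV⟩)).R 1)} :=
      Set.ext fun z => (z.unit_one (V := ⟨V, hV⟩)).symm
    rw [this]
    exact isOpen_fracUnit _

lemma exists_fracMap (V : Opens Y) : ∃ g : Sect Y V ⟶ fracSect (⟨_, V.2.preimage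
    (continuous_fracPt H M)⟩ : Opens (FracPt H M)), ∀ z hz, g ≫ fracEv _ z hz = z.ev V hz :=
  exists_toFracSect (fun z => z.1.ev V z.2) fun k a z =>
    ⟨V, 1, a, z.1.unit_one.2 z.2, fun w hw _ => by rw [map_one, one_smul]⟩

lemma exists_fracProj : ∃ π : fracSp H M ⟶ Y, IsFrac U (fracGerms H M) H π ∧
    (∀ z, π.base z = z.pt) ∧ ∀ (z : FracPt H M) (V : Opens Y) (f : (U.obj (Sect Y V)).R 1),
      (fracGerms H M).UnitAt z (sc U (pb π V) f) ↔
        ∃ hz : z.pt ∈ V, sc U (H.ev V z.pt hz) f ∉ z.prime.carrier := by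
  let q : (fracSp H M).carrier ⟶ Y.carrier := TopCat.ofHom ⟨_, continuous_fracPt H M⟩
  let π : fracSp H M ⟶ Y := ⟨q, ⟨fun V => (exists_fracMap H M V.unop).choose, fun V W i => by
    refine fracSect_hom_ext (O := (Opens.map q).obj W.unop) fun z hz => ?_
    have h1 := (exists_fracMap H M W.unop).choose_spec z hz
    have h2 := (exists_fracMap H M V.unop).choose_spec z (leOfHom i.unop hz)
    refine (Category.assoc _ _ _).trans ((congrArg (fun y => Y.presheaf.map i ≫ y) h1).trans ?_)
    refine Eq.trans ?_ (Category.assoc _ _ _).symm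
    refine Eq.trans ?_ (congrArg (fun y => _ ≫ y)
      (fracRes_ev (leOfHom ((Opens.map q).map i.unop)) z hz)).symm
    refine Eq.trans ?_ h2.symm
    exact (Category.assoc _ _ _).symm.trans (congrArg (fun y => y ≫ z.loc)
      (H.rs_ev (leOfHom i.unop) z.pt hz))⟩⟩
  have hπ : ∀ V (z : FracPt H M) (hz : z.pt ∈ V), pb π V ≫ fracEv (pre π V) z hz = z.ev V hz :=
    fun V z hz => (exists_fracMap H M V).choose_spec z hz
  have hun : ∀ (z : FracPt H M) (V : Opens Y) (f : (U.obj (Sect Y V)).R 1),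
      (fracGerms H M).UnitAt z (sc U (pb π V) f) ↔ z.Unit f := fun z V f => by
    refine exists_congr fun hz => ?_
    exact iff_of_eq (congrArg IsUnit ((sc_comp (pb π V) (fracEv (pre π V) z hz) f).symm.trans
      (congrArg (fun g => sc U g f) (hπ V z hz))))
  have hs : ∀ z : FracPt H M, (fracGerms H M).smap H π z = z.loc := fun z => H.hom_ext fun V hz =>
    ((fracGerms H M).ev_smap H π V z hz).trans (hπ V z hz)
  refine ⟨π, ⟨fun (z : FracPt H M) => ?_, fun O z hz => ?_, fun z z' h h' => ?_⟩, fun _ => rfl, fun z V f =>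
    (hun z V f).trans (z.unit_iff f)⟩
  · have key : ∀ g : H.L z.pt ⟶ z.stalk, g = z.loc →
        IsLocz g ((IsUnit.submonoid ((U.obj z.stalk).R 1)).comap (sc U g)) := by
      rintro _ rfl
      exact z.isLocz.comap_units
    exact key _ (hs z)
  · obtain ⟨V, f, h₁, h₂⟩ := exists_fracUnit_subset O.2 hz
    exact ⟨V, f, (hun _ _ _).2 h₁, fun w hw => h₂ w ((hun _ _ _).1 hw)⟩
  · have h' : ∀ (V : Opens Y) (f : (U.obj (Sect Y V)).R 1),
        FracPt.Unit z f ↔ FracPt.Unit z' f := fun V f => by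
      exact (hun z V f).symm.trans ((h' V f).trans (hun z' V f))
    obtain ⟨t, p, hp⟩ := z
    obtain ⟨t', p', hp'⟩ := z'
    obtain rfl : t = t' := h
    obtain rfl : p = p' := CBio.Prime.ext (Set.ext fun s => by
      obtain ⟨V, hV, f, rfl⟩ := H.surj_sc U s
      have := h' V f
      rw [FracPt.unit_iff, FracPt.unit_iff] at this
      exact not_iff_not.1 ⟨fun h => (this.1 ⟨hV, h⟩).2, fun h => (this.2 ⟨hV, h⟩).2⟩)
    rfl

end Germs

/-- The localization of a space at primes of its stalks. -/
lemma exists_localization {Y : PSp C} (H : Germs Y) (M : ∀ t, Set ((U.obj (H.L t)).Prime)) :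
    ∃ (Z : LocSp U) (π : Z.toPresheafedSpace ⟶ Y) (G : Germs Z.toPresheafedSpace),
      (∀ z, (Z.isLocal G z).prime (U.map (G.smap H π z)) ∈ M (π.base z)) ∧
      (∀ (W : LocSp U) (K : Germs W.toPresheafedSpace) (φ : W.toPresheafedSpace ⟶ Y),
        (∀ w, (W.isLocal K w).prime (U.map (K.smap H φ w)) ∈ M (φ.base w)) →
          ∃ ψ : W ⟶ Z, ψ.hom ≫ π = φ) ∧
      ∀ (W : LocSp U) (ψ ψ' : W ⟶ Z), ψ.hom ≫ π = ψ'.hom ≫ π → ψ = ψ' := by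
  obtain ⟨π, hπ, hb, hu⟩ := Germs.exists_fracProj H M
  let Z : LocSp U := LocSp.ofGerms (Germs.fracGerms H M) Germs.isSheaf_fracGerms
    fun z => (Germs.FracPt.isLocz z).isLocal
  have hloc : ∀ (W : LocSp U) (K : Germs W.toPresheafedSpace) (ψ : W ⟶ Z),
      K.IsLocalHom U (Germs.fracGerms H M) ψ.hom := fun W K ψ =>
    (LocSp.isLocalOnStalks_iff K _ _).1 ψ.isLocal
  have hmem : ∀ {Z : LocSp U} (G : Germs Z.toPresheafedSpace) (π : Z.toPresheafedSpace ⟶ Y) (z)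
      (V : Opens Y) (hV : π.base z ∈ V) (f : (U.obj (Sect Y V)).R 1),
      sc U (H.ev V _ hV) f ∉ ((Z.isLocal G z).prime (U.map (G.smap H π z))).carrier ↔
        G.UnitAt z (sc U (pb π V) f) := by
    intro Z G π z V hV f
    rw [CBio.IsLocal.mem_prime, not_not, G.sc_ev_smap]
    exact ⟨fun h => ⟨hV, h⟩, fun ⟨_, h⟩ => h⟩
  refine ⟨Z, π, Germs.fracGerms H M, fun z => ?_, fun W K φ hφ => ?_, fun W ψ ψ' h => ?_⟩
  · have key : ∀ (z : Germs.FracPt H M) (t : Y) (_ : t = z.pt) (p : (U.obj (H.L t)).Prime),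
        (∀ V (hV : t ∈ V) f, sc U (H.ev V t hV) f ∉ p.carrier ↔
          ∃ hz : z.pt ∈ V, sc U (H.ev V z.pt hz) f ∉ z.prime.carrier) → p ∈ M t := by
      rintro z _ rfl p h
      have : p = z.prime := CBio.Prime.ext (Set.ext fun s => by
        obtain ⟨V, hV, f, rfl⟩ := H.surj_sc U s
        exact not_iff_not.1 ((h V hV f).trans ⟨fun h => h.2, fun h => ⟨hV, h⟩⟩))
      rw [this]
      exact z.mem
    exact key z _ (hb z) _ fun V hV f => (hmem (Z := Z) _ π z V hV f).trans (hu z V f)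
  -- The lift sends `w` to the point `φ w` with the prime of those germs whose image in the local
  -- stalk at `w` is not invertible.
  · obtain ⟨ψ, h₁, h₂, -⟩ := hπ.exists_lift K (W.isSheaf K) φ
      (fun w => (⟨φ.base w, _, hφ w⟩ : Germs.FracPt H M)) (fun w => hb _) fun w V f => by
        refine (hu _ V f).trans ?_
        exact ⟨fun ⟨hV, h⟩ => (hmem K φ w V hV f).1 h, fun h => ⟨h.1, (hmem K φ w V h.1 f).2 h⟩⟩
    exact ⟨⟨ψ, (LocSp.isLocalOnStalks_iff (Y := Z) K _ _).2 h₂⟩, h₁⟩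
  · exact LocSp.Hom.ext (hπ.hom_ext (Germs.canonical _) (W.isSheaf _) (hloc _ _ _) (hloc _ _ _) h)

end

/-! ### Limits of spaces with a presheaf -/

section
variable {C : Type (u + 1)} [Category.{u} C] [AlgCat C]

/-- A colimit given by generators and relations, as a coequalizer of coproducts. It avoids setting
up an index category for the sections of all factors over all open sets. -/
lemma exists_presentation {I R : Type u} (B : I → C) (K : R → C) (s t : R → I)
    (φ : ∀ r, K r ⟶ B (s r)) (ψ : ∀ r, K r ⟶ B (t r)) :
    ∃ (E : C) (e : ∀ i, B i ⟶ E), (∀ r, φ r ≫ e (s r) = ψ r ≫ e (t r)) ∧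
      (∀ (D : C) (f g : E ⟶ D), (∀ i, e i ≫ f = e i ≫ g) → f = g) ∧
      ∀ (D : C) (m : ∀ i, B i ⟶ D), (∀ r, φ r ≫ m (s r) = ψ r ≫ m (t r)) →
        ∃ g : E ⟶ D, ∀ i, e i ≫ g = m i := by
  let a : ∐ K ⟶ ∐ B := Sigma.desc fun r => φ r ≫ Sigma.ι B (s r)
  let b : ∐ K ⟶ ∐ B := Sigma.desc fun r => ψ r ≫ Sigma.ι B (t r)
  have h : ∀ r, (φ r ≫ Sigma.ι B (s r)) ≫ coequalizer.π a b =
      (ψ r ≫ Sigma.ι B (t r)) ≫ coequalizer.π a b := fun r => by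
    have := congrArg (fun z => Sigma.ι K r ≫ z) (coequalizer.condition a b)
    simpa only [a, b, ← Category.assoc, Sigma.ι_desc] using this
  refine ⟨coequalizer a b, fun i => Sigma.ι B i ≫ coequalizer.π a b, fun r => ?_,
    fun D f g hfg => ?_, fun D m hm => ?_⟩
  · simpa only [Category.assoc] using h r
  · refine coequalizer.hom_ext (Sigma.hom_ext _ _ fun i => ?_)
    simpa only [Category.assoc] using hfg i
  · refine ⟨coequalizer.desc (Sigma.desc m) (Sigma.hom_ext _ _ fun r => ?_), fun i => ?_⟩
    · rw [← Category.assoc, Sigma.ι_desc, ← Category.assoc, Sigma.ι_desc, Category.assoc,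
        Category.assoc, Sigma.ι_desc, Sigma.ι_desc]
      exact hm r
    · rw [Category.assoc, coequalizer.π_desc, Sigma.ι_desc]

lemma pb_rs_self {X : PSp C} {φ : X ⟶ X} (hφ : φ = 𝟙 X) {V W : Opens X} (h : W ≤ pre φ V)
    (h' : W ≤ V) : pb φ V ≫ rs X h = rs X h' := by
  subst hφ
  exact Category.id_comp _

lemma psp_hom_ext {X Y : PSp C} {f g : X ⟶ Y} (hb : f.base = g.base)
    (h : ∀ V W (h₁ : W ≤ pre f V) (h₂ : W ≤ pre g V), pb f V ≫ rs X h₁ = pb g V ≫ rs X h₂) :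
    f = g := by
  obtain ⟨f, φ⟩ := f
  obtain ⟨g, ψ⟩ := g
  obtain rfl : f = g := hb
  congr 1
  refine NatTrans.ext (funext fun V => ?_)
  have := h V.unop _ le_rfl le_rfl
  refine (Category.comp_id _).symm.trans ((congrArg (fun z => _ ≫ z) (rs_self X le_rfl)).symm.trans
    (this.trans ((congrArg (fun z => _ ≫ z) (rs_self X le_rfl)).trans (Category.comp_id _))))

lemma pb_comp_rs {X Y Z : PSp C} (f : X ⟶ Y) (g : Y ⟶ Z) {V : Opens Z} {W : Opens X}
    (h : W ≤ pre (f ≫ g) V) :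
    pb (f ≫ g) V ≫ rs X h = pb g V ≫ pb f (pre g V) ≫ rs X (V := pre f (pre g V)) h :=
  Category.assoc _ _ _

lemma pb_comp_rs' {X Y Z : PSp C} (f : X ⟶ Y) (g : Y ⟶ Z) {V : Opens Z} {V' : Opens Y}
    (hV : V' ≤ pre g V) {W : Opens X} (h : W ≤ pre f V') (h' : W ≤ pre (f ≫ g) V) :
    pb (f ≫ g) V ≫ rs X h' = (pb g V ≫ rs Y hV) ≫ pb f V' ≫ rs X h := by
  rw [pb_comp_rs, Category.assoc, ← Category.assoc (rs Y hV), rs_pb, Category.assoc, rs_rs]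

lemma pb_rs_congr {X Y : PSp C} {f g : X ⟶ Y} (h : f = g) {V : Opens Y} {W : Opens X}
    (h₁ : W ≤ pre f V) (h₂ : W ≤ pre g V) : pb f V ≫ rs X h₁ = pb g V ≫ rs X h₂ := by
  subst h
  rfl

/-! ### The presheaf generated by pull-backs of sections -/

section
variable {J : Type} [SmallCategory J] {F : J ⥤ PSp C} {T : TopCat.{u}}
  (p : ∀ j, T ⟶ (F.obj j).carrier)

/-- Indices of the generating sections over `O`. -/
structure CoGenIdx (O : Opens T) : Type u where
  j : J
  V : Opens (F.obj j)
  h : O ≤ (Opens.map (p j)).obj V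

/-- Indices of the relations between the generating sections over `O`. -/
structure CoRelIdx (O : Opens T) : Type u where
  j : J
  k : J
  i : j ⟶ k
  V : Opens (F.obj k)
  W : Opens (F.obj j)
  h : W ≤ pre (F.map i) V
  hV : O ≤ (Opens.map (p k)).obj V
  hW : O ≤ (Opens.map (p j)).obj W

/-- The presheaf on the limit space: over `O`, the colimit of the sections over all `V` in the
factors whose preimage contains `O`. It is not sheafified, as the localization applied afterwards
yields a sheaf in any case. -/
lemma exists_colimitSections (O : Opens T) :
    ∃ (E : C) (e : ∀ j (V : Opens (F.obj j)), O ≤ (Opens.map (p j)).obj V →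
        (Sect (F.obj j) V ⟶ E)),
      (∀ {j k} (i : j ⟶ k) V W (h : W ≤ pre (F.map i) V) (hW : O ≤ (Opens.map (p j)).obj W)
        (hV : O ≤ (Opens.map (p k)).obj V),
          e k V hV = (pb (F.map i) V ≫ rs _ h) ≫ e j W hW) ∧
      (∀ (D : C) (f g : E ⟶ D), (∀ j V h, e j V h ≫ f = e j V h ≫ g) → f = g) ∧
      ∀ (D : C) (m : ∀ j (V : Opens (F.obj j)), O ≤ (Opens.map (p j)).obj V →
          (Sect (F.obj j) V ⟶ D)),
        (∀ {j k} (i : j ⟶ k) V W (h : W ≤ pre (F.map i) V) (hW : O ≤ (Opens.map (p j)).obj W)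
          (hV : O ≤ (Opens.map (p k)).obj V), m k V hV = (pb (F.map i) V ≫ rs _ h) ≫ m j W hW) →
        ∃ g : E ⟶ D, ∀ j V h, e j V h ≫ g = m j V h := by
  obtain ⟨E, e, h₁, h₂, h₃⟩ := exists_presentation (I := CoGenIdx p O) (R := CoRelIdx p O)
    (fun i => Sect (F.obj i.j) i.V) (fun r => Sect (F.obj r.k) r.V)
    (fun r => ⟨r.k, r.V, r.hV⟩) (fun r => ⟨r.j, r.W, r.hW⟩)
    (fun r => 𝟙 (Sect (F.obj r.k) r.V)) (fun r => pb (F.map r.i) r.V ≫ rs (F.obj r.j) r.h)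
  refine ⟨E, fun j V h => e ⟨j, V, h⟩, fun {j k} i V W h hW hV => ?_, fun D f g h => ?_,
    fun D m hm => ?_⟩
  · exact (Category.id_comp _).symm.trans (h₁ ⟨j, k, i, V, W, h, hV, hW⟩)
  · exact h₂ D f g fun i => h _ _ _
  · obtain ⟨g, hg⟩ := h₃ D (fun i => m i.j i.V i.h) fun r =>
      (Category.id_comp _).trans (hm r.i _ _ r.h _ _)
    exact ⟨g, fun j V h => hg ⟨j, V, h⟩⟩

/-- The sections over `O` of the presheaf generated by the pull-backs of sections. -/
def coSect (O : Opens T) : C := (exists_colimitSections p O).choose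

/-- The pull-back of sections over `V`. -/
def coGen {O : Opens T} (j : J) (V : Opens (F.obj j)) (h : O ≤ (Opens.map (p j)).obj V) :
    Sect (F.obj j) V ⟶ coSect p O := (exists_colimitSections p O).choose_spec.choose j V h

lemma coGen_rel {O : Opens T} {j k : J} (i : j ⟶ k) {V W} (h : W ≤ pre (F.map i) V)
    (hW : O ≤ (Opens.map (p j)).obj W) (hV : O ≤ (Opens.map (p k)).obj V) :
    coGen p k V hV = (pb (F.map i) V ≫ rs _ h) ≫ coGen p j W hW :=
  (exists_colimitSections p O).choose_spec.choose_spec.1 i V W h hW hV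

/-- Restriction within one factor is the relation that belongs to the identity arrow of `j`. -/
lemma coGen_rs {O : Opens T} {j : J} {V W : Opens (F.obj j)} (h : W ≤ V)
    (hW : O ≤ (Opens.map (p j)).obj W) :
    rs _ h ≫ coGen p j W hW = coGen p j V (hW.trans fun _ h' => h h') := by
  have h' : W ≤ pre (F.map (𝟙 j)) V := by
    rw [F.map_id]
    exact h
  rw [coGen_rel p (𝟙 j) h' hW, pb_rs_self (F.map_id j) h' h]

variable {p}

lemma coSect_hom_ext {O : Opens T} {D : C} {f g : coSect p O ⟶ D}
    (h : ∀ j V h, coGen p j V h ≫ f = coGen p j V h ≫ g) : f = g :=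
  (exists_colimitSections p O).choose_spec.choose_spec.2.1 D f g h

lemma exists_coSect_desc {O : Opens T} {D : C} (m : ∀ j (V : Opens (F.obj j)),
    O ≤ (Opens.map (p j)).obj V → (Sect (F.obj j) V ⟶ D))
    (hm : ∀ {j k} (i : j ⟶ k) V W (h : W ≤ pre (F.map i) V) (hW : O ≤ (Opens.map (p j)).obj W)
      (hV : O ≤ (Opens.map (p k)).obj V), m k V hV = (pb (F.map i) V ≫ rs _ h) ≫ m j W hW) :
    ∃ g : coSect p O ⟶ D, ∀ j V h, coGen p j V h ≫ g = m j V h :=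
  (exists_colimitSections p O).choose_spec.choose_spec.2.2 D m hm

lemma exists_coRes {O O' : Opens T} (h : O' ≤ O) : ∃ g : coSect p O ⟶ coSect p O',
    ∀ j V hV, coGen p j V hV ≫ g = coGen p j V (h.trans hV) :=
  exists_coSect_desc (fun j V hV => coGen p j V (h.trans hV)) fun i _ _ h' _ _ => coGen_rel p i h' _ _

variable (p) in
/-- The space `T` with the presheaf generated by the pull-backs of sections. -/
def coSp : PSp C where
  carrier := T
  presheaf :=
    { obj := fun O => coSect p O.unop
      map := fun i => (exists_coRes (leOfHom i.unop)).choose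
      map_id := fun O => coSect_hom_ext fun j V h =>
        ((exists_coRes (leOfHom (𝟙 O : O ⟶ O).unop)).choose_spec j V h).trans
          (Category.comp_id _).symm
      map_comp := fun i i' => coSect_hom_ext fun j V h => by
        rw [← Category.assoc, (exists_coRes (leOfHom (i ≫ i').unop)).choose_spec,
          (exists_coRes (leOfHom i.unop)).choose_spec,
          (exists_coRes (leOfHom i'.unop)).choose_spec] }

lemma coGen_coRes {O O' : Opens T} (h : O' ≤ O) (j V hV) :
    coGen p j V hV ≫ rs (coSp p) h = coGen p j V (h.trans hV) :=
  (exists_coRes h).choose_spec j V hV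

variable (p) in
/-- The projections of the space with the generated presheaf. -/
def coProj (j : J) : coSp p ⟶ F.obj j where
  base := p j
  c :=
    { app := fun V => coGen p j V.unop le_rfl
      naturality := fun V W i =>
        (coGen_rs p (leOfHom i.unop) le_rfl).trans
          (coGen_coRes (leOfHom ((Opens.map (p j)).map i.unop)) j V.unop le_rfl).symm }

lemma pb_coProj_rs {j : J} {V : Opens (F.obj j)} {O : Opens T} (h : O ≤ (Opens.map (p j)).obj V) :
    pb (coProj p j) V ≫ rs (coSp p) h = coGen p j V h :=
  coGen_coRes h j V le_rfl

variable (p) in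
lemma coProj_w {j k : J} (i : j ⟶ k) (hp : p j ≫ (F.map i).base = p k) :
    coProj p j ≫ F.map i = coProj p k := by
  refine psp_hom_ext hp fun V W h₁ h₂ => ?_
  refine (pb_comp_rs _ _ _).trans ((congrArg (fun z => pb (F.map i) V ≫ z)
    (pb_coProj_rs (p := p) h₁)).trans (Eq.trans ?_ (pb_coProj_rs (p := p) h₂).symm))
  rw [coGen_rel p i le_rfl h₁ h₂, rs_self, Category.comp_id]
  rfl

lemma exists_coLift {X : PSp C} (s : ∀ j, X ⟶ F.obj j) (hs : ∀ {j k} (i : j ⟶ k), s j ≫ F.map i = s k)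
    (l : X.carrier ⟶ T) (hl : ∀ j, l ≫ p j = (s j).base) :
    ∃ l' : X ⟶ coSp p, ∀ j, l' ≫ coProj p j = s j := by
  have hle : ∀ {O : Opens T} {j} {V : Opens (F.obj j)}
      (_ : O ≤ (Opens.map (p j)).obj V), (Opens.map l).obj O ≤ pre (s j) V := by
    intro O j V h x hx
    have := h hx
    change (s j).base x ∈ V
    rw [← hl]
    exact this
  have hd : ∀ O : Opens T, ∃ g : coSect p O ⟶ Sect X ((Opens.map l).obj O),
      ∀ j V h, coGen p j V h ≫ g = pb (s j) V ≫ rs X (hle h) := fun O =>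
    exists_coSect_desc _ fun {j k} i V W h hW hV => by
      rw [← pb_rs_congr (hs i) ((hle hW).trans (pre_mono _ h)) (hle hV)]
      exact pb_comp_rs' _ _ h _ _
  choose g hg using hd
  refine ⟨⟨l, ⟨fun O => g O.unop, fun O O' i => coSect_hom_ext fun j V h => ?_⟩⟩, fun j => ?_⟩
  · refine (Category.assoc _ _ _).symm.trans (Eq.trans ?_ (Category.assoc _ _ _))
    refine (congrArg (fun z => z ≫ g O'.unop) (coGen_coRes (leOfHom i.unop) j V h)).trans ?_
    refine (hg _ _ _ _).trans (Eq.trans ?_ (congrArg (fun z => z ≫ _) (hg O.unop j V h)).symm)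
    refine Eq.trans ?_ (Category.assoc _ _ _).symm
    exact congrArg _ (rs_rs X _ (leOfHom ((Opens.map l).map i.unop))).symm
  · refine psp_hom_ext (hl j) fun V W h₁ h₂ => ?_
    refine (pb_comp_rs _ _ _).trans ?_
    refine (Category.assoc _ _ _).symm.trans ((congrArg (fun z => z ≫ rs X (V := (Opens.map l).obj _) h₁)
      (hg _ j V le_rfl)).trans ((Category.assoc _ _ _).trans (congrArg (fun z => pb (s j) V ≫ z)
        (rs_rs X _ (W := (Opens.map l).obj _) h₁))))

lemma coSp_hom_ext {X : PSp C} {m m' : X ⟶ coSp p} (hb : m.base = m'.base)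
    (h : ∀ j, m ≫ coProj p j = m' ≫ coProj p j) : m = m' := by
  refine psp_hom_ext hb fun O W h₁ h₂ => coSect_hom_ext fun j V hV => ?_
  have h₁' := h₁.trans (pre_mono m hV)
  have h₂' := h₂.trans (pre_mono m' hV)
  have := pb_rs_congr (h j) (V := V) (W := W) h₁' h₂'
  have e : ∀ (m : X ⟶ coSp p) (h₁ : W ≤ pre m O) (h₁' : W ≤ pre (m ≫ coProj p j) V),
      pb (m ≫ coProj p j) V ≫ rs X h₁' = coGen p j V hV ≫ pb m O ≫ rs X h₁ := fun m h₁ h₁' => by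
    rw [pb_comp_rs' _ _ hV h₁ h₁']
    exact congrArg (fun z => z ≫ _) (pb_coProj_rs hV)
  exact (e m h₁ h₁').symm.trans (this.trans (e m' h₂ h₂'))

end

/-- Pull-back of sections reverses arrows, so a limit of spaces carries a colimit of sections. -/
lemma hasLimitsOfShape_psp (J : Type) [SmallCategory J] : HasLimitsOfShape J (PSp C) where
  has_limit F := by
    let F' := F ⋙ PresheafedSpace.forget C
    let p : ∀ j, limit F' ⟶ (F.obj j).carrier := fun j => limit.π F' j
    let c : Cone F := ⟨coSp p, ⟨coProj p, fun j k i => (Category.id_comp _).trans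
      (coProj_w p i (limit.w F' i)).symm⟩⟩
    have key : ∀ s : Cone F, ∃ l : s.pt ⟶ coSp p, ∀ j, l ≫ coProj p j = s.π.app j := fun s =>
      exists_coLift s.π.app (fun i => s.w i) (limit.lift F' ((PresheafedSpace.forget C).mapCone s))
        fun j => limit.lift_π _ j
    refine ⟨⟨⟨c, ⟨fun s => (key s).choose, fun s j => (key s).choose_spec j, fun s m hm => ?_⟩⟩⟩⟩
    have hm' : ∀ j, m ≫ coProj p j = (key s).choose ≫ coProj p j := fun j =>
      (hm j).trans ((key s).choose_spec j).symm
    exact coSp_hom_ext (limit.hom_ext fun j => congrArg PresheafedSpace.Hom.base (hm' j)) hm'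

end

/-! ### Limits of spaces with local stalks -/

section
variable {C : Type (u + 1)} [Category.{u} C] [AlgCat C] {U : C ⥤ CBio.{u}} [Geo U]

lemma LocSp.notMem_prime_iff {Z : LocSp U} (G : Germs Z.toPresheafedSpace) {Y : PSp C} (H : Germs Y)
    (π : Z.toPresheafedSpace ⟶ Y) {z : Z.toPresheafedSpace} {V : Opens Y} (hV : π.base z ∈ V)
    (f : (U.obj (Sect Y V)).R 1) :
    sc U (H.ev V _ hV) f ∉ ((Z.isLocal G z).prime (U.map (G.smap H π z))).carrier ↔
      G.UnitAt z (sc U (pb π V) f) := by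
  rw [CBio.IsLocal.mem_prime, not_not]
  refine (iff_of_eq (congrArg IsUnit (G.sc_ev_smap H π hV f))).trans ?_
  exact ⟨fun h => ⟨hV, h⟩, fun ⟨_, h⟩ => h⟩

lemma LocSp.Hom.unitAt_iff {X Y : LocSp U} (f : X ⟶ Y) (G : Germs X.toPresheafedSpace)
    (H : Germs Y.toPresheafedSpace) {x : X.toPresheafedSpace} {V : Opens Y.toPresheafedSpace}
    (s : (U.obj (Sect Y.toPresheafedSpace V)).R 1) :
    G.UnitAt x (sc U (pb f.hom V) s) ↔ H.UnitAt (f.hom.base x) s :=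
  Germs.IsLocalHom.unitAt_iff G H ((LocSp.isLocalOnStalks_iff G H _).1 f.isLocal)

/-- The limit `Y` of the underlying spaces with presheaves has stalks that need not be local.
Localizing `Y` at a suitable set of primes of its stalks makes the stalks and the projections local;
and each cone of local morphisms factors through the localization. -/
lemma hasLimitsOfShape_locSp (J : Type) [SmallCategory J] : HasLimitsOfShape J (LocSp U) where
  has_limit F := by
    have := hasLimitsOfShape_psp (C := C) J
    let F' := F ⋙ LocSp.forget U
    let Y : PSp C := limit F'
    let p : ∀ j, Y ⟶ (F.obj j).toPresheafedSpace := fun j => limit.π F' j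
    have hp : ∀ {j k} (i : j ⟶ k), p j ≫ (F.map i).hom = p k := fun i => limit.w F' i
    let H := Germs.canonical Y
    let K : ∀ X : LocSp U, Germs X.toPresheafedSpace := fun X => Germs.canonical _
    -- The primes of the stalk at `t` whose preimage in the stalk of each factor consists of the
    -- nonunits.
    let M : ∀ t, Set ((U.obj (H.L t)).Prime) := fun t => {q | ∀ j (V : Opens (F.obj j).toPresheafedSpace)
      (hV : (p j).base t ∈ V) (f : (U.obj (Sect (F.obj j).toPresheafedSpace V)).R 1),
        sc U (H.ev (pre (p j) V) t hV) (sc U (pb (p j) V) f) ∉ q.carrier ↔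
          (K (F.obj j)).UnitAt ((p j).base t) f}
    obtain ⟨Z, π, G, h₁, h₂, h₃⟩ := exists_localization H M
    have hπ : ∀ j, IsLocalOnStalks U (X := Z.toPresheafedSpace) (π ≫ p j) := fun j => by
      refine (LocSp.isLocalOnStalks_iff (X := Z) (Y := F.obj j) G (K _) _).2 ?_
      refine (Germs.isLocalHom_iff_unitAt _ _ _).2 fun z V f h => ?_
      have hV : (p j).base (π.base z) ∈ V := h.1
      refine (h₁ z j V hV f).1 ((LocSp.notMem_prime_iff G H π (V := pre (p j) V) hV _).2 ?_)
      exact (Germs.unitAt_comp G π (p j) f).1 h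
    let c : Cone F := ⟨Z, ⟨fun j => ⟨π ≫ p j, hπ j⟩, fun j k i => LocSp.Hom.ext
      ((Category.id_comp _).trans ((congrArg (fun z => π ≫ z) (hp i).symm).trans
        (Category.assoc _ _ _).symm))⟩⟩
    have key : ∀ s : Cone F, ∃ l : s.pt ⟶ Z, ∀ j, l ≫ c.π.app j = s.π.app j := fun s => by
      let φ : s.pt.toPresheafedSpace ⟶ Y := limit.lift F' ((LocSp.forget U).mapCone s)
      have hφ : ∀ j, φ ≫ p j = (s.π.app j).hom := fun j => limit.lift_π _ j
      -- The prime of `Y` induced by the local stalk at `w` belongs to `M` precisely because the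
      -- legs of the cone are local.
      obtain ⟨l, hl⟩ := h₂ s.pt (K _) φ fun w j V hV f => by
        have hV' : φ.base w ∈ pre (p j) V := hV
        refine (LocSp.notMem_prime_iff (K s.pt) H φ hV' _).trans ?_
        refine (Germs.unitAt_comp (K s.pt) φ (p j) f).symm.trans ?_
        have := fun g hg => (iff_of_eq (congrArg (fun g : s.pt.toPresheafedSpace ⟶ _ =>
          ((K s.pt).UnitAt w (sc U (pb g V) f) ↔ (K (F.obj j)).UnitAt (g.base w) f))
            (show g = (s.π.app j).hom from hg))).2
              (LocSp.Hom.unitAt_iff (s.π.app j) (K s.pt) (K (F.obj j)) f)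
        exact this _ (hφ j)
      exact ⟨l, fun j => LocSp.Hom.ext ((Category.assoc _ _ _).symm.trans
        ((congrArg (fun z => z ≫ p j) hl).trans (hφ j)))⟩
    refine ⟨⟨⟨c, ⟨fun s => (key s).choose, fun s j => (key s).choose_spec j, fun s m hm => ?_⟩⟩⟩⟩
    refine h₃ _ _ _ (limit.hom_ext (F := F') fun j => ?_)
    have := congrArg LocSp.Hom.hom ((hm j).trans ((key s).choose_spec j).symm)
    exact (Category.assoc _ _ _).trans (this.trans (Category.assoc _ _ _).symm)

end

/-! ### Open subspaces -/

section
variable {C : Type (u + 1)} [Category.{u} C] [AlgCat C]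

/-- The stalks of an open subspace. -/
def Germs.restrict {X : PSp C} (G : Germs X) {T : TopCat.{u}} {f : T ⟶ X.carrier}
    (h : Topology.IsOpenEmbedding f) : Germs (X.restrict h) where
  L z := G.L (f z)
  ev V z hz := G.ev (h.functor.obj V) (f z) ⟨z, hz, rfl⟩
  rs_ev hVW z hz := G.rs_ev (leOfHom (h.functor.map (homOfLE hVW))) (f z) ⟨z, hz, rfl⟩
  surj {z k} y := by
    obtain ⟨V, hV, a, rfl⟩ := G.surj y
    have hle : h.functor.obj ((Opens.map f).obj V) ≤ V := by
      rintro _ ⟨w, hw, rfl⟩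
      exact hw
    exact ⟨(Opens.map f).obj V, hV, ap (rs X hle) a, G.ev_rs hle _ a⟩
  near {V z hz k a b} e := by
    obtain ⟨W, hW, hzW, e⟩ := G.near e
    have hle : h.functor.obj ((Opens.map f).obj W) ≤ W := by
      rintro _ ⟨w, hw, rfl⟩
      exact hw
    have hle' : (Opens.map f).obj W ≤ V := by
      intro w hw
      obtain ⟨w', hw', e⟩ := hW hw
      rwa [← h.injective e]
    refine ⟨(Opens.map f).obj W, hle', hzW, ?_⟩
    have e₁ := (ap_comp (rs X hW) (rs X hle) a).trans ((congrArg (ap (rs X hle)) e).trans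
      (ap_comp (rs X hW) (rs X hle) b).symm)
    have e₂ := rs_rs X hW hle
    exact Eq.mp (congrArg (fun g => ap g a = ap g b) e₂) e₁

lemma rs_ofRestrict {X : PSp C} {T : TopCat.{u}} {f : T ⟶ X.carrier}
    (h : Topology.IsOpenEmbedding f) (V : Opens (X.restrict h))
    (hV : V ≤ pre (X.ofRestrict h) (h.functor.obj V)) :
    @Eq (Sect X (h.functor.obj V) ⟶ Sect (X.restrict h) V)
      (pb (X.ofRestrict h) (h.functor.obj V) ≫ rs (X.restrict h) hV) (𝟙 _) :=
  (rs_rs X _ (leOfHom (h.functor.map (homOfLE hV)))).trans (rs_self X _)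

variable {U : C ⥤ CBio.{u}} [Geo U]

namespace LocSp

lemma isLocalOnStalks_of_unitAt {X Y : LocSp U} (G : Germs X.toPresheafedSpace)
    (H : Germs Y.toPresheafedSpace) (f : X.toPresheafedSpace ⟶ Y.toPresheafedSpace)
    (h : ∀ x (V : Opens Y.toPresheafedSpace) (s : (U.obj (Sect Y.toPresheafedSpace V)).R 1),
      G.UnitAt x (sc U (pb f V) s) → H.UnitAt (f.base x) s) : IsLocalOnStalks U f :=
  (isLocalOnStalks_iff G H f).2 ((Germs.isLocalHom_iff_unitAt G H f).2 h)

lemma isLocalOnStalks_of_inv {X Y : LocSp U} (f : X.toPresheafedSpace ⟶ Y.toPresheafedSpace)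
    (g : Y.toPresheafedSpace ⟶ X.toPresheafedSpace) (h : g ≫ f = 𝟙 _) (h' : f ≫ g = 𝟙 _) :
    IsLocalOnStalks U f := by
  let G := Germs.canonical X.toPresheafedSpace
  let H := Germs.canonical Y.toPresheafedSpace
  refine isLocalOnStalks_of_unitAt G H f fun x V s hs => ?_
  have hx : g.base (f.base x) = x := congrArg (fun φ : X.toPresheafedSpace ⟶ _ => φ.base x) h'
  have h1 := H.unitAt_pb G g (x := f.base x) (s := sc U (pb f V) s) (by rwa [hx])
  have h2 := (H.unitAt_comp g f s).2 h1
  have : ∀ φ : Y.toPresheafedSpace ⟶ Y.toPresheafedSpace, φ = 𝟙 _ →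
      H.UnitAt (f.base x) (sc U (pb φ V) s) → H.UnitAt (f.base x) s := by
    rintro _ rfl h
    have e := hom_ext_sc (U := U) (pb_id (X := Y.toPresheafedSpace) V) s
    exact Eq.mp (congrArg (H.UnitAt (V := V) (f.base x)) (e.trans (sc_id _ s))) h
  exact this _ h h2

/-- Isomorphisms of spaces with presheaves are local. -/
def isoMk {X Y : LocSp U} (e : X.toPresheafedSpace ≅ Y.toPresheafedSpace) : X ≅ Y where
  hom := ⟨e.hom, isLocalOnStalks_of_inv _ e.inv e.inv_hom_id e.hom_inv_id⟩
  inv := ⟨e.inv, isLocalOnStalks_of_inv _ e.hom e.hom_inv_id e.inv_hom_id⟩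
  hom_inv_id := Hom.ext e.hom_inv_id
  inv_hom_id := Hom.ext e.inv_hom_id

/-- The open subspace `W` of `X`. -/
def restr (X : LocSp U) (W : Opens X.toPresheafedSpace) : LocSp U where
  toPresheafedSpace := X.toPresheafedSpace.restrict W.isOpenEmbedding
  IsSheaf := TopCat.Presheaf.isSheaf_of_isOpenEmbedding W.isOpenEmbedding X.IsSheaf
  local_stalks x := ⟨_, ((Germs.canonical X.toPresheafedSpace).restrict
    W.isOpenEmbedding).nonempty_isColimit x, X.isLocal (Germs.canonical _) _⟩

variable (X : LocSp U) (W : Opens X.toPresheafedSpace)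

lemma unitAt_ofRestrict (G : Germs X.toPresheafedSpace) {z : X.toPresheafedSpace.restrict W.isOpenEmbedding}
    {V : Opens X.toPresheafedSpace} (s : (U.obj (Sect X.toPresheafedSpace V)).R 1) :
    (G.restrict W.isOpenEmbedding).UnitAt z
      (sc U (pb (X.toPresheafedSpace.ofRestrict W.isOpenEmbedding) V) s) ↔ G.UnitAt z.1 s := by
  refine ⟨fun ⟨h, h'⟩ => ?_, fun h => Germs.unitAt_pb (G.restrict W.isOpenEmbedding) G _ h⟩
  have hle : W.isOpenEmbedding.functor.obj ((Opens.map W.inclusion').obj V) ≤ V := by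
    rintro _ ⟨w, hw, rfl⟩
    exact hw
  exact (G.unitAt_rs hle ⟨z, h, rfl⟩ s).1 ⟨_, h'⟩

/-- The inclusion of an open subspace. -/
def ι : X.restr W ⟶ X where
  hom := X.toPresheafedSpace.ofRestrict W.isOpenEmbedding
  isLocal := isLocalOnStalks_of_unitAt ((Germs.canonical X.toPresheafedSpace).restrict
    W.isOpenEmbedding) (Germs.canonical _) _ fun _ _ _ h => (unitAt_ofRestrict X W _ _).1 h

instance : Mono (X.ι W) where
  right_cancellation _ _ h := Hom.ext ((cancel_mono (X.toPresheafedSpace.ofRestrict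
    W.isOpenEmbedding)).1 (congrArg Hom.hom h))

variable {X W}

lemma exists_restr_lift {T : LocSp U} (f : T ⟶ X) (hf : ∀ t, f.hom.base t ∈ W) :
    ∃ l : T ⟶ X.restr W, l ≫ X.ι W = f := by
  let i := X.toPresheafedSpace.ofRestrict W.isOpenEmbedding
  have hr : Set.range f.hom.base ⊆ Set.range i.base := by
    rintro _ ⟨t, rfl⟩
    exact ⟨⟨_, hf t⟩, rfl⟩
  let l := PresheafedSpace.IsOpenImmersion.lift i f.hom hr
  have hl : l ≫ i = f.hom := PresheafedSpace.IsOpenImmersion.lift_fac i f.hom hr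
  let G := Germs.canonical X.toPresheafedSpace
  let K := Germs.canonical T.toPresheafedSpace
  refine ⟨⟨l, ?_⟩, Hom.ext hl⟩
  refine isLocalOnStalks_of_unitAt (Y := X.restr W) K (G.restrict W.isOpenEmbedding) l
    fun t V s hs => ?_
  have hV : V ≤ pre i (W.isOpenEmbedding.functor.obj V) := fun z hz => ⟨z, hz, rfl⟩
  -- A section of the open subspace over `V` is by definition a section of `X` over the image of
  -- `V`. So its invertibility can be tested in `X`, where `f` is known to be local.
  let s' : (U.obj (Sect X.toPresheafedSpace (W.isOpenEmbedding.functor.obj V))).R 1 := s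
  have e : sc U (rs _ hV) (sc U (pb i _) s') = s :=
    (sc_comp _ _ _).symm.trans ((hom_ext_sc (rs_ofRestrict _ V hV) s').trans (sc_id _ s'))
  have ht : t ∈ pre l V := hs.1
  rw [← e] at hs ⊢
  refine (Germs.unitAt_rs _ hV ht _).2 ((unitAt_ofRestrict X W G s').2 ?_)
  replace hs := (K.unitAt_rs _ ht _).1 (Eq.mp (congrArg (K.UnitAt (V := pre l V) t)
    (sc_pb_rs l hV (sc U (pb i _) s'))) hs)
  have hs' := (K.unitAt_comp l i s').2 hs
  have key : ∀ g : T.toPresheafedSpace ⟶ X.toPresheafedSpace, g = f.hom →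
      K.UnitAt t (sc U (pb g _) s') → G.UnitAt (g.base t) s' := by
    rintro _ rfl h
    exact (f.unitAt_iff K G s').1 h
  exact key _ hl hs'

end LocSp

end

/-! ### Affine open subspaces and limits of schemes -/

section
variable {C : Type (u + 1)} [Category.{u} C] [AlgCat C] {U : C ⥤ CBio.{u}} [Geo U]

/-- Inverses exist near each point and have prescribed germs, so they glue. -/
lemma Germs.IsSheaf.isUnit {X : PSp C} {G : Germs X} (hG : G.IsSheaf) {V : Opens X}
    {s : (U.obj (Sect X V)).R 1} (h : ∀ x ∈ V, G.UnitAt x s) : IsUnit s := by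
  have hu : ∀ x (hx : x ∈ V), IsUnit (sc U (G.ev V x hx) s) := fun x hx => (h x hx).choose_spec
  obtain ⟨a, ha⟩ := hG.glue (k := Geo.row U 1) (V := V) (fun x hx =>
    toEl U (↑(hu x hx).unit⁻¹ : (U.obj (G.L x)).R 1)) fun x hx => by
    obtain ⟨W, hW, hxW, hs⟩ := G.isUnit_near (hu x hx)
    refine ⟨W, hW, hxW, toEl U (↑hs.unit⁻¹ : (U.obj (Sect X W)).R 1), fun y hy => ?_⟩
    rw [ap_toEl]
    congr 1
    refine (Units.eq_inv_of_mul_eq_one_left ?_).trans (Units.val_inj.2 rfl)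
    rw [IsUnit.unit_spec, ← G.ev_rs_sc hW hy, ← map_mul, IsUnit.mul_val_inv, map_one]
  have key : s * (toEl U).symm a = 1 := (toEl U).injective (hG.sep fun x hx => by
    rw [← smul_toEl, Equiv.apply_symm_apply, ap_smul, ha, smul_toEl, IsUnit.mul_val_inv, ap_toEl,
      map_one (sc U _)])
  exact IsUnit.of_mul_eq_one _ key

/-! ### Morphisms to affine spectra and basic open sets -/

section
variable {Sp : Cᵒᵖ ⥤ PSp C} [AffSpec U Sp]

/-- The morphism to the global sections induced by a morphism to an affine spectrum. -/
def toΓ {A : C} {W : LocSp U} (g : W ⟶ (spec U Sp).obj (op A)) : A ⟶ Sect W.toPresheafedSpace ⊤ :=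
  AffSpec.unit U (Sp := Sp) A ≫ pb g.hom ⊤

lemma toΓ_comp {A : C} {W T : LocSp U} (f : T ⟶ W) (g : W ⟶ (spec U Sp).obj (op A)) :
    toΓ (f ≫ g) = toΓ g ≫ pb f.hom ⊤ := (Category.assoc _ _ _).symm

lemma toΓ_map {A B : C} {W : LocSp U} (g : W ⟶ (spec U Sp).obj (op B)) (φ : A ⟶ B) :
    toΓ (g ≫ (spec U Sp).map φ.op) = φ ≫ toΓ g :=
  (Category.assoc _ _ _).symm.trans ((congrArg (fun z => z ≫ pb g.hom ⊤)
    (AffSpec.unit_map (U := U) (Sp := Sp) φ)).trans (Category.assoc _ _ _))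

lemma exists_toΓ {A : C} {W : LocSp U} (θ : A ⟶ Sect W.toPresheafedSpace ⊤) :
    ∃ g : W ⟶ (spec U Sp).obj (op A), toΓ g = θ := exists_homToSpec θ

lemma toΓ_injective {A : C} {W : LocSp U} {g g' : W ⟶ (spec U Sp).obj (op A)}
    (h : toΓ g = toΓ g') : g = g' := homToSpec_ext h

variable (Sp) in
-- Morphisms to a spectrum are maps to global sections, so a pushout of algebras is a pullback of
-- spectra, tested by all spaces with local stalks and not only by schemes.
lemma exists_pullback_spec {A A' B : C} (α : B ⟶ A) (β : B ⟶ A') :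
    ∃ (E : C) (a : A ⟶ E) (b : A' ⟶ E), α ≫ a = β ≫ b ∧
      (∀ (T : LocSp U) (u v : T ⟶ (spec U Sp).obj (op E)),
        u ≫ (spec U Sp).map a.op = v ≫ (spec U Sp).map a.op →
        u ≫ (spec U Sp).map b.op = v ≫ (spec U Sp).map b.op → u = v) ∧
      ∀ (T : LocSp U) (u : T ⟶ (spec U Sp).obj (op A)) (v : T ⟶ (spec U Sp).obj (op A')),
        u ≫ (spec U Sp).map α.op = v ≫ (spec U Sp).map β.op →
        ∃ w, w ≫ (spec U Sp).map a.op = u ∧ w ≫ (spec U Sp).map b.op = v := by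
  refine ⟨pushout α β, pushout.inl α β, pushout.inr α β, pushout.condition, fun T u v h h' => ?_,
    fun T u v h => ?_⟩
  · refine toΓ_injective (pushout.hom_ext ?_ ?_)
    · rw [← toΓ_map, h, toΓ_map]
    · rw [← toΓ_map, h', toΓ_map]
  · obtain ⟨w, hw⟩ := exists_toΓ (U := U) (Sp := Sp) (pushout.desc (toΓ u) (toΓ v) (by
      rw [← toΓ_map, h, toΓ_map]))
    refine ⟨w, toΓ_injective ?_, toΓ_injective ?_⟩
    · rw [toΓ_map, hw, pushout.inl_desc]
    · rw [toΓ_map, hw, pushout.inr_desc]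

variable (Sp) in
-- The locus of `f` is the spectrum of the localization at the powers of `f`: a morphism lands in it
-- exactly when `f` becomes invertible in the global sections, that is, when the map from `A`
-- extends to the localization.
lemma exists_basicOpen {A : C} (f : (U.obj A).R 1) :
    ∃ (B : C) (φ : A ⟶ B), Mono ((spec U Sp).map φ.op) ∧
      (∀ t, (AffSpec.germs U (Sp := Sp) A).UnitAt
        (((spec U Sp).map φ.op).hom.base t) (sc U (AffSpec.unit U (Sp := Sp) A) f)) ∧
      ∀ (T : LocSp U) (g : T ⟶ (spec U Sp).obj (op A)),
        (∀ t, (AffSpec.germs U (Sp := Sp) A).UnitAt (g.hom.base t)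
          (sc U (AffSpec.unit U (Sp := Sp) A) f)) → ∃ l, l ≫ (spec U Sp).map φ.op = g := by
  have hφ := isLocz_locHom U A (Submonoid.powers f)
  have key : ∀ (T : LocSp U) (K : Germs T.toPresheafedSpace) (g : T ⟶ (spec U Sp).obj (op A)) t,
      (AffSpec.germs U (Sp := Sp) A).UnitAt (g.hom.base t)
        (sc U (AffSpec.unit U (Sp := Sp) A) f) ↔ K.UnitAt t (sc U (toΓ g) f) := by
    intro T K g t
    refine (g.unitAt_iff K (AffSpec.germs U (Sp := Sp) A) _).symm.trans ?_
    exact iff_of_eq (congrArg (K.UnitAt (V := ⊤) t) (sc_comp _ _ f).symm)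
  refine ⟨_, Geo.locHom (U := U) A (Submonoid.powers f), ⟨fun u v h => ?_⟩, fun t => ?_,
    fun T g hg => ?_⟩
  · refine toΓ_injective (hφ.hom_ext ?_)
    rw [← toΓ_map, h, toΓ_map]
  · refine (key _ (AffSpec.germs U (Sp := Sp) _) _ t).2 ?_
    have e : toΓ ((spec U Sp).map (Geo.locHom (U := U) A (Submonoid.powers f)).op) =
        Geo.locHom (U := U) A (Submonoid.powers f) ≫ AffSpec.unit U (Sp := Sp) _ :=
      AffSpec.unit_map (U := U) (Sp := Sp) _
    have hu : IsUnit (sc U (Geo.locHom (U := U) A (Submonoid.powers f) ≫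
        AffSpec.unit U (Sp := Sp) _) f) := by
      rw [sc_comp]
      exact (hφ.isUnit f (Submonoid.mem_powers f)).map _
    rw [e]
    exact ⟨trivial, hu.map (sc U (Germs.ev _ ⊤ t trivial))⟩
  · have hu : IsUnit (sc U (toΓ g) f) := (T.isSheaf (Germs.canonical _)).isUnit
      fun t _ => (key T _ g t).1 (hg t)
    obtain ⟨θ, hθ⟩ := hφ.exists_desc (toΓ g) (by
      rintro _ ⟨n, rfl⟩
      change IsUnit (sc U (toΓ g) (f ^ n))
      rw [map_pow]
      exact hu.pow n)
    obtain ⟨l, hl⟩ := exists_toΓ (U := U) (Sp := Sp) θ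
    exact ⟨l, toΓ_injective (by rw [toΓ_map, hl, hθ])⟩

end

variable (Sp : Cᵒᵖ ⥤ PSp C) [AffSpec U Sp]

/-- The open subspace `W` of `X` is an affine spectrum. -/
def IsAffOpen (X : LocSp U) (W : Opens X.toPresheafedSpace) : Prop :=
  ∃ (A : C) (j : (spec U Sp).obj (op A) ⟶ X), Mono j ∧ (∀ t, j.hom.base t ∈ W) ∧
    ∀ (T : LocSp U) (g : T ⟶ X), (∀ t, g.hom.base t ∈ W) → ∃ l, l ≫ j = g

variable {Sp}

/-- An open subspace represents the morphisms that land in it. Stating affineness in this form makes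
it a matter of universal properties, which behave well under fiber products. -/
lemma isLocallyAffine_iff {X : LocSp U} : LocSp.IsLocallyAffine U Sp X ↔
    ∀ x : X.toPresheafedSpace, ∃ W, x ∈ W ∧ IsAffOpen Sp X W := by
  refine forall_congr' fun x => ?_
  constructor
  · rintro ⟨W, A, hx, ⟨e⟩⟩
    let e' : X.restr W ≅ (spec U Sp).obj (op A) := LocSp.isoMk e
    refine ⟨W, hx, A, e'.inv ≫ X.ι W, inferInstance, fun t => (e'.inv.hom.base t).2, fun T g hg => ?_⟩
    obtain ⟨l, hl⟩ := LocSp.exists_restr_lift g hg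
    exact ⟨l ≫ e'.hom, by rw [Category.assoc, e'.hom_inv_id_assoc, hl]⟩
  · rintro ⟨W, hx, A, j, hj, h, hl⟩
    obtain ⟨l, hl⟩ := hl _ (X.ι W) fun t => t.2
    obtain ⟨m, hm⟩ := LocSp.exists_restr_lift j h
    let e : X.restr W ≅ (spec U Sp).obj (op A) := ⟨l, m,
      (cancel_mono (X.ι W)).1 (by rw [Category.assoc, hm, hl, Category.id_comp]),
      (cancel_mono j).1 (by rw [Category.assoc, hl, hm, Category.id_comp])⟩
    exact ⟨W, A, hx, ⟨(LocSp.forget U).mapIso e⟩⟩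

/-- Inside an affine open set, the loci of scalars form a basis, and they are affine by
`exists_basicOpen`. The set `W'` is such a locus, transported to `X` along the identification of `W`
with a spectrum. -/
lemma IsAffOpen.exists_le {X : LocSp U} {W : Opens X.toPresheafedSpace} (hW : IsAffOpen Sp X W)
    {x : X.toPresheafedSpace} (hx : x ∈ W) (O : Opens X.toPresheafedSpace) (hO : x ∈ O) :
    ∃ W' ≤ O, x ∈ W' ∧ IsAffOpen Sp X W' := by
  obtain ⟨A, j, hj, hjW, hl⟩ := hW
  obtain ⟨l, hlj⟩ := hl _ (X.ι W) fun t => t.2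
  have hlj' : ∀ t : (X.restr W).toPresheafedSpace, j.hom.base (l.hom.base t) = t.1 := fun t =>
    congrArg (fun g : X.restr W ⟶ X => g.hom.base t) hlj
  let G := AffSpec.germs U (Sp := Sp) A
  have hxO : l.hom.base ⟨x, hx⟩ ∈ pre j.hom O := by
    change j.hom.base (l.hom.base ⟨x, hx⟩) ∈ O
    exact (hlj' ⟨x, hx⟩).symm ▸ hO
  obtain ⟨f, hf, hfO⟩ := (AffSpec.isSpec (U := U) (Sp := Sp) A).nhds (pre j.hom O) _ hxO
  obtain ⟨B, φ, hφ, hφ', hφl⟩ := exists_basicOpen Sp f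
  let D : Opens ((spec U Sp).obj (op A)).toPresheafedSpace :=
    ⟨_, G.isOpen_unitAt (sc U (AffSpec.unit U (Sp := Sp) A) f)⟩
  let W' : Opens X.toPresheafedSpace := W.isOpenEmbedding.functor.obj (pre l.hom D)
  have hjm : ∀ t : ((spec U Sp).obj (op A)).toPresheafedSpace, t ∈ D → j.hom.base t ∈ W' := by
    intro t ht
    obtain ⟨m, hm⟩ := LocSp.exists_restr_lift j hjW
    have hml : m ≫ l = 𝟙 _ := (cancel_mono j).1 (by rw [Category.assoc, hlj, hm, Category.id_comp])
    have h₁ : l.hom.base (m.hom.base t) = t :=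
      congrArg (fun g : (spec U Sp).obj (op A) ⟶ (spec U Sp).obj (op A) => g.hom.base t) hml
    have h₂ : (m.hom.base t).1 = j.hom.base t :=
      congrArg (fun g : (spec U Sp).obj (op A) ⟶ X => g.hom.base t) hm
    refine ⟨m.hom.base t, ?_, h₂⟩
    change l.hom.base (m.hom.base t) ∈ D
    rwa [h₁]
  refine ⟨W', ?_, ⟨⟨x, hx⟩, hf, rfl⟩, B, (spec U Sp).map φ.op ≫ j, mono_comp _ _,
    fun t => hjm _ (hφ' t), fun T g hg => ?_⟩
  · rintro _ ⟨t, ht, rfl⟩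
    have h₁ := hfO _ ht
    change j.hom.base (l.hom.base t) ∈ O at h₁
    have h₂ : t.1 ∈ O := (hlj' t) ▸ h₁
    exact h₂
  · have hgW : ∀ t, g.hom.base t ∈ W := fun t => by
      obtain ⟨w, -, e⟩ := hg t
      rw [← e]
      exact w.2
    obtain ⟨m, hm⟩ := LocSp.exists_restr_lift g hgW
    obtain ⟨k, hk⟩ := hφl T (m ≫ l) fun t => by
      obtain ⟨w, hw, e⟩ := hg t
      have : m.hom.base t = w := Subtype.ext ((congrArg (fun g : T ⟶ X => g.hom.base t) hm).trans e.symm)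
      change l.hom.base (m.hom.base t) ∈ D
      rw [this]
      exact hw
    exact ⟨k, by rw [← Category.assoc, hk, Category.assoc, hlj, hm]⟩

/-- The intersection of the two preimages represents the fiber product of `W₁` and `W₂` over `W`.
All three are spectra, and `spec` is full, so it is the spectrum of a pushout. -/
lemma isAffOpen_pullback {X Y Z P : LocSp U} {fst : P ⟶ X} {snd : P ⟶ Y} {f : X ⟶ Z} {g : Y ⟶ Z}
    (hP : IsPullback fst snd f g) {W₁ : Opens X.toPresheafedSpace} {W₂ : Opens Y.toPresheafedSpace}
    {W : Opens Z.toPresheafedSpace} (h₁ : IsAffOpen Sp X W₁) (h₂ : IsAffOpen Sp Y W₂)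
    (h : IsAffOpen Sp Z W) (hf : W₁ ≤ pre f.hom W) (hg : W₂ ≤ pre g.hom W) :
    IsAffOpen Sp P (pre fst.hom W₁ ⊓ pre snd.hom W₂) := by
  obtain ⟨A, j₁, hj₁, hm₁, hl₁⟩ := h₁
  obtain ⟨A', j₂, hj₂, hm₂, hl₂⟩ := h₂
  obtain ⟨B, j, hj, hm, hl⟩ := h
  obtain ⟨α, hα⟩ := hl _ (j₁ ≫ f) fun t => hf (hm₁ t)
  obtain ⟨β, hβ⟩ := hl _ (j₂ ≫ g) fun t => hg (hm₂ t)
  obtain ⟨α, rfl⟩ := (spec U Sp).map_surjective α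
  obtain ⟨β, rfl⟩ := (spec U Sp).map_surjective β
  obtain ⟨E, a, b, hab, hE, hE'⟩ := exists_pullback_spec (U := U) Sp α.unop β.unop
  have hc : (spec U Sp).map a.op ≫ (spec U Sp).map α = (spec U Sp).map b.op ≫ (spec U Sp).map β := by
    rw [← Functor.map_comp, ← Functor.map_comp]
    exact congrArg (fun z => (spec U Sp).map (Quiver.Hom.op z)) hab
  let i : (spec U Sp).obj (op E) ⟶ P := hP.lift ((spec U Sp).map a.op ≫ j₁)
    ((spec U Sp).map b.op ≫ j₂) (by
      rw [Category.assoc, ← hα, ← Category.assoc, hc, Category.assoc, hβ, Category.assoc])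
  have hi₁ : i ≫ fst = (spec U Sp).map a.op ≫ j₁ := hP.lift_fst _ _ _
  have hi₂ : i ≫ snd = (spec U Sp).map b.op ≫ j₂ := hP.lift_snd _ _ _
  refine ⟨E, i, ⟨fun u v huv => hE _ u v ?_ ?_⟩, fun t => Opens.mem_inf.2 ⟨?_, ?_⟩, fun T k hk => ?_⟩
  · rw [← cancel_mono j₁, Category.assoc, ← hi₁, ← Category.assoc, huv, Category.assoc, hi₁,
      Category.assoc]
  · rw [← cancel_mono j₂, Category.assoc, ← hi₂, ← Category.assoc, huv, Category.assoc, hi₂,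
      Category.assoc]
  · have e : fst.hom.base (i.hom.base t) = j₁.hom.base (((spec U Sp).map a.op).hom.base t) :=
      congrArg (fun g : _ ⟶ X => g.hom.base t) hi₁
    change fst.hom.base (i.hom.base t) ∈ W₁
    rw [e]
    exact hm₁ _
  · have e : snd.hom.base (i.hom.base t) = j₂.hom.base (((spec U Sp).map b.op).hom.base t) :=
      congrArg (fun g : _ ⟶ Y => g.hom.base t) hi₂
    change snd.hom.base (i.hom.base t) ∈ W₂
    rw [e]
    exact hm₂ _
  · obtain ⟨k₁, hk₁⟩ := hl₁ T (k ≫ fst) fun t => (hk t).1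
    obtain ⟨k₂, hk₂⟩ := hl₂ T (k ≫ snd) fun t => (hk t).2
    obtain ⟨w, hw₁, hw₂⟩ := hE' T k₁ k₂ (by
      change k₁ ≫ (spec U Sp).map α = k₂ ≫ (spec U Sp).map β
      rw [← cancel_mono j, Category.assoc, hα, Category.assoc, hβ, ← Category.assoc, hk₁,
        ← Category.assoc, hk₂, Category.assoc, hP.w, Category.assoc])
    refine ⟨w, hP.hom_ext ?_ ?_⟩
    · rw [Category.assoc, hi₁, ← Category.assoc, hw₁, hk₁]
    · rw [Category.assoc, hi₂, ← Category.assoc, hw₂, hk₂]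

lemma isLocallyAffine_pullback {X Y Z P : LocSp U} {fst : P ⟶ X} {snd : P ⟶ Y} {f : X ⟶ Z}
    {g : Y ⟶ Z} (hP : IsPullback fst snd f g) (hX : LocSp.IsLocallyAffine U Sp X)
    (hY : LocSp.IsLocallyAffine U Sp Y) (hZ : LocSp.IsLocallyAffine U Sp Z) :
    LocSp.IsLocallyAffine U Sp P := by
  rw [isLocallyAffine_iff] at hX hY hZ ⊢
  intro t
  have e : f.hom.base (fst.hom.base t) = g.hom.base (snd.hom.base t) :=
    congrArg (fun g : P ⟶ Z => g.hom.base t) hP.w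
  obtain ⟨W, hW, hWa⟩ := hZ (f.hom.base (fst.hom.base t))
  obtain ⟨W₁, hW₁, hWa₁⟩ := hX (fst.hom.base t)
  obtain ⟨W₂, hW₂, hWa₂⟩ := hY (snd.hom.base t)
  obtain ⟨W₁', hle₁, hx₁, ha₁⟩ := hWa₁.exists_le hW₁ (pre f.hom W) hW
  obtain ⟨W₂', hle₂, hx₂, ha₂⟩ := hWa₂.exists_le hW₂ (pre g.hom W) (by
    change g.hom.base (snd.hom.base t) ∈ W
    rwa [← e])
  exact ⟨_, Opens.mem_inf.2 ⟨hx₁, hx₂⟩, isAffOpen_pullback hP ha₁ ha₂ hWa hle₁ hle₂⟩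

variable (U Sp)

lemma hasPullbacks_sch : HasPullbacks (Sch U Sp) := by
  have := hasLimitsOfShape_locSp (U := U) WalkingCospan
  have : (LocSp.IsLocallyAffine U Sp).IsClosedUnderLimitsOfShape WalkingCospan := ⟨by
    rintro P ⟨p⟩
    have h := p.prop_diag_obj
    have hP : IsPullback (p.π.app WalkingCospan.left) (p.π.app WalkingCospan.right)
        (p.diag.map WalkingCospan.Hom.inl) (p.diag.map WalkingCospan.Hom.inr) :=
      IsPullback.of_isLimit_cone p.isLimit
    exact isLocallyAffine_pullback hP (h _) (h _) (h _)⟩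
  exact hasLimitsOfShape_of_closedUnderLimits _ _

/-- A morphism to the spectrum of the initial object is a morphism from the initial object to the
global sections. -/
lemma hasTerminal_sch : HasTerminal (Sch U Sp) := by
  have h : ∀ X : Sch U Sp, Nonempty (Unique (X ⟶ (specSch U Sp).obj (op (⊥_ C)))) := fun X => by
    obtain ⟨g, -⟩ := exists_toΓ (U := U) (Sp := Sp) (W := X.obj) (initial.to _ : ⊥_ C ⟶ _)
    exact ⟨⟨⟨⟨g⟩⟩, fun g' => ObjectProperty.hom_ext _ (toΓ_injective (initial.hom_ext _ _))⟩⟩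
  have := fun X => (h X).some
  exact hasTerminal_of_unique ((specSch U Sp).obj (op (⊥_ C)))

lemma hasFiniteLimits_sch : HasFiniteLimits (Sch U Sp) :=
  have := hasPullbacks_sch U Sp
  have := hasTerminal_sch U Sp
  hasFiniteLimits_of_hasTerminal_and_pullbacks

end

/-! ### Commutative rings as algebraic structures -/

/-- The operations of a ring. -/
inductive RingOp
  | zero
  | one
  | neg
  | add
  | mul

/-- The signature of rings. -/
abbrev ringSig : Sig where
  K := Unit
  Op := RingOp
  ar
    | .zero | .one => Empty
    | .neg => Unit
    | .add | .mul => Bool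
  fin o := by cases o <;> (dsimp only; infer_instance)
  dom _ _ := ()
  cod _ := ()

/-- The functor from commutative rings to structures. -/
def ringStr : CommRingCat.{u} ⥤ Str.{u} ringSig where
  obj R :=
    { carrier := fun _ => R
      op := fun o => match o with
        | .zero => fun _ => (0 : R)
        | .one => fun _ => (1 : R)
        | .neg => fun x => -(x () : R)
        | .add => fun x => (x false + x true : R)
        | .mul => fun x => (x false * x true : R) }
  map φ :=
    { app := fun _ => φ.hom
      map_op := fun o x => by
        cases o
        · exact map_zero φ.hom
        · exact map_one φ.hom
        · exact map_neg φ.hom _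
        · exact map_add φ.hom _ _
        · exact map_mul φ.hom _ _ }

namespace Str
variable (A B : Str.{u} ringSig) (h : Str.Hom A B)

/-- The zero of a structure. -/
def rZero : B.carrier () := B.op .zero Empty.rec
/-- The unit of a structure. -/
def rOne : B.carrier () := B.op .one Empty.rec
/-- The negation of a structure. -/
def rNeg (a : B.carrier ()) : B.carrier () := B.op .neg fun _ => a
/-- The addition of a structure. -/
def rAdd (a b : B.carrier ()) : B.carrier () := B.op .add (Bool.rec a b)
/-- The multiplication of a structure. -/
def rMul (a b : B.carrier ()) : B.carrier () := B.op .mul (Bool.rec a b)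

variable {A B}

lemma map_rZero : h.app () A.rZero = B.rZero :=
  (h.map_op .zero _).trans (congrArg _ (funext fun a => a.elim))
lemma map_rOne : h.app () A.rOne = B.rOne :=
  (h.map_op .one _).trans (congrArg _ (funext fun a => a.elim))
lemma map_rNeg (a : A.carrier ()) : h.app () (A.rNeg a) = B.rNeg (h.app () a) := h.map_op .neg _
lemma map_rAdd (a b : A.carrier ()) : h.app () (A.rAdd a b) = B.rAdd (h.app () a) (h.app () b) :=
  (h.map_op .add _).trans (congrArg _ (funext fun a => by cases a <;> rfl))
lemma map_rMul (a b : A.carrier ()) : h.app () (A.rMul a b) = B.rMul (h.app () a) (h.app () b) :=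
  (h.map_op .mul _).trans (congrArg _ (funext fun a => by cases a <;> rfl))

/-- The laws of rings have at most three variables. Both sides of a law are term operations natural
in homomorphisms, so it can be lifted to a cover and checked in rings. -/
lemma IsLike.ring_law (hB : IsLike ringStr B)
    (l r : ∀ B : Str.{u} ringSig, B.carrier () → B.carrier () → B.carrier () → B.carrier ())
    (hl : ∀ {A B : Str.{u} ringSig} (h : Str.Hom A B) a b c,
      h.app () (l A a b c) = l B (h.app () a) (h.app () b) (h.app () c))
    (hr : ∀ {A B : Str.{u} ringSig} (h : Str.Hom A B) a b c,
      h.app () (r A a b c) = r B (h.app () a) (h.app () b) (h.app () c))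
    (H : ∀ (R : CommRingCat.{u}) (a b c : R), l (ringStr.obj R) a b c = r (ringStr.obj R) a b c)
    (a b c : B.carrier ()) : l B a b c = r B a b c := by
  obtain ⟨B', φ, a, b, c, rfl, rfl, rfl, ker⟩ := hB.triple a b c
  rw [← hl, ← hr]
  exact ker _ _ _ fun A ψ => by rw [hl, hr]; exact H A _ _ _

/-- A structure that satisfies the equations of commutative rings is a commutative ring. -/
abbrev IsLike.commRing (hB : IsLike ringStr B) : CommRing (B.carrier ()) where
  zero := B.rZero
  one := B.rOne
  neg := B.rNeg
  add := B.rAdd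
  mul := B.rMul
  nsmul := @nsmulRec _ ⟨B.rZero⟩ ⟨B.rAdd⟩
  zsmul := @zsmulRec _ ⟨B.rZero⟩ ⟨B.rAdd⟩ ⟨B.rNeg⟩ (@nsmulRec _ ⟨B.rZero⟩ ⟨B.rAdd⟩)
  add_assoc := hB.ring_law (fun B a b c => B.rAdd (B.rAdd a b) c)
    (fun B a b c => B.rAdd a (B.rAdd b c)) (by simp [map_rAdd]) (by simp [map_rAdd])
    fun R => add_assoc (G := R)
  add_comm a b := hB.ring_law (fun B a b _ => B.rAdd a b) (fun B a b _ => B.rAdd b a)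
    (by simp [map_rAdd]) (by simp [map_rAdd]) (fun R a b _ => add_comm (G := R) a b) a b a
  zero_add a := hB.ring_law (fun B a _ _ => B.rAdd B.rZero a) (fun B a _ _ => a)
    (by simp [map_rAdd, map_rZero]) (by simp) (fun R a _ _ => zero_add (M := R) a) a a a
  add_zero a := hB.ring_law (fun B a _ _ => B.rAdd a B.rZero) (fun B a _ _ => a)
    (by simp [map_rAdd, map_rZero]) (by simp) (fun R a _ _ => add_zero (M := R) a) a a a
  neg_add_cancel a := hB.ring_law (fun B a _ _ => B.rAdd (B.rNeg a) a) (fun B _ _ _ => B.rZero)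
    (by simp [map_rAdd, map_rNeg]) (by simp [map_rZero])
    (fun R a _ _ => neg_add_cancel (G := R) a) a a a
  mul_assoc := hB.ring_law (fun B a b c => B.rMul (B.rMul a b) c)
    (fun B a b c => B.rMul a (B.rMul b c)) (by simp [map_rMul]) (by simp [map_rMul])
    fun R => mul_assoc (G := R)
  mul_comm a b := hB.ring_law (fun B a b _ => B.rMul a b) (fun B a b _ => B.rMul b a)
    (by simp [map_rMul]) (by simp [map_rMul]) (fun R a b _ => mul_comm (G := R) a b) a b a
  one_mul a := hB.ring_law (fun B a _ _ => B.rMul B.rOne a) (fun B a _ _ => a)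
    (by simp [map_rMul, map_rOne]) (by simp) (fun R a _ _ => one_mul (M := R) a) a a a
  mul_one a := hB.ring_law (fun B a _ _ => B.rMul a B.rOne) (fun B a _ _ => a)
    (by simp [map_rMul, map_rOne]) (by simp) (fun R a _ _ => mul_one (M := R) a) a a a
  zero_mul a := hB.ring_law (fun B a _ _ => B.rMul B.rZero a) (fun B _ _ _ => B.rZero)
    (by simp [map_rMul, map_rZero]) (by simp [map_rZero])
    (fun R a _ _ => zero_mul (M₀ := R) a) a a a
  mul_zero a := hB.ring_law (fun B a _ _ => B.rMul a B.rZero) (fun B _ _ _ => B.rZero)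
    (by simp [map_rMul, map_rZero]) (by simp [map_rZero])
    (fun R a _ _ => mul_zero (M₀ := R) a) a a a
  left_distrib := hB.ring_law (fun B a b c => B.rMul a (B.rAdd b c))
    (fun B a b c => B.rAdd (B.rMul a b) (B.rMul a c)) (by simp [map_rMul, map_rAdd])
    (by simp [map_rMul, map_rAdd]) fun R => mul_add (R := R)
  right_distrib := hB.ring_law (fun B a b c => B.rMul (B.rAdd a b) c)
    (fun B a b c => B.rAdd (B.rMul a c) (B.rMul b c)) (by simp [map_rMul, map_rAdd])
    (by simp [map_rMul, map_rAdd]) fun R => add_mul (R := R)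

end Str

instance : AlgCat CommRingCat.{u} where
  S := ringSig
  E := ringStr
  ff :=
    { preimage := fun {R S} g => CommRingCat.ofHom
        { toFun := Str.Hom.app g ()
          map_zero' := Str.map_rZero g
          map_one' := Str.map_rOne g
          map_add' := Str.map_rAdd g
          map_mul' := Str.map_rMul g }
      map_preimage := fun g => rfl
      preimage_map := fun f => rfl }
  closed B hB := by
    let _ := hB.commRing
    refine ⟨CommRingCat.of (B.carrier ()), ⟨⟨⟨fun _ x => x, ?_⟩, ⟨fun _ x => x, ?_⟩, rfl, rfl⟩⟩⟩
    · rintro (_ | _) x <;>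
        exact congrArg (B.op _) (funext fun a => by first | rfl | (cases a <;> rfl))
    · rintro (_ | _) x <;>
        exact congrArg (B.op _) (funext fun a => by first | rfl | (cases a <;> rfl))

/-! ### Change of the structure sheaf -/

/-- The elements of `F.obj A` are finite families of elements of `A`. -/
class Elementwise {C D : Type (u + 1)} [Category.{u} C] [Category.{u} D] [AlgCat C] [AlgCat D]
    (F : C ⥤ D) where
  ι : (AlgCat.S D).K → Type
  fin : ∀ k, Finite (ι k)
  κ : ∀ k, ι k → (AlgCat.S C).K
  e : ∀ (k) (A : C), El k (F.obj A) ≃ ∀ i, El (κ k i) A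
  e_ap : ∀ {A B : C} (f : A ⟶ B) (k) (x : El k (F.obj A)) (i),
    e k B (ap (F.map f) x) i = ap f (e k A x i)

instance : Elementwise propOfRing.{u} where
  ι k := Fin k.1 × Fin k.2
  fin _ := inferInstance
  κ _ _ := ()
  e k A := (Equiv.curry (Fin k.1) (Fin k.2) A).symm
  e_ap _ _ _ _ := rfl

instance : Elementwise bioOfProp.{u} where
  ι _ := Unit
  fin _ := inferInstance
  κ
    | .inl n, _ => (1, n)
    | .inr n, _ => (n, 1)
  e
    | .inl n, _ => (Equiv.funUnique Unit _).symm
    | .inr n, _ => (Equiv.funUnique Unit _).symm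
  e_ap f k x i := by cases k <;> rfl

section
variable {C D : Type (u + 1)} [Category.{u} C] [Category.{u} D] [AlgCat C] [AlgCat D]
  (F : C ⥤ D) [Elementwise F]

attribute [instance] Elementwise.fin

variable {F} in
lemma el_map_ext {A : C} {k} {x y : El k (F.obj A)}
    (h : ∀ i, Elementwise.e k A x i = Elementwise.e k A y i) : x = y :=
  (Elementwise.e k A).injective (funext h)

variable {X : PSp C} (G : Germs X)

lemma Germs.exists_common {ι : Type} [Finite ι] {k : ι → (AlgCat.S C).K} {x : X}
    (y : ∀ i, El (k i) (G.L x)) :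
    ∃ (V : Opens X) (hx : x ∈ V) (a : ∀ i, El (k i) (Sect X V)), ∀ i, ap (G.ev V x hx) (a i) = y i := by
  choose V hV a ha using fun i => G.surj (y i)
  let V' : Opens X := ⟨⋂ i, (V i : Set X), isOpen_iInter_of_finite fun i => (V i).2⟩
  have hle : ∀ i, V' ≤ V i := fun i => Set.iInter_subset _ i
  refine ⟨V', Set.mem_iInter.2 hV, fun i => ap (rs X (hle i)) (a i), fun i => ?_⟩
  rw [G.ev_rs, ha]

lemma Germs.exists_near {ι : Type} [Finite ι] {k : ι → (AlgCat.S C).K} {V : Opens X} {x : X}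
    {hx : x ∈ V} {a b : ∀ i, El (k i) (Sect X V)}
    (h : ∀ i, ap (G.ev V x hx) (a i) = ap (G.ev V x hx) (b i)) :
    ∃ (W : Opens X) (h : W ≤ V), x ∈ W ∧ ∀ i, ap (rs X h) (a i) = ap (rs X h) (b i) := by
  choose W hW hxW e using fun i => G.near (h i)
  let W' : Opens X := ⟨V ∩ ⋂ i, (W i : Set X), V.2.inter (isOpen_iInter_of_finite fun i => (W i).2)⟩
  have hle : ∀ i, W' ≤ W i := fun i x h => Set.mem_iInter.1 h.2 i
  refine ⟨W', fun x h => h.1, ⟨hx, Set.mem_iInter.2 hxW⟩, fun i => ?_⟩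
  have := congrArg (ap (rs X (hle i))) (e i)
  rwa [← ap_comp, ← ap_comp, rs_rs] at this

/-- The stalks of the space with the changed structure sheaf. -/
def Germs.map : Germs (F.mapPresheaf.obj X) where
  L x := F.obj (G.L x)
  ev V x hx := F.map (G.ev V x hx)
  rs_ev h x hx := (F.map_comp _ _).symm.trans (congrArg F.map (G.rs_ev h x hx))
  surj {x k} y := by
    obtain ⟨V, hx, a, ha⟩ := G.exists_common fun i => Elementwise.e (F := F) k _ y i
    refine ⟨V, hx, (Elementwise.e (F := F) k _).symm a, el_map_ext fun i => ?_⟩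
    refine (Elementwise.e_ap (F := F) (G.ev V x hx) k _ i).trans ?_
    exact (congrArg (ap (G.ev V x hx)) (congrFun (Equiv.apply_symm_apply _ a) i)).trans (ha i)
  near {V x hx k a b} h := by
    obtain ⟨W, hW, hxW, e⟩ := G.exists_near (hx := hx) (a := Elementwise.e (F := F) k _ a)
      (b := Elementwise.e (F := F) k _ b) fun i => by
        refine (Elementwise.e_ap (F := F) (G.ev V x hx) k a i).symm.trans (Eq.trans ?_
          (Elementwise.e_ap (F := F) (G.ev V x hx) k b i))
        exact congrFun (congrArg _ h) i
    refine ⟨W, hW, hxW, el_map_ext fun i => ?_⟩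
    exact (Elementwise.e_ap (F := F) (rs X hW) k a i).trans ((e i).trans
      (Elementwise.e_ap (F := F) (rs X hW) k b i).symm)

variable {G} in
-- Separation and gluing are carried out in each of the finitely many coordinates.
lemma Germs.IsSheaf.map (hG : G.IsSheaf) : (G.map F).IsSheaf where
  sep {V k a b} h := el_map_ext fun i => hG.sep fun x hx =>
    (Elementwise.e_ap (F := F) (G.ev V x hx) k a i).symm.trans (Eq.trans
      (congrFun (congrArg _ (h x hx)) i) (Elementwise.e_ap (F := F) (G.ev V x hx) k b i))
  glue {V k} s hs := by
    have key : ∀ i, ∃ a : El (Elementwise.κ (F := F) k i) (Sect X V), ∀ x hx, ap (G.ev V x hx) a =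
        Elementwise.e (F := F) k _ (s x hx) i := fun i => hG.glue _ fun x hx => by
      obtain ⟨W, hW, hxW, a, ha⟩ := hs x hx
      refine ⟨W, hW, hxW, Elementwise.e (F := F) k _ a i, fun y hy => ?_⟩
      exact (Elementwise.e_ap (F := F) (G.ev W y hy) k a i).symm.trans
        (congrFun (congrArg (Elementwise.e (F := F) k _) (ha y hy)) i)
    choose a ha using key
    refine ⟨(Elementwise.e (F := F) k _).symm a, fun x hx => el_map_ext fun i => ?_⟩
    refine (Elementwise.e_ap (F := F) (G.ev V x hx) k _ i).trans ?_
    exact (congrArg (ap (G.ev V x hx)) (congrFun (Equiv.apply_symm_apply _ a) i)).trans (ha i x hx)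

end

section
variable {C D : Type (u + 1)} [Category.{u} C] [Category.{u} D] (F : C ⥤ D) [F.Full] [F.Faithful]
  {X Y : PSp C}

lemma exists_preimage_mapPresheaf (g : F.mapPresheaf.obj X ⟶ F.mapPresheaf.obj Y) :
    ∃ g' : X ⟶ Y, F.mapPresheaf.map g' = g := by
  have h : ∀ {V W : (Opens Y)ᵒᵖ} (i : V ⟶ W), Y.presheaf.map i ≫ F.preimage (X := Y.presheaf.obj W)
      (Y := X.presheaf.obj ((Opens.map g.base).op.obj W)) (g.c.app W) =
      F.preimage (X := Y.presheaf.obj V) (Y := X.presheaf.obj ((Opens.map g.base).op.obj V))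
        (g.c.app V) ≫ X.presheaf.map ((Opens.map g.base).op.map i) := fun {V W} i => F.map_injective (by
    refine (F.map_comp _ _).trans (Eq.trans ?_ (F.map_comp _ _).symm)
    refine (congrArg (fun z => F.map (Y.presheaf.map i) ≫ z) (F.map_preimage (X := Y.presheaf.obj W)
      (Y := X.presheaf.obj ((Opens.map g.base).op.obj W)) (g.c.app W))).trans ?_
    refine (g.c.naturality i).trans ?_
    exact (congrArg (fun z => z ≫ F.map (X.presheaf.map ((Opens.map g.base).op.map i)))
      (F.map_preimage (X := Y.presheaf.obj V)
        (Y := X.presheaf.obj ((Opens.map g.base).op.obj V)) (g.c.app V))).symm)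
  refine ⟨⟨g.base, ⟨fun V => F.preimage (g.c.app V), fun V W i => h i⟩⟩, ?_⟩
  refine PresheafedSpace.ext _ _ rfl (NatTrans.ext (funext fun V => ?_))
  refine Eq.trans ?_ (F.map_preimage (X := Y.presheaf.obj V)
    (Y := X.presheaf.obj ((Opens.map g.base).op.obj V)) (g.c.app V))
  exact (congrArg (fun z => _ ≫ z) ((F.mapPresheaf.obj X).presheaf.map_id _)).trans
    (Category.comp_id _)

lemma mapPresheaf_injective {g g' : X ⟶ Y} (h : F.mapPresheaf.map g = F.mapPresheaf.map g') :
    g = g' := by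
  have hb : g.base = g'.base := congrArg
    (fun z : F.mapPresheaf.obj X ⟶ F.mapPresheaf.obj Y => z.base) h
  obtain ⟨g, φ⟩ := g
  obtain ⟨g', ψ⟩ := g'
  obtain rfl : g = g' := hb
  congr 1
  refine NatTrans.ext (funext fun V => F.map_injective ?_)
  have := PresheafedSpace.congr_app h V
  refine this.trans ?_
  exact (congrArg (fun z => _ ≫ z) ((F.mapPresheaf.obj X).presheaf.map_id _)).trans
    (Category.comp_id _)

end

/-! ### Matrices over commutative rings -/

namespace MatrixBio

section
variable {R : Type u} [CommRing R]

lemma compR_apply {n m : ℕ} {k : Fin n → ℕ} (e : Split k m) (p : Matrix (Fin 1) (Fin n) R)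
    (q : ∀ i, Matrix (Fin 1) (Fin (k i)) R) (i : Fin n) (x : Fin (k i)) :
    (matCPrp R).toCBio.compR e p q (0 : Fin 1) (e ⟨i, x⟩) = p 0 i * q i 0 x := by
  change (p * Matrix.reindex (Split.ones n) e (Matrix.blockDiagonal' q)) 0 (e ⟨i, x⟩) = _
  rw [Matrix.mul_apply, Finset.sum_eq_single i]
  · rw [Matrix.reindex_apply, Matrix.submatrix_apply, Equiv.symm_apply_apply]
    exact congrArg (p 0 i * ·) (Matrix.blockDiagonal'_apply_eq q i 0 x)
  · intro j _ hj
    rw [Matrix.reindex_apply, Matrix.submatrix_apply, Equiv.symm_apply_apply]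
    exact (congrArg (p 0 j * ·) (Matrix.blockDiagonal'_apply_ne q (0 : Fin 1) x hj)).trans
      (mul_zero _)
  · simp

lemma compC_apply {n m : ℕ} {k : Fin n → ℕ} (e : Split k m)
    (q : ∀ i, Matrix (Fin (k i)) (Fin 1) R) (c : Matrix (Fin n) (Fin 1) R) (i : Fin n)
    (x : Fin (k i)) :
    (matCPrp R).toCBio.compC e q c (e ⟨i, x⟩) (0 : Fin 1) = q i x 0 * c i 0 := by
  change (Matrix.reindex e (Split.ones n) (Matrix.blockDiagonal' q) * c) (e ⟨i, x⟩) 0 = _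
  rw [Matrix.mul_apply, Finset.sum_eq_single i]
  · rw [Matrix.reindex_apply, Matrix.submatrix_apply, Equiv.symm_apply_apply]
    exact congrArg (· * c i 0) (Matrix.blockDiagonal'_apply_eq q i x 0)
  · intro j _ hj
    rw [Matrix.reindex_apply, Matrix.submatrix_apply, Equiv.symm_apply_apply]
    exact (congrArg (· * c j 0) (Matrix.blockDiagonal'_apply_ne q x (0 : Fin 1) hj.symm)).trans
      (zero_mul _)
  · simp

lemma reindex_single {n : ℕ} (a : Matrix (Fin n) (Fin 1) R) :
    Matrix.reindex (Split.single n) (Split.ones 1) (Matrix.blockDiagonal' fun _ : Fin 1 => a) = a := by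
  rw [← CBio.single_one]
  exact (matPrp R).dsum_single a

lemma reindex_single' {n : ℕ} (a : Matrix (Fin 1) (Fin n) R) :
    Matrix.reindex (Split.ones 1) (Split.single n) (Matrix.blockDiagonal' fun _ : Fin 1 => a) = a := by
  rw [← CBio.single_one]
  exact (matPrp R).dsum_single a

lemma actR_single {n : ℕ} (p : Matrix (Fin 1) (Fin n) R) (c : Matrix (Fin n) (Fin 1) R) :
    (matCPrp R).toCBio.actR (Split.single n) p (fun _ => c) = p * c :=
  congrArg (p * ·) (reindex_single c)

lemma actC_single {n : ℕ} (p : Matrix (Fin 1) (Fin n) R) (c : Matrix (Fin n) (Fin 1) R) :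
    (matCPrp R).toCBio.actC (Split.single n) (fun _ => p) c = p * c :=
  congrArg (· * c) (reindex_single' p)

lemma contr_apply {n : ℕ} (b : Matrix (Fin 1) (Fin n) R) (a : Fin n → Matrix (Fin 1) (Fin 1) R)
    (d : Matrix (Fin n) (Fin 1) R) :
    (matCPrp R).toCBio.contr b a d (0 : Fin 1) (0 : Fin 1) = ∑ i, b 0 i * a i 0 0 * d i 0 := by
  refine (congrFun (congrFun (actR_single ((matCPrp R).toCBio.compR (Split.ones n) b a) d) 0)
    0).trans ?_
  refine (Matrix.mul_apply (M := ((matCPrp R).toCBio.compR (Split.ones n) b a :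
    Matrix (Fin 1) (Fin n) R)) (N := d)).trans ?_
  refine Finset.sum_congr rfl fun i _ => congrArg (· * d i 0) ?_
  exact compR_apply (Split.ones n) b a i 0

lemma mul_apply (s t : Matrix (Fin 1) (Fin 1) R) :
    ((s : (matCPrp R).toCBio.R 1) * t : (matCPrp R).toCBio.R 1) (0 : Fin 1) (0 : Fin 1) =
      s 0 0 * t 0 0 :=
  compR_apply (Split.single 1) s (fun _ => t) 0 0

end

/-- The decomposition of a point into empty blocks and the block with index `i`. -/
def splitAt {n : ℕ} (i : Fin n) : Split (fun t => if t = i then 1 else 0) 1 :=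
  Fintype.equivFinOfCardEq (by simp)

section
variable {R S : CommRingCat.{u}} (Ψ : bioOfRing.obj R ⟶ bioOfRing.obj S)

/-- The map of rows. -/
def onR (n : ℕ) (a : Matrix (Fin 1) (Fin n) R) : Matrix (Fin 1) (Fin n) S := Bio.Hom.onR Ψ n a
/-- The map of columns. -/
def onC (n : ℕ) (a : Matrix (Fin n) (Fin 1) R) : Matrix (Fin n) (Fin 1) S := Bio.Hom.onC Ψ n a

lemma onR_ones {n : ℕ} (hn : n ≤ 1) : onR Ψ n (fun _ _ => 1) = fun _ _ => 1 := by
  interval_cases n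
  · exact Subsingleton.elim _ _
  · have h := Bio.Hom.map_oneR Ψ
    have e : ∀ R : CommRingCat.{u}, (bioOfRing.obj R).oneR =
        (fun _ _ => 1 : Matrix (Fin 1) (Fin 1) R) := fun R => by
      funext i j
      exact Matrix.one_apply.trans (if_pos (Subsingleton.elim _ _))
    rw [e, e] at h
    exact h

lemma onC_one_eq (a : Matrix (Fin 1) (Fin 1) R) : onC Ψ 1 a = onR Ψ 1 a := by
  have h := Bio.Hom.map_actC Ψ (Split.single 1) (fun _ => a) (bioOfRing.obj R).oneC
  rw [Bio.Hom.map_oneC] at h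
  exact (congrArg (onC Ψ 1) ((actC_single a 1).trans (Matrix.mul_one a))).symm.trans (h.trans
    ((actC_single (onR Ψ 1 a) 1).trans (Matrix.mul_one _)))

lemma onC_ones {n : ℕ} (hn : n ≤ 1) : onC Ψ n (fun _ _ => 1) = fun _ _ => 1 := by
  interval_cases n
  · exact Subsingleton.elim _ _
  · exact (onC_one_eq Ψ _).trans (onR_ones Ψ le_rfl)

/-- An entry of a row is obtained by composing with the unit in one block and with the unique empty
row in all others. Both are preserved by homomorphisms of bios, so these act entrywise. -/
lemma onR_apply {n : ℕ} (p : Matrix (Fin 1) (Fin n) R) (i : Fin n) :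
    onR Ψ n p 0 i = onR Ψ 1 (fun _ _ => p 0 i) 0 0 := by
  have h := Bio.Hom.map_compR Ψ (splitAt i) p (fun t => (fun _ _ => 1 : Matrix (Fin 1) (Fin _) R))
  have hk : ∀ t, (if t = i then 1 else 0) ≤ 1 := fun t => by split_ifs <;> omega
  have e : (bioOfRing.obj R).compR (splitAt i) p
      (fun t => (fun _ _ => 1 : Matrix (Fin 1) (Fin _) R)) = fun _ _ => p 0 i := by
    funext a b
    have := compR_apply (splitAt i) p (fun t => (fun _ _ => 1)) i ⟨0, by simp⟩
    rw [mul_one] at this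
    obtain rfl : a = 0 := Subsingleton.elim (α := Fin 1) _ _
    obtain rfl : b = splitAt i ⟨i, ⟨0, by simp⟩⟩ := Subsingleton.elim (α := Fin 1) _ _
    exact this
  rw [e] at h
  have h' := congrFun (congrFun h (0 : Fin 1)) ((splitAt i) ⟨i, ⟨0, by simp⟩⟩)
  refine Eq.symm (Eq.trans ?_ (h'.trans ((compR_apply (splitAt i) (onR Ψ n p) _ i _).trans
    ((congrArg (_ * ·) (congrFun (congrFun (onR_ones Ψ (hk i)) 0) _)).trans (mul_one _)))))
  exact congrArg (onR Ψ 1 (fun _ _ => p 0 i) 0) (Subsingleton.elim _ _)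

lemma onC_apply {n : ℕ} (p : Matrix (Fin n) (Fin 1) R) (i : Fin n) :
    onC Ψ n p i 0 = onR Ψ 1 (fun _ _ => p i 0) 0 0 := by
  have h := Bio.Hom.map_compC Ψ (splitAt i) (fun t => (fun _ _ => 1 : Matrix (Fin _) (Fin 1) R)) p
  have hk : ∀ t, (if t = i then 1 else 0) ≤ 1 := fun t => by split_ifs <;> omega
  have e : (bioOfRing.obj R).compC (splitAt i)
      (fun t => (fun _ _ => 1 : Matrix (Fin _) (Fin 1) R)) p = fun _ _ => p i 0 := by
    funext a b
    have := compC_apply (splitAt i) (fun t => (fun _ _ => 1)) p i ⟨0, by simp⟩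
    rw [one_mul] at this
    obtain rfl : b = 0 := Subsingleton.elim (α := Fin 1) _ _
    obtain rfl : a = splitAt i ⟨i, ⟨0, by simp⟩⟩ := Subsingleton.elim (α := Fin 1) _ _
    exact this
  rw [e] at h
  have h' := congrFun (congrFun h ((splitAt i) ⟨i, ⟨0, by simp⟩⟩)) (0 : Fin 1)
  refine Eq.symm (Eq.trans ?_ (h'.trans ((compC_apply (splitAt i) _ (onC Ψ n p) i _).trans
    ((congrArg (· * _) (congrFun (congrFun (onC_ones Ψ (hk i)) _) 0)).trans (one_mul _)))))
  refine (congrFun (congrFun (onC_one_eq Ψ fun _ _ => p i 0) 0) 0).symm.trans ?_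
  exact congrFun (congrArg (onC Ψ 1 (fun _ _ => p i 0)) (Subsingleton.elim _ _)) 0

/-- The ring homomorphism underlying a homomorphism of bios of matrices. -/
def ringHom : R ⟶ S := CommRingCat.ofHom
  (RingHom.mk' (α := R) (β := S)
    { toFun := fun a => onR Ψ 1 (fun _ _ => a) 0 0
      map_one' := congrFun (congrFun (onR_ones Ψ le_rfl) 0) 0
      map_mul' := fun a b => by
        have h := Bio.Hom.map_compR Ψ (Split.single 1) (fun _ _ => a : Matrix (Fin 1) (Fin 1) R)
          (fun _ => (fun _ _ => b : Matrix (Fin 1) (Fin 1) R))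
        have e : (bioOfRing.obj R).compR (Split.single 1) (fun _ _ => a : Matrix (Fin 1) (Fin 1) R)
            (fun _ => (fun _ _ => b : Matrix (Fin 1) (Fin 1) R)) = fun _ _ => a * b := by
          funext i j
          have := compR_apply (Split.single 1) (fun _ _ => a : Matrix (Fin 1) (Fin 1) R)
            (fun _ => (fun _ _ => b : Matrix (Fin 1) (Fin 1) R)) 0 0
          obtain rfl : i = 0 := Subsingleton.elim (α := Fin 1) _ _
          obtain rfl : j = 0 := Subsingleton.elim (α := Fin 1) _ _
          exact this
        rw [e] at h
        exact (congrFun (congrFun h (0 : Fin 1)) (0 : Fin 1)).trans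
          (compR_apply (Split.single 1) (onR Ψ 1 fun _ _ => a) (fun _ => onR Ψ 1 fun _ _ => b) 0 0) }
    -- The sum is the row `(a, b)` composed with the column `(1, 1)`. Homomorphisms preserve this
    -- composite and act on the row and the column entrywise.
    fun a b => by
      have h := Bio.Hom.map_actR Ψ (Split.single 2) (!![a, b] : Matrix (Fin 1) (Fin 2) R)
        (fun _ => (!![1; 1] : Matrix (Fin 2) (Fin 1) R))
      have e : (bioOfRing.obj R).actR (Split.single 2) (!![a, b] : Matrix (Fin 1) (Fin 2) R)
        (fun _ => (!![1; 1] : Matrix (Fin 2) (Fin 1) R)) = fun _ _ => a + b := by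
        refine (actR_single (!![a, b] : Matrix (Fin 1) (Fin 2) R) !![1; 1]).trans ?_
        refine Matrix.ext fun i j => ?_
        simp [Matrix.mul_apply]
      rw [e] at h
      refine (congrFun (congrFun h (0 : Fin 1)) (0 : Fin 1)).trans ?_
      refine (congrFun (congrFun (actR_single (onR Ψ 2 !![a, b]) (onC Ψ 2 !![1; 1])) 0) 0).trans ?_
      rw [Matrix.mul_apply, Fin.sum_univ_two, onR_apply, onR_apply, onC_apply, onC_apply]
      have h1 := congrFun (congrFun (onR_ones Ψ le_rfl) 0) 0
      simp only [Matrix.of_apply, Matrix.cons_val', Matrix.cons_val_zero, Matrix.cons_val_one,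
        Matrix.cons_val_fin_one, h1, mul_one]
      rfl)

lemma map_ringHom : bioOfRing.map (ringHom Ψ) = Ψ := by
  refine Bio.Hom.ext (funext fun n => funext fun a => funext fun i => funext fun j => ?_)
    (funext fun n => funext fun a => funext fun i => funext fun j => ?_)
  · obtain rfl : i = 0 := Subsingleton.elim (α := Fin 1) _ _
    exact (onR_apply Ψ a j).symm
  · obtain rfl : j = 0 := Subsingleton.elim (α := Fin 1) _ _
    exact (onC_apply Ψ a i).symm

end

end MatrixBio

instance : bioOfRing.{u}.Full := ⟨fun Ψ => ⟨_, MatrixBio.map_ringHom Ψ⟩⟩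

instance : propOfRing.{u}.Faithful where
  map_injective {R S f g} h := by
    refine CommRingCat.hom_ext (RingHom.ext fun a => ?_)
    exact congrArg (fun φ : propOfRing.obj R ⟶ propOfRing.obj S =>
      Prp.Hom.on φ 1 1 (fun _ _ => a : Matrix (Fin 1) (Fin 1) R) (0 : Fin 1) (0 : Fin 1)) h

instance : bioOfRing.{u}.Faithful where
  map_injective {R S f g} h := by
    refine CommRingCat.hom_ext (RingHom.ext fun a => ?_)
    exact congrArg (fun φ : bioOfRing.obj R ⟶ bioOfRing.obj S =>
      Bio.Hom.onR φ 1 (fun _ _ => a : Matrix (Fin 1) (Fin 1) R) (0 : Fin 1) (0 : Fin 1)) h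

/-- The entries of a matrix are its products with unit rows and columns. A homomorphism between
props of matrices is therefore determined by its effect on rows and columns. -/
lemma matrix_entry {R : Type u} [CommRing R] {n m : ℕ} (a : Matrix (Fin n) (Fin m) R) (i : Fin n)
    (j : Fin m) : (Matrix.of fun _ x => (1 : Matrix (Fin n) (Fin n) R) i x :
      Matrix (Fin 1) (Fin n) R) *
      (a * (Matrix.of fun x _ => (1 : Matrix (Fin m) (Fin m) R) x j : Matrix (Fin m) (Fin 1) R)) =
      Matrix.of fun _ _ => a i j := by
  ext x y
  simp [Matrix.mul_apply, Matrix.one_apply]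

lemma propOfRing_map_eq {R S : CommRingCat.{u}} {f : propOfRing.obj R ⟶ propOfRing.obj S}
    {φ : R ⟶ S} (h : bioOfRing.map φ = bioOfProp.map f) : propOfRing.map φ = f := by
  refine Prp.Hom.ext (funext fun n => funext fun m => funext fun
    (a : Matrix (Fin n) (Fin m) R) => ?_)
  have hr : ∀ {n} (p : Matrix (Fin 1) (Fin n) R), Prp.Hom.on f 1 n p = p.map φ.hom := fun {n} p =>
    congrArg (fun φ : bioOfRing.obj R ⟶ bioOfRing.obj S => Bio.Hom.onR φ n p) h.symm
  have hc : ∀ {n} (p : Matrix (Fin n) (Fin 1) R), Prp.Hom.on f n 1 p = p.map φ.hom := fun {n} p =>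
    congrArg (fun φ : bioOfRing.obj R ⟶ bioOfRing.obj S => Bio.Hom.onC φ n p) h.symm
  refine Matrix.ext fun i j => ?_
  have key := (Prp.Hom.map_comp f (Matrix.of fun _ x => (1 : Matrix (Fin n) (Fin n) R) i x :
      Matrix (Fin 1) (Fin n) R) (a * (Matrix.of fun x _ =>
        (1 : Matrix (Fin m) (Fin m) R) x j : Matrix (Fin m) (Fin 1) R))).trans (congrArg
    ((propOfRing.obj S).comp _) (Prp.Hom.map_comp f a (Matrix.of fun x _ =>
        (1 : Matrix (Fin m) (Fin m) R) x j : Matrix (Fin m) (Fin 1) R)))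
  rw [hr, hc] at key
  have e₁ : (Matrix.of fun _ x => (1 : Matrix (Fin n) (Fin n) R) i x : Matrix (Fin 1) (Fin n) R).map
      φ.hom = Matrix.of fun _ x => (1 : Matrix (Fin n) (Fin n) S) i x := by
    ext x y
    simp [Matrix.one_apply, apply_ite φ.hom]
  have e₂ : (Matrix.of fun x _ => (1 : Matrix (Fin m) (Fin m) R) x j : Matrix (Fin m) (Fin 1) R).map
      φ.hom = Matrix.of fun x _ => (1 : Matrix (Fin m) (Fin m) S) x j := by
    ext x y
    simp [Matrix.one_apply, apply_ite φ.hom]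
  rw [e₁, e₂] at key
  have key' := key.trans (matrix_entry (Prp.Hom.on f n m a : Matrix (Fin n) (Fin m) S) i j)
  have key'' := (congrArg (Prp.Hom.on f 1 1) (matrix_entry a i j)).symm.trans key'
  rw [hr] at key''
  exact congrFun (congrFun key'' 0) 0

instance : propOfRing.{u}.Full := ⟨fun Φ => ⟨MatrixBio.ringHom (bioOfProp.map Φ),
  propOfRing_map_eq (MatrixBio.map_ringHom (bioOfProp.map Φ))⟩⟩

/-! ### Matrices over locally ringed spaces -/

lemma isUnit_matrix_iff {R : CommRingCat.{u}} (s : (bioOfProp.obj (propOfRing.obj R)).R 1) :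
    IsUnit s ↔ IsUnit ((s : Matrix (Fin 1) (Fin 1) R) 0 0) := by
  have key : ∀ s t : (bioOfProp.obj (propOfRing.obj R)).R 1,
      (s * t) (0 : Fin 1) (0 : Fin 1) = (s (0 : Fin 1) (0 : Fin 1) * t (0 : Fin 1) (0 : Fin 1) : R) :=
    fun s t => MatrixBio.mul_apply s t
  have h1 : (1 : (bioOfProp.obj (propOfRing.obj R)).R 1) (0 : Fin 1) (0 : Fin 1) = (1 : R) := rfl
  constructor
  · intro h
    obtain ⟨t, ht⟩ := isUnit_iff_exists_inv.1 h
    exact isUnit_iff_exists_inv.2 ⟨t (0 : Fin 1) (0 : Fin 1), by rw [← h1, ← ht, key]⟩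
  · intro h
    obtain ⟨t, ht⟩ := isUnit_iff_exists_inv.1 h
    refine isUnit_iff_exists_inv.2 ⟨(fun _ _ => t : Matrix (Fin 1) (Fin 1) R), ?_⟩
    funext i j
    obtain rfl : i = 0 := Subsingleton.elim (α := Fin 1) _ _
    obtain rfl : j = 0 := Subsingleton.elim (α := Fin 1) _ _
    exact (key _ _).trans (ht.trans h1.symm)

lemma isLocal_matrix (R : CommRingCat.{u}) [IsLocalRing R] :
    (bioOfProp.obj (propOfRing.obj R)).IsLocal := by
  refine CBio.isLocal_iff.2 fun n b a d h hu => ?_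
  have hu' := (isUnit_matrix_iff _).1 hu
  have e : (CBio.contr _ b a d : Matrix (Fin 1) (Fin 1) R) 0 0 = _ := MatrixBio.contr_apply b a d
  rw [e] at hu'
  -- Over a ring the contraction is a sum of products, and in a local ring a sum that is a unit has
  -- a unit among its terms.
  obtain ⟨i, -, hi⟩ := IsLocalRing.exists_of_isUnit_sum hu'
  exact h i ((isUnit_matrix_iff _).2 (isUnit_of_mul_isUnit_right (isUnit_of_mul_isUnit_left hi)))

section
variable (X Y : LocallyRingedSpace.{u})

/-- The stalks of a locally ringed space. -/
def lrsGerms : Germs (lrsForget.obj X) where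
  L x := X.presheaf.stalk x
  ev V x hx := X.presheaf.germ V x hx
  rs_ev h x hx := X.presheaf.germ_res (homOfLE h) x hx
  surj {x k} y := by
    obtain ⟨V, hx, a, h⟩ := TopCat.Presheaf.exists_germ_eq X.presheaf (show X.presheaf.stalk x from y)
    exact ⟨V, hx, a, h⟩
  near {V x hx k a b} h := by
    obtain ⟨W, hW, i, j, e⟩ := TopCat.Presheaf.germ_eq (C := CommRingCat.{u}) X.presheaf x hx hx
      (show X.presheaf.obj (op V) from a) (show X.presheaf.obj (op V) from b) h
    exact ⟨W, leOfHom i, hW, e⟩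

lemma isSheaf_lrsGerms : (lrsGerms X).IsSheaf := (lrsGerms X).isSheaf_of_isSheaf X.IsSheaf

variable {X Y}

lemma unitAt_matrix {V : Opens (lrsForget.obj X)} (x : X)
    (s : Matrix (Fin 1) (Fin 1) (X.presheaf.obj (op V))) :
    ((lrsGerms X).map propOfRing.{u}).UnitAt (U := bioOfProp.{u}) (V := V) x s ↔
      ∃ hx : x ∈ V, IsUnit (X.presheaf.germ V x hx (s 0 0)) :=
  exists_congr fun _ => isUnit_matrix_iff _

lemma unitAt_of_isLocalHom (f : X ⟶ Y) {V : Opens Y} {x : X}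
    (s : Matrix (Fin 1) (Fin 1) (Y.presheaf.obj (op V)))
    (h : ((lrsGerms X).map propOfRing.{u}).UnitAt (U := bioOfProp.{u}) x
      (sc bioOfProp.{u} (pb (propOfRing.{u}.mapPresheaf.map (lrsForget.map f)) V) s)) :
    ((lrsGerms Y).map propOfRing.{u}).UnitAt (U := bioOfProp.{u}) (V := V) (f.base x) s := by
  obtain ⟨hx, h⟩ := (unitAt_matrix x _).1 h
  refine (unitAt_matrix (f.base x) s).2 ⟨hx, ?_⟩
  have := f.prop x
  refine isUnit_of_map_unit (f.stalkMap x).hom _ ?_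
  have e := PresheafedSpace.stalkMap_germ_apply f.toHom V x hx (s 0 0)
  exact Eq.mp (congrArg IsUnit e.symm) h

/-- Converse to `unitAt_of_isLocalHom`: a `1 × 1` matrix of sections is invertible at a point
exactly when its entry is, so reflection of units for matrices makes the map of ringed spaces local.
-/
lemma exists_hom_of_unitAt (g : lrsForget.obj X ⟶ lrsForget.obj Y)
    (h : ∀ (x : X) (V : Opens Y) (s : Matrix (Fin 1) (Fin 1) (Y.presheaf.obj (op V))),
      ((lrsGerms X).map propOfRing.{u}).UnitAt (U := bioOfProp.{u}) x
        (sc bioOfProp.{u} (pb (propOfRing.{u}.mapPresheaf.map g) V) s) →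
      ((lrsGerms Y).map propOfRing.{u}).UnitAt (U := bioOfProp.{u}) (V := V) (g.base x) s) :
    ∃ f : X ⟶ Y, lrsForget.map f = g := by
  refine ⟨⟨g, fun x => ⟨fun a ha => ?_⟩⟩, rfl⟩
  obtain ⟨V, hx, t, rfl⟩ := TopCat.Presheaf.exists_germ_eq Y.presheaf (show Y.presheaf.stalk (g.base x) from a)
  have := h x V (fun _ _ => t) ((unitAt_matrix x _).2 ⟨hx, ?_⟩)
  · exact ((unitAt_matrix (g.base x) _).1 this).choose_spec
  · exact Eq.mp (congrArg IsUnit (PresheafedSpace.stalkMap_germ_apply g V x hx t)) ha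

end

/-- The matrices over the structure sheaf of a locally ringed space. -/
def LRP : LocallyRingedSpace.{u} ⥤ LocPropSp.{u} where
  obj X := LocSp.ofGerms ((lrsGerms X).map propOfRing) ((isSheaf_lrsGerms X).map propOfRing)
    fun x => by
      have : IsLocalRing (X.presheaf.stalk x) := X.isLocalRing x
      exact isLocal_matrix (X.presheaf.stalk x)
  map {X Y} f := ⟨propOfRing.mapPresheaf.map (lrsForget.map f), LocSp.isLocalOnStalks_of_unitAt
    ((lrsGerms X).map propOfRing) ((lrsGerms Y).map propOfRing) _
    fun _ _ s h => unitAt_of_isLocalHom f s h⟩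
  map_id X := LocSp.Hom.ext (propOfRing.mapPresheaf.map_id _)
  map_comp f g := LocSp.Hom.ext (propOfRing.mapPresheaf.map_comp _ _)

lemma LocSp.Hom.unitAt_iff_map {X Y : LocPropSp.{u}} (f : X ⟶ Y) (G : Germs X.toPresheafedSpace)
    (H : Germs Y.toPresheafedSpace) {V : Opens Y.toPresheafedSpace} {x : X.toPresheafedSpace}
    (s : (bioOfProp.obj (Sect Y.toPresheafedSpace V)).R 1) :
    (G.map bioOfProp).UnitAt (U := 𝟭 CBio.{u}) x
      (sc (𝟭 CBio.{u}) (pb (bioOfProp.mapPresheaf.map f.hom) V) s) ↔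
    (H.map bioOfProp).UnitAt (U := 𝟭 CBio.{u}) (V := V) (f.hom.base x) s :=
  f.unitAt_iff G H s

/-- The rows and columns of a space with a sheaf of props. -/
def LPB : LocPropSp.{u} ⥤ LocBioSp.{u} where
  obj X := LocSp.ofGerms ((Germs.canonical X.toPresheafedSpace).map bioOfProp)
    ((X.isSheaf _).map bioOfProp) (X.isLocal (Germs.canonical X.toPresheafedSpace))
  map {X Y} f := ⟨bioOfProp.mapPresheaf.map f.hom, LocSp.isLocalOnStalks_of_unitAt
    ((Germs.canonical X.toPresheafedSpace).map bioOfProp)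
    ((Germs.canonical Y.toPresheafedSpace).map bioOfProp) _
    fun _ _ s h => (f.unitAt_iff_map _ _ s).1 h⟩
  map_id X := LocSp.Hom.ext (bioOfProp.mapPresheaf.map_id _)
  map_comp f g := LocSp.Hom.ext (bioOfProp.mapPresheaf.map_comp _ _)

instance : LRP.{u}.Faithful where
  map_injective {X Y f g} h := LocallyRingedSpace.Hom.ext'
    (mapPresheaf_injective propOfRing (congrArg LocSp.Hom.hom h))

instance : LRP.{u}.Full where
  map_surjective {X Y} g := by
    obtain ⟨g', hg⟩ := exists_preimage_mapPresheaf (X := lrsForget.obj X) (Y := lrsForget.obj Y)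
      propOfRing g.hom
    -- Fullness of `propOfRing` gives a map of ringed spaces; its locality is read off from that of
    -- `g`.
    obtain ⟨f, rfl⟩ := exists_hom_of_unitAt g' fun x V s h => by
      have := (g.unitAt_iff (x := x) ((lrsGerms X).map propOfRing) ((lrsGerms Y).map propOfRing) s).1
      rw [← hg] at this
      exact this h
    exact ⟨f, LocSp.Hom.ext hg⟩

instance : (LRP.{u} ⋙ LPB.{u}).Faithful where
  map_injective {X Y f g} h := LocallyRingedSpace.Hom.ext'
    (mapPresheaf_injective bioOfRing (congrArg LocSp.Hom.hom h))

instance : (LRP.{u} ⋙ LPB.{u}).Full where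
  map_surjective {X Y} g := by
    obtain ⟨g', hg⟩ := exists_preimage_mapPresheaf (X := lrsForget.obj X) (Y := lrsForget.obj Y)
      bioOfRing g.hom
    obtain ⟨f, rfl⟩ := exists_hom_of_unitAt g' fun x V s h => by
      have := (g.unitAt_iff (x := x) (((lrsGerms X).map propOfRing).map bioOfProp)
        (((lrsGerms Y).map propOfRing).map bioOfProp) s).1
      rw [← hg] at this
      exact this h
    exact ⟨f, LocSp.Hom.ext hg⟩

/-! ### Recognition of affine spectra -/

section
variable {C : Type (u + 1)} [Category.{u} C] [AlgCat C] {U : C ⥤ CBio.{u}} [Geo U]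
  {Sp : Cᵒᵖ ⥤ PSp C} [AffSpec U Sp]

/-- Both spaces represent the maps from `A` to global sections. This identifies spectra transported
along the comparison functors without inspecting their structure sheaves. -/
lemma IsSpec.exists_iso {A : C} {X : LocSp U} {G : Germs X.toPresheafedSpace}
    {φ : A ⟶ Sect X.toPresheafedSpace ⊤} (hX : IsSpec U G φ) :
    ∃ e : X ≅ (spec U Sp).obj (op A), toΓ e.hom = φ := by
  obtain ⟨ψ, hψ⟩ := exists_toΓ (Sp := Sp) φ
  have hS := AffSpec.isSpec (U := U) (Sp := Sp) A
  obtain ⟨χ', hl, hχ⟩ := hX.exists_lift _ hS.isSheaf hS.isLocal (AffSpec.unit U (Sp := Sp) A)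
  let χ : (spec U Sp).obj (op A) ⟶ X := ⟨χ', (LocSp.isLocalOnStalks_iff _ G _).2 hl⟩
  refine ⟨⟨ψ, χ, LocSp.Hom.ext ?_, toΓ_injective ?_⟩, hψ⟩
  · refine hX.hom_ext G hX.isSheaf ((LocSp.isLocalOnStalks_iff G G _).1 (ψ ≫ χ).isLocal)
      ((LocSp.isLocalOnStalks_iff G G _).1 (LocSp.Hom.isLocal (𝟙 X))) ?_
    refine Eq.trans ?_ (Category.comp_id φ).symm
    refine (Category.assoc φ (pb χ' ⊤) (pb ψ.hom ⊤)).symm.trans ?_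
    exact (congrArg (fun z => z ≫ pb ψ.hom ⊤) hχ).trans hψ
  · exact (toΓ_comp χ ψ).trans ((congrArg (fun z => z ≫ pb χ' ⊤) hψ).trans (hχ.trans
      (Category.comp_id _).symm))

variable (Sp) in
-- Naturality is a comparison of morphisms to a spectrum, hence may be checked on global sections.
lemma nonempty_iso_specSch {D : Type (u + 1)} [Category.{u} D] (T : Dᵒᵖ ⥤ Sch U Sp) (H : D ⥤ C)
    (G : ∀ R, Germs (T.obj (op R)).obj.toPresheafedSpace)
    (θ : ∀ R, H.obj R ⟶ Sect (T.obj (op R)).obj.toPresheafedSpace ⊤)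
    (hG : ∀ R, IsSpec U (G R) (θ R))
    (hθ : ∀ {R S : D} (f : R ⟶ S), θ R ≫ pb (T.map f.op).hom.hom ⊤ = H.map f ≫ θ S) :
    Nonempty (T ≅ H.op ⋙ specSch U Sp) := by
  choose e he using fun R => (hG R).exists_iso (Sp := Sp)
  refine ⟨NatIso.ofComponents (fun R => ObjectProperty.isoMk _ (e R.unop)) fun {R S} f =>
    ObjectProperty.hom_ext _ ?_⟩
  refine toΓ_injective ((toΓ_comp _ _).trans ?_)
  refine (congrArg (fun z => z ≫ pb (T.map f).hom.hom ⊤) (he S.unop)).trans ((hθ f.unop).trans ?_)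
  exact (congrArg (fun z => H.map f.unop ≫ z) (he R.unop)).symm.trans
    (toΓ_map (e R.unop).hom (H.map f.unop)).symm

end

/-! ### Spectra of matrices -/

section
variable {R L : CommRingCat.{u}}

lemma matrix_smul_apply {k : ℕ × ℕ} (s : (bioOfProp.obj (propOfRing.obj R)).R 1)
    (x : El (C := CPrp.{u}) k (propOfRing.obj R)) (i : Fin k.1) (j : Fin k.2) :
    (s • x : El (C := CPrp.{u}) k (propOfRing.obj R)) i j =
      ((s : Matrix (Fin 1) (Fin 1) R) 0 0 * (x : Matrix (Fin k.1) (Fin k.2) R) i j : R) := by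
  have key : ∀ (s : Matrix (Fin 1) (Fin 1) R) (x : Matrix (Fin k.1) (Fin k.2) R),
      (Matrix.reindex (Split.ones k.1) (Split.ones k.1) (Matrix.blockDiagonal' fun _ => s) * x) i j =
        s 0 0 * x i j := fun s x => by
    rw [mat_scal, Matrix.smul_mul, Matrix.one_mul, Matrix.smul_apply, smul_eq_mul]
  exact key s x

/-- A matrix has finitely many entries: they have a common denominator, and finitely many equations
between entries hold after multiplication by one element of `M`. -/
lemma isLocz_matrix (φ : R ⟶ L) (M : Submonoid R) (h : @IsLocalization R _ M L _ φ.hom.toAlgebra)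
    (S : Submonoid ((bioOfProp.obj (propOfRing.obj R)).R 1))
    (hS : ∀ s, s ∈ S ↔ (s : Matrix (Fin 1) (Fin 1) R) 0 0 ∈ M) :
    IsLocz (U := bioOfProp.{u}) (propOfRing.map φ) S := by
  let _ := φ.hom.toAlgebra
  refine ⟨fun s hs => (isUnit_matrix_iff _).2 (IsLocalization.map_units L ⟨_, (hS s).1 hs⟩),
    fun k y => ?_, fun k x x' e => ?_⟩
  · obtain ⟨b, hb⟩ := IsLocalization.exist_integer_multiples_of_finite M
      fun i : Fin k.1 × Fin k.2 => (y : Matrix (Fin k.1) (Fin k.2) L) i.1 i.2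
    choose x hx using hb
    refine ⟨(fun _ _ => b : Matrix (Fin 1) (Fin 1) R), (hS _).2 b.2,
      (fun i j => x (i, j) : Matrix (Fin k.1) (Fin k.2) R), funext fun i => funext fun j => ?_⟩
    refine (matrix_smul_apply _ _ i j).trans (Eq.trans ?_ (hx (i, j)).symm)
    exact (Algebra.smul_def (b : R) _).symm
  · have e' : ∀ i : Fin k.1 × Fin k.2, ∃ c : M,
        c * (x : Matrix (Fin k.1) (Fin k.2) R) i.1 i.2 = c * (x' : Matrix (Fin k.1) (Fin k.2) R) i.1 i.2 :=
      fun i => IsLocalization.exists_of_eq (S := L) (congrFun (congrFun e i.1) i.2)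
    choose c hc using e'
    refine ⟨(fun _ _ => (∏ i, c i : M) : Matrix (Fin 1) (Fin 1) R), (hS _).2 (∏ i, c i : M).2,
      funext fun i => funext fun j => ?_⟩
    refine (matrix_smul_apply _ _ i j).trans (Eq.trans ?_ (matrix_smul_apply _ _ i j).symm)
    obtain ⟨d, hd⟩ := Finset.dvd_prod_of_mem c (Finset.mem_univ (i, j))
    rw [hd, mul_comm (c (i, j)) d, Submonoid.coe_mul, mul_assoc, mul_assoc, hc (i, j)]

variable (R)

/-- The prime of the matrices over `R` given by a prime ideal. -/
def matrixPrime (p : PrimeSpectrum R) : (bioOfProp.obj (propOfRing.obj R)).Prime where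
  carrier := {s | (s : Matrix (Fin 1) (Fin 1) R) 0 0 ∈ p.asIdeal}
  isIdeal n b a d h := by
    have e : (CBio.contr _ b a d : Matrix (Fin 1) (Fin 1) R) 0 0 = _ := MatrixBio.contr_apply b a d
    refine (congrArg (· ∈ p.asIdeal) e).mpr (Ideal.sum_mem _ fun i _ => ?_)
    exact Ideal.mul_mem_right _ _ (Ideal.mul_mem_left _ _ (h i))
  one_notMem h := (Ideal.ne_top_iff_one _).1 p.2.ne_top h
  mem_or_mem s t h := p.2.mem_or_mem ((congrArg (· ∈ p.asIdeal) (MatrixBio.mul_apply s t)).mp h)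

/-- Contractions in the matrices over `R` are the sums `∑ bᵢ aᵢ dᵢ`, so ideals of the bio and ideals
of the ring are the same thing. -/
lemma matrixPrime_bijective : Function.Bijective (matrixPrime R) := by
  refine ⟨fun p q h => PrimeSpectrum.ext (Ideal.ext fun a => ?_), fun q => ?_⟩
  · exact iff_of_eq (congrArg (fun z : (bioOfProp.obj (propOfRing.obj R)).Prime =>
      (fun _ _ => a : Matrix (Fin 1) (Fin 1) R) ∈ z.carrier) h)
  · have key : ∀ {n} (b : Matrix (Fin 1) (Fin n) R) (a : Fin n → R) (d : Matrix (Fin n) (Fin 1) R),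
        (∀ i, (fun _ _ => a i : Matrix (Fin 1) (Fin 1) R) ∈ q.carrier) →
        (fun _ _ => ∑ i, b 0 i * a i * d i 0 : Matrix (Fin 1) (Fin 1) R) ∈ q.carrier := by
      intro n b a d h
      have := q.isIdeal n b (fun i => (fun _ _ => a i : Matrix (Fin 1) (Fin 1) R)) d h
      refine (congrArg (· ∈ q.carrier) (funext fun i => funext fun j => ?_)).mp this
      obtain rfl : i = 0 := Subsingleton.elim (α := Fin 1) _ _
      obtain rfl : j = 0 := Subsingleton.elim (α := Fin 1) _ _
      exact MatrixBio.contr_apply b _ d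
    have eta : ∀ s : Matrix (Fin 1) (Fin 1) R, (fun _ _ => s 0 0) = s := fun s => by
      ext i j
      rw [Subsingleton.elim i 0, Subsingleton.elim j 0]
    -- Zero, sums and multiples are contractions of lengths 0, 2 and 1.
    let I : Ideal R :=
      { carrier := {a | (fun _ _ => a : Matrix (Fin 1) (Fin 1) R) ∈ q.carrier}
        zero_mem' := by simpa using key (n := 0) 0 Fin.elim0 0 fun i => i.elim0
        add_mem' := fun {a b} ha hb => by
          simpa using key (fun _ _ => 1) ![a, b] (fun _ _ => 1) (Fin.forall_fin_two.2 ⟨ha, hb⟩)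
        smul_mem' := fun c a ha => by
          simpa using key (fun _ _ => c) ![a] (fun _ _ => 1) (Fin.forall_fin_one.2 ha) }
    have hI : ∀ s : Matrix (Fin 1) (Fin 1) R, s 0 0 ∈ I ↔ s ∈ q.carrier := fun s =>
      iff_of_eq (congrArg (· ∈ q.carrier) (eta s))
    refine ⟨⟨I, ⟨(Ideal.ne_top_iff_one _).2 fun h => q.one_notMem ((hI _).1 h), fun {a b} h => ?_⟩⟩,
      CBio.Prime.ext (Set.ext hI)⟩
    have := q.mem_or_mem (fun _ _ => a : Matrix (Fin 1) (Fin 1) R) (fun _ _ => b) ((hI _).1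
      ((congrArg (· ∈ I) (MatrixBio.mul_apply _ _)).mpr h))
    exact this

lemma isOpen_image_matrixPrime {V : Set (PrimeSpectrum R)} (hV : IsOpen V) :
    IsOpen (matrixPrime R '' V) := by
  refine isOpen_iff_forall_mem_open.2 ?_
  rintro _ ⟨p, hp, rfl⟩
  obtain ⟨_, ⟨f, rfl⟩, hf, hfV⟩ :=
    PrimeSpectrum.isTopologicalBasis_basic_opens.exists_subset_of_mem_open hp hV
  refine ⟨{x | (fun _ _ => f : Matrix (Fin 1) (Fin 1) R) ∉ x.carrier}, fun x hx => ?_,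
    isOpen_generateFrom_of_mem ⟨_, rfl⟩, hf⟩
  obtain ⟨y, rfl⟩ := (matrixPrime_bijective R).2 x
  exact ⟨y, hfV hx, rfl⟩

/-- The stalks of `Spec R` are the localizations of `R` at its primes; passing to matrices commutes
with localization and preserves the primes. -/
lemma isSpec_matrix : IsSpec bioOfProp.{u}
    (G := (lrsGerms (Spec.toLocallyRingedSpace.obj (op R))).map propOfRing)
    (propOfRing.map (toSpecΓ R)) := by
  refine IsSpec.of_equiv ((isSheaf_lrsGerms _).map propOfRing)
    (Equiv.ofBijective _ (matrixPrime_bijective R)) (fun V => isOpen_image_matrixPrime R V.2)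
    fun (x : PrimeSpectrum R) => ?_
  have h := isLocz_matrix (StructureSheaf.toStalk R x) (Ideal.primeCompl x.asIdeal)
    (StructureSheaf.IsLocalization.to_stalk R x) (matrixPrime R x).compl fun s => Iff.rfl
  exact h

end

section
variable {A L : CPrp.{u}}

lemma IsLocz.map_bioOfProp {φ : A ⟶ L} {S : Submonoid ((bioOfProp.obj A).R 1)}
    (h : IsLocz (U := bioOfProp.{u}) φ S) : IsLocz (U := 𝟭 CBio.{u}) (bioOfProp.map φ) S where
  isUnit := h.isUnit
  surj k y := match k with
    | .inl n => by
      obtain ⟨s, hs, x, hx⟩ := h.surj (1, n) y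
      exact ⟨s, hs, x, (Geo.rowE_act (U := bioOfProp.{u}) n _ y).symm.trans hx⟩
    | .inr n => by
      obtain ⟨s, hs, x, hx⟩ := h.surj (n, 1) y
      exact ⟨s, hs, x, (Geo.colE_act (U := bioOfProp.{u}) n _ y).symm.trans hx⟩
  eq k x x' e := match k with
    | .inl n => by
      obtain ⟨s, hs, hx⟩ := h.eq (1, n) x x' e
      exact ⟨s, hs, (Geo.rowE_act (U := bioOfProp.{u}) n s x).symm.trans (hx.trans
        (Geo.rowE_act (U := bioOfProp.{u}) n s x'))⟩
    | .inr n => by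
      obtain ⟨s, hs, hx⟩ := h.eq (n, 1) x x' e
      exact ⟨s, hs, (Geo.colE_act (U := bioOfProp.{u}) n s x).symm.trans (hx.trans
        (Geo.colE_act (U := bioOfProp.{u}) n s x'))⟩

variable (A)

lemma isSpec_bioOfProp : IsSpec (𝟭 CBio.{u}) (G := A.specGerms.map bioOfProp)
    (bioOfProp.map A.specUnit) :=
  IsSpec.of_equiv (A.isSheaf_specGerms.map bioOfProp) (Equiv.refl A.toCBio.Prime)
    (fun V => (congrArg IsOpen (Set.image_id (V.1 : Set A.toCBio.Prime))).mpr V.2)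
    fun x => (A.isLocz_specUnit x).map_bioOfProp

end

/-! ### The functors between the categories of schemes -/

/-- Change of the structure sheaf commutes with restriction to open subspaces, so an affine chart
`Spec R` becomes the spectrum of the prop of matrices over `R`. -/
lemma isLocallyAffine_LRP (X : Scheme.{u}) :
    LocSp.IsLocallyAffine bioOfProp.{u} specProp.{u} (LRP.obj X.toLocallyRingedSpace) := fun x => by
  obtain ⟨W, R, ⟨e⟩⟩ := X.local_affine x
  obtain ⟨e', -⟩ := IsSpec.exists_iso (Sp := specProp.{u})
    (X := LRP.obj (Spec.toLocallyRingedSpace.obj (op R))) (isSpec_matrix R)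
  exact ⟨W.1, propOfRing.obj R, W.2, ⟨propOfRing.mapPresheaf.mapIso (lrsForget.mapIso e) ≪≫
    (LocSp.forget bioOfProp.{u}).mapIso e'⟩⟩

lemma exists_iso_specBio (A : CPrp.{u}) : Nonempty
    (LPB.obj ((spec bioOfProp.{u} specProp.{u}).obj (op A)) ≅
      (spec (𝟭 CBio.{u}) specBio.{u}).obj (op (bioOfProp.obj A))) :=
  (IsSpec.exists_iso (Sp := specBio.{u})
    (X := LPB.obj ((spec bioOfProp.{u} specProp.{u}).obj (op A))) (isSpec_bioOfProp A)).nonempty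

lemma isLocallyAffine_LPB (X : PSch.{u}) :
    LocSp.IsLocallyAffine (𝟭 CBio.{u}) specBio.{u} (LPB.obj X.obj) := fun x => by
  obtain ⟨W, A, hx, ⟨e⟩⟩ := X.property x
  obtain ⟨e'⟩ := exists_iso_specBio A
  exact ⟨W, bioOfProp.obj A, hx, ⟨bioOfProp.mapPresheaf.mapIso e ≪≫
    (LocSp.forget (𝟭 CBio.{u})).mapIso e'⟩⟩

/-- The matrices over the structure sheaf of a scheme. -/
def SRP : Scheme.{u} ⥤ PSch.{u} :=
  ObjectProperty.lift _ (Scheme.forgetToLocallyRingedSpace ⋙ LRP) isLocallyAffine_LRP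

/-- The rows and columns of a prop scheme. -/
def SPB : PSch.{u} ⥤ BSch.{u} := ObjectProperty.lift _ (pschIncl ⋙ LPB) isLocallyAffine_LPB

instance : SRP.{u}.Full := Functor.Full.of_comp_faithful_iso
  (show SRP.{u} ⋙ pschIncl ≅ Scheme.forgetToLocallyRingedSpace ⋙ LRP from Iso.refl _)
instance : SRP.{u}.Faithful := Functor.Faithful.of_comp_iso
  (show SRP.{u} ⋙ pschIncl ≅ Scheme.forgetToLocallyRingedSpace ⋙ LRP from Iso.refl _)

instance : (SRP.{u} ⋙ SPB.{u}).Full := Functor.Full.of_comp_faithful_iso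
  (show (SRP.{u} ⋙ SPB.{u}) ⋙ bschIncl ≅ Scheme.forgetToLocallyRingedSpace ⋙ (LRP ⋙ LPB) from
    Iso.refl _)
instance : (SRP.{u} ⋙ SPB.{u}).Faithful := Functor.Faithful.of_comp_iso
  (show (SRP.{u} ⋙ SPB.{u}) ⋙ bschIncl ≅ Scheme.forgetToLocallyRingedSpace ⋙ (LRP ⋙ LPB) from
    Iso.refl _)

lemma nonempty_spec_SRP : Nonempty (Scheme.Spec.{u} ⋙ SRP.{u} ≅
    propOfRing.{u}.op ⋙ specSch bioOfProp.{u} specProp.{u}) :=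
  nonempty_iso_specSch specProp.{u} (Scheme.Spec ⋙ SRP) propOfRing
    (fun R => (lrsGerms (Spec.toLocallyRingedSpace.obj (op R))).map propOfRing)
    (fun R => propOfRing.map (toSpecΓ R)) isSpec_matrix fun {R S} f =>
      (propOfRing.map_comp _ _).symm.trans ((congrArg (fun z => propOfRing.map z)
        (Spec_Γ_naturality f).symm).trans (propOfRing.map_comp _ _))

lemma nonempty_spec_SPB : Nonempty (specSch bioOfProp.{u} specProp.{u} ⋙ SPB.{u} ≅
    bioOfProp.{u}.op ⋙ specSch (𝟭 CBio.{u}) specBio.{u}) :=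
  nonempty_iso_specSch specBio.{u} (specSch bioOfProp.{u} specProp.{u} ⋙ SPB) bioOfProp
    (fun A => A.specGerms.map bioOfProp)
    (fun A => bioOfProp.map A.specUnit) isSpec_bioOfProp fun {A B} f =>
      (bioOfProp.map_comp _ _).symm.trans ((congrArg (fun z => bioOfProp.map z)
        (CPrp.specUnit_map f)).trans (bioOfProp.map_comp _ _))

end GenGeom

end

open GenGeom CategoryTheory CategoryTheory.Limits AlgebraicGeometry in
theorem mainTheorem5 :
    ∃ (SpecB : CBio.{u}ᵒᵖ ⥤ BSch.{u}) (SpecP : CPrp.{u}ᵒᵖ ⥤ PSch.{u})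
      (LRP : LocallyRingedSpace.{u} ⥤ LocPropSp.{u}) (LPB : LocPropSp.{u} ⥤ LocBioSp.{u})
      (SRP : Scheme.{u} ⥤ PSch.{u}) (SPB : PSch.{u} ⥤ BSch.{u}),
      -- the spectrum of a bio or prop, with its explicit structure sheaf, is an affine scheme
      Nonempty (SpecB ⋙ bschIncl ⋙ LocSp.forget (𝟭 CBio.{u}) ≅ specBio.{u}) ∧
      Nonempty (SpecP ⋙ pschIncl ⋙ LocSp.forget bioOfProp.{u} ≅ specProp.{u}) ∧
      -- the right column is the change of the structure sheaf along `CRing → CProp → CBio`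
      Nonempty (LRP ⋙ LocSp.forget bioOfProp.{u} ≅ lrsForget ⋙ propOfRing.{u}.mapPresheaf) ∧
      Nonempty (LPB ⋙ LocSp.forget (𝟭 CBio.{u}) ≅
        LocSp.forget bioOfProp.{u} ⋙ bioOfProp.{u}.mapPresheaf) ∧
      -- the squares between the middle and the right columns
      Nonempty (SRP ⋙ pschIncl ≅ Scheme.forgetToLocallyRingedSpace ⋙ LRP) ∧
      Nonempty (SPB ⋙ bschIncl ≅ pschIncl ⋙ LPB) ∧
      -- the squares between the left and the middle columns
      Nonempty (Scheme.Spec ⋙ SRP ≅ propOfRing.{u}.op ⋙ SpecP) ∧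
      Nonempty (SpecP ⋙ SPB ≅ bioOfProp.{u}.op ⋙ SpecB) ∧
      -- the rows are full embeddings
      (Scheme.Spec.{u}.Full ∧ Scheme.Spec.{u}.Faithful) ∧
      (SpecB.Full ∧ SpecB.Faithful) ∧
      (SpecP.Full ∧ SpecP.Faithful) ∧
      (Scheme.forgetToLocallyRingedSpace.{u}.Full ∧
        Scheme.forgetToLocallyRingedSpace.{u}.Faithful) ∧
      (bschIncl.{u}.Full ∧ bschIncl.{u}.Faithful) ∧
      (pschIncl.{u}.Full ∧ pschIncl.{u}.Faithful) ∧
      -- the first row embeds fully into the two others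
      (propOfRing.{u}.Full ∧ propOfRing.{u}.Faithful) ∧
      (bioOfRing.{u}.Full ∧ bioOfRing.{u}.Faithful) ∧
      (SRP.Full ∧ SRP.Faithful) ∧
      ((SRP ⋙ SPB).Full ∧ (SRP ⋙ SPB).Faithful) ∧
      (LRP.Full ∧ LRP.Faithful) ∧
      ((LRP ⋙ LPB).Full ∧ (LRP ⋙ LPB).Faithful) ∧
      -- finite completeness; in particular, fiber products exist
      (HasFiniteLimits BSch.{u} ∧ HasPullbacks BSch.{u}) ∧
      (HasFiniteLimits PSch.{u} ∧ HasPullbacks PSch.{u}) :=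
  ⟨specSch (𝟭 CBio.{u}) specBio.{u}, specSch bioOfProp.{u} specProp.{u}, LRP, LPB, SRP, SPB,
    specSch_forget _, specSch_forget _, ⟨Iso.refl _⟩, ⟨Iso.refl _⟩, ⟨Iso.refl _⟩, ⟨Iso.refl _⟩,
    nonempty_spec_SRP, nonempty_spec_SPB,
    ⟨inferInstance, inferInstance⟩, ⟨inferInstance, inferInstance⟩, ⟨inferInstance, inferInstance⟩,
    ⟨inferInstance, inferInstance⟩, ⟨inferInstance, inferInstance⟩, ⟨inferInstance, inferInstance⟩,
    ⟨inferInstance, inferInstance⟩, ⟨inferInstance, inferInstance⟩, ⟨inferInstance, inferInstance⟩,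
    ⟨inferInstance, inferInstance⟩, ⟨inferInstance, inferInstance⟩, ⟨inferInstance, inferInstance⟩,
    ⟨hasFiniteLimits_sch _ _, hasPullbacks_sch _ _⟩, ⟨hasFiniteLimits_sch _ _, hasPullbacks_sch _ _⟩⟩
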